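/- **Drawings and configurations.** Graphs are finite and simple, and drawings are in the plane. A *near-triangulation* is a non-null connected plane drawing in which every finite region is a triangle. A *configuration* $L$ consists of a near-triangulation $G(L)$ and a map $\gamma_L:V(G(L))\to\mathbb Z$ such that, with $d(v)$ the degree of $v$ in $G(L)$: (i) for every vertex $v$, $G(L)\setminus v$ has at most two components, and if there are two then $\gamma_L(v)=d(v)+2$; (ii) $\gamma_L(v)=d(v)$ if $v$ is not incident with the infinite region, $\gamma_L(v)>d(v)$ otherwise, and $\gamma_L(v)\ge 5$ in either case; (iii) $\sum_v(\gamma_L(v)-d(v)-1)\ge 2$, the sum being over all $v$ that are incident with the infinite region and for which $G(L)\setminus v$ is not disconnected. Two configurations are *isomorphic* if some homeomorphism of the plane (possibly reversing the orientation) takes one to the other. $K$ is a *subconfiguration* of $L$ if $G(K)$ is a subdrawing of $G(L)$ and $\gamma_K$ is the restriction of $\gamma_L$; it is an *induced* subconfiguration if moreover $G(K)$ is an induced subdrawing. Fix a set $\mathcal C$ of configurations; a configuration is *good* if it is isomorphic to a member of $\mathcal C$. (In the proof of the Four Colour Theorem of Robertson, Sanders, Seymour and Thomas, $\mathcal C$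 is a list of 633 configurations, each of radius at most two.) $L$ has *radius at most two* if some vertex of $G(L)$ is joined to every vertex by a path with at most two edges. "$u,v,w$ form a triangle in clockwise order" means that $u,v,w$ are, in this clockwise order, the vertices of a finite region. **Questions.** A *free completion* of $L$ with ring $R$ is a near-triangulation $S$ such that $R$ is an induced circuit of $S$ bounding the infinite region of $S$; $G(L)=S\setminus V(R)$ is an induced subdrawing of $S$, every finite region of $G(L)$ is a finite region of $S$; and every $v\in V(G(L))$ has degree $\gamma_L(v)$ in $S$. An *enhancement* $J$ of $L$ is: $G(L)$ itself, if $G(L)$ is $2$-connected; and, if there is a unique vertex $v$ with $G(L)\setminus v$ disconnected, the subdrawing of a free completion of $L$ with ring $R$ induced by $V(G(L))\cup\{v'\}$, for some neighbour $v'\in V(R)$ of $v$. Let $\xi(v)=\gamma_L(v)$ for $v\in V(G(L))$ and $\xi(v)=0$ for other $v\in V(J)$. A *query* is a quadruple $(u,v,z,\xi(z))$ such that $u,v,z$ form a triangle of $J$ in clockwise order. A *question* for $L$ (with respect to $J$) is a sequence $Q=(Q_0,\dots,Q_n)$, $n\ge 1$, of queries $Q_i=(u_i,v_i,z_i,\xi(z_i))$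 such that $z_0,\dots,z_n$ are distinct and make up $V(J)$, $z_0,z_1$ are adjacent in $G(L)$, and $u_i,v_i\in\{z_0,\dots,z_{i-1}\}$ for $2\le i\le n$. An injective map $f:V(J)\to V(G(K))$ *is a positive answer* to $Q$ for a configuration $K$ if $f(z_0),f(z_1)$ are adjacent in $G(K)$; $\gamma_K(f(z_i))=\xi(z_i)$ whenever $\xi(z_i)>0$; and $f(u_i),f(v_i),f(z_i)$ form a triangle in $G(K)$ in clockwise order for $2\le i\le n$. $Q$ *has a positive answer* for $K$ if there is such an $f$. **Axles and skeletons.** An *axle of degree $d$* is a pair $A=(l,u)$ of functions on $\{1,\dots,5d\}$ with $l(i)\le u(i)$, $l(i)\in\{5,6,7,8,9\}$, $u(i)\in\{5,6,7,8,12\}$ for all $i$, such that if $1\le i\le d$ and $l(i)\ne u(i)$ then $(l(j),u(j))=(5,12)$ for $j=2d+i,3d+i,4d+i$. Its *skeleton* (for $d\ge 5$) is the configuration $K$ described as follows. Let $(l',u)$ arise from $(l,u)$ by putting $l'(i)=u(i)$ for all $i\le d$ with $u(i)\le 8$. The vertices of $G(K)$ are the hub $0$, the spokes $1,\dots,d$,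 the hats $d+1,\dots,2d$, and, for every spoke $i$ with $l'(i)=u(i)=k$, the fan vertices $2d+i,3d+i,\dots,(k-4)d+i$ (none if $k=5$). The hub is adjacent to the spokes, which form a circuit in this clockwise order around the hub; the hat $d+i$ is adjacent to the spokes $i$ and $i+1$ (to $d$ and $1$ if $i=d$); for every spoke $i$ with $l'(i)=u(i)=k$, the hat adjacent to $i$ and to the spoke preceding $i$, followed by $2d+i,\dots,(k-4)d+i$ and the hat $d+i$, is a path all of whose vertices are adjacent to $i$; there are no other edges, and the resulting triangles are the finite regions. Finally $\gamma_K(0)=d$ and $\gamma_K(x)=u(x)$ for $x\ne 0$. A subconfiguration $K_0$ of $K$ is *well-positioned* in $K$ if for every spoke $v$ of $K$ not in $V(G(K_0))$, at least one of the two hats adjacent to $v$ is not in $V(G(K_0))$. $A$ is *semi-reducible* if a good configuration is a well-positioned induced subconfiguration of its skeleton. **Theorem.** Let $L$ be a good configuration, let $Q$ be a question for $L$, and let $A$ be an axle of degree $d$ with skeleton $K$. If $Q$ has a positive answer for $K$, then a configuration $K_0$ isomorphic to $L$ is a subconfiguration of $K$; more precisely, for every positive answer $f$ there is such a $K_0$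 for which the restriction of $f$ to $V(G(L))$ is an orientation-preserving isomorphism from $L$ to $K_0$. If moreover $d\ge 6$, $L$ has radius at most two, and $K_0$ is well-positioned in $K$, then $K_0$ is an induced subconfiguration of $K$, and hence $A$ is semi-reducible. -/

import Mathlib

/-! ### Plane drawings, given by the clockwise rotation at every vertex -/

/-- A finite loopless simple graph together with a clockwise cyclic order of the neighbours of
every vertex. `next v u` is the neighbour of `v` that follows `u` in clockwise order around `v`;
its value is irrelevant if `u` is not a neighbour of `v`. -/
structure Drawing (α : Type*) where
  verts : Finset α
  Adj : α → α → Prop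
  next : α → α → α
  symm : ∀ u v, Adj u v → Adj v u
  loopless : ∀ v, ¬ Adj v v
  mem_verts : ∀ u v, Adj u v → u ∈ verts
  next_adj : ∀ v u, Adj v u → Adj v (next v u)
  next_cyclic : ∀ v a b, Adj v a → Adj v b → ∃ k : ℕ, (next v)^[k] a = b

namespace Drawing

variable {α : Type*} (D : Drawing α)

/-- The darts: edges with a direction. -/
def darts : Set (α × α) := {p | D.Adj p.1 p.2}

noncomputable def deg (v : α) : ℕ := {u | D.Adj v u}.ncard

/-- The region to the right of the dart `(u, v)` is bounded by this dart and, preceding it in the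
clockwise tour of that region, the dart `(next u v, u)`. -/
def faceNext (p : α × α) : α × α := (D.next p.1 p.2, p.1)

/-- The set of darts that have the same region on their right-hand side as the dart `p`. -/
def region (p : α × α) : Set (α × α) := {q | ∃ k : ℕ, D.faceNext^[k] p = q}

/-- The regions that are incident with an edge, each given by its set of darts. -/
def regions : Set (Set (α × α)) := {R | ∃ p ∈ D.darts, R = D.region p}

/-- The number of regions of a connected drawing; a drawing without edges has one region. -/
noncomputable def numRegions : ℕ := max 1 D.regions.ncard

def Connected : Prop :=
  D.verts.Nonempty ∧ ∀ u ∈ D.verts, ∀ v ∈ D.verts, Relation.ReflTransGen D.Adj u v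

/-- Adjacency in the drawing obtained by deleting the vertex `x`. -/
def AdjAvoiding (x u v : α) : Prop := D.Adj u v ∧ u ≠ x ∧ v ≠ x

/-- The number of components of the drawing obtained by deleting the vertex `x`. -/
noncomputable def numComponentsDelete (x : α) : ℕ :=
  {C : Set α | ∃ u ∈ D.verts, u ≠ x ∧
    C = {w | Relation.ReflTransGen (D.AdjAvoiding x) u w}}.ncard

/-- Deleting `x` leaves a disconnected drawing. -/
def IsCutVertex (x : α) : Prop := x ∈ D.verts ∧ 2 ≤ D.numComponentsDelete x

def TwoConnected : Prop := 3 ≤ D.verts.card ∧ D.Connected ∧ ∀ x, ¬ D.IsCutVertex x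

/-- Every vertex is joined to a common vertex by a path with at most two edges. -/
def HasRadiusAtMostTwo : Prop :=
  ∃ c ∈ D.verts, ∀ u ∈ D.verts, u = c ∨ D.Adj c u ∨ ∃ w, D.Adj c w ∧ D.Adj w u

end Drawing

/-- A near-triangulation: a non-null connected drawing in the plane (planarity is Euler's formula,
with twice the number of edges written as the number of darts) with a distinguished infinite
region, all of whose finite regions are triangles. `outer` is the set of darts that have the
infinite region on their right-hand side. -/
structure NearTriangulation (α : Type*) extends Drawing α where
  outer : Set (α × α)
  connected : toDrawing.Connected
  euler : 2 * (verts.card + toDrawing.numRegions) = toDrawing.darts.ncard + 4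
  outer_region : outer ∈ toDrawing.regions ∨ (toDrawing.darts = ∅ ∧ outer = ∅)
  finite_triangle : ∀ p ∈ toDrawing.darts, p ∉ outer → toDrawing.faceNext^[3] p = p

namespace NearTriangulation

variable {α : Type*}

/-- The vertex `v` is incident with the infinite region. -/
def OnOuter (D : NearTriangulation α) (v : α) : Prop :=
  v ∈ D.verts ∧ ((∃ u, (v, u) ∈ D.outer) ∨ ∀ u, ¬ D.Adj v u)

/-- `u, v, w` are, in this clockwise order, the vertices of a finite (triangular) region. -/
def ClockwiseTriangle (D : NearTriangulation α) (u v w : α) : Prop :=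
  D.Adj u v ∧ (u, v) ∉ D.outer ∧ D.next u v = w ∧ D.next v w = u ∧ D.next w u = v

/-- Two darts of `G` that have, in the drawing obtained from `G` by deleting all edges and vertices
that are not in `H`, the same region on their right-hand side: either they are consecutive on a
region of `G`, or they are the two directions of a deleted edge. -/
def RegionStep (H G : NearTriangulation α) (p q : α × α) : Prop :=
  p ∈ G.darts ∧ (q = G.faceNext p ∨ (q = p.swap ∧ p ∉ H.darts))

/-- `H` is a subdrawing of `G`: its vertices and edges are vertices and edges of `G`, the cyclic
order around each vertex is the one induced by `G`, and the infinite region of `H` is the region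
of `H` that includes the infinite region of `G`. -/
structure IsSubdrawing (H G : NearTriangulation α) : Prop where
  verts_subset : H.verts ⊆ G.verts
  adj : ∀ u v, H.Adj u v → G.Adj u v
  next : ∀ v a, H.Adj v a → ∃ k : ℕ, 0 < k ∧ (G.next v)^[k] a = H.next v a ∧
    ∀ j : ℕ, 0 < j → j < k → ¬ H.Adj v ((G.next v)^[j] a)
  outer : ∀ p ∈ H.darts,
    (p ∈ H.outer ↔ ∃ q ∈ G.outer, Relation.EqvGen (RegionStep H G) q p)

structure IsInducedSubdrawing (H G : NearTriangulation α) : Prop extends IsSubdrawing H G where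
  induced : ∀ u ∈ H.verts, ∀ v ∈ H.verts, G.Adj u v → H.Adj u v

end NearTriangulation

/-! ### Configurations -/

structure Configuration (α : Type*) extends NearTriangulation α where
  γ : α → ℕ
  components_le : ∀ v ∈ verts, toDrawing.numComponentsDelete v ≤ 2
  cut_vertex : ∀ v ∈ verts, toDrawing.numComponentsDelete v = 2 → γ v = toDrawing.deg v + 2
  inner : ∀ v ∈ verts, ¬ toNearTriangulation.OnOuter v → γ v = toDrawing.deg v
  on_outer : ∀ v ∈ verts, toNearTriangulation.OnOuter v → toDrawing.deg v < γ v
  five_le : ∀ v ∈ verts, 5 ≤ γ v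
  /-- The ring-size is at least two. -/
  ring_size : open Classical in
    2 ≤ ∑ v ∈ verts.filter (fun v => toNearTriangulation.OnOuter v ∧ ¬ toDrawing.IsCutVertex v),
      (γ v - toDrawing.deg v - 1)

namespace Configuration

variable {α β : Type*}

/-- The map `f` on the vertices comes from an orientation-preserving homeomorphism of the plane
that takes `L` to `M`. -/
structure IsOrientedIso (f : α → β) (L : Configuration α) (M : Configuration β) : Prop where
  bij : Set.BijOn f L.verts M.verts
  adj : ∀ u ∈ L.verts, ∀ v ∈ L.verts, (L.Adj u v ↔ M.Adj (f u) (f v))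
  next : ∀ v a, L.Adj v a → M.next (f v) (f a) = f (L.next v a)
  outer : ∀ u v, L.Adj u v → ((u, v) ∈ L.outer ↔ (f u, f v) ∈ M.outer)
  γ : ∀ v ∈ L.verts, M.γ (f v) = L.γ v

/-- The map `f` on the vertices comes from an orientation-reversing homeomorphism of the plane
that takes `L` to `M`. -/
structure IsReversedIso (f : α → β) (L : Configuration α) (M : Configuration β) : Prop where
  bij : Set.BijOn f L.verts M.verts
  adj : ∀ u ∈ L.verts, ∀ v ∈ L.verts, (L.Adj u v ↔ M.Adj (f u) (f v))
  next : ∀ v a, L.Adj v a → M.next (f v) (f (L.next v a)) = f a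
  outer : ∀ u v, L.Adj u v → ((u, v) ∈ L.outer ↔ (f v, f u) ∈ M.outer)
  γ : ∀ v ∈ L.verts, M.γ (f v) = L.γ v

/-- A homeomorphism of the plane takes `L` to `M`. -/
def Isomorphic (L : Configuration α) (M : Configuration β) : Prop :=
  ∃ f : α → β, IsOrientedIso f L M ∨ IsReversedIso f L M

/-- `L` is isomorphic to a member of the given list `𝒞` of configurations. -/
def IsGood (𝒞 : Set (Configuration ℕ)) (L : Configuration α) : Prop := ∃ M ∈ 𝒞, Isomorphic M L

structure IsSubconfiguration (K L : Configuration α) : Prop where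
  sub : K.toNearTriangulation.IsSubdrawing L.toNearTriangulation
  γ : ∀ v ∈ K.verts, K.γ v = L.γ v

structure IsInducedSubconfiguration (K L : Configuration α) : Prop where
  sub : K.toNearTriangulation.IsInducedSubdrawing L.toNearTriangulation
  γ : ∀ v ∈ K.verts, K.γ v = L.γ v

/-- `S` is a free completion of `L`; its ring is the circuit that bounds the infinite region of
`S`, and its vertices are those vertices of `S` that are not vertices of `L`. -/
structure IsFreeCompletion (L : Configuration α) (S : NearTriangulation α) : Prop where
  induced : L.toNearTriangulation.IsInducedSubdrawing S
  /-- every finite region of `L` is a finite region of `S` -/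
  finite_regions : ∀ u v, L.Adj u v → (u, v) ∉ L.outer →
    (u, v) ∉ S.outer ∧ S.next u v = L.next u v
  ring_outer : ∀ v ∈ S.verts, (v ∉ L.verts ↔ ∃ u, (v, u) ∈ S.outer)
  ring_circuit : ∀ v u u', (v, u) ∈ S.outer → (v, u') ∈ S.outer → u = u'
  ring_induced : ∀ u v, u ∉ L.verts → v ∉ L.verts → S.Adj u v →
    (u, v) ∈ S.outer ∨ (v, u) ∈ S.outer
  degree : ∀ v ∈ L.verts, S.deg v = L.γ v

/-- `J` is an enhancement of `L`. -/
def IsEnhancement (L : Configuration α) (J : NearTriangulation α) : Prop :=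
  (L.TwoConnected ∧ J = L.toNearTriangulation) ∨
  (∃ v, L.IsCutVertex v ∧ (∀ w, L.IsCutVertex w → w = v) ∧
    ∃ (S : NearTriangulation α) (v' : α), IsFreeCompletion L S ∧
      v' ∈ S.verts ∧ v' ∉ L.verts ∧ S.Adj v v' ∧
      J.IsInducedSubdrawing S ∧ ∀ x, x ∈ J.verts ↔ x = v' ∨ x ∈ L.verts)

/-! ### Queries and questions -/

open Classical in
/-- `γ v` for the vertices `v` of `L`, and `0` otherwise. -/
noncomputable def ξ (L : Configuration α) (v : α) : ℕ := if v ∈ L.verts then L.γ v else 0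

end Configuration

/-- A quadruple `(u, v, z, deg)`. -/
structure Query (α : Type*) where
  u : α
  v : α
  z : α
  deg : ℕ

def IsQuery {α : Type*} (L : Configuration α) (J : NearTriangulation α) (q : Query α) : Prop :=
  J.ClockwiseTriangle q.u q.v q.z ∧ q.deg = L.ξ q.z

/-- `Q` is a question for `L`, with respect to the enhancement `J` of `L`. -/
structure IsQuestion {α : Type*} (L : Configuration α) (J : NearTriangulation α) {n : ℕ}
    (Q : Fin (n + 2) → Query α) : Prop where
  enhancement : L.IsEnhancement J
  query : ∀ i, IsQuery L J (Q i)
  distinct : Function.Injective fun i => (Q i).z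
  exhaust : ∀ x, x ∈ J.verts ↔ ∃ i, (Q i).z = x
  adj : L.Adj (Q 0).z (Q 1).z
  earlier : ∀ i : Fin (n + 2), 2 ≤ i.val →
    (∃ j, j < i ∧ (Q j).z = (Q i).u) ∧ (∃ j, j < i ∧ (Q j).z = (Q i).v)

/-- The map `f`, from the vertices of `J` to the vertices of `K`, shows that the question `Q` has
a positive answer for `K`. -/
structure IsPositiveAnswer {α β : Type*} (J : NearTriangulation α) {n : ℕ}
    (Q : Fin (n + 2) → Query α) (K : Configuration β) (f : α → β) : Prop where
  mapsTo : Set.MapsTo f J.verts K.verts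
  injOn : Set.InjOn f J.verts
  adj : K.Adj (f (Q 0).z) (f (Q 1).z)
  degree : ∀ i, 0 < (Q i).deg → K.γ (f (Q i).z) = (Q i).deg
  triangle : ∀ i : Fin (n + 2), 2 ≤ i.val →
    K.ClockwiseTriangle (f (Q i).u) (f (Q i).v) (f (Q i).z)

/-! ### Axles and their skeletons -/

/-- An axle of degree `d`. Only the values of `l` and `u` on `{1, …, 5d}` matter. -/
structure Axle (d : ℕ) where
  l : ℕ → ℕ
  u : ℕ → ℕ
  le : ∀ i ∈ Finset.Icc 1 (5 * d), l i ≤ u i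
  l_mem : ∀ i ∈ Finset.Icc 1 (5 * d), l i ∈ ({5, 6, 7, 8, 9} : Finset ℕ)
  u_mem : ∀ i ∈ Finset.Icc 1 (5 * d), u i ∈ ({5, 6, 7, 8, 12} : Finset ℕ)
  fan : ∀ i ∈ Finset.Icc 1 d, l i ≠ u i → ∀ j ∈ Finset.Icc 2 4,
    l (j * d + i) = 5 ∧ u (j * d + i) = 12

namespace Axle

variable {d : ℕ}

/-- The axle obtained from `A` by raising `l` to `u` at each spoke where `u` is at most eight. -/
def raise (A : Axle d) : Axle d where
  l i := if 1 ≤ i ∧ i ≤ d ∧ A.u i ≤ 8 then A.u i else A.l i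
  u := A.u
  le i hi := by
    have := A.le i hi
    split_ifs <;> omega
  l_mem i hi := by
    have h1 := A.l_mem i hi
    have h2 := A.u_mem i hi
    simp only [Finset.mem_insert, Finset.mem_singleton] at h1 h2 ⊢
    split_ifs <;> omega
  u_mem := A.u_mem
  fan i hi h j hj := by
    have hi' := Finset.mem_Icc.mp hi
    have hj' := Finset.mem_Icc.mp hj
    have hd : d < j * d + i := by nlinarith
    have h1 : ¬ (1 ≤ j * d + i ∧ j * d + i ≤ d ∧ A.u (j * d + i) ≤ 8) := by omega
    rw [if_neg h1]
    refine A.fan i hi ?_ j hj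
    intro he
    apply h
    split_ifs
    · rfl
    · exact he

/-- The fan over the spoke `i` is present in the part derived from `A`. -/
def HasFan (A : Axle d) (i : ℕ) : Prop := A.l i = A.u i

/-- The vertices of the part derived from `A`: the hub `0`, the spokes `1, …, d`, the hats
`d + 1, …, 2 * d`, and, for each spoke `i` with `k = l i = u i`, the `k - 5` fan vertices
`2 * d + i, …, (k - 4) * d + i`. -/
def IsPartVertex (A : Axle d) (x : ℕ) : Prop :=
  x ≤ 2 * d ∨ ∃ i ∈ Finset.Icc 1 d, ∃ j, 2 ≤ j ∧ A.HasFan i ∧ j + 4 ≤ A.u i ∧ x = j * d + i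

/-- The spoke that follows the spoke `i` in clockwise order. -/
def succSpoke (d i : ℕ) : ℕ := if i = d then 1 else i + 1

/-- The hat adjacent to the spoke `i` and to the spoke preceding `i`; the hat adjacent to `i` and
to the spoke following `i` is `d + i`. -/
def hatBefore (d i : ℕ) : ℕ := if i = 1 then 2 * d else d + (i - 1)

/-- If the fan over the spoke `i` is present, then the neighbours of `i` other than the hub and
two spokes form a path, in clockwise order: position `0` is the hat before `i`, positions
`1, …, u i - 5` are the fan vertices, and position `u i - 4` is the hat `d + i`. -/
def rim (A : Axle d) (i m : ℕ) : ℕ :=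
  if m = 0 then hatBefore d i else if m + 5 ≤ A.u i then (m + 1) * d + i else d + i

/-- The finite regions of the part derived from `A`, each with its vertices in clockwise order. -/
inductive PartTriangle (A : Axle d) : ℕ → ℕ → ℕ → Prop
  | hub (i : ℕ) : i ∈ Finset.Icc 1 d → PartTriangle A 0 i (succSpoke d i)
  | hat (i : ℕ) : i ∈ Finset.Icc 1 d → PartTriangle A i (d + i) (succSpoke d i)
  | fan (i m : ℕ) : i ∈ Finset.Icc 1 d → A.HasFan i → m + 5 ≤ A.u i →
      PartTriangle A i (A.rim i m) (A.rim i (m + 1))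

/-- `u` and `v` are two vertices, in one of the two orders, of a triangle of the part. -/
def IsPartEdge (A : Axle d) (x y : ℕ) : Prop :=
  ∃ a b c, A.PartTriangle a b c ∧ x ≠ y ∧ x ∈ ({a, b, c} : Set ℕ) ∧ y ∈ ({a, b, c} : Set ℕ)

/-- The configuration `K` is the skeleton of the axle `A`: its drawing is the one of the part
derived from `A.raise`, and `γ` is the upper bound function (with value `d` at the hub). -/
structure IsSkeleton (A : Axle d) (K : Configuration ℕ) : Prop where
  verts : ∀ x, x ∈ K.verts ↔ A.raise.IsPartVertex x
  adj : ∀ x y, K.Adj x y ↔ A.raise.IsPartEdge x y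
  triangle : ∀ x y z, A.raise.PartTriangle x y z → K.ClockwiseTriangle x y z
  hub : K.γ 0 = d
  γ : ∀ x ∈ K.verts, x ≠ 0 → K.γ x = A.u x

end Axle

/-- For every spoke of the skeleton that is not in `L`, one of the two hats adjacent to it is not
in `L` either. Here `L` is a subconfiguration of the skeleton of an axle of degree `d`. -/
def WellPositioned (d : ℕ) (L : Configuration ℕ) : Prop :=
  ∀ i ∈ Finset.Icc 1 d, i ∉ L.verts → d + i ∉ L.verts ∨ Axle.hatBefore d i ∉ L.verts

/-- A good configuration is a well-positioned induced subconfiguration of the skeleton. -/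
def Axle.SemiReducible (𝒞 : Set (Configuration ℕ)) {d : ℕ} (A : Axle d) : Prop :=
  ∃ K M : Configuration ℕ, A.IsSkeleton K ∧ M.IsGood 𝒞 ∧ M.IsInducedSubconfiguration K ∧
    WellPositioned d M

/-! ### Systems of oriented triangles -/

namespace TriSys

open Classical Finset

variable {W : Type*}
variable {R D E Z : Finset (W × W × W)} {a b c : W} {C : Finset W} {par : W → W} {rank : W → ℕ}

/-- `(a, b)` is a dart of a triangle of `D`. -/
def Dart (D : Finset (W × W × W)) (a b : W) : Prop := ∃ c, (a, b, c) ∈ D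

def rot (t : W × W × W) : W × W × W := (t.2.1, t.2.2, t.1)

def RotClosed (D : Finset (W × W × W)) : Prop := ∀ a b c, (a, b, c) ∈ D → (b, c, a) ∈ D

/-- An oriented triangle system: different triangles have different darts, and every nonempty
subsystem has a boundary. -/
structure Sys (R : Finset (W × W × W)) : Prop where
  rot : RotClosed R
  func : ∀ a b c c', (a, b, c) ∈ R → (a, b, c') ∈ R → c = c'
  irr : ∀ a b c, (a, b, c) ∈ R → a ≠ b
  planar : ∀ D ⊆ R, RotClosed D → D.Nonempty → ∃ a b c, (a, b, c) ∈ D ∧ ¬ Dart D b a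

theorem Sys.mono (h : Sys R) (hD : D ⊆ R) (hr : RotClosed D) :
    Sys D where
  rot := hr
  func a b c c' h1 h2 := h.func a b c c' (hD h1) (hD h2)
  irr a b c h1 := h.irr a b c (hD h1)
  planar E hE := h.planar E (hE.trans hD)

noncomputable def verts (D : Finset (W × W × W)) : Finset W := D.image Prod.fst

theorem mem_verts {v : W} : v ∈ verts D ↔ ∃ b c, (v, b, c) ∈ D := by
  simp [verts]

/-- The darts of `D` whose reversal is also a dart of `D`. -/
noncomputable def inn (D : Finset (W × W × W)) : Finset (W × W × W) :=
  D.filter fun t => Dart D t.2.1 t.1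

theorem mem_inn :
    (a, b, c) ∈ inn D ↔ (a, b, c) ∈ D ∧ Dart D b a := by
  simp [inn]

/-- Six times (one minus the Euler characteristic), with twice the number of edges equal to
`2 * |D| - |inn D|`. -/
noncomputable def c6 (D : Finset (W × W × W)) : ℤ :=
  4 * (D.card : ℤ) - 3 * (inn D).card + 6 - 6 * (verts D).card

def Edge (D : Finset (W × W × W)) (a b : W) : Prop := Dart D a b ∨ Dart D b a

theorem Edge.symm (h : Edge D a b) : Edge D b a := Or.symm h

theorem RotClosed.sdiff (hD : RotClosed D) (hE : RotClosed E) :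
    RotClosed (D \ E) := by
  intro a b c h
  rw [mem_sdiff] at h ⊢
  exact ⟨hD _ _ _ h.1, fun h' => h.2 (hE _ _ _ (hE _ _ _ h'))⟩

theorem RotClosed.union (hD : RotClosed D) (hE : RotClosed E) :
    RotClosed (D ∪ E) := by
  intro a b c h
  rw [mem_union] at h ⊢
  exact h.imp (hD _ _ _) (hE _ _ _)

theorem Dart.mono (h : D ⊆ E) (hd : Dart D a b) :
    Dart E a b := hd.imp fun _ hc => h hc

theorem verts_mono (h : D ⊆ E) : verts D ⊆ verts E :=
  image_subset_image h

theorem RotClosed.mem_verts (hD : RotClosed D)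
    (h : (a, b, c) ∈ D) : a ∈ verts D ∧ b ∈ verts D ∧ c ∈ verts D :=
  ⟨TriSys.mem_verts.2 ⟨_, _, h⟩, TriSys.mem_verts.2 ⟨_, _, hD _ _ _ h⟩,
    TriSys.mem_verts.2 ⟨_, _, hD _ _ _ (hD _ _ _ h)⟩⟩

theorem RotClosed.edge_verts (hD : RotClosed D)
    (h : Edge D a b) : a ∈ verts D ∧ b ∈ verts D := by
  rcases h with ⟨c, h⟩ | ⟨c, h⟩
  exacts [⟨(hD.mem_verts h).1, (hD.mem_verts h).2.1⟩, ⟨(hD.mem_verts h).2.1, (hD.mem_verts h).1⟩]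

/-- The triangle `(a, b, c)` in its three rotations. -/
noncomputable def tri (a b c : W) : Finset (W × W × W) := {(a, b, c), (b, c, a), (c, a, b)}

theorem mem_tri {t : W × W × W} :
    t ∈ tri a b c ↔ t = (a, b, c) ∨ t = (b, c, a) ∨ t = (c, a, b) := by
  simp [tri]

theorem rotClosed_tri (a b c : W) : RotClosed (tri a b c) := by
  intro x y z h
  simp only [mem_tri, Prod.mk.injEq] at h ⊢
  tauto

theorem RotClosed.tri_subset (hD : RotClosed D)
    (h : (a, b, c) ∈ D) : tri a b c ⊆ D := by
  intro t ht
  rcases mem_tri.1 ht with rfl | rfl | rfl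
  exacts [h, hD _ _ _ h, hD _ _ _ (hD _ _ _ h)]

theorem Sys.ne (hR : Sys R) (h : (a, b, c) ∈ R) :
    a ≠ b ∧ b ≠ c ∧ c ≠ a :=
  ⟨hR.irr _ _ _ h, hR.irr _ _ _ (hR.rot _ _ _ h),
    hR.irr _ _ _ (hR.rot _ _ _ (hR.rot _ _ _ h))⟩

theorem card_tri (h : a ≠ b ∧ b ≠ c ∧ c ≠ a) : (tri a b c).card = 3 := by
  obtain ⟨h1, h2, h3⟩ := h
  rw [tri, card_insert_of_notMem, card_insert_of_notMem, card_singleton]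
  · simp [h2]
  · simp [h1, h3.symm]

/-! #### Rank trees -/

/-- The tree edges join the vertices of `C` to their parents. -/
def TreeEdge (C : Finset W) (par : W → W) (a b : W) : Prop :=
  (a ∈ C ∧ par a = b) ∨ (b ∈ C ∧ par b = a)

theorem TreeEdge.symm (h : TreeEdge C par a b) :
    TreeEdge C par b a := Or.symm h

/-- The out-neighbours and in-neighbours of a vertex are equinumerous. -/
theorem Sys.card_out_eq_in (hD : Sys D) (v : W) :
    ((verts D).filter fun b => Dart D v b).card = ((verts D).filter fun a => Dart D a v).card := by
  refine card_bij' (fun b _ => if h : Dart D v b then h.choose else b)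
    (fun a _ => if h : Dart D a v then h.choose else a) ?_ ?_ ?_ ?_
  · intro b hb
    have h := (mem_filter.1 hb).2
    have hs := h.choose_spec
    simp only [dif_pos h, mem_filter]
    exact ⟨(hD.rot.mem_verts hs).2.2, ⟨_, hD.rot _ _ _ (hD.rot _ _ _ hs)⟩⟩
  · intro a ha
    have h := (mem_filter.1 ha).2
    have hs := h.choose_spec
    simp only [dif_pos h, mem_filter]
    exact ⟨(hD.rot.mem_verts hs).2.2, ⟨_, (hD.rot _ _ _ hs)⟩⟩
  · intro b hb
    have h := (mem_filter.1 hb).2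
    have hs := h.choose_spec
    have h2 : Dart D h.choose v := ⟨_, hD.rot _ _ _ (hD.rot _ _ _ hs)⟩
    simp only [dif_pos h, dif_pos h2]
    exact hD.func _ _ _ _ h2.choose_spec (hD.rot _ _ _ (hD.rot _ _ _ hs))
  · intro a ha
    have h := (mem_filter.1 ha).2
    have hs := h.choose_spec
    have h2 : Dart D v h.choose := ⟨_, hD.rot _ _ _ hs⟩
    simp only [dif_pos h, dif_pos h2]
    exact hD.func _ _ _ _ h2.choose_spec (hD.rot _ _ _ hs)

/-- The numbers of boundary darts leaving and entering a vertex agree. -/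
theorem Sys.card_bdry (hD : Sys D) (v : W) :
    ((verts D).filter fun b => Dart D v b ∧ ¬ Dart D b v).card =
      ((verts D).filter fun a => Dart D a v ∧ ¬ Dart D v a).card := by
  have h1 := card_filter_add_card_filter_not (s := (verts D).filter fun b => Dart D v b)
    (fun b => Dart D b v)
  have h2 := card_filter_add_card_filter_not (s := (verts D).filter fun b => Dart D b v)
    (fun b => Dart D v b)
  simp only [filter_filter] at h1 h2
  have h3 := hD.card_out_eq_in v
  have h4 : ((verts D).filter fun b => Dart D v b ∧ Dart D b v) =
      ((verts D).filter fun b => Dart D b v ∧ Dart D v b) := by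
    ext; simp [and_comm]
  rw [h4] at h1
  omega

theorem Sys.exists_bdry_not_tree (hD : Sys D) (hne : D.Nonempty)
    (hrank : ∀ v ∈ C, rank (par v) < rank v) :
    ∃ a b c, (a, b, c) ∈ D ∧ ¬ Dart D b a ∧ ¬ TreeEdge C par a b := by
  by_contra! hcon
  let B : Finset W := (verts D).filter fun v => v ∈ C ∧
    ((Dart D v (par v) ∧ ¬ Dart D (par v) v) ∨ (Dart D (par v) v ∧ ¬ Dart D v (par v)))
  have key : ∀ a b, Dart D a b → ¬ Dart D b a → (par a = b ∧ a ∈ B) ∨ (par b = a ∧ b ∈ B) := by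
    intro a b hab hba
    have hv := hD.rot.edge_verts (.inl hab)
    obtain ⟨c, hc⟩ := hab
    rcases hcon a b c hc hba with ⟨ha, rfl⟩ | ⟨hb, rfl⟩
    exacts [.inl ⟨rfl, mem_filter.2 ⟨hv.1, ha, .inl ⟨⟨c, hc⟩, hba⟩⟩⟩,
      .inr ⟨rfl, mem_filter.2 ⟨hv.2, hb, .inr ⟨⟨c, hc⟩, hba⟩⟩⟩]
  have hB : B.Nonempty := by
    obtain ⟨a, b, c, h1, h2⟩ := hD.planar D subset_rfl hD.rot hne
    rcases key a b ⟨c, h1⟩ h2 with h | h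
    exacts [⟨a, h.2⟩, ⟨b, h.2⟩]
  obtain ⟨v, hv, hmax⟩ := exists_max_image B rank hB
  have hvC := (mem_filter.1 hv).2.1
  have ho : ∀ b, Dart D v b → ¬ Dart D b v → b = par v := by grind
  have hi : ∀ b, Dart D b v → ¬ Dart D v b → b = par v := by grind
  have hc := hD.card_bdry v
  rcases (mem_filter.1 hv).2.2 with h | h
  · have h1 : ((verts D).filter fun a => Dart D a v ∧ ¬ Dart D v a) = ∅ := by
      refine filter_eq_empty_iff.2 fun x _ hx => ?_
      grind
    rw [h1, card_empty, card_eq_zero] at hc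
    exact filter_eq_empty_iff.1 hc (hD.rot.edge_verts (.inl h.1)).2 h
  · have h1 : ((verts D).filter fun b => Dart D v b ∧ ¬ Dart D b v) = ∅ := by
      refine filter_eq_empty_iff.2 fun x _ hx => ?_
      grind
    rw [h1, card_empty, eq_comm, card_eq_zero] at hc
    exact filter_eq_empty_iff.1 hc (hD.rot.edge_verts (.inl h.1)).1 h

/-- The edges that do not belong to the tree, as ordered pairs. -/
noncomputable def nontree (D : Finset (W × W × W)) (C : Finset W) (par : W → W) :
    Finset (W × W) :=
  (verts D ×ˢ verts D).filter fun p => Edge D p.1 p.2 ∧ ¬ TreeEdge C par p.1 p.2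

theorem mem_nontree (hD : RotClosed D) :
    (a, b) ∈ nontree D C par ↔ Edge D a b ∧ ¬ TreeEdge C par a b := by
  simp only [nontree, mem_filter, mem_product, and_iff_right_iff_imp]
  exact fun h => hD.edge_verts h.1

/-- Removing a triangle with a boundary dart that is not a tree edge. -/
theorem Sys.remove_bdry (hD : Sys D) (h : (a, b, c) ∈ D) (hb : ¬ Dart D b a)
    (ht : ¬ TreeEdge C par a b) :
    (D \ tri a b c).card + 3 = D.card ∧ Sys (D \ tri a b c) ∧
    nontree (D \ tri a b c) C par ⊆ nontree D C par \ {(a, b), (b, a)} ∧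
    (nontree D C par \ {(a, b), (b, a)}).card + 2 = (nontree D C par).card := by
  have hrc := hD.rot.sdiff (rotClosed_tri a b c)
  refine ⟨?_, hD.mono sdiff_subset hrc, ?_, ?_⟩
  · have := card_sdiff_add_card_eq_card (hD.rot.tri_subset h)
    rwa [card_tri (hD.ne h)] at this
  · have hd : ¬ Edge (D \ tri a b c) a b := by
      rintro (⟨c', hc⟩ | hc)
      · rw [mem_sdiff] at hc
        obtain rfl := hD.func _ _ _ _ h hc.1
        exact hc.2 (mem_tri.2 (.inl rfl))
      · exact hb (hc.mono sdiff_subset)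
    rintro ⟨x, y⟩ hxy
    rw [mem_nontree hrc] at hxy
    rw [mem_sdiff, mem_nontree hD.rot]
    refine ⟨⟨hxy.1.imp (Dart.mono sdiff_subset) (Dart.mono sdiff_subset), hxy.2⟩, ?_⟩
    simp only [mem_insert, mem_singleton, Prod.mk.injEq]
    rintro (⟨rfl, rfl⟩ | ⟨rfl, rfl⟩)
    exacts [hd hxy.1, hd hxy.1.symm]
  · have hs : ({(a, b), (b, a)} : Finset (W × W)) ⊆ nontree D C par := by
      intro p hp
      simp only [mem_insert, mem_singleton] at hp
      rcases hp with rfl | rfl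
      exacts [(mem_nontree hD.rot).2 ⟨.inl ⟨c, h⟩, ht⟩,
        (mem_nontree hD.rot).2 ⟨.inr ⟨c, h⟩, fun h' => ht h'.symm⟩]
    have := card_sdiff_add_card_eq_card hs
    rwa [card_pair] at this
    intro he
    exact (hD.ne h).1 (Prod.mk.inj he).1

theorem Sys.two_mul_card_le
    (hrank : ∀ v ∈ C, rank (par v) < rank v) (n : ℕ) :
    ∀ D : Finset (W × W × W), D.card = n → Sys D → 2 * D.card ≤ 3 * (nontree D C par).card := by
  induction n using Nat.strong_induction_on with
  | _ n ih =>
    intro D hn hD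
    rcases D.eq_empty_or_nonempty with rfl | hne
    · simp
    · obtain ⟨a, b, c, h, hb, ht⟩ := hD.exists_bdry_not_tree hne hrank
      obtain ⟨h1, h2, h3, h4⟩ := hD.remove_bdry h hb ht
      have := ih _ (by omega) _ rfl h2
      have := card_le_card h3
      omega

/-- In a triangle system that is a disc, if some sides are missing and the others connect the
system, then some triangle has exactly one missing side. -/
theorem Sys.exists_one_missing
    (hrank : ∀ v ∈ C, rank (par v) < rank v) {M : W → W → Prop} (hM : ∀ a b, M a b → M b a)
    (n : ℕ) :
    ∀ D : Finset (W × W × W), D.card = n → Sys D → 2 * D.card = 3 * (nontree D C par).card →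
      (∀ a b, Edge D a b → M a b → ¬ TreeEdge C par a b) → (∃ a b, Edge D a b ∧ M a b) →
      ∃ a b c, (a, b, c) ∈ D ∧ M a b ∧ ¬ M b c ∧ ¬ M c a := by
  induction n using Nat.strong_induction_on with
  | _ n ih =>
    intro D hn hD heq hMt hex
    have hne : D.Nonempty := by
      obtain ⟨a, b, ⟨c, h⟩ | ⟨c, h⟩, -⟩ := hex <;> exact ⟨_, h⟩
    obtain ⟨a, b, c, h, hb, ht⟩ := hD.exists_bdry_not_tree hne hrank
    obtain ⟨h1, h2, h3, h4⟩ := hD.remove_bdry h hb ht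
    have h5 := Sys.two_mul_card_le hrank _ _ rfl h2
    have h6 := card_le_card h3
    have h7 := eq_of_subset_of_card_le h3 (by omega)
    by_cases hex' : ∃ a' b', Edge (D \ tri a b c) a' b' ∧ M a' b'
    · obtain ⟨x, y, z, hx, hx'⟩ := ih _ (by omega) _ rfl h2 (by omega)
        (fun x y hxy => hMt x y (hxy.imp (Dart.mono sdiff_subset)
          (Dart.mono sdiff_subset))) hex'
      grind
    · push Not at hex'
      have hside : ∀ x y, Edge D x y → M x y → (x = a ∧ y = b) ∨ (x = b ∧ y = a) := by
        intro x y hxy hm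
        by_contra hcon
        have : (x, y) ∈ nontree (D \ tri a b c) C par := by
          rw [h7, mem_sdiff, mem_nontree hD.rot]
          grind
        rw [mem_nontree h2.rot] at this
        exact hex' x y this.1 hm
      obtain ⟨n1, n2, n3⟩ := hD.ne h
      obtain ⟨x, y, hxy, hm⟩ := hex
      refine ⟨a, b, c, h, ?_, fun hm' => ?_, fun hm' => ?_⟩
      · rcases hside x y hxy hm with ⟨rfl, rfl⟩ | ⟨rfl, rfl⟩
        exacts [hm, hM _ _ hm]
      · rcases hside b c (.inl ⟨_, hD.rot _ _ _ h⟩) hm' with ⟨e1, e2⟩ | ⟨e1, e2⟩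
        exacts [n1 e1.symm, n3 e2]
      · rcases hside c a (.inl ⟨_, hD.rot _ _ _ (hD.rot _ _ _ h)⟩) hm' with ⟨e1, e2⟩ | ⟨e1, e2⟩
        exacts [n3 e1, n2 e1.symm]

/-- The edges as ordered pairs. -/
noncomputable def edges (D : Finset (W × W × W)) : Finset (W × W) :=
  (verts D ×ˢ verts D).filter fun p => Edge D p.1 p.2

theorem mem_edges (hD : RotClosed D) :
    (a, b) ∈ edges D ↔ Edge D a b := by
  simp only [edges, mem_filter, mem_product, and_iff_right_iff_imp]
  exact fun h => hD.edge_verts h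

theorem Sys.card_edges (hD : Sys D) :
    (edges D).card + (inn D).card = 2 * D.card := by
  have hinj : Set.InjOn (fun t : W × W × W => (t.1, t.2.1)) D := by
    rintro ⟨a, b, c⟩ h1 ⟨a', b', c'⟩ h2 h
    obtain ⟨rfl, rfl⟩ := Prod.mk.inj h
    rw [hD.func _ _ _ _ h1 h2]
  have hinj' : Set.InjOn (fun t : W × W × W => (t.2.1, t.1)) D := by
    intro x h1 y h2 h
    refine hinj h1 h2 ?_
    grind
  have h1 := card_union_add_card_inter (D.image fun t : W × W × W => (t.1, t.2.1))
    (D.image fun t : W × W × W => (t.2.1, t.1))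
  rw [card_image_of_injOn hinj, card_image_of_injOn hinj'] at h1
  have h2 : D.image (fun t : W × W × W => (t.1, t.2.1)) ∪
      D.image (fun t : W × W × W => (t.2.1, t.1)) = edges D := by
    ext ⟨a, b⟩
    rw [mem_edges hD.rot]
    simp [Edge, Dart]
  have h3 : D.image (fun t : W × W × W => (t.1, t.2.1)) ∩
      D.image (fun t : W × W × W => (t.2.1, t.1)) =
      (inn D).image fun t : W × W × W => (t.1, t.2.1) := by
    ext ⟨a, b⟩
    simp only [mem_inter, mem_image, Prod.mk.injEq, Prod.exists, mem_inn]
    constructor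
    · rintro ⟨⟨a', b', c, h, rfl, rfl⟩, ⟨x, y, z, h', rfl, rfl⟩⟩
      exact ⟨_, _, c, ⟨h, z, h'⟩, rfl, rfl⟩
    · rintro ⟨a', b', c, ⟨h, z, h'⟩, rfl, rfl⟩
      grind
  rw [h2, h3, card_image_of_injOn
    (hinj.mono (by rw [coe_subset]; exact filter_subset _ _))] at h1
  omega

theorem Sys.c6_eq (hD : Sys D) :
    c6 D = 3 * (edges D).card - 2 * D.card + 6 - 6 * (verts D).card := by
  have h1 := hD.card_edges
  zify at h1
  unfold c6
  linarith

theorem card_treeEdges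
    (hrank : ∀ v ∈ C, rank (par v) < rank v) :
    (C.image (fun v => (v, par v)) ∪ C.image (fun v => (par v, v))).card = 2 * C.card := by
  rw [card_union_of_disjoint, card_image_of_injective, card_image_of_injective]
  · omega
  · intro x y h; exact (Prod.mk.inj h).2
  · intro x y h; exact (Prod.mk.inj h).1
  · rw [disjoint_left]
    grind

theorem exists_rank {E : W → W → Prop} (hE : ∀ a b, E a b → E b a) (r : W) :
    ∃ (rank : W → ℕ) (par : W → W), ∀ v, Relation.ReflTransGen E r v → v ≠ r →
      E v (par v) ∧ rank (par v) < rank v := by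
  let G : SimpleGraph W := SimpleGraph.fromRel E
  have hG : ∀ a b, G.Adj a b → E a b := by
    intro a b h
    rcases h.2 with h | h
    exacts [h, hE _ _ h]
  have hreach : ∀ v, Relation.ReflTransGen E r v → G.Reachable v r := by
    intro v h
    induction h with
    | refl => exact SimpleGraph.Reachable.refl _
    | @tail b c _ hbc ih =>
      by_cases he : b = c
      · subst he; exact ih
      · have : G.Adj c b := ⟨fun h => he h.symm, .inr hbc⟩
        exact this.reachable.trans ih
  have hstep : ∀ v, Relation.ReflTransGen E r v → v ≠ r →
      ∃ w, E v w ∧ G.dist w r < G.dist v r := by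
    intro v hv hne
    obtain ⟨p, hp⟩ := (hreach v hv).exists_walk_length_eq_dist
    cases p with
    | nil => exact absurd rfl hne
    | cons h q =>
      refine ⟨_, hG _ _ h, ?_⟩
      have := SimpleGraph.dist_le q
      simp only [SimpleGraph.Walk.length_cons] at hp
      omega
  refine ⟨fun v => G.dist v r, fun v => if h : ∃ w, E v w ∧ G.dist w r < G.dist v r then
    h.choose else v, ?_⟩
  grind

/-- Euler's inequality for a connected graph with dart set `A`, and the case of equality. -/
theorem Sys.graph_le (hD : Sys D) {V : Finset W} {A : Finset (W × W)}
    (hAV : ∀ a b, (a, b) ∈ A → a ∈ V ∧ b ∈ V) (hDA : ∀ a b, Edge D a b → (a, b) ∈ A)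
    {E : W → W → Prop} (hE : ∀ a b, E a b → E b a) (hEA : ∀ a b, E a b → (a, b) ∈ A)
    (hV : V.Nonempty) (hconn : ∀ a ∈ V, ∀ b ∈ V, Relation.ReflTransGen E a b) :
    2 * D.card + 6 * V.card ≤ 3 * A.card + 6 ∧ (2 * D.card + 6 * V.card = 3 * A.card + 6 →
      (∀ a b, (a, b) ∈ A → ¬ E a b → Edge D a b) ∧ ((∃ a b, (a, b) ∈ A ∧ ¬ E a b) →
        ∃ a b c, (a, b, c) ∈ D ∧ ¬ E a b ∧ E b c ∧ E c a)) := by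
  obtain ⟨r, hr⟩ := hV
  obtain ⟨rank, par, h⟩ := exists_rank hE r
  have h' : ∀ v ∈ V.erase r, E v (par v) ∧ rank (par v) < rank v := fun v hv =>
    h v (hconn r hr v (mem_of_mem_erase hv)) (ne_of_mem_erase hv)
  have htree : ∀ x y, TreeEdge (V.erase r) par x y → E x y := by
    rintro x y (⟨hx, rfl⟩ | ⟨hy, rfl⟩)
    exacts [(h' _ hx).1, hE _ _ (h' _ hy).1]
  have h1 := Sys.two_mul_card_le (fun v hv => (h' v hv).2) _ D rfl hD
  have h2 := card_filter_add_card_filter_not (s := A)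
    (fun p => TreeEdge (V.erase r) par p.1 p.2)
  have h3 : nontree D (V.erase r) par ⊆ A.filter fun p => ¬ TreeEdge (V.erase r) par p.1 p.2 := by
    rintro ⟨a, b⟩ hp
    rw [mem_nontree hD.rot] at hp
    grind
  have h4 : A.filter (fun p => TreeEdge (V.erase r) par p.1 p.2) =
      (V.erase r).image (fun v => (v, par v)) ∪ (V.erase r).image (fun v => (par v, v)) := by
    ext ⟨a, b⟩
    rw [mem_filter, and_iff_right_of_imp fun h => hEA _ _ (htree _ _ h)]
    simp [TreeEdge, mem_image, Prod.mk.injEq]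
  have h5 := card_treeEdges fun v hv => (h' v hv).2
  have h6 := card_le_card h3
  have h7 := card_erase_add_one hr
  rw [h4, h5] at h2
  refine ⟨by omega, fun heq => ?_⟩
  have h8 := eq_of_subset_of_card_le h3 (by omega)
  have h9 : ∀ a b, (a, b) ∈ A → ¬ E a b → Edge D a b := by
    intro a b hab hn
    have : (a, b) ∈ nontree D (V.erase r) par := by grind
    exact ((mem_nontree hD.rot).1 this).1
  refine ⟨h9, ?_⟩
  rintro ⟨a, b, hab, hm⟩
  obtain ⟨x, y, z, k1, k2, k3, k4⟩ := Sys.exists_one_missing (fun v hv => (h' v hv).2)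
    (M := fun a b => ¬ E a b) (fun a b h h' => h (hE _ _ h')) _ D rfl hD (by omega)
    (fun x y _ h h' => h (htree x y h')) ⟨a, b, h9 a b hab hm, hm⟩
  grind

/-- `D` is connected. -/
def Conn (D : Finset (W × W × W)) : Prop :=
  ∀ a ∈ verts D, ∀ b ∈ verts D, Relation.ReflTransGen (Edge D) a b

theorem Sys.c6_nonneg (hD : Sys D) (hc : Conn D) : 0 ≤ c6 D := by
  rcases D.eq_empty_or_nonempty with rfl | ⟨⟨a, b, c⟩, hne⟩
  · simp [c6, inn, verts]
  · have := (hD.graph_le (V := verts D) (A := edges D) (fun a b h => hD.rot.edge_verts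
      ((mem_edges hD.rot).1 h)) (fun a b h => (mem_edges hD.rot).2 h) (fun _ _ h => Edge.symm h)
      (fun a b h => (mem_edges hD.rot).2 h) ⟨a, mem_verts.2 ⟨_, _, hne⟩⟩ hc).1
    rw [hD.c6_eq]
    zify at this
    linarith

/-- If `c6 D = 0` and the sides that are not missing connect `D`, then some triangle has exactly
one missing side. -/
theorem Sys.exists_one_missing' (hD : Sys D) (h0 : c6 D = 0)
    {E : W → W → Prop} (hE : ∀ a b, E a b → E b a) (hED : ∀ a b, E a b → Edge D a b)
    (hconn : ∀ a ∈ verts D, ∀ b ∈ verts D, Relation.ReflTransGen E a b)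
    (hex : ∃ a b, Edge D a b ∧ ¬ E a b) :
    ∃ a b c, (a, b, c) ∈ D ∧ ¬ E a b ∧ E b c ∧ E c a := by
  obtain ⟨a, b, hab, hm⟩ := hex
  rw [hD.c6_eq] at h0
  exact ((hD.graph_le (V := verts D) (A := edges D) (fun a b h => hD.rot.edge_verts
    ((mem_edges hD.rot).1 h)) (fun a b h => (mem_edges hD.rot).2 h) hE
    (fun a b h => (mem_edges hD.rot).2 (hED a b h)) ⟨a, (hD.rot.edge_verts hab).1⟩ hconn).2
    (by zify; linarith)).2 ⟨a, b, (mem_edges hD.rot).2 hab, hm⟩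

/-! #### Counting -/

theorem sum_rot (hD : RotClosed D) (φ : W × W × W → ℤ) :
    ∑ t ∈ D, φ (rot t) = ∑ t ∈ D, φ t := by
  refine sum_bij' (fun t _ => rot t) (fun t _ => rot (rot t)) ?_ ?_ ?_ ?_ ?_
  · rintro ⟨a, b, c⟩ h; exact hD _ _ _ h
  · rintro ⟨a, b, c⟩ h; exact hD _ _ _ (hD _ _ _ h)
  · rintro ⟨a, b, c⟩ h; rfl
  · rintro ⟨a, b, c⟩ h; rfl
  · rintro ⟨a, b, c⟩ h; rfl

/-- The darts of `D` whose reversal is a dart of `Z`. -/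
noncomputable def shared (D Z : Finset (W × W × W)) : Finset (W × W × W) :=
  D.filter fun t => Dart Z t.2.1 t.1

theorem mem_shared :
    (a, b, c) ∈ shared D Z ↔ (a, b, c) ∈ D ∧ Dart Z b a := by
  simp [shared]

theorem card_shared_le (hR : Sys R) (hD : D ⊆ R) :
    (shared D Z).card ≤ (shared Z D).card := by
  refine card_le_card_of_injOn
    (fun t => if h : Dart Z t.2.1 t.1 then (t.2.1, t.1, h.choose) else t) ?_ ?_
  · rintro ⟨a, b, c⟩ ht
    obtain ⟨h1, h2⟩ := mem_filter.1 ht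
    simp only [dif_pos h2]
    exact mem_filter.2 ⟨h2.choose_spec, ⟨c, h1⟩⟩
  · rintro ⟨a, b, c⟩ ht ⟨a', b', c'⟩ ht' he
    obtain ⟨h1, h2⟩ := mem_filter.1 ht
    obtain ⟨h1', h2'⟩ := mem_filter.1 ht'
    simp only [dif_pos h2, dif_pos h2', Prod.mk.injEq] at he
    obtain ⟨rfl, rfl, -⟩ := he
    rw [hR.func _ _ _ _ (hD h1) (hD h1')]

theorem card_shared_comm (hR : Sys R) (hD : D ⊆ R) (hZ : Z ⊆ R) :
    (shared D Z).card = (shared Z D).card :=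
  le_antisymm (card_shared_le hR hD) (card_shared_le hR hZ)

theorem card_inn_union (hR : Sys R) (hD : D ⊆ R) (hZ : Z ⊆ R)
    (hdisj : Disjoint D Z) :
    (inn (D ∪ Z)).card = (inn D).card + (inn Z).card + 2 * (shared D Z).card := by
  have hnot : ∀ a b, Dart D a b → Dart Z a b → False := by
    rintro a b ⟨c, h1⟩ ⟨c', h2⟩
    obtain rfl := hR.func _ _ _ _ (hD h1) (hZ h2)
    exact disjoint_left.1 hdisj h1 h2
  have h1 : inn (D ∪ Z) = (inn D ∪ shared D Z) ∪ (inn Z ∪ shared Z D) := by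
    ext ⟨a, b, c⟩
    have : Dart (D ∪ Z) b a ↔ Dart D b a ∨ Dart Z b a := by
      simp only [Dart, mem_union, exists_or]
    simp only [mem_inn, mem_shared, mem_union, this]
    tauto
  rw [h1, card_union_of_disjoint, card_union_of_disjoint,
    card_union_of_disjoint, card_shared_comm hR hZ hD]
  · ring
  · rw [disjoint_left]
    rintro t h2 h3
    exact hnot _ _ (mem_filter.1 h3).2 (mem_filter.1 h2).2
  · rw [disjoint_left]
    rintro t h2 h3
    exact hnot _ _ (mem_filter.1 h2).2 (mem_filter.1 h3).2
  · refine disjoint_of_subset_left (union_subset (filter_subset _ _)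
      (filter_subset _ _)) (disjoint_of_subset_right (union_subset
      (filter_subset _ _) (filter_subset _ _)) hdisj)

theorem verts_union (D Z : Finset (W × W × W)) : verts (D ∪ Z) = verts D ∪ verts Z :=
  image_union _ _

theorem c6_union (hR : Sys R) (hD : D ⊆ R) (hZ : Z ⊆ R)
    (hdisj : Disjoint D Z) :
    c6 (D ∪ Z) = c6 D + c6 Z - 6 + 6 * ((verts D ∩ verts Z).card : ℤ) -
      6 * ((shared D Z).card : ℤ) := by
  have h1 := card_inn_union hR hD hZ hdisj
  have h2 := card_union_of_disjoint hdisj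
  have h3 := card_union_add_card_inter (verts D) (verts Z)
  unfold c6
  rw [verts_union, h1, h2]
  omega

theorem c6_tri (h : a ≠ b ∧ b ≠ c ∧ c ≠ a) : c6 (tri a b c) = 0 := by
  have h1 := card_tri h
  obtain ⟨n1, n2, n3⟩ := h
  have h2 : inn (tri a b c) = ∅ := by
    refine filter_eq_empty_iff.2 ?_
    rintro ⟨x, y, z⟩ hx ⟨w, hw⟩
    simp only [mem_tri, Prod.mk.injEq] at hx hw
    grind
  have h3 : verts (tri a b c) = {a, b, c} := by
    ext x
    simp [verts, tri]
  unfold c6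
  grind

/-- The corners of triangles of `R \ D` both of whose sides belong to triangles of `D`. -/
noncomputable def leaves (R D : Finset (W × W × W)) : Finset (W × W × W) :=
  (R \ D).filter fun t => Dart D t.2.1 t.1 ∧ Dart D t.1 t.2.2

theorem mem_leaves {p : W} :
    (p, a, b) ∈ leaves R D ↔ (p, a, b) ∈ R ∧ (p, a, b) ∉ D ∧ Dart D a p ∧ Dart D p b := by
  simp [leaves, and_assoc]

/-- The darts outside `D` on the boundary of `R`. -/
noncomputable def outBdry (R D : Finset (W × W × W)) : Finset (W × W × W) :=
  (R \ D).filter fun t => ¬ Dart R t.2.1 t.1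

theorem c6_le_leaves (hR : Sys R) (h0 : c6 R = 0) (hDR : D ⊆ R)
    (hD : RotClosed D) (hv : verts D = verts R) :
    c6 D + 3 * (outBdry R D).card ≤ 3 * (leaves R D).card := by
  set U := R \ D with hU
  have hUr : RotClosed U := hR.rot.sdiff hD
  have hUR : U ⊆ R := sdiff_subset
  have hdisj : Disjoint D U := disjoint_sdiff
  have hun : D ∪ U = R := union_sdiff_of_subset hDR
  have hnot : ∀ a b, Dart D a b → Dart U a b → False := by
    rintro a b ⟨c, h1⟩ ⟨c', h2⟩
    obtain rfl := hR.func _ _ _ _ (hDR h1) (hUR h2)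
    grind
  have h1 := card_inn_union hR hDR hUR hdisj
  rw [hun] at h1
  have h2 := card_union_of_disjoint hdisj
  rw [hun] at h2
  have h3 : U.card = (inn U).card + (shared U D).card + (outBdry R D).card := by
    rw [← card_union_of_disjoint, ← card_union_of_disjoint]
    · congr 1
      ext ⟨a, b, c⟩
      simp only [inn, shared, outBdry, mem_union, mem_filter, ← hU]
      have : Dart R b a ↔ Dart D b a ∨ Dart U b a := by
        rw [← hun]; simp only [Dart, mem_union, exists_or]
      tauto
    · rw [disjoint_left]
      intro t ht ht'
      have h4 := (mem_filter.1 ht').2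
      rcases mem_union.1 ht with h | h
      exacts [h4 ((mem_filter.1 h).2.mono hUR), h4 ((mem_filter.1 h).2.mono hDR)]
    · rw [disjoint_left]
      intro t ht ht'
      exact hnot _ _ (mem_filter.1 ht').2 (mem_filter.1 ht).2
  have h4 := card_shared_comm hR hDR hUR
  have h5 : 3 * ((shared U D).card : ℤ) - U.card ≤ 3 * (leaves R D).card := by
    let χ : W × W × W → ℤ := fun t => if Dart D t.2.1 t.1 then 1 else 0
    let ψ : W × W × W → ℤ := fun t => if Dart D t.2.1 t.1 ∧ Dart D t.1 t.2.2 then 1 else 0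
    have e1 : ((shared U D).card : ℤ) = ∑ t ∈ U, χ t := by
      rw [shared, card_filter]; push_cast; rfl
    have e2 : ((leaves R D).card : ℤ) = ∑ t ∈ U, ψ t := by
      rw [leaves, card_filter]; push_cast; rfl
    have e3 : ∑ t ∈ U, (χ t + χ (rot t) + χ (rot (rot t)) - 1) ≤
        ∑ t ∈ U, (ψ t + ψ (rot t) + ψ (rot (rot t))) := by
      refine sum_le_sum ?_
      rintro ⟨a, b, c⟩ -
      simp only [χ, ψ, rot]
      grind
    have r1 := fun φ : W × W × W → ℤ => sum_rot hUr φ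
    have r2 : ∀ φ : W × W × W → ℤ, ∑ t ∈ U, φ (rot (rot t)) = ∑ t ∈ U, φ t := fun φ => by grind
    simp only [sum_add_distrib, sum_sub_distrib, r1, r2, sum_const,
      nsmul_eq_mul, mul_one] at e3
    rw [e1, e2]
    linarith
  unfold c6 at h0 ⊢
  grind

theorem Sys.six_dvd_c6 {D : Finset (W × W × W)} (hD : Sys D) : (6 : ℤ) ∣ c6 D := by
  induction hn : D.card using Nat.strong_induction_on generalizing D with
  | _ n ih =>
    rcases D.eq_empty_or_nonempty with rfl | ⟨⟨a, b, c⟩, hne⟩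
    · simp [c6, inn, verts]
    · have hsub := hD.rot.tri_subset hne
      have hr := hD.rot.sdiff (rotClosed_tri a b c)
      have h1 := c6_union hD (sdiff_subset (s := D) (t := tri a b c)) hsub
        sdiff_disjoint
      rw [sdiff_union_of_subset hsub, c6_tri (hD.ne hne)] at h1
      have h2 := ih _ (by
        rw [← hn]
        exact card_lt_card (sdiff_ssubset hsub ⟨_, mem_tri.2 (.inl rfl)⟩))
        (hD.mono sdiff_subset hr) rfl
      omega

theorem Sys.six_le_c6 {D : Finset (W × W × W)} (hD : Sys D) (hc : Conn D) (h : c6 D ≠ 0) :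
    6 ≤ c6 D := by
  have h1 := hD.six_dvd_c6
  have h2 := hD.c6_nonneg hc
  omega

/-- Adding a leaf does not create new leaves away from its free side. -/
theorem card_leaves_insert {R D : Finset (W × W × W)} (hR : Sys R) (h0 : c6 R = 0) (hDR : D ⊆ R)
    (hD : RotClosed D) (hv : verts D = verts R) {p a b : W} (hl : (p, a, b) ∈ leaves R D)
    (hba : ¬ Dart D b a)
    (hnew : ∀ v x y, v = a ∨ v = b → (v, x, y) ∉ leaves R (D ∪ tri p a b)) :
    c6 D + 3 ≤ 3 * (leaves R D).card := by
  obtain ⟨h1, h2, h3, h4⟩ := mem_leaves.1 hl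
  have htR := hR.rot.tri_subset h1
  have hne := hR.ne h1
  have hsub : D ∪ tri p a b ⊆ R := union_subset hDR htR
  have hrc := hD.union (rotClosed_tri p a b)
  have hmem := hR.rot.mem_verts h1
  have hdisj : Disjoint D (tri p a b) := by
    rw [disjoint_left]
    rintro ⟨x, y, z⟩ h5 h6
    rcases mem_tri.1 h6 with h | h | h <;> cases h
    exacts [h2 h5, h2 (hD _ _ _ (hD _ _ _ h5)), h2 (hD _ _ _ h5)]
  have hvt : verts D ∩ verts (tri p a b) = {p, a, b} := by
    have h5 := (rotClosed_tri p a b).mem_verts (mem_tri.2 (.inl rfl))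
    ext x
    rw [mem_inter, hv]
    simp only [mem_insert, mem_singleton]
    constructor
    · rintro ⟨-, hx⟩
      obtain ⟨y, z, h6⟩ := mem_verts.1 hx
      rcases mem_tri.1 h6 with h | h | h <;> cases h <;> simp
    grind
  have hsh :
    shared D (tri p a b) ⊆
      (D.filter fun x => (x.1, x.2.1) ∈ ({(a, p), (p, b)} : Finset (W × W))) := by
    rintro ⟨x, y, z⟩ hx
    rw [mem_shared] at hx
    obtain ⟨h5, w, h6⟩ := hx
    rw [mem_filter]
    refine ⟨h5, ?_⟩
    simp only [mem_insert, mem_singleton, Prod.mk.injEq]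
    rcases mem_tri.1 h6 with h | h | h <;> cases h
    exacts [.inl ⟨rfl, rfl⟩, absurd ⟨_, h5⟩ hba, .inr ⟨rfl, rfl⟩]
  have hsh2 : (shared D (tri p a b)).card ≤ 2 := by
    refine (card_le_card hsh).trans ?_
    refine (card_le_card_of_injOn (t := ({(a, p), (p, b)} : Finset (W × W)))
      (fun x : W × W × W => (x.1, x.2.1)) (fun x hx => (mem_filter.1 hx).2)
      ?_).trans card_le_two
    rintro ⟨x, y, z⟩ hx ⟨x', y', z'⟩ hx' h
    obtain ⟨rfl, rfl⟩ := Prod.mk.inj h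
    rw [hR.func _ _ _ _ (hDR (mem_filter.1 hx).1) (hDR (mem_filter.1 hx').1)]
  have hc := c6_union hR hDR htR hdisj
  rw [c6_tri hne, hvt, card_eq_three.2 ⟨p, a, b, hne.1, hne.2.2.symm, hne.2.1, rfl⟩] at hc
  have hle := c6_le_leaves hR h0 hsub hrc (subset_antisymm (verts_mono hsub) (by
    rw [← hv]; exact verts_mono subset_union_left))
  have hlv : leaves R (D ∪ tri p a b) ⊆ (leaves R D).erase (p, a, b) := by
    rintro ⟨v, x, y⟩ hx
    obtain ⟨g1, g2, g3, g4⟩ := mem_leaves.1 hx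
    rw [mem_union, not_or] at g2
    have hva : v ≠ a := fun h => hnew v x y (.inl h) hx
    have hvb : v ≠ b := fun h => hnew v x y (.inr h) hx
    refine mem_erase.2 ⟨?_, mem_leaves.2 ⟨g1, g2.1, ?_, ?_⟩⟩
    · intro h
      rw [h] at g2
      exact g2.2 (mem_tri.2 (.inl rfl))
    · obtain ⟨w, g3⟩ := g3
      rcases mem_union.1 g3 with g3 | g3
      · exact ⟨w, g3⟩
      · exfalso
        rcases mem_tri.1 g3 with h | h | h <;> cases h
        · exact hva rfl
        · exact hvb rfl
        · obtain ⟨u, h4⟩ := h4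
          obtain rfl := hR.func _ _ _ _ (hDR h4) g1
          exact g2.1 h4
    · obtain ⟨w, g4⟩ := g4
      rcases mem_union.1 g4 with g4 | g4
      · exact ⟨w, g4⟩
      · exfalso
        rcases mem_tri.1 g4 with h | h | h <;> cases h
        · obtain ⟨u, h3⟩ := h3
          have := hR.rot _ _ _ (hR.rot _ _ _ g1)
          obtain rfl := hR.func _ _ _ _ (hDR h3) this
          exact g2.1 (hD _ _ _ h3)
        exacts [hva rfl, hvb rfl]
  have h5 := card_le_card hlv
  rw [card_erase_of_mem hl] at h5
  have h6 : 0 < (leaves R D).card := card_pos.2 ⟨_, hl⟩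
  push_cast at hc
  omega

end TriSys

/-! ### The part around a hub -/

namespace Wheel

open TriSys

/-- The vertices: hub, spokes, hats (`h i` is adjacent to the spokes `i` and `i + 1`), and the
inner vertices of the rims of the fans. -/
inductive KV (d : ℕ)
  | hub
  | s (i : ZMod d)
  | h (i : ZMod d)
  | r (i : ZMod d) (m : ℕ)

/-- The faces: `t i` at the hub, `e i` below the hat `i`, and the faces `p i m` of the fans. -/
inductive Fc (d : ℕ)
  | t (i : ZMod d)
  | e (i : ZMod d)
  | p (i : ZMod d) (m : ℕ)

open KV Fc

/-- The data of a part: the number of faces of the fan over each spoke, and whether the fan is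
present. -/
structure Fan (d : ℕ) where
  g : ZMod d → ℕ
  fan : ZMod d → Prop
  pos : ∀ i, 0 < g i
  five_le : 5 ≤ d
  g_eq_one : ∀ i, ¬ fan i → g i = 1

namespace Fan

variable {d : ℕ} (W : Fan d)
variable {F : Fc d} {a b : KV d} {i : ZMod d} {m k j n : ℕ}

/-- The rim over the spoke `i`, from the hat `i - 1` to the hat `i`. -/
def rho (i : ZMod d) (m : ℕ) : KV d :=
  if m = 0 then h (i - 1) else if m = W.g i then h i else r i m

def nodes : Fc d → KV d × KV d × KV d
  | t i => (hub, s i, s (i + 1))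
  | e i => (s i, h i, s (i + 1))
  | p i m => (s i, W.rho i m, W.rho i (m + 1))

def Valid : Fc d → Prop
  | t _ => True
  | e _ => True
  | p i m => W.fan i ∧ m < W.g i

/-- `(x, a, b)` is a rotation of the vertices of `F`. -/
def At (F : Fc d) (x a b : KV d) : Prop :=
  W.nodes F = (x, a, b) ∨ W.nodes F = (a, b, x) ∨ W.nodes F = (b, x, a)

theorem At.rot {W : Fan d} {x : KV d} (h : W.At F x a b) : W.At F a b x := by
  unfold At at h ⊢; tauto

@[simp] theorem rho_zero (i : ZMod d) : W.rho i 0 = h (i - 1) := by simp [rho]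

@[simp] theorem rho_g (i : ZMod d) : W.rho i (W.g i) = h i := by
  have := W.pos i
  simp [rho, this.ne']

theorem rho_inner (h0 : 0 < m) (h1 : m < W.g i) : W.rho i m = r i m := by
  simp [rho, h0.ne', h1.ne]

@[simp] theorem rho_ne_s (i j : ZMod d) (m : ℕ) : W.rho i m ≠ s j := by
  unfold rho; split_ifs <;> simp

@[simp] theorem rho_ne_hub (i : ZMod d) (m : ℕ) : W.rho i m ≠ hub := by
  unfold rho; split_ifs <;> simp

include W in
theorem cast_ne_zero (h0 : 0 < k) (h1 : k < 5) : ((k : ℕ) : ZMod d) ≠ 0 := by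
  intro h
  rw [ZMod.natCast_eq_zero_iff] at h
  have := Nat.le_of_dvd h0 h
  have := W.five_le
  omega

include W in
theorem ne_of_sub {a b : ZMod d} (k : ℕ) (h0 : 0 < k := by norm_num)
    (h1 : k < 5 := by norm_num) (h : a - b = k := by push_cast; ring) : a ≠ b := by
  rintro rfl
  rw [sub_self] at h
  exact W.cast_ne_zero h0 h1 h.symm

theorem rho_eq_h {j : ZMod d} (hm : m ≤ W.g i) :
    W.rho i m = h j ↔ (m = 0 ∧ j = i - 1) ∨ (m = W.g i ∧ j = i) := by
  have := W.pos i
  unfold rho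
  grind

theorem rho_eq_r {j : ZMod d} :
    W.rho i m = r j n ↔ j = i ∧ n = m ∧ 0 < m ∧ m ≠ W.g i := by
  unfold rho
  grind

theorem rho_inj (hm : m ≤ W.g i) (hn : n ≤ W.g i)
    (h : W.rho i m = W.rho i n) : m = n := by
  have h1 : i - 1 ≠ i := (W.ne_of_sub 1).symm
  have := W.pos i
  unfold rho at h
  grind

/-- The neighbours of the spoke `i`, in clockwise order. -/
def X (i : ZMod d) (j : ℕ) : KV d :=
  if j = 0 then s (i - 1) else if j ≤ W.g i + 1 then W.rho i (j - 1) else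
    if j = W.g i + 2 then s (i + 1) else if j = W.g i + 3 then hub else s (i - 1)

/-- The faces at the spoke `i`, in clockwise order. -/
def Φ (i : ZMod d) (j : ℕ) : Fc d :=
  if j = 0 then e (i - 1) else if j ≤ W.g i then p i (j - 1) else
    if j = W.g i + 1 then e i else if j = W.g i + 2 then t i else t (i - 1)

@[simp] theorem X_zero (i : ZMod d) : W.X i 0 = s (i - 1) := by simp [X]
theorem X_succ (h : m ≤ W.g i) : W.X i (m + 1) = W.rho i m := by
  simp [X, h]
@[simp] theorem X_one (i : ZMod d) : W.X i 1 = h (i - 1) := by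
  have := W.X_succ (i := i) (m := 0) (by omega); simpa using this
@[simp] theorem X_g1 (i : ZMod d) : W.X i (W.g i + 1) = h i := by rw [X_succ _ le_rfl, rho_g]
@[simp] theorem X_g2 (i : ZMod d) : W.X i (W.g i + 2) = s (i + 1) := by simp [X]
@[simp] theorem X_g3 (i : ZMod d) : W.X i (W.g i + 3) = hub := by simp [X]
@[simp] theorem X_g4 (i : ZMod d) : W.X i (W.g i + 4) = s (i - 1) := by simp [X]
@[simp] theorem Φ_zero (i : ZMod d) : W.Φ i 0 = e (i - 1) := by simp [Φ]
theorem Φ_succ (h : m < W.g i) : W.Φ i (m + 1) = p i m := by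
  have : m + 1 ≤ W.g i := h
  simp [Φ, this]
@[simp] theorem Φ_g1 (i : ZMod d) : W.Φ i (W.g i + 1) = e i := by simp [Φ]
@[simp] theorem Φ_g2 (i : ZMod d) : W.Φ i (W.g i + 2) = t i := by simp [Φ]
@[simp] theorem Φ_g3 (i : ZMod d) : W.Φ i (W.g i + 3) = t (i - 1) := by simp [Φ]

/-- Case distinction for the position of a face at a spoke. -/
theorem pos_cases (h : j < W.g i + 4) :
    j = 0 ∨ (∃ m < W.g i, j = m + 1) ∨ j = W.g i + 1 ∨ j = W.g i + 2 ∨ j = W.g i + 3 := by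
  rcases Nat.eq_zero_or_pos j with h0 | h0
  · exact .inl h0
  · by_cases h1 : j ≤ W.g i
    · exact .inr (.inl ⟨j - 1, by omega, by omega⟩)
    · omega

theorem X_inj (hj : j < W.g i + 4) (hk : k < W.g i + 4)
    (h : W.X i j = W.X i k) : j = k := by
  have h2 : i - 1 ≠ i + 1 :=
    (W.ne_of_sub 2).symm
  have h3 := fun m n => W.rho_ne_s i m n
  have h4 := fun m n => (W.rho_ne_s i m n).symm
  have h5 := fun m => (W.rho_ne_hub i m).symm
  unfold X at h
  split_ifs at h
  all_goals first
    | omega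
    | exact absurd h (by simp [h2, h2.symm, h4, h5])
    | (have := W.rho_inj (by omega) (by omega) h; omega)

theorem at_spoke (hF : W.Valid F) :
    W.At F (s i) a b ↔ ∃ j < W.g i + 4, F = W.Φ i j ∧ a = W.X i j ∧ b = W.X i (j + 1) := by
  constructor
  · intro hat
    rcases F with k | k | ⟨k, m⟩
    · rcases hat with h | h | h <;> simp only [nodes, Prod.mk.injEq] at h
      · exact absurd h.1 (by simp)
      · obtain ⟨rfl, rfl, h⟩ := h
        obtain rfl : k = i - 1 := eq_sub_of_add_eq (KV.s.inj h)
        exact ⟨W.g i + 3, by omega, by simp, by simp, by simp⟩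
      · obtain ⟨rfl, h, rfl⟩ := h
        obtain rfl := KV.s.inj h
        exact ⟨W.g k + 2, by omega, by simp, by simp, by simp⟩
    · rcases hat with h | h | h <;> simp only [nodes, Prod.mk.injEq] at h
      · obtain ⟨h, rfl, rfl⟩ := h
        obtain rfl := KV.s.inj h
        exact ⟨W.g k + 1, by omega, by simp, by simp, by simp⟩
      · obtain ⟨rfl, rfl, h⟩ := h
        obtain rfl : k = i - 1 := eq_sub_of_add_eq (KV.s.inj h)
        exact ⟨0, by omega, by simp, by simp, by simp⟩
      · exact absurd h.2.1 (by simp)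
    · rcases hat with h | h | h <;> simp only [nodes, Prod.mk.injEq] at h
      · obtain ⟨h, rfl, rfl⟩ := h
        obtain rfl := KV.s.inj h
        refine ⟨m + 1, by have := hF.2; omega, (W.Φ_succ hF.2).symm, (W.X_succ hF.2.le).symm,
          (W.X_succ hF.2).symm⟩
      exacts [absurd h.2.2 (by simp), absurd h.2.1 (by simp)]
  · rintro ⟨j, hj, rfl, rfl, rfl⟩
    rcases W.pos_cases hj with rfl | ⟨m, hm, rfl⟩ | rfl | rfl | rfl
    · simp [At, nodes]
    · rw [W.Φ_succ hm, W.X_succ hm.le, W.X_succ hm]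
      exact .inl rfl
    · simp [At, nodes]
    · simp [At, nodes]
    · simp [At, nodes]

theorem at_hub :
    W.At F hub a b ↔ ∃ j, F = t j ∧ a = s j ∧ b = s (j + 1) := by
  constructor
  · intro hat
    rcases F with k | k | ⟨k, m⟩
    · rcases hat with h | h | h <;> simp only [nodes, Prod.mk.injEq] at h
      exacts [⟨k, rfl, h.2.1.symm, h.2.2.symm⟩, absurd h.2.2 (by simp), absurd h.2.1 (by simp)]
    · rcases hat with h | h | h <;> simp [nodes] at h
    · rcases hat with h | h | h <;> simp [nodes] at h
  · rintro ⟨j, rfl, rfl, rfl⟩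
    exact .inl rfl

theorem at_hat (hF : W.Valid F) :
    W.At F (h i) a b ↔ (F = p (i + 1) 0 ∧ a = W.rho (i + 1) 1 ∧ b = s (i + 1)) ∨
      (F = e i ∧ a = s (i + 1) ∧ b = s i) ∨
      (F = p i (W.g i - 1) ∧ a = s i ∧ b = W.rho i (W.g i - 1)) := by
  have hg := W.pos i
  constructor
  · intro hat
    rcases F with k | k | ⟨k, m⟩
    · rcases hat with h | h | h <;> simp [nodes] at h
    · rcases hat with h | h | h <;> simp only [nodes, Prod.mk.injEq] at h
      exacts [absurd h.1 (by simp), absurd h.2.2 (by simp), by grind]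
    · have hm := hF.2
      rcases hat with h | h | h <;> simp only [nodes, Prod.mk.injEq] at h
      · exact absurd h.1 (by simp)
      · obtain ⟨rfl, rfl, h⟩ := h
        rcases (W.rho_eq_h hm).1 h with h | ⟨h, rfl⟩
        · omega
        grind
      · obtain ⟨rfl, h, rfl⟩ := h
        rcases (W.rho_eq_h hm.le).1 h with ⟨rfl, rfl⟩ | ⟨h, rfl⟩
        · simp
        · omega
  · rintro (⟨rfl, rfl, rfl⟩ | ⟨rfl, rfl, rfl⟩ | ⟨rfl, rfl, rfl⟩)
    · simp [At, nodes]
    · simp [At, nodes]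
    · have : W.g i - 1 + 1 = W.g i := by omega
      simp [At, nodes, this]

theorem at_rim (hF : W.Valid F)
    (hat : W.At F (r i m) a b) : 0 < m ∧ m < W.g i ∧
      ((F = p i m ∧ a = W.rho i (m + 1) ∧ b = s i) ∨
        (F = p i (m - 1) ∧ a = s i ∧ b = W.rho i (m - 1))) := by
  rcases F with k | k | ⟨k, n⟩
  · rcases hat with h | h | h <;> simp [nodes] at h
  · rcases hat with h | h | h <;> simp [nodes] at h
  · have hm := hF.2
    rcases hat with h | h | h <;> simp only [nodes, Prod.mk.injEq] at h
    · exact absurd h.1 (by simp)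
    · obtain ⟨rfl, rfl, h⟩ := h
      obtain ⟨rfl, rfl, h1, h2⟩ := W.rho_eq_r.1 h
      grind
    · obtain ⟨rfl, h, rfl⟩ := h
      obtain ⟨rfl, rfl, h1, h2⟩ := W.rho_eq_r.1 h
      grind

/-- Two faces that share an edge. -/
inductive Nb : Fc d → Fc d → Prop
  | tt (i : ZMod d) : Nb (t i) (t (i + 1))
  | te (i : ZMod d) : Nb (t i) (e i)
  | pe (i : ZMod d) : Nb (p i (W.g i - 1)) (e i)
  | ep (i : ZMod d) : Nb (e i) (p (i + 1) 0)
  | pp (i : ZMod d) (m : ℕ) : m + 1 < W.g i → Nb (p i m) (p i (m + 1))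

/-- A symmetric version of `Nb`. -/
def Nbs (F G : Fc d) : Prop := W.Nb F G ∨ W.Nb G F

theorem nbs_Φ (hj : j < W.g i + 3) : W.Nbs (W.Φ i j) (W.Φ i (j + 1)) := by
  have hg := W.pos i
  rcases W.pos_cases (show j < W.g i + 4 by omega) with rfl | ⟨m, hm, rfl⟩ | rfl | rfl | rfl
  · rw [W.Φ_succ hg, W.Φ_zero]
    have := Nb.ep (W := W) (i - 1)
    rw [sub_add_cancel] at this
    exact .inl this
  · by_cases h : m + 1 < W.g i
    · rw [W.Φ_succ hm, W.Φ_succ h]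
      exact .inl (Nb.pp i m h)
    · have h : m + 1 = W.g i := by omega
      rw [W.Φ_succ hm, h, Φ_g1]
      obtain rfl : m = W.g i - 1 := by omega
      exact .inl (Nb.pe i)
  · rw [Φ_g1, Φ_g2]; exact .inr (Nb.te i)
  · rw [Φ_g2, Φ_g3]
    have := Nb.tt (W := W) (i - 1)
    rw [sub_add_cancel] at this
    exact .inr this
  · omega

theorem nbs_Φ_last (i : ZMod d) : W.Nbs (W.Φ i (W.g i + 3)) (W.Φ i 0) := by
  rw [Φ_g3, Φ_zero]; exact .inl (Nb.te _)

/-- The triangle `(a, b, c)` is a face, up to rotation. -/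
def IsFace (a b c : KV d) : Prop := ∃ F, W.Valid F ∧ W.At F a b c

end Fan

end Wheel

namespace Wheel

open TriSys KV Fc Fan Classical Finset

variable {d : ℕ} {W : Fan d} {γ : KV d → ℕ} {R : Finset (KV d × KV d × KV d)} {z₀ z₁ : KV d}
variable {F G F₀ M F' : Fc d} {a b c x y a' b' : KV d} {P : Fc d → Prop} {v m n q g u : ℕ}
  {D : Finset (KV d × KV d × KV d)} {i j k : ZMod d} {A : ℕ → Prop}

/-- The face `F` belongs to the system `R`. -/
def Fan.Has (W : Fan d) (R : Finset (KV d × KV d × KV d)) (F : Fc d) : Prop :=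
  W.Valid F ∧ W.nodes F ∈ R

/-- A disc of triangles on the vertices of a part, whose degrees are those of the part, and which
is generated by faces of the part. -/
structure Disc (W : Fan d) (γ : KV d → ℕ) (R : Finset (KV d × KV d × KV d)) (z₀ z₁ : KV d) :
    Prop where
  sys : Sys R
  c6_eq : c6 R = 0
  link : ∀ p (S : Finset (KV d)), S.Nonempty → (∀ a ∈ S, ∃ b ∈ S, (p, a, b) ∈ R) → S.card = γ p
  deg_hub : γ hub = d
  spoke : ∀ i, W.fan i → γ (s i) = W.g i + 4
  spoke' : ∀ i, ¬ W.fan i → 7 ≤ γ (s i)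
  hat : ∀ i, 5 ≤ γ (h i)
  rim : ∀ i m, 5 ≤ γ (r i m)
  close_hub : ∀ i, (∀ j, j ≠ i → W.Has R (t j)) → W.Has R (t i)
  close_spoke : ∀ i, W.fan i → ∀ q < W.g i + 4,
    (∀ j < W.g i + 4, j ≠ q → W.Has R (W.Φ i j)) → W.Has R (W.Φ i q)
  gen : ∀ X : KV d → Prop, (∃ v ∈ verts R, X v) → ¬ X z₀ → ¬ X z₁ →
    ∃ F a b c, W.Has R F ∧ W.At F a b c ∧ X a ∧ ¬ X b ∧ ¬ X c
  start : ∃ F c, W.Has R F ∧ (W.At F z₀ z₁ c ∨ W.At F z₁ z₀ c)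

theorem Fan.Has.mem (hR : Sys R) (hF : W.Has R F) (h : W.At F a b c) :
    (a, b, c) ∈ R := by
  rcases h with h | h | h
  exacts [h ▸ hF.2, hR.rot _ _ _ (hR.rot _ _ _ (h ▸ hF.2)), hR.rot _ _ _ (h ▸ hF.2)]

theorem Fan.has_of_mem (hR : Sys R) (hF : W.Valid F) (h : W.At F a b c)
    (hm : (a, b, c) ∈ R) : W.Has R F := by
  refine ⟨hF, ?_⟩
  rcases h with h | h | h <;> rw [h]
  exacts [hm, hR.rot _ _ _ hm, hR.rot _ _ _ (hR.rot _ _ _ hm)]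

/-- The triangles of the faces that satisfy `P`. -/
noncomputable def Fan.sub (W : Fan d) (R : Finset (KV d × KV d × KV d)) (P : Fc d → Prop) :
    Finset (KV d × KV d × KV d) :=
  R.filter fun x => ∃ F, P F ∧ W.At F x.1 x.2.1 x.2.2

/-- `P` is a set of faces in `R` that is closed under adjacency in `R`. -/
structure Closed (W : Fan d) (R : Finset (KV d × KV d × KV d)) (P : Fc d → Prop) : Prop where
  has : ∀ F, P F → W.Has R F
  adj : ∀ F G, P F → W.Has R G → W.Nbs F G → P G

theorem sub_subset : W.sub R P ⊆ R := filter_subset _ _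

/-- The next position at the spoke `i`. -/
def Fan.nx (W : Fan d) (i : ZMod d) (j : ℕ) : ℕ := if j = W.g i + 3 then 0 else j + 1

theorem X_nx {j : ℕ} : W.X i (W.nx i j) = W.X i (j + 1) := by
  unfold Fan.nx
  split_ifs with h
  · subst h; simp
  · rfl

theorem nx_lt {j : ℕ} (h : j < W.g i + 4) : W.nx i j < W.g i + 4 := by
  unfold Fan.nx; split_ifs <;> omega

theorem nbs_nx {j : ℕ} (h : j < W.g i + 4) :
    W.Nbs (W.Φ i j) (W.Φ i (W.nx i j)) := by
  unfold Fan.nx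
  split_ifs with h1
  · subst h1; exact W.nbs_Φ_last i
  · exact W.nbs_Φ (by omega)

/-- The last positions of the runs of faces at a spoke. -/
def EndPos (W : Fan d) (P : Fc d → Prop) (i : ZMod d) (j : ℕ) : Prop :=
  j < W.g i + 4 ∧ P (W.Φ i j) ∧ ¬ P (W.Φ i (W.nx i j))

/-- The first positions of the runs of faces at a spoke. -/
def StartPos (W : Fan d) (P : Fc d → Prop) (i : ZMod d) (k : ℕ) : Prop :=
  k < W.g i + 4 ∧ P (W.Φ i k) ∧ ∀ j < W.g i + 4, W.nx i j = k → ¬ P (W.Φ i j)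

theorem at_self (F : Fc d) : W.At F (W.nodes F).1 (W.nodes F).2.1 (W.nodes F).2.2 := .inl rfl

theorem At.eq_or {v : KV d} (h : W.At F a b c) (h' : W.At F v x y) :
    v = a ∨ v = b ∨ v = c := by
  rcases h with h | h | h <;> rcases h' with h' | h' | h' <;> rw [h] at h' <;>
    simp only [Prod.mk.injEq] at h' <;> tauto

section

variable (hR : Sys R) (hP : ∀ F, P F → W.Has R F)
include hR hP

theorem mem_sub :
    (a, b, c) ∈ W.sub R P ↔ ∃ F, P F ∧ W.At F a b c := by
  simp only [Fan.sub, mem_filter, and_iff_right_iff_imp]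
  rintro ⟨F, h1, h2⟩
  exact (hP F h1).mem hR h2

theorem rotClosed_sub :
    RotClosed (W.sub R P) := by
  intro a b c h
  rw [mem_sub hR hP] at h ⊢
  obtain ⟨F, h1, h2⟩ := h
  exact ⟨F, h1, h2.rot⟩

theorem sys_sub :
    Sys (W.sub R P) := hR.mono sub_subset (rotClosed_sub hR hP)

theorem dart_out {p : KV d} :
    Dart (W.sub R P) p b ↔ ∃ F c, P F ∧ W.At F p b c := by
  simp only [Dart, mem_sub hR hP]
  exact exists_comm

theorem dart_in {p : KV d} :
    Dart (W.sub R P) a p ↔ ∃ F b, P F ∧ W.At F p b a := by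
  rw [dart_out hR hP]
  constructor
  · rintro ⟨F, c, h1, h2⟩; exact ⟨F, c, h1, h2.rot⟩
  · rintro ⟨F, c, h1, h2⟩; exact ⟨F, c, h1, h2.rot.rot⟩

theorem mem_verts_sub {v : KV d} :
    v ∈ verts (W.sub R P) ↔ ∃ F a b, P F ∧ W.At F v a b := by
  simp only [mem_verts, mem_sub hR hP]
  grind

theorem out_spoke :
    Dart (W.sub R P) (s i) b ↔ ∃ j < W.g i + 4, P (W.Φ i j) ∧ b = W.X i j := by
  rw [dart_out hR hP]
  constructor
  · rintro ⟨F, c, h1, h2⟩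
    obtain ⟨j, hj, rfl, h3, -⟩ := (W.at_spoke (hP F h1).1).1 h2
    exact ⟨j, hj, h1, h3⟩
  · rintro ⟨j, hj, h1, rfl⟩
    exact ⟨_, _, h1, (W.at_spoke (hP _ h1).1).2 ⟨j, hj, rfl, rfl, rfl⟩⟩

theorem in_spoke :
    Dart (W.sub R P) a (s i) ↔ ∃ j < W.g i + 4, P (W.Φ i j) ∧ a = W.X i (j + 1) := by
  rw [dart_in hR hP]
  constructor
  · rintro ⟨F, c, h1, h2⟩
    obtain ⟨j, hj, rfl, -, h3⟩ := (W.at_spoke (hP F h1).1).1 h2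
    exact ⟨j, hj, h1, h3⟩
  · rintro ⟨j, hj, h1, rfl⟩
    exact ⟨_, _, h1, (W.at_spoke (hP _ h1).1).2 ⟨j, hj, rfl, rfl, rfl⟩⟩

theorem inEnd_spoke (h1 : Dart (W.sub R P) a (s i))
    (h2 : ¬ Dart (W.sub R P) (s i) a) :
    ∃ j, EndPos W P i j ∧ a = W.X i (j + 1) := by
  obtain ⟨j, hj, h3, rfl⟩ := (in_spoke hR hP).1 h1
  refine ⟨j, ⟨hj, h3, fun h4 => h2 ?_⟩, rfl⟩
  exact (out_spoke hR hP).2 ⟨_, nx_lt hj, h4, X_nx.symm⟩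

theorem outEnd_spoke (h1 : Dart (W.sub R P) (s i) b)
    (h2 : ¬ Dart (W.sub R P) b (s i)) :
    ∃ k, StartPos W P i k ∧ b = W.X i k := by
  obtain ⟨k, hk, h3, rfl⟩ := (out_spoke hR hP).1 h1
  refine ⟨k, ⟨hk, h3, ?_⟩, rfl⟩
  rintro j hj rfl h4
  exact h2 ((in_spoke hR hP).2 ⟨j, hj, h4, X_nx⟩)

theorem card_out_spoke (i : ZMod d) :
    ((verts (W.sub R P)).filter fun b => Dart (W.sub R P) (s i) b).card ≤
      ((range (W.g i + 4)).filter fun j => P (W.Φ i j)).card := by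
  refine (card_le_card ?_).trans (card_image_le (f := W.X i))
  intro b hb
  obtain ⟨j, hj, h1, rfl⟩ := (out_spoke hR hP).1 (mem_filter.1 hb).2
  grind

theorem At.edges (hF : P F) (h : W.At F a b c) :
    Edge (W.sub R P) a b ∧ Edge (W.sub R P) b c ∧ Edge (W.sub R P) c a :=
  ⟨.inl ((dart_out hR hP).2 ⟨F, c, hF, h⟩), .inl ((dart_out hR hP).2 ⟨F, a, hF, h.rot⟩),
    .inl ((dart_out hR hP).2 ⟨F, b, hF, h.rot.rot⟩)⟩

theorem mem_verts_spoke :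
    s i ∈ verts (W.sub R P) ↔ ∃ j < W.g i + 4, P (W.Φ i j) := by
  rw [mem_verts_sub hR hP]
  constructor
  · rintro ⟨F, a, b, h1, h2⟩
    obtain ⟨j, hj, rfl, -⟩ := (W.at_spoke (hP F h1).1).1 h2
    exact ⟨j, hj, h1⟩
  · rintro ⟨j, hj, h1⟩
    exact ⟨_, _, _, h1, (W.at_spoke (hP _ h1).1).2 ⟨j, hj, rfl, rfl, rfl⟩⟩

theorem mem_verts_hat :
    h i ∈ verts (W.sub R P) ↔ P (p (i + 1) 0) ∨ P (e i) ∨ P (p i (W.g i - 1)) := by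
  rw [mem_verts_sub hR hP]
  constructor
  · rintro ⟨F, a, b, h1, h2⟩
    rcases (W.at_hat (hP F h1).1).1 h2 with ⟨rfl, -⟩ | ⟨rfl, -⟩ | ⟨rfl, -⟩ <;> simp [h1]
  · rintro (h1 | h1 | h1)
    exacts [⟨_, _, _, h1, (W.at_hat (hP _ h1).1).2 (.inl ⟨rfl, rfl, rfl⟩)⟩,
      ⟨_, _, _, h1, (W.at_hat (hP _ h1).1).2 (.inr (.inl ⟨rfl, rfl, rfl⟩))⟩,
      ⟨_, _, _, h1, (W.at_hat (hP _ h1).1).2 (.inr (.inr ⟨rfl, rfl, rfl⟩))⟩]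

theorem mem_verts_rim (hv : r i m ∈ verts (W.sub R P)) :
    0 < m ∧ m < W.g i ∧ (P (p i m) ∨ P (p i (m - 1))) := by
  obtain ⟨F, a, b, h1, h2⟩ := (mem_verts_sub hR hP).1 hv
  obtain ⟨h3, h4, ⟨rfl, -⟩ | ⟨rfl, -⟩⟩ := W.at_rim (hP F h1).1 h2 <;> simp [h1, h3, h4]

theorem mem_verts_hub :
    hub ∈ verts (W.sub R P) ↔ ∃ i, P (t i) := by
  rw [mem_verts_sub hR hP]
  constructor
  · rintro ⟨F, a, b, h1, h2⟩
    obtain ⟨j, rfl, -⟩ := W.at_hub.1 h2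
    exact ⟨j, h1⟩
  · rintro ⟨j, h1⟩
    exact ⟨_, _, _, h1, W.at_hub.2 ⟨j, rfl, rfl, rfl⟩⟩

theorem nodes_mem_verts
    (hF : P F) : (W.nodes F).1 ∈ verts (W.sub R P) ∧ (W.nodes F).2.1 ∈ verts (W.sub R P) ∧
      (W.nodes F).2.2 ∈ verts (W.sub R P) :=
  ⟨(mem_verts_sub hR hP).2 ⟨F, _, _, hF, .inl rfl⟩,
    (mem_verts_sub hR hP).2 ⟨F, _, _, hF, .inr (.inr rfl)⟩,
    (mem_verts_sub hR hP).2 ⟨F, _, _, hF, .inr (.inl rfl)⟩⟩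

end

/-! #### Corners -/

/-- A corner of `R` between two sides of triangles of `D`, at a vertex with only one last
neighbour. -/
theorem Disc.card_out (H : Disc W γ R z₀ z₁) (hD : D ⊆ R)
    (hr : RotClosed D) {p : KV d} (hl : (p, a, b) ∈ leaves R D)
    (huniq : ∀ x, Dart D x p → ¬ Dart D p x → x = a) :
    ((verts D).filter fun b => Dart D p b).card + 1 = γ p := by
  obtain ⟨h1, h2, h3, h4⟩ := mem_leaves.1 hl
  have ha : a ∉ (verts D).filter fun b => Dart D p b := by
    intro ha
    obtain ⟨c, hc⟩ := (mem_filter.1 ha).2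
    rw [H.sys.func _ _ _ _ h1 (hD hc)] at h2
    exact h2 hc
  rw [← card_insert_of_notMem ha]
  refine H.link p _ ⟨a, mem_insert_self _ _⟩ ?_
  have hmem : ∀ x, Dart D p x → x ∈ insert a ((verts D).filter fun b => Dart D p b) := fun x hx =>
    mem_insert_of_mem (mem_filter.2 ⟨(hr.edge_verts (.inl hx)).2, hx⟩)
  intro x hx
  rcases mem_insert.1 hx with rfl | hx
  · exact ⟨b, hmem b h4, h1⟩
  · obtain ⟨c, hc⟩ := (mem_filter.1 hx).2
    refine ⟨c, ?_, hD hc⟩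
    by_cases hpc : Dart D p c
    · exact hmem c hpc
    · rw [huniq c ⟨x, hr _ _ _ (hr _ _ _ hc)⟩ hpc]
      exact mem_insert_self _ _

/-- A leaf at a spoke leads from the end of a run to the start of a run, and is not a face. -/
theorem Disc.leaf_spoke (H : Disc W γ R z₀ z₁) (hP : Closed W R P)
    (hl : (s i, a, b) ∈ leaves R (W.sub R P)) :
    ∃ j k, EndPos W P i j ∧ StartPos W P i k ∧ a = W.X i (j + 1) ∧ b = W.X i k ∧
      (k = W.nx i (W.nx i j) → ¬ W.Valid (W.Φ i (W.nx i j))) := by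
  obtain ⟨h1, h2, h3, h4⟩ := mem_leaves.1 hl
  have ha : ¬ Dart (W.sub R P) (s i) a := by
    rintro ⟨c, hc⟩
    rw [H.sys.func _ _ _ _ h1 (sub_subset hc)] at h2
    exact h2 hc
  have hb : ¬ Dart (W.sub R P) b (s i) := by
    rintro ⟨c, hc⟩
    obtain rfl := H.sys.func _ _ _ _ (H.sys.rot _ _ _ (H.sys.rot _ _ _ h1)) (sub_subset hc)
    exact h2 (rotClosed_sub H.sys hP.has _ _ _ hc)
  obtain ⟨j, hj, rfl⟩ := inEnd_spoke H.sys hP.has h3 ha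
  obtain ⟨k, hk, rfl⟩ := outEnd_spoke H.sys hP.has h4 hb
  refine ⟨j, k, hj, hk, rfl, rfl, fun hkj hv => hj.2.2 ?_⟩
  have hat : W.At (W.Φ i (W.nx i j)) (s i) (W.X i (j + 1)) (W.X i k) :=
    (W.at_spoke hv).2 ⟨_, nx_lt hj.1, rfl, X_nx.symm, by rw [hkj, X_nx]⟩
  exact hP.adj _ _ hj.2.1 (Fan.has_of_mem H.sys hv hat h1) (nbs_nx hj.1)

theorem Disc.le_spoke (H : Disc W γ R z₀ z₁) (i : ZMod d) : W.g i + 4 ≤ γ (s i) := by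
  by_cases hf : W.fan i
  · exact (H.spoke i hf).ge
  · have := H.spoke' i hf
    have := W.g_eq_one i hf
    omega

/-- There is no leaf at a spoke with only one run of faces. -/
theorem Disc.no_leaf_spoke (H : Disc W γ R z₀ z₁) (hP : Closed W R P)
    (huniq : ∀ j j', EndPos W P i j → EndPos W P i j' → j = j') :
    (s i, a, b) ∉ leaves R (W.sub R P) := by
  intro hl
  obtain ⟨j, k, hj, hk, rfl, rfl, hne⟩ := H.leaf_spoke hP hl
  have hc := H.card_out sub_subset (rotClosed_sub H.sys hP.has) hl (by
    intro x h1 h2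
    obtain ⟨j', hj', rfl⟩ := inEnd_spoke H.sys hP.has h1 h2
    rw [huniq j j' hj hj'])
  have h1 := card_out_spoke H.sys hP.has i
  have h2 := card_filter_add_card_filter_not (s := range (W.g i + 4))
    (fun j => P (W.Φ i j))
  rw [card_range] at h2
  have h3 := H.le_spoke i
  have h4 : ((range (W.g i + 4)).filter fun j => ¬ P (W.Φ i j)).card ≤ 1 := by omega
  rw [card_le_one] at h4
  have hfan : W.fan i := by
    by_contra hf
    have h5 := H.spoke' i hf
    have h6 := W.g_eq_one i hf
    omega
  have hall : ∀ q < W.g i + 4, ¬ P (W.Φ i q) → q = W.nx i j := fun q hq hn =>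
    h4 q (mem_filter.2 ⟨mem_range.2 hq, hn⟩) _
      (mem_filter.2 ⟨mem_range.2 (nx_lt hj.1), hj.2.2⟩)
  have hpre : ∃ q < W.g i + 4, W.nx i q = k := by
    rcases Nat.eq_zero_or_pos k with h0 | h0
    · exact ⟨W.g i + 3, by omega, by simp [Fan.nx, h0]⟩
    · refine ⟨k - 1, by have := hk.1; omega, ?_⟩
      have := hk.1
      unfold Fan.nx
      split_ifs <;> omega
  obtain ⟨q, hq, rfl⟩ := hpre
  have hq' := hall q hq (hk.2.2 q hq rfl)
  refine hne (by rw [hq']) ?_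
  rcases W.pos_cases (nx_lt hj.1) with h | ⟨m, hm, h⟩ | h | h | h <;> rw [h]
  · rw [Φ_zero]; trivial
  · rw [W.Φ_succ hm]; exact ⟨hfan, hm⟩
  · rw [Φ_g1]; trivial
  · rw [Φ_g2]; trivial
  · rw [Φ_g3]; trivial

/-- There is no leaf at the hub if it has only one run of faces. -/
theorem Disc.no_leaf_hub (H : Disc W γ R z₀ z₁) (hP : Closed W R P)
    (huniq : ∀ i j, P (t i) → ¬ P (t (i + 1)) → P (t j) → ¬ P (t (j + 1)) → i = j) :
    (hub, a, b) ∉ leaves R (W.sub R P) := by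
  intro hl
  obtain ⟨h1, h2, h3, h4⟩ := mem_leaves.1 hl
  have hout : ∀ b, Dart (W.sub R P) hub b ↔ ∃ j, P (t j) ∧ b = s j := by
    intro b
    rw [dart_out H.sys hP.has]
    constructor
    · rintro ⟨F, c, h5, h6⟩
      obtain ⟨j, rfl, rfl, -⟩ := W.at_hub.1 h6
      exact ⟨j, h5, rfl⟩
    · rintro ⟨j, h5, rfl⟩
      exact ⟨_, _, h5, W.at_hub.2 ⟨j, rfl, rfl, rfl⟩⟩
  have hin : ∀ b, Dart (W.sub R P) b hub ↔ ∃ j, P (t j) ∧ b = s (j + 1) := by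
    intro b
    rw [dart_in H.sys hP.has]
    constructor
    · rintro ⟨F, c, h5, h6⟩
      obtain ⟨j, rfl, -, rfl⟩ := W.at_hub.1 h6
      exact ⟨j, h5, rfl⟩
    · rintro ⟨j, h5, rfl⟩
      exact ⟨_, _, h5, W.at_hub.2 ⟨j, rfl, rfl, rfl⟩⟩
  have ha : ¬ Dart (W.sub R P) hub a := by
    rintro ⟨c, hc⟩
    rw [H.sys.func _ _ _ _ h1 (sub_subset hc)] at h2
    exact h2 hc
  have hb : ¬ Dart (W.sub R P) b hub := by
    rintro ⟨c, hc⟩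
    obtain rfl := H.sys.func _ _ _ _ (H.sys.rot _ _ _ (H.sys.rot _ _ _ h1)) (sub_subset hc)
    exact h2 (rotClosed_sub H.sys hP.has _ _ _ hc)
  obtain ⟨j, hj, rfl⟩ := (hin a).1 h3
  obtain ⟨k, hk, rfl⟩ := (hout b).1 h4
  have hj' : ¬ P (t (j + 1)) := fun h => ha ((hout _).2 ⟨_, h, rfl⟩)
  have hk' : ¬ P (t (k - 1)) := fun h => hb ((hin _).2 ⟨_, h, by rw [sub_add_cancel]⟩)
  have hc := H.card_out sub_subset (rotClosed_sub H.sys hP.has) hl (by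
    intro x h5 h6
    obtain ⟨j', hj1, rfl⟩ := (hin x).1 h5
    rw [huniq j j' hj hj' hj1 fun h => h6 ((hout _).2 ⟨_, h, rfl⟩)])
  have : NeZero d := ⟨by have := W.five_le; omega⟩
  have h5 : ((verts (W.sub R P)).filter fun b => Dart (W.sub R P) hub b).card ≤
      ((univ : Finset (ZMod d)).filter fun j => P (t j)).card := by
    refine (card_le_card ?_).trans (card_image_le (f := fun j => s j))
    intro b hb
    obtain ⟨j, h6, rfl⟩ := (hout b).1 (mem_filter.1 hb).2
    grind
  have h6 := card_filter_add_card_filter_not (s := (univ : Finset (ZMod d)))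
    (fun j => P (t j))
  rw [card_univ, ZMod.card] at h6
  have h7 := H.deg_hub
  have h8 : ((univ : Finset (ZMod d)).filter fun j => ¬ P (t j)).card ≤ 1 := by omega
  rw [card_le_one] at h8
  have h9 := h8 _ (mem_filter.2 ⟨mem_univ _, hj'⟩) _
    (mem_filter.2 ⟨mem_univ _, hk'⟩)
  have hat : W.At (t (j + 1)) hub (s (j + 1)) (s k) :=
    W.at_hub.2 ⟨_, rfl, rfl, by rw [h9, sub_add_cancel]⟩
  exact hj' (hP.adj _ _ hj (Fan.has_of_mem H.sys trivial hat h1) (.inl (Nb.tt j)))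

/-- A leaf at a hat. -/
theorem Disc.leaf_hat (H : Disc W γ R z₀ z₁) (hP : Closed W R P)
    (hl : (h i, a, b) ∈ leaves R (W.sub R P)) :
    ¬ P (e i) ∧ P (p i (W.g i - 1)) ∧ P (p (i + 1) 0) ∧ a = W.rho i (W.g i - 1) ∧
      b = W.rho (i + 1) 1 := by
  have hsl := hl
  obtain ⟨h1, h2, h3, h4⟩ := mem_leaves.1 hl
  have ha : ¬ Dart (W.sub R P) (h i) a := by
    rintro ⟨c, hc⟩
    rw [H.sys.func _ _ _ _ h1 (sub_subset hc)] at h2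
    exact h2 hc
  have hb : ¬ Dart (W.sub R P) b (h i) := by
    rintro ⟨c, hc⟩
    obtain rfl := H.sys.func _ _ _ _ (H.sys.rot _ _ _ (H.sys.rot _ _ _ h1)) (sub_subset hc)
    exact h2 (rotClosed_sub H.sys hP.has _ _ _ hc)
  have hout : ∀ b, Dart (W.sub R P) (h i) b ↔ (P (p (i + 1) 0) ∧ b = W.rho (i + 1) 1) ∨
      (P (e i) ∧ b = s (i + 1)) ∨ (P (p i (W.g i - 1)) ∧ b = s i) := by
    intro b
    rw [dart_out H.sys hP.has]
    constructor
    · rintro ⟨F, c, h5, h6⟩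
      rcases (W.at_hat (hP.has _ h5).1).1 h6 with ⟨rfl, rfl, -⟩ | ⟨rfl, rfl, -⟩ | ⟨rfl, rfl, -⟩ <;>
        simp [h5]
    · rintro (⟨h5, rfl⟩ | ⟨h5, rfl⟩ | ⟨h5, rfl⟩)
      exacts [⟨_, _, h5, (W.at_hat (hP.has _ h5).1).2 (.inl ⟨rfl, rfl, rfl⟩)⟩,
        ⟨_, _, h5, (W.at_hat (hP.has _ h5).1).2 (.inr (.inl ⟨rfl, rfl, rfl⟩))⟩,
        ⟨_, _, h5, (W.at_hat (hP.has _ h5).1).2 (.inr (.inr ⟨rfl, rfl, rfl⟩))⟩]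
  have hin : ∀ a, Dart (W.sub R P) a (h i) ↔ (P (p (i + 1) 0) ∧ a = s (i + 1)) ∨
      (P (e i) ∧ a = s i) ∨ (P (p i (W.g i - 1)) ∧ a = W.rho i (W.g i - 1)) := by
    intro b
    rw [dart_in H.sys hP.has]
    constructor
    · rintro ⟨F, c, h5, h6⟩
      rcases (W.at_hat (hP.has _ h5).1).1 h6 with ⟨rfl, -, rfl⟩ | ⟨rfl, -, rfl⟩ | ⟨rfl, -, rfl⟩ <;>
        simp [h5]
    · rintro (⟨h5, rfl⟩ | ⟨h5, rfl⟩ | ⟨h5, rfl⟩)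
      exacts [⟨_, _, h5, (W.at_hat (hP.has _ h5).1).2 (.inl ⟨rfl, rfl, rfl⟩)⟩,
        ⟨_, _, h5, (W.at_hat (hP.has _ h5).1).2 (.inr (.inl ⟨rfl, rfl, rfl⟩))⟩,
        ⟨_, _, h5, (W.at_hat (hP.has _ h5).1).2 (.inr (.inr ⟨rfl, rfl, rfl⟩))⟩]
  by_cases hcase : ¬ P (e i) ∧ P (p i (W.g i - 1)) ∧ P (p (i + 1) 0)
  · obtain ⟨c1, c2, c3⟩ := hcase
    refine ⟨c1, c2, c3, ?_⟩
    simp only [hout, hin, c1, c2, c3, true_and, false_and, false_or] at h3 h4 ha hb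
    push Not at ha hb
    have hor : (a = s (i + 1) ∧ b = s i) ∨ (a = s (i + 1) ∧ b = W.rho (i + 1) 1) ∨
        (a = W.rho i (W.g i - 1) ∧ b = s i) ∨
        (a = W.rho i (W.g i - 1) ∧ b = W.rho (i + 1) 1) := by tauto
    rcases hor with ⟨rfl, rfl⟩ | ⟨rfl, rfl⟩ | ⟨rfl, rfl⟩ | h
    · have hat : W.At (e i) (h i) (s (i + 1)) (s i) :=
        (W.at_hat (F := e i) trivial).2 (.inr (.inl ⟨rfl, rfl, rfl⟩))
      exact absurd (hP.adj _ _ c2 (Fan.has_of_mem H.sys (F := e i) trivial hat h1) (.inl (Nb.pe i)))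
        c1
    · have hat := (hP.has _ c3).mem H.sys
        ((W.at_hat (hP.has _ c3).1 (i := i)).2 (.inl ⟨rfl, rfl, rfl⟩))
      have := H.link (h i) {W.rho (i + 1) 1, s (i + 1)} (by simp) (by
        intro x hx
        simp only [mem_insert, mem_singleton] at hx
        rcases hx with rfl | rfl
        exacts [⟨_, by simp, hat⟩, ⟨_, by simp, h1⟩])
      have := H.hat i
      grind
    · have hat := (hP.has _ c2).mem H.sys
        ((W.at_hat (hP.has _ c2).1 (i := i)).2 (.inr (.inr ⟨rfl, rfl, rfl⟩)))
      have := H.link (h i) {s i, W.rho i (W.g i - 1)} (by simp) (by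
        intro x hx
        simp only [mem_insert, mem_singleton] at hx
        rcases hx with rfl | rfl
        exacts [⟨_, by simp, hat⟩, ⟨_, by simp, h1⟩])
      have := H.hat i
      grind
    · exact h
  · exfalso
    have hc := H.card_out sub_subset (rotClosed_sub H.sys hP.has) hl (by
      intro x h5 h6
      rw [hin] at h5 h3
      rw [hout] at h6 ha
      push Not at h6 ha
      by_cases q1 : P (p (i + 1) 0) <;> by_cases q2 : P (e i) <;> by_cases q3 : P (p i (W.g i - 1))
      all_goals simp_all)
    have h5 : ((verts (W.sub R P)).filter fun b => Dart (W.sub R P) (h i) b) ⊆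
        {W.rho (i + 1) 1, s (i + 1), s i} := by
      intro b hb
      have := (hout b).1 (mem_filter.1 hb).2
      grind
    have h6 := card_le_card h5
    have h7 := card_le_three (a := W.rho (i + 1) 1) (b := s (i + 1)) (c := s i)
    have := H.hat i
    omega

/-- There is no leaf at an inner vertex of a rim. -/
theorem Disc.no_leaf_rim (H : Disc W γ R z₀ z₁) (hP : Closed W R P) :
    (r i m, a, b) ∉ leaves R (W.sub R P) := by
  intro hl
  obtain ⟨h1, h2, h3, h4⟩ := mem_leaves.1 hl
  have hout : ∀ b, Dart (W.sub R P) (r i m) b → (P (p i m) ∧ b = W.rho i (m + 1)) ∨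
      (P (p i (m - 1)) ∧ b = s i) := by
    intro b hb
    obtain ⟨F, c, h5, h6⟩ := (dart_out H.sys hP.has).1 hb
    rcases (W.at_rim (hP.has _ h5).1 h6).2.2 with ⟨rfl, rfl, -⟩ | ⟨rfl, rfl, -⟩ <;> simp [h5]
  have hin : ∀ a, Dart (W.sub R P) a (r i m) → (P (p i m) ∧ a = s i) ∨
      (P (p i (m - 1)) ∧ a = W.rho i (m - 1)) := by
    intro b hb
    obtain ⟨F, c, h5, h6⟩ := (dart_in H.sys hP.has).1 hb
    rcases (W.at_rim (hP.has _ h5).1 h6).2.2 with ⟨rfl, -, rfl⟩ | ⟨rfl, -, rfl⟩ <;> simp [h5]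
  have hs : P (p i (m - 1)) → 0 < m → m < W.g i → Dart (W.sub R P) (r i m) (s i) := by
    intro h5 h6 h7
    refine (dart_out H.sys hP.has).2 ⟨_, W.rho i (m - 1), h5, ?_⟩
    have : m - 1 + 1 = m := by omega
    exact .inr (.inl (by simp [nodes, this, W.rho_inner h6 h7]))
  have hm : 0 < m ∧ m < W.g i := by
    obtain ⟨F, c, h5, h6⟩ := (dart_out H.sys hP.has).1 h4
    have := W.at_rim (hP.has _ h5).1 h6
    exact ⟨this.1, this.2.1⟩
  have ha : ¬ Dart (W.sub R P) (r i m) a := by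
    rintro ⟨c, hc⟩
    rw [H.sys.func _ _ _ _ h1 (sub_subset hc)] at h2
    exact h2 hc
  have hc := H.card_out sub_subset (rotClosed_sub H.sys hP.has) hl (by
    intro x h5 h6
    rcases hin x h5 with ⟨q1, rfl⟩ | ⟨q1, rfl⟩ <;> rcases hin a h3 with ⟨q2, rfl⟩ | ⟨q2, rfl⟩
    · rfl
    · grind
    · grind
    · rfl)
  have h5 : ((verts (W.sub R P)).filter fun b => Dart (W.sub R P) (r i m) b) ⊆
      {W.rho i (m + 1), s i} := by grind
  have h6 := card_le_card h5
  have h7 := card_le_two (a := W.rho i (m + 1)) (b := s i)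
  have := H.rim i m
  omega

/-- A connected closed set of faces that has all vertices and no leaves is everything. -/
theorem Disc.isFace_of_no_leaf (H : Disc W γ R z₀ z₁) (hP : Closed W R P)
    (hv : verts R ⊆ verts (W.sub R P)) (hc : Conn (W.sub R P))
    (hno : ∀ x, x ∉ leaves R (W.sub R P)) (habc : (a, b, c) ∈ R) :
    W.IsFace a b c := by
  suffices hmem : (a, b, c) ∈ W.sub R P by
    obtain ⟨F, h1, h2⟩ := (mem_sub H.sys hP.has).1 hmem
    exact ⟨F, (hP.has F h1).1, h2⟩
  by_contra hmem
  have hmono : ∀ x y, Edge (W.sub R P) x y → Edge R x y := fun x y h =>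
    h.imp (Dart.mono sub_subset) (Dart.mono sub_subset)
  have hrev : ∀ x y z, (x, y, z) ∈ R → (x, y, z) ∉ W.sub R P → Edge (W.sub R P) x y →
      Dart (W.sub R P) y x := by
    rintro x y z h1 h2 (⟨w, h3⟩ | h3)
    · obtain rfl := H.sys.func _ _ _ _ h1 (sub_subset h3)
      exact absurd h3 h2
    · exact h3
  have hrc := rotClosed_sub H.sys hP.has
  have hleaf : ∀ x y z, (x, y, z) ∈ R → (x, y, z) ∉ W.sub R P → Edge (W.sub R P) x y →
      Edge (W.sub R P) z x → False := by
    intro x y z h1 h2 h3 h4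
    refine hno (x, y, z) (mem_leaves.2 ⟨h1, h2, hrev _ _ _ h1 h2 h3, ?_⟩)
    exact hrev _ _ _ (H.sys.rot _ _ _ (H.sys.rot _ _ _ h1)) (fun h => h2 (hrc _ _ _ h)) h4
  by_cases hex : ∃ x y, Edge R x y ∧ ¬ Edge (W.sub R P) x y
  · obtain ⟨x, y, z, h1, h2, h3, h4⟩ := H.sys.exists_one_missing' H.c6_eq
      (E := Edge (W.sub R P)) (fun _ _ h => h.symm) hmono
      (fun a ha b hb => hc a (hv ha) b (hv hb)) hex
    refine hleaf z x y (H.sys.rot _ _ _ (H.sys.rot _ _ _ h1)) (fun h => h2 ?_) h4 h3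
    exact .inl ⟨z, hrc _ _ _ h⟩
  · push Not at hex
    exact hleaf a b c habc hmem (hex _ _ (.inl ⟨_, habc⟩))
      (hex _ _ (.inl ⟨_, H.sys.rot _ _ _ (H.sys.rot _ _ _ habc)⟩))

/-! #### Components -/

/-- `F` and `G` can be joined through adjacent faces in `R`. -/
def Joined (W : Fan d) (R : Finset (KV d × KV d × KV d)) : Fc d → Fc d → Prop :=
  Relation.ReflTransGen fun F G => W.Has R F ∧ W.Has R G ∧ W.Nbs F G

theorem Joined.symm (h : Joined W R F G) : Joined W R G F := by
  induction h with
  | refl => exact Relation.ReflTransGen.refl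
  | tail _ hbc ih => exact Relation.ReflTransGen.head ⟨hbc.2.1, hbc.1, hbc.2.2.symm⟩ ih

/-- The component of the face `F₀`. -/
def Comp (W : Fan d) (R : Finset (KV d × KV d × KV d)) (F₀ F : Fc d) : Prop :=
  W.Has R F₀ ∧ Joined W R F₀ F

theorem Comp.has (h : Comp W R F₀ F) : W.Has R F := by
  obtain ⟨h0, h⟩ := h
  cases h with
  | refl => exact h0
  | tail _ hbc => exact hbc.2.1

theorem Comp.adj (h : Comp W R F₀ F) (hG : W.Has R G) (hn : W.Nbs F G) :
    Comp W R F₀ G := ⟨h.1, h.2.tail ⟨h.has, hG, hn⟩⟩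

theorem closed_comp (F₀ : Fc d) : Closed W R (Comp W R F₀) where
  has _ h := h.has
  adj _ _ h hG hn := h.adj hG hn

theorem Comp.induct {B : Fc d → Prop} (hF : Comp W R F₀ F) (hB : B F)
    (step : ∀ A A', W.Nb A A' → Comp W R F₀ A → Comp W R F₀ A' → (B A ↔ B A'))
    (hG : Comp W R F₀ G) : B G := by
  have hj : Joined W R F G := hF.2.symm.trans hG.2
  have : Comp W R F₀ G ∧ B G := by
    clear hG
    induction hj with
    | refl => exact ⟨hF, hB⟩
    | tail _ hbc ih =>
      have h1 := ih.1.adj hbc.2.1 hbc.2.2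
      refine ⟨h1, ?_⟩
      rcases hbc.2.2 with h | h
      exacts [(step _ _ h ih.1 h1).1 ih.2, (step _ _ h h1 ih.1).2 ih.2]
  exact this.2

theorem conn_of_root (r : KV d)
    (h : ∀ v ∈ verts D, Relation.ReflTransGen (Edge D) r v) : Conn D := by
  have hs : ∀ a b, Relation.ReflTransGen (Edge D) a b → Relation.ReflTransGen (Edge D) b a := by
    intro a b hab
    induction hab with
    | refl => exact Relation.ReflTransGen.refl
    | tail _ hbc ih => exact Relation.ReflTransGen.head hbc.symm ih
  exact fun a ha b hb => (hs _ _ (h a ha)).trans (h b hb)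

theorem Fan.Nb.share (h : W.Nb F G) : ∃ v a b a' b', W.At F v a b ∧ W.At G v a' b' := by
  rcases h with i | i | i | i | ⟨i, m, hm⟩
  exacts [⟨hub, _, _, _, _, .inl rfl, .inl rfl⟩, ⟨s i, _, _, _, _, .inr (.inr rfl), .inl rfl⟩,
    ⟨s i, _, _, _, _, .inl rfl, .inl rfl⟩, ⟨s (i + 1), _, _, _, _, .inr (.inl rfl), .inl rfl⟩,
    ⟨s i, _, _, _, _, .inl rfl, .inl rfl⟩]

theorem conn_comp (hR : Sys R) (F₀ : Fc d) : Conn (W.sub R (Comp W R F₀)) := by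
  have hP := (closed_comp (W := W) (R := R) F₀).has
  have key : ∀ F, Joined W R F₀ F → Comp W R F₀ F → ∀ v a b, W.At F v a b →
      Relation.ReflTransGen (Edge (W.sub R (Comp W R F₀))) (W.nodes F₀).1 v := by
    have hface : ∀ F, Comp W R F₀ F → ∀ v a b x y z, W.At F v a b → W.At F x y z →
        Relation.ReflTransGen (Edge (W.sub R (Comp W R F₀))) v x := by
      intro F hF v a b x y z h1 h2
      have h3 := At.edges hR hP hF h1
      rcases At.eq_or h1 h2 with rfl | rfl | rfl
      exacts [Relation.ReflTransGen.refl, Relation.ReflTransGen.single h3.1,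
        Relation.ReflTransGen.single h3.2.2.symm]
    intro F hj
    induction hj with
    | refl =>
      intro hF v a b h
      exact hface _ hF _ _ _ _ _ _ (at_self F₀) h
    | @tail A B hA hAB ih =>
      intro hF v a b h
      have hAc : Comp W R F₀ A := ⟨hF.1, hA⟩
      obtain ⟨w, x, y, x', y', h1, h2⟩ : ∃ v a b a' b', W.At A v a b ∧ W.At B v a' b' := by
        rcases hAB.2.2 with h | h
        · exact h.share
        · obtain ⟨v, a, b, a', b', h1, h2⟩ := h.share
          grind
      exact (ih hAc w x y h1).trans (hface _ hF _ _ _ _ _ _ h2 h)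
  refine conn_of_root (W.nodes F₀).1 fun v hv => ?_
  obtain ⟨F, a, b, h1, h2⟩ := (mem_verts_sub hR hP).1 hv
  exact key F h1.2 h1 v a b h2

/-- Either `P` has all vertices, or some face has exactly one vertex outside. -/
theorem Disc.grow (H : Disc W γ R z₀ z₁)
    (h0 : z₀ ∈ verts (W.sub R P)) (h1 : z₁ ∈ verts (W.sub R P)) :
    verts R ⊆ verts (W.sub R P) ∨ ∃ F, W.Has R F ∧
      (((W.nodes F).1 ∉ verts (W.sub R P) ∧ (W.nodes F).2.1 ∈ verts (W.sub R P) ∧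
        (W.nodes F).2.2 ∈ verts (W.sub R P)) ∨
      ((W.nodes F).1 ∈ verts (W.sub R P) ∧ (W.nodes F).2.1 ∉ verts (W.sub R P) ∧
        (W.nodes F).2.2 ∈ verts (W.sub R P)) ∨
      ((W.nodes F).1 ∈ verts (W.sub R P) ∧ (W.nodes F).2.1 ∈ verts (W.sub R P) ∧
        (W.nodes F).2.2 ∉ verts (W.sub R P))) := by
  by_cases hX : ∃ v ∈ verts R, v ∉ verts (W.sub R P)
  · right
    obtain ⟨F, a, b, c, h2, h3, h4, h5, h6⟩ := H.gen (fun v => v ∉ verts (W.sub R P)) hX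
      (not_not.2 h0) (not_not.2 h1)
    refine ⟨F, h2, ?_⟩
    rw [not_not] at h5 h6
    rcases h3 with h | h | h <;> rw [h]
    exacts [.inl ⟨h4, h5, h6⟩, .inr (.inr ⟨h5, h6, h4⟩), .inr (.inl ⟨h6, h4, h5⟩)]
  grind

/-! #### A gap of one face between two hats -/

/-- The spoke `i` is missing, but the face between the two hats next to it is there. -/
structure Gap (W : Fan d) (R : Finset (KV d × KV d × KV d)) (P : Fc d → Prop) (i : ZMod d) :
    Prop where
  has : W.Has R (p i 0)
  g_eq : W.g i = 1
  not_mem : s i ∉ verts (W.sub R P)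
  left : P (p (i - 1) (W.g (i - 1) - 1))
  right : P (p (i + 1) 0)

theorem Gap.not_Φ (hR : Sys R) (hP : Closed W R P)
    (hg : Gap W R P i) {j : ℕ} (hj : j < W.g i + 4) : ¬ P (W.Φ i j) := fun h =>
  hg.not_mem ((mem_verts_spoke hR hP.has).2 ⟨j, hj, h⟩)

theorem Gap.not_e (hR : Sys R) (hP : Closed W R P)
    (hg : Gap W R P i) : ¬ W.Has R (e i) ∧ ¬ W.Has R (e (i - 1)) := by
  constructor
  · intro h
    refine hg.not_Φ hR hP (j := W.g i + 1) (by omega) ?_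
    rw [Φ_g1]
    exact hP.adj _ _ hg.right h (.inr (Nb.ep i))
  · intro h
    refine hg.not_Φ hR hP (j := 0) (by omega) ?_
    rw [Φ_zero]
    exact hP.adj _ _ hg.left h (.inl (Nb.pe _))

theorem rho_ne_rho_two (i : ZMod d) (hm0 : 0 < m)
    (hn : n < W.g (i - 1)) : W.rho (i + 1) m ≠ W.rho (i - 1) n := by
  have h1 : i + 1 ≠ i - 1 := W.ne_of_sub 2
  have h2 : i + 1 ≠ i - 1 - 1 := W.ne_of_sub 3
  unfold rho
  split_ifs <;> simp_all

/-- The face of a gap. -/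
theorem Gap.closed (hR : Sys R) (hP : Closed W R P)
    (hg : Gap W R P i) : Closed W R (fun F => P F ∨ F = p i 0) where
  has F hF := by
    rcases hF with h | rfl
    exacts [hP.has F h, hg.has]
  adj F G hF hG hn := by
    rcases hF with h | rfl
    · exact .inl (hP.adj F G h hG hn)
    · exfalso
      have hne := hg.not_e hR hP
      rcases hn with hn | hn
      · generalize hA : p i 0 = A at hn
        cases hn with
        | pe j => obtain ⟨rfl, -⟩ := Fc.p.inj hA; exact hne.1 hG
        | pp j m hm =>
          obtain ⟨rfl, rfl⟩ := Fc.p.inj hA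
          have := hg.g_eq
          omega
        | _ => simp at hA
      · generalize hA : p i 0 = A at hn
        cases hn with
        | ep j =>
          grind
        | pp j m hm => simp at hA
        | _ => simp at hA

theorem at_iff_tri :
    W.At F a b c ↔ (a, b, c) ∈ tri (W.nodes F).1 (W.nodes F).2.1 (W.nodes F).2.2 := by
  rw [mem_tri, At]
  grind

theorem sub_insert (hR : Sys R) (hP : ∀ F, P F → W.Has R F)
    (h0 : W.Has R F₀) : W.sub R (fun F => P F ∨ F = F₀) =
      W.sub R P ∪ tri (W.nodes F₀).1 (W.nodes F₀).2.1 (W.nodes F₀).2.2 := by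
  have hP' : ∀ F, P F ∨ F = F₀ → W.Has R F := by grind
  ext ⟨a, b, c⟩
  rw [mem_union, mem_sub hR hP, mem_sub hR hP', ← at_iff_tri]
  grind

theorem Disc.gap_false (H : Disc W γ R z₀ z₁) (hP : Closed W R P)
    (hc : Conn (W.sub R P)) (hno : ∀ x, x ∉ leaves R (W.sub R P))
    (hg : Gap W R P i) (hv : verts R ⊆ verts (W.sub R (fun F => P F ∨ F = p i 0))) : False := by
  have hR := H.sys
  have hP' := hg.closed hR hP
  set P' : Fc d → Prop := fun F => P F ∨ F = p i 0 with hP'def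
  have hg1 := hg.g_eq
  have hρ1 : W.rho i 1 = h i := by
    have := W.rho_g i
    rwa [hg1] at this
  have hnodes : W.nodes (p i 0) = (s i, h (i - 1), h i) := by simp [nodes, hρ1]
  have hne := hR.ne (hnodes ▸ hg.has.2)
  have hmono : W.sub R P ⊆ W.sub R P' := by
    rintro ⟨a, b, c⟩ hx
    rw [mem_sub hR hP.has] at hx
    rw [mem_sub hR hP'.has]
    grind
  have hunion : W.sub R P' = W.sub R P ∪ tri (s i) (h (i - 1)) (h i) := by
    have := sub_insert hR hP.has hg.has
    rwa [hnodes] at this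
  have hmem1 : h i ∈ verts (W.sub R P) := (mem_verts_hat hR hP.has).2 (.inl hg.right)
  have hmem2 : h (i - 1) ∈ verts (W.sub R P) :=
    (mem_verts_hat hR hP.has).2 (.inr (.inr hg.left))
  have htR : tri (s i) (h (i - 1)) (h i) ⊆ R := hR.rot.tri_subset (hnodes ▸ hg.has.2)
  have hsv : ∀ x, x ∈ verts (W.sub R P) → x ≠ s i := fun x hx he => hg.not_mem (he ▸ hx)
  have hdisj : Disjoint (W.sub R P) (tri (s i) (h (i - 1)) (h i)) := by
    rw [disjoint_left]
    rintro ⟨a, b, c⟩ h1 h2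
    have h3 := (rotClosed_sub hR hP.has).mem_verts h1
    rcases mem_tri.1 h2 with h | h | h <;> simp only [Prod.mk.injEq] at h
    exacts [hsv _ h3.1 h.1, hsv _ h3.2.2 h.2.2, hsv _ h3.2.1 h.2.1]
  have hshared : shared (W.sub R P) (tri (s i) (h (i - 1)) (h i)) = ∅ := by
    rw [eq_empty_iff_forall_notMem]
    rintro ⟨a, b, c⟩ hx
    rw [mem_shared] at hx
    obtain ⟨h1, w, h2⟩ := hx
    have h3 := (rotClosed_sub hR hP.has).mem_verts h1
    rcases mem_tri.1 h2 with h | h | h <;> simp only [Prod.mk.injEq] at h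
    · exact hsv _ h3.2.1 h.1
    · obtain ⟨rfl, rfl, -⟩ := h
      obtain ⟨F, h4, h5⟩ := (mem_sub hR hP.has).1 h1
      have h6 : i + 1 ≠ i - 1 := W.ne_of_sub 2
      rcases (W.at_hat (hP.has F h4).1).1 h5 with ⟨-, h7, -⟩ | ⟨-, h7, -⟩ | ⟨-, h7, -⟩
      · rcases (W.rho_eq_h (W.pos (i + 1))).1 h7.symm with h8 | h8
        · omega
        · exact h6 h8.2.symm
      · simp at h7
      · simp at h7
    · exact hsv _ h3.1 h.2.1
  have hc6 : 6 ≤ c6 (W.sub R P') := by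
    rw [hunion, c6_union hR sub_subset htR hdisj, c6_tri hne, hshared]
    have h1 := (sys_sub hR hP.has).c6_nonneg hc
    have h2 : ({h (i - 1), h i} : Finset (KV d)) ⊆
        verts (W.sub R P) ∩ verts (tri (s i) (h (i - 1)) (h i)) := by
      intro x hx
      have h3 := (rotClosed_tri _ _ _).mem_verts
        ((mem_tri (a := s i) (b := h (i - 1)) (c := h i)).2 (.inl rfl))
      simp only [mem_insert, mem_singleton] at hx
      rcases hx with rfl | rfl
      exacts [mem_inter.2 ⟨hmem2, h3.2.1⟩, mem_inter.2 ⟨hmem1, h3.2.2⟩]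
    have h3 := card_le_card h2
    grind
  have hle := c6_le_leaves hR H.c6_eq sub_subset (rotClosed_sub hR hP'.has)
    (subset_antisymm (verts_mono sub_subset) hv)
  have hat0 : ∀ v x y, W.At (p i 0) v x y → v = s i ∨ v = h (i - 1) ∨ v = h i := by
    intro v x y hat
    have := At.eq_or (at_self (W := W) (p i 0)) hat
    rwa [hnodes] at this
  have hloc : ∀ v a b, (v, a, b) ∈ leaves R (W.sub R P') →
      (v = h i ∧ a = W.rho i (W.g i - 1) ∧ b = W.rho (i + 1) 1) ∨
      (v = h (i - 1) ∧ a = W.rho (i - 1) (W.g (i - 1) - 1) ∧ b = h i) := by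
    intro v a b hl
    by_cases hv1 : v = s i
    · subst hv1
      refine absurd hl (H.no_leaf_spoke hP' fun j j' hj hj' => ?_)
      have : ∀ j, EndPos W P' i j → j = 1 := by
        intro j hj
        have h1 := hj.2.1.resolve_left (hg.not_Φ hR hP hj.1)
        rcases W.pos_cases hj.1 with rfl | ⟨m, hm, rfl⟩ | rfl | rfl | rfl
        · simp at h1
        · omega
        · simp at h1
        · simp at h1
        · simp at h1
      rw [this j hj, this j' hj']
    · by_cases hv2 : v = h i
      · subst hv2
        have := H.leaf_hat hP' hl
        grind
      · by_cases hv3 : v = h (i - 1)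
        · subst hv3
          have := H.leaf_hat hP' hl
          rw [sub_add_cancel, hρ1] at this
          grind
        · exfalso
          obtain ⟨h1, h2, h3, h4⟩ := mem_leaves.1 hl
          refine hno (v, a, b) (mem_leaves.2 ⟨h1, fun h => h2 (hmono h), ?_, ?_⟩)
          · rw [dart_in hR hP'.has] at h3
            rw [dart_in hR hP.has]
            obtain ⟨F, x, h5 | rfl, h6⟩ := h3
            · exact ⟨F, x, h5, h6⟩
            grind
          · rw [dart_out hR hP'.has] at h4
            rw [dart_out hR hP.has]
            obtain ⟨F, x, h5 | rfl, h6⟩ := h4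
            · exact ⟨F, x, h5, h6⟩
            grind
  have hle1 : (leaves R (W.sub R P')).card ≤ 1 := by
    rw [card_le_one]
    have hnot : ∀ x y, x ∈ leaves R (W.sub R P') → y ∈ leaves R (W.sub R P') →
        x = (h i, W.rho i (W.g i - 1), W.rho (i + 1) 1) →
        y = (h (i - 1), W.rho (i - 1) (W.g (i - 1) - 1), h i) → False := by
      rintro x y hx hy rfl rfl
      have h1 := (mem_leaves.1 hx).1
      have h2 := hR.rot _ _ _ (hR.rot _ _ _ (mem_leaves.1 hy).1)
      have h3 : W.g i - 1 = 0 := by omega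
      rw [h3, rho_zero] at h1
      have h4 := hR.func _ _ _ _ h1 h2
      have h5 := W.pos (i - 1)
      exact rho_ne_rho_two i (by omega) (by omega) h4
    rintro ⟨v, a, b⟩ hx ⟨v', a', b'⟩ hy
    rcases hloc _ _ _ hx with ⟨rfl, rfl, rfl⟩ | ⟨rfl, rfl, rfl⟩ <;>
      rcases hloc _ _ _ hy with ⟨rfl, rfl, rfl⟩ | ⟨rfl, rfl, rfl⟩
    · rfl
    · grind
    · grind
    · rfl
  omega

/-! #### The component of a face at the hub -/

/-- Every face is joined inside its cell to a face at the hub. -/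
def Anch (W : Fan d) (Y : Fc d → Prop) : Fc d → Prop
  | t _ => True
  | e j => Y (t j)
  | p j m => ((∀ m', m ≤ m' → m' < W.g j → Y (p j m')) ∧ Y (e j) ∧ Y (t j)) ∨
      ((∀ m', m' ≤ m → Y (p j m')) ∧ Y (e (j - 1)) ∧ Y (t (j - 1)))

theorem Disc.close (H : Disc W γ R z₀ z₁) (hP : Closed W R P)
    (hf : W.fan i) (hp : ∀ m < W.g i, P (p i m)) :
    (P (e (i - 1)) → P (e i) → P (t (i - 1)) → P (t i)) ∧
    (P (e (i - 1)) → P (e i) → P (t i) → P (t (i - 1))) ∧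
    (P (e (i - 1)) → P (t i) → P (t (i - 1)) → P (e i)) ∧
    (P (e i) → P (t i) → P (t (i - 1)) → P (e (i - 1))) := by
  refine ⟨fun h1 h2 h3 => ?_, fun h1 h2 h3 => ?_, fun h1 h2 h3 => ?_, fun h1 h2 h3 => ?_⟩
  · have := H.close_spoke i hf (W.g i + 2) (by omega) fun j hj hne => by
      rcases W.pos_cases hj with rfl | ⟨m, hm, rfl⟩ | rfl | rfl | rfl
      · rw [Φ_zero]; exact hP.has _ h1
      · rw [W.Φ_succ hm]; exact hP.has _ (hp m hm)
      · rw [Φ_g1]; exact hP.has _ h2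
      · exact absurd rfl hne
      · rw [Φ_g3]; exact hP.has _ h3
    rw [Φ_g2] at this
    exact hP.adj _ _ h2 this (.inr (Nb.te i))
  · have := H.close_spoke i hf (W.g i + 3) (by omega) fun j hj hne => by
      rcases W.pos_cases hj with rfl | ⟨m, hm, rfl⟩ | rfl | rfl | rfl
      · rw [Φ_zero]; exact hP.has _ h1
      · rw [W.Φ_succ hm]; exact hP.has _ (hp m hm)
      · rw [Φ_g1]; exact hP.has _ h2
      · rw [Φ_g2]; exact hP.has _ h3
      · exact absurd rfl hne
    rw [Φ_g3] at this
    exact hP.adj _ _ h1 this (.inr (Nb.te _))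
  · have := H.close_spoke i hf (W.g i + 1) (by omega) fun j hj hne => by
      rcases W.pos_cases hj with rfl | ⟨m, hm, rfl⟩ | rfl | rfl | rfl
      · rw [Φ_zero]; exact hP.has _ h1
      · rw [W.Φ_succ hm]; exact hP.has _ (hp m hm)
      · exact absurd rfl hne
      · rw [Φ_g2]; exact hP.has _ h2
      · rw [Φ_g3]; exact hP.has _ h3
    rw [Φ_g1] at this
    exact hP.adj _ _ h2 this (.inl (Nb.te i))
  · have := H.close_spoke i hf 0 (by omega) fun j hj hne => by
      rcases W.pos_cases hj with rfl | ⟨m, hm, rfl⟩ | rfl | rfl | rfl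
      · exact absurd rfl hne
      · rw [W.Φ_succ hm]; exact hP.has _ (hp m hm)
      · rw [Φ_g1]; exact hP.has _ h1
      · rw [Φ_g2]; exact hP.has _ h2
      · rw [Φ_g3]; exact hP.has _ h3
    rw [Φ_zero] at this
    exact hP.adj _ _ h3 this (.inl (Nb.te _))

theorem Disc.anch (H : Disc W γ R z₀ z₁) (hk : Comp W R F₀ (t k)) (hG : Comp W R F₀ G) :
    Anch W (Comp W R F₀) G := by
  have hP := closed_comp (W := W) (R := R) F₀
  refine Comp.induct (B := Anch W (Comp W R F₀)) hk trivial ?_ hG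
  rintro A A' hn hA hA'
  rcases hn with i | i | i | i | ⟨i, m, hm⟩
  · exact Iff.rfl
  · exact ⟨fun _ => hA, fun _ => trivial⟩
  · have hv := hA.has.1
    have hpos := W.pos i
    constructor
    · rintro (h1 | h1)
      exacts [h1.2.2, (H.close hP hv.1 fun m hm => h1.1 m (by omega)).1 h1.2.1 hA' h1.2.2]
    · intro h1
      refine .inl ⟨fun m' h2 h3 => ?_, hA', h1⟩
      grind
  · have hv := hA'.has.1
    have h0 : i + 1 - 1 = i := by ring
    constructor
    · intro h1
      refine .inr ⟨fun m' h2 => ?_, by rwa [h0], by rwa [h0]⟩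
      grind
    · rintro (h1 | h1)
      · have := (H.close hP hv.1 fun m hm => h1.1 m (by omega) hm).2.1 (by rwa [h0]) h1.2.1 h1.2.2
        rwa [h0] at this
      · have := h1.2.2
        rwa [h0] at this
  · constructor
    · rintro (h1 | h1)
      · exact .inl ⟨fun m' h2 h3 => h1.1 m' (by omega) h3, h1.2⟩
      · refine .inr ⟨fun m' h2 => ?_, h1.2⟩
        grind
    · rintro (h1 | h1)
      · refine .inl ⟨fun m' h2 h3 => ?_, h1.2⟩
        grind
      · exact .inr ⟨fun m' h2 => h1.1 m' (by omega), h1.2⟩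

theorem val_succ [NeZero d] (hd : 1 < d) (x : ZMod d) :
    (x + 1).val = if x.val + 1 = d then 0 else x.val + 1 := by
  have : Fact (1 < d) := ⟨hd⟩
  rw [ZMod.val_add, ZMod.val_one]
  have := x.val_lt
  split_ifs with h
  · rw [h, Nat.mod_self]
  · exact Nat.mod_eq_of_lt (by omega)

/-- Two missing faces at the hub separate the others. -/
theorem Disc.hub_sep (H : Disc W γ R z₀ z₁) [NeZero d] {a b c : ZMod d}
    (ha : ¬ Comp W R F₀ (t a)) (hb : ¬ Comp W R F₀ (t b)) (hc : Comp W R F₀ (t c))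
    (h1 : 0 < (c - a).val) (h2 : (c - a).val < (b - a).val) {x : ZMod d}
    (hx : Comp W R F₀ (t x)) : 0 < (x - a).val ∧ (x - a).val < (b - a).val := by
  have hd : 1 < d := by have := W.five_le; omega
  let B : Fc d → Prop := fun F => match F with
    | t j => 0 < (j - a).val ∧ (j - a).val < (b - a).val
    | e j => 0 < (j - a).val ∧ (j - a).val < (b - a).val
    | p j _ => 0 < (j - a).val ∧ (j - a).val ≤ (b - a).val
  have hne : ∀ i, Comp W R F₀ (t i) → (i - a).val ≠ 0 ∧ (i - a).val ≠ (b - a).val := by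
    intro i hi
    constructor
    · intro h
      rw [ZMod.val_eq_zero, sub_eq_zero] at h
      exact ha (h ▸ hi)
    · intro h
      have := ZMod.val_injective d h
      grind
  have hsucc : ∀ i : ZMod d, (i + 1 - a).val = if (i - a).val + 1 = d then 0 else (i - a).val +
    1 := by
    intro i
    rw [← val_succ hd]
    congr 1
    ring
  have hbl := (b - a).val_lt
  refine Comp.induct (B := B) hc ⟨h1, h2⟩ ?_ hx
  rintro A A' hn hA hA'
  rcases hn with i | i | i | i | ⟨i, m, hm⟩
  · grind
  · exact Iff.rfl
  · have e1 := hne i (H.anch hc hA')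
    simp only [B]
    omega
  · have e1 := hne i (H.anch hc hA)
    grind
  · exact Iff.rfl

theorem Disc.hub_mid (H : Disc W γ R z₀ z₁) [NeZero d]
    (h1 : Comp W R F₀ (t (i - 1))) (h2 : Comp W R F₀ (t (i + 1))) : Comp W R F₀ (t i) := by
  have hd := W.five_le
  by_contra hn
  refine hn (h2.adj (H.close_hub i fun j hj => ?_) (.inr (Nb.tt i)))
  by_contra hj'
  have hj'' : ¬ Comp W R F₀ (t j) := fun h => hj' h.has
  have e1 : (i + 1 - i : ZMod d).val = 1 := by
    have : Fact (1 < d) := ⟨by omega⟩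
    rw [add_sub_cancel_left, ZMod.val_one]
  have e2 : (j - i).val ≠ 0 := by
    rw [Ne, ZMod.val_eq_zero, sub_eq_zero]; exact hj
  have e3 : (j - i).val ≠ 1 := by
    rw [← e1]
    intro h
    have := ZMod.val_injective d h
    grind
  have := H.hub_sep hn hj'' h2 (by omega) (by omega) h1
  have e4 : (i - 1 - i : ZMod d).val + 1 = d := by
    have h3 := val_succ (by omega) (i - 1 - i : ZMod d)
    simp_all
  have := (j - i).val_lt
  omega

theorem Disc.hub_uniq (H : Disc W γ R z₀ z₁) [NeZero d]
    (h1 : Comp W R F₀ (t i)) (h2 : ¬ Comp W R F₀ (t (i + 1))) (h3 : Comp W R F₀ (t j))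
    (h4 : ¬ Comp W R F₀ (t (j + 1))) : i = j := by
  have hd := W.five_le
  by_contra hne
  have e1 : (j - (i + 1)).val ≠ 0 := by
    rw [Ne, ZMod.val_eq_zero, sub_eq_zero]
    rintro rfl
    exact h2 h3
  have e2 : (j + 1 - (i + 1)).val = (j - (i + 1)).val + 1 := by
    have h5 := val_succ (by omega) (j - (i + 1))
    rw [show j - (i + 1) + 1 = j + 1 - (i + 1) by ring] at h5
    split_ifs at h5 with h6
    · rw [ZMod.val_eq_zero, sub_eq_zero] at h5
      grind
    · exact h5
  have := H.hub_sep h2 h4 h3 (by omega) (by omega) h1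
  have e4 : (i - (i + 1) : ZMod d).val + 1 = d := by
    have h3 := val_succ (by omega) (i - (i + 1) : ZMod d)
    simp_all
  grind

theorem nx_zero (i : ZMod d) : W.nx i 0 = 1 := by
  unfold Fan.nx; split_ifs <;> omega

/-- What the ends of runs at a spoke look like. -/
theorem EndPos.cases {j : ℕ} (h : EndPos W P i j) :
    (j = 0 ∧ P (e (i - 1)) ∧ ¬ P (p i 0)) ∨
    (∃ m < W.g i, j = m + 1 ∧ P (p i m) ∧
      ((m + 1 < W.g i ∧ ¬ P (p i (m + 1))) ∨ (m + 1 = W.g i ∧ ¬ P (e i)))) ∨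
    (j = W.g i + 1 ∧ P (e i) ∧ ¬ P (t i)) ∨ (j = W.g i + 2 ∧ P (t i) ∧ ¬ P (t (i - 1))) ∨
    (j = W.g i + 3 ∧ P (t (i - 1)) ∧ ¬ P (e (i - 1))) := by
  obtain ⟨hj, h1, h2⟩ := h
  rcases W.pos_cases hj with rfl | ⟨m, hm, rfl⟩ | rfl | rfl | rfl
  · rw [nx_zero, show 1 = 0 + 1 from rfl, W.Φ_succ (W.pos i)] at h2
    simp_all
  · right; left
    rw [W.Φ_succ hm] at h1
    have e1 : W.nx i (m + 1) = m + 1 + 1 := by unfold Fan.nx; split_ifs <;> omega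
    rw [e1] at h2
    refine ⟨m, hm, rfl, h1, ?_⟩
    by_cases h3 : m + 1 < W.g i
    · rw [W.Φ_succ h3] at h2
      exact .inl ⟨h3, h2⟩
    · have h4 : m + 1 = W.g i := by omega
      simp_all
  · have e1 : W.nx i (W.g i + 1) = W.g i + 2 := by unfold Fan.nx; split_ifs <;> omega
    simp_all
  · have e1 : W.nx i (W.g i + 2) = W.g i + 3 := by unfold Fan.nx; split_ifs <;> omega
    simp_all
  · have e1 : W.nx i (W.g i + 3) = 0 := by unfold Fan.nx; simp
    simp_all

theorem Disc.hub_spoke_uniq (H : Disc W γ R z₀ z₁)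
    (hk : Comp W R F₀ (t k)) {j j' : ℕ} (h : EndPos W (Comp W R F₀) i j)
    (h' : EndPos W (Comp W R F₀) i j') : j = j' := by
  set Y := Comp W R F₀ with hY
  have an_e : ∀ j, Y (e j) → Y (t j) := fun j h => H.anch hk h
  have left : ∀ m, Y (p i m) → ((m + 1 < W.g i ∧ ¬ Y (p i (m + 1))) ∨ (m + 1 = W.g i ∧ ¬ Y (e i))) →
      (∀ m' ≤ m, Y (p i m')) ∧ Y (e (i - 1)) ∧ Y (t (i - 1)) := by
    intro m hm h2
    rcases H.anch hk hm with h3 | h3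
    · grind
    · exact h3
  wlog hlt : j < j' generalizing j j'
  · grind
  exfalso
  have hg := W.pos i
  rcases h.cases with ⟨rfl, a1, a2⟩ | ⟨m, hm, rfl, a1, a2⟩ | ⟨rfl, a1, a2⟩ | ⟨rfl, a1, a2⟩ |
    ⟨rfl, a1, a2⟩ <;>
  rcases h'.cases with ⟨rfl, b1, b2⟩ | ⟨n, hn, rfl, b1, b2⟩ | ⟨rfl, b1, b2⟩ | ⟨rfl, b1, b2⟩ |
    ⟨rfl, b1, b2⟩ <;> try omega
  · exact a2 ((left n b1 b2).1 0 (by omega))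
  · exact b2 (an_e _ b1)
  · exact b2 (an_e _ a1)
  · exact b2 a1
  · rcases a2 with a2 | a2
    · grind
    · omega
  exacts [b2 (an_e _ b1), b2 (left m a1 a2).2.2, b2 (left m a1 a2).2.1, a2 (an_e _ a1),
    a2 (an_e _ a1), a2 b1]

theorem Disc.hub_no_leaf (H : Disc W γ R z₀ z₁) [NeZero d]
    (hk : Comp W R F₀ (t k)) (x : KV d × KV d × KV d) :
    x ∉ leaves R (W.sub R (Comp W R F₀)) := by
  have hP := closed_comp (W := W) (R := R) F₀
  obtain ⟨v, a, b⟩ := x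
  rcases v with _ | i | i | ⟨i, m⟩
  · exact H.no_leaf_hub hP fun i j h1 h2 h3 h4 => H.hub_uniq h1 h2 h3 h4
  · exact H.no_leaf_spoke hP fun j j' h1 h2 => H.hub_spoke_uniq hk h1 h2
  · intro hl
    obtain ⟨h1, h2, h3, -⟩ := H.leaf_hat hP hl
    have hg := W.pos i
    have e0 : i + 1 - 1 = i := by ring
    rcases H.anch hk h2 with h4 | h4
    · exact h1 h4.2.1
    · rcases H.anch hk h3 with h5 | h5
      · have h6 := H.hub_mid h4.2.2 h5.2.2
        exact h1 ((H.close hP h2.has.1.1 fun m hm => h4.1 m (by omega)).2.2.1 h4.2.1 h6 h4.2.2)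
      grind
  · exact H.no_leaf_rim hP

theorem Disc.hub_grow (H : Disc W γ R z₀ z₁) [NeZero d]
    (hk : Comp W R F₀ (t k)) (hF : W.Has R F)
    (hV : ((W.nodes F).1 ∉ verts (W.sub R (Comp W R F₀)) ∧
        (W.nodes F).2.1 ∈ verts (W.sub R (Comp W R F₀)) ∧
        (W.nodes F).2.2 ∈ verts (W.sub R (Comp W R F₀))) ∨
      ((W.nodes F).1 ∈ verts (W.sub R (Comp W R F₀)) ∧
        (W.nodes F).2.1 ∉ verts (W.sub R (Comp W R F₀)) ∧
        (W.nodes F).2.2 ∈ verts (W.sub R (Comp W R F₀))) ∨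
      ((W.nodes F).1 ∈ verts (W.sub R (Comp W R F₀)) ∧
        (W.nodes F).2.1 ∈ verts (W.sub R (Comp W R F₀)) ∧
        (W.nodes F).2.2 ∉ verts (W.sub R (Comp W R F₀)))) :
    ∃ i, F = p i 0 ∧ Gap W R (Comp W R F₀) i := by
  have hR := H.sys
  have hP := closed_comp (W := W) (R := R) F₀
  set Y := Comp W R F₀ with hY
  have hFY : ¬ Y F := by
    intro h
    have := nodes_mem_verts hR hP.has h
    tauto
  have an_e : ∀ j, Y (e j) → Y (t j) := fun j h => H.anch hk h
  have hsp : ∀ i, s i ∈ verts (W.sub R Y) → Y (t i) ∨ Y (t (i - 1)) := by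
    intro i hi
    obtain ⟨j, hj, h1⟩ := (mem_verts_spoke hR hP.has).1 hi
    rcases W.pos_cases hj with rfl | ⟨m, hm, rfl⟩ | rfl | rfl | rfl
    · simp_all
    · rw [W.Φ_succ hm] at h1
      rcases H.anch hk h1 with h2 | h2
      exacts [.inl h2.2.2, .inr h2.2.2]
    · simp_all
    · rw [Φ_g2] at h1; exact .inl h1
    simp_all
  have hsp1 : ∀ i, s (i + 1) ∈ verts (W.sub R Y) → Y (t (i + 1)) ∨ Y (t i) := by
    intro i hi
    have := hsp _ hi
    simp_all
  have hhub : hub ∈ verts (W.sub R Y) := (mem_verts_hub hR hP.has).2 ⟨k, hk⟩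
  have notT : ∀ i, W.Has R (t i) → ¬ Y (t i) → ¬ Y (t (i + 1)) ∧ ¬ Y (t (i - 1)) := by
    intro i h1 h2
    refine ⟨fun h => h2 (h.adj h1 (.inr (Nb.tt i))), fun h => h2 (h.adj h1 (.inl ?_))⟩
    have := Nb.tt (W := W) (i - 1)
    rwa [sub_add_cancel] at this
  rcases F with i | i | ⟨i, m⟩
  · exfalso
    have hn := notT i hF hFY
    simp only [nodes] at hV
    grind
  · exfalso
    have hti : ¬ Y (t i) := fun h => hFY (h.adj hF (.inl (Nb.te i)))
    have hpe : ¬ Y (p i (W.g i - 1)) := fun h => hFY (h.adj hF (.inl (Nb.pe i)))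
    have hep : ¬ Y (p (i + 1) 0) := fun h => hFY (h.adj hF (.inr (Nb.ep i)))
    have hh : h i ∉ verts (W.sub R Y) := fun h => by
      rcases (mem_verts_hat hR hP.has).1 h with h | h | h
      exacts [hep h, hFY h, hpe h]
    simp only [nodes] at hV
    rcases hV with hV | hV | hV
    · exact hh hV.2.1
    · have h1 := (hsp i hV.1).resolve_left hti
      have h2 := (hsp1 i hV.2.2).resolve_right hti
      exact hti (H.hub_mid h1 h2)
    · exact hh hV.2.1
  · have hv := hF.1
    have hm := hv.2
    simp only [nodes] at hV
    have hin : ∀ n, 0 < n → n < W.g i → W.rho i n ∈ verts (W.sub R Y) →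
        Y (p i n) ∨ Y (p i (n - 1)) := by
      intro n h0 h1 h2
      rw [W.rho_inner h0 h1] at h2
      exact (mem_verts_rim hR hP.has h2).2.2
    have hpv : ∀ n, Y (p i n) → s i ∈ verts (W.sub R Y) := fun n h =>
      (nodes_mem_verts hR hP.has h).1
    have e1 : i - 1 + 1 = i := by ring
    rcases hV with hV | hV | hV
    · have hm0 : m = 0 := by
        by_contra h0
        grind
      subst hm0
      have hg1 : W.g i = 1 := by
        by_contra h0
        have := W.pos i
        rcases hin 1 (by omega) (by omega) hV.2.2 with h | h <;> exact hV.1 (hpv _ h)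
      refine ⟨i, rfl, hF, hg1, hV.1, ?_, ?_⟩
      · have h1 := hV.2.1
        rw [rho_zero] at h1
        rcases (mem_verts_hat hR hP.has).1 h1 with h | h | h
        · grind
        · have := (nodes_mem_verts hR hP.has h).2.2
          simp only [nodes, e1] at this
          exact absurd this hV.1
        · exact h
      · have h1 := hV.2.2
        rw [zero_add, ← hg1, rho_g] at h1
        rcases (mem_verts_hat hR hP.has).1 h1 with h | h | h
        · exact h
        · have := (nodes_mem_verts hR hP.has h).1
          exact absurd this hV.1
        · exact absurd (hpv _ h) hV.1
    · exfalso
      have hm0 : m + 1 = W.g i := by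
        by_contra h0
        rcases hin (m + 1) (by omega) (by omega) hV.2.2 with h | h
        exacts [hFY (h.adj hF (.inr (Nb.pp i m (by omega)))), hFY h]
      obtain rfl : m = W.g i - 1 := by omega
      have h1 := hV.2.2
      rw [hm0, rho_g] at h1
      have hei : ¬ Y (e i) := fun h => hFY (h.adj hF (.inr (Nb.pe i)))
      have h2 : Y (p (i + 1) 0) := by
        rcases (mem_verts_hat hR hP.has).1 h1 with h | h | h
        exacts [h, absurd h hei, absurd h hFY]
      have h3 : (∀ m', 0 ≤ m' → m' < W.g (i + 1) → Y (p (i + 1) m')) ∧ Y (e (i + 1)) ∧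
          Y (t (i + 1)) := by
        rcases H.anch hk h2 with h | h
        · exact h
        simp_all
      have h4 : Y (t i) := by
        rcases hsp i hV.1 with h | h
        exacts [h, H.hub_mid h h3.2.2]
      have := (H.close hP h2.has.1.1 fun m hm => h3.1 m (by omega) hm).2.2.2 h3.2.1 h3.2.2
        (by rwa [add_sub_cancel_right])
      simp_all
    · exfalso
      have hm0 : m = 0 := by
        by_contra h0
        rcases hin m (by omega) (by omega) hV.2.1 with h | h
        · exact hFY h
        · have := Nb.pp (W := W) i (m - 1) (by omega)
          rw [show m - 1 + 1 = m by omega] at this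
          exact hFY (h.adj hF (.inl this))
      subst hm0
      have h1 := hV.2.1
      rw [rho_zero] at h1
      have hei : ¬ Y (e (i - 1)) := fun h => by
        have := Nb.ep (W := W) (i - 1)
        rw [e1] at this
        exact hFY (h.adj hF (.inl this))
      have h2 : Y (p (i - 1) (W.g (i - 1) - 1)) := by
        rcases (mem_verts_hat hR hP.has).1 h1 with h | h | h
        · grind
        exacts [absurd h hei, h]
      have h3 := (H.anch hk h2).resolve_left fun h => hei h.2.1
      have hpos := W.pos (i - 1)
      have h4 : Y (t (i - 1)) := by
        rcases hsp i hV.1 with h | h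
        · refine H.hub_mid h3.2.2 ?_
          rwa [e1]
        · exact h
      exact hei ((H.close hP h2.has.1.1 fun m hm => h3.1 m (by omega)).2.2.1 h3.2.1 h4 h3.2.2)

theorem Disc.isFace_of_hub (H : Disc W γ R z₀ z₁) [NeZero d]
    (hk : Comp W R F₀ (t k)) (hz0 : z₀ ∈ verts (W.sub R (Comp W R F₀)))
    (hz1 : z₁ ∈ verts (W.sub R (Comp W R F₀))) (habc : (a, b, c) ∈ R) :
    W.IsFace a b c := by
  have hR := H.sys
  have hP := closed_comp (W := W) (R := R) F₀
  have hd := W.five_le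
  rcases H.grow hz0 hz1 with hv | ⟨F, hF, hV⟩
  · exact H.isFace_of_no_leaf hP hv (conn_comp hR F₀) (H.hub_no_leaf hk) habc
  · exfalso
    obtain ⟨i, rfl, hg⟩ := H.hub_grow hk hF hV
    have e1 : i - 1 + 1 = i := by ring
    have e2 : i + 1 - 1 = i := by ring
    have hΦ := fun j hj => hg.not_Φ hR hP (j := j) hj
    have tn : ∀ i, Gap W R (Comp W R F₀) i → Comp W R F₀ (t (i + 1)) ∧
        Comp W R F₀ (t (i - 1 - 1)) ∧ ¬ Comp W R F₀ (t i) ∧ ¬ Comp W R F₀ (t (i - 1)) := by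
      intro i hg
      have hΦ := fun j hj => hg.not_Φ hR hP (j := j) hj
      refine ⟨?_, ?_, ?_, ?_⟩
      · rcases H.anch hk hg.right with h | h
        · exact h.2.2
        · have := hΦ (W.g i + 1) (by omega)
          simp_all
      · rcases H.anch hk hg.left with h | h
        · have := hΦ 0 (by omega)
          simp_all
        · exact h.2.2
      · have := hΦ (W.g i + 2) (by omega)
        rwa [Φ_g2] at this
      · have := hΦ (W.g i + 3) (by omega)
        rwa [Φ_g3] at this
    have huniq : ∀ i', Gap W R (Comp W R F₀) i' → i' = i := by
      intro i' hg'
      by_contra hne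
      obtain ⟨a1, a2, a3, a4⟩ := tn i hg
      obtain ⟨b1, b2, b3, b4⟩ := tn i' hg'
      have f1 : (i + 1 - i : ZMod d).val = 1 := by
        have : Fact (1 < d) := ⟨by omega⟩
        rw [add_sub_cancel_left, ZMod.val_one]
      have f2 : (i' - i).val ≠ 0 := by
        rw [Ne, ZMod.val_eq_zero, sub_eq_zero]; exact hne
      have f3 : (i' - i).val ≠ 1 := by
        rw [← f1]
        intro h
        have := ZMod.val_injective d h
        grind
      have f4 := H.hub_sep a3 b3 a1 (by omega) (by omega) b1
      have f5 := val_succ (by omega) (i' - i)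
      rw [show i' - i + 1 = i' + 1 - i by ring] at f5
      split_ifs at f5 <;> omega
    refine H.gap_false hP (conn_comp hR F₀) (H.hub_no_leaf hk) hg ?_
    have hP' := hg.closed hR hP
    have hVV : verts (W.sub R (Comp W R F₀)) ⊆
        verts (W.sub R (fun F => Comp W R F₀ F ∨ F = p i 0)) := by
      intro v hv
      rw [mem_verts_sub hR hP.has] at hv
      rw [mem_verts_sub hR hP'.has]
      obtain ⟨F, x, y, h1, h2⟩ := hv
      grind
    have hVs : ∀ v, v ∈ verts (W.sub R (fun F => Comp W R F₀ F ∨ F = p i 0)) →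
        v ∈ verts (W.sub R (Comp W R F₀)) ∨ v = s i := by
      intro v hv
      rw [mem_verts_sub hR hP'.has] at hv
      obtain ⟨F, x, y, h1 | rfl, h2⟩ := hv
      · exact .inl ((mem_verts_sub hR hP.has).2 ⟨F, x, y, h1, h2⟩)
      · have h3 : W.rho i 1 = h i := by
          have := W.rho_g i
          rwa [hg.g_eq] at this
        rcases At.eq_or (at_self (W := W) (p i 0)) h2 with h | h | h
        · exact .inr h
        · simp only [nodes, rho_zero] at h
          rw [h]
          exact .inl ((mem_verts_hat hR hP.has).2 (.inr (.inr hg.left)))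
        · simp only [nodes, zero_add, h3] at h
          rw [h]
          exact .inl ((mem_verts_hat hR hP.has).2 (.inl hg.right))
    rcases H.grow (hVV hz0) (hVV hz1) with hv | ⟨F, hF', hV'⟩
    · exact hv
    · exfalso
      by_cases hs : (W.nodes F).1 = s i ∨ (W.nodes F).2.1 = s i ∨ (W.nodes F).2.2 = s i
      · have hat : ∃ x y, W.At F (s i) x y := by
          rcases hs with h | h | h
          exacts [⟨_, _, .inl (by rw [← h])⟩, ⟨_, _, .inr (.inr (by rw [← h]))⟩,
            ⟨_, _, .inr (.inl (by rw [← h]))⟩]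
        obtain ⟨x, y, hat⟩ := hat
        obtain ⟨j, hj, rfl, -⟩ := (W.at_spoke hF'.1).1 hat
        have hne := hg.not_e hR hP
        have htn := tn i hg
        rcases W.pos_cases hj with rfl | ⟨m, hm, rfl⟩ | rfl | rfl | rfl
        · simp_all
        · have : m = 0 := by have := hg.g_eq; omega
          subst this
          rw [W.Φ_succ hm] at hV'
          have := nodes_mem_verts hR hP'.has (F := p i 0) (.inr rfl)
          tauto
        · simp_all
        · rw [Φ_g2] at hF'
          exact htn.2.2.1 (htn.1.adj hF' (.inr (Nb.tt i)))
        · rw [Φ_g3] at hF'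
          have := Nb.tt (W := W) (i - 1 - 1)
          rw [sub_add_cancel] at this
          exact htn.2.2.2 (htn.2.1.adj hF' (.inl this))
      · push Not at hs
        have hq1 := hVs (W.nodes F).1
        have hq2 := hVs (W.nodes F).2.1
        have hq3 := hVs (W.nodes F).2.2
        have hr1 := @hVV (W.nodes F).1
        have hr2 := @hVV (W.nodes F).2.1
        have hr3 := @hVV (W.nodes F).2.2
        obtain ⟨i', rfl, hg'⟩ := H.hub_grow hk hF' (by
          rcases hV' with ⟨u1, u2, u3⟩ | ⟨u1, u2, u3⟩ | ⟨u1, u2, u3⟩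
          · exact .inl ⟨fun h => u1 (hr1 h), (hq2 u2).resolve_right hs.2.1,
              (hq3 u3).resolve_right hs.2.2⟩
          · exact .inr (.inl ⟨(hq1 u1).resolve_right hs.1, fun h => u2 (hr2 h),
              (hq3 u3).resolve_right hs.2.2⟩)
          · exact .inr (.inr ⟨(hq1 u1).resolve_right hs.1, (hq2 u2).resolve_right hs.2.1,
              fun h => u3 (hr3 h)⟩))
        exact hs.1 (by rw [huniq i' hg']; rfl)

/-! #### The ring of faces around the hub -/

/-- The column of a face, counted from the spoke `b`. -/
def col (b : ZMod d) : Fc d → ℕ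
  | t i => (i - b).val
  | e i => (i - b).val
  | p i _ => (i - b).val

/-- The position of a face in its column. -/
def pos (W : Fan d) : Fc d → ℕ
  | t _ => 0
  | e i => W.g i
  | p _ m => m

/-- The faces of the ring, including those of absent fans. -/
def InRing (W : Fan d) : Fc d → Prop
  | t _ => False
  | e _ => True
  | p i m => m < W.g i

def Before (W : Fan d) (b : ZMod d) (F G : Fc d) : Prop :=
  col b F < col b G ∨ (col b F = col b G ∧ pos W F < pos W G)

theorem pos_le [NeZero d] {b : ZMod d} (hF : InRing W F) (h : col b F = (i - b).val) :
    pos W F ≤ W.g i := by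
  rcases F with j | j | ⟨j, m⟩
  · exact hF.elim
  · have := ZMod.val_injective d h
    rw [sub_left_inj] at this
    subst this; exact le_rfl
  · have := ZMod.val_injective d h
    rw [sub_left_inj] at this
    subst this; exact le_of_lt hF

theorem key_inj [NeZero d] {b : ZMod d} (hF : InRing W F) (hG : InRing W G)
    (h1 : col b F = col b G) (h2 : pos W F = pos W G) : F = G := by
  rcases F with i | i | ⟨i, m⟩ <;> rcases G with j | j | ⟨j, n⟩ <;>
    simp only [InRing, col, pos] at hF hG h1 h2 <;>
    have h3 := ZMod.val_injective d h1 <;> rw [sub_left_inj] at h3 <;> subst h3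
  · rfl
  · omega
  · omega
  · rw [h2]

theorem col_lt [NeZero d] {b : ZMod d} (F : Fc d) : col b F < d := by
  rcases F with j | j | ⟨j, m⟩ <;> exact ZMod.val_lt _

theorem Comp.inRing (hnt : ∀ i, ¬ Comp W R F₀ (t i)) (hF : Comp W R F₀ F) :
    InRing W F := by
  rcases F with i | i | ⟨i, m⟩
  · exact hnt i hF
  · trivial
  · exact hF.has.1.2

/-- Two missing faces of the ring separate the others. -/
theorem ring_sep [NeZero d] (hnt : ∀ i, ¬ Comp W R F₀ (t i)) (b : ZMod d) {c : Fc d}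
    (hM : ¬ Comp W R F₀ M) (hG : ¬ Comp W R F₀ G) (hMr : InRing W M) (hGr : InRing W G)
    (hc : Comp W R F₀ c) (h1 : Before W b M c) (h2 : Before W b c G) {x : Fc d}
    (hx : Comp W R F₀ x) : Before W b M x ∧ Before W b x G := by
  have hd : 1 < d := by have := W.five_le; omega
  refine Comp.induct (B := fun x => Before W b M x ∧ Before W b x G) hc ⟨h1, h2⟩ ?_ hx
  have hMd := col_lt (b := b) M
  have hGd := col_lt (b := b) G
  have hMne : ∀ A, Comp W R F₀ A → ¬ (col b M = col b A ∧ pos W M = pos W A) := fun A hA h =>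
    hM (key_inj hMr (hA.inRing hnt) h.1 h.2 ▸ hA)
  have hGne : ∀ A, Comp W R F₀ A → ¬ (col b G = col b A ∧ pos W G = pos W A) := fun A hA h =>
    hG (key_inj hGr (hA.inRing hnt) h.1 h.2 ▸ hA)
  rintro A A' hn hA hA'
  have a1 := hMne _ hA
  have a2 := hMne _ hA'
  have a3 := hGne _ hA
  have a4 := hGne _ hA'
  rcases hn with i | i | i | i | ⟨i, m, hm⟩
  · exact absurd hA (hnt i)
  · exact absurd hA (hnt i)
  · have hg := W.pos i
    simp only [Before, col, pos] at a1 a2 a3 a4 ⊢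
    omega
  · have b1 := pos_le (b := b) (i := i) hMr
    have b2 := pos_le (b := b) (i := i) hGr
    have hsucc : (i + 1 - b).val = if (i - b).val + 1 = d then 0 else (i - b).val + 1 := by
      rw [← val_succ hd]; congr 1; ring
    have := (i - b).val_lt
    simp only [Before]
    have d1 : col b (e i) = (i - b).val := rfl
    have d2 : col b (p (i + 1) 0) = (i + 1 - b).val := rfl
    have d3 : pos W (e i) = W.g i := rfl
    have d4 : pos W (p (i + 1) 0) = 0 := rfl
    grind
  · simp only [Before, col, pos] at a1 a2 a3 a4 ⊢
    omega

/-- If there is a gap in the ring, then everything outside the gap is there. -/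
theorem ring_gap [NeZero d] (hnt : ∀ i, ¬ Comp W R F₀ (t i)) (b : ZMod d) (hF : Comp W R F₀ F)
    (hF' : Comp W R F₀ F') (hM : ¬ Comp W R F₀ M)
    (hMr : InRing W M) (h1 : Before W b F M) (h2 : Before W b M F') (hGr : InRing W G)
    (hG : Before W b G F ∨ Before W b F' G) : Comp W R F₀ G := by
  by_contra hn
  rcases hG with hG | hG
  · have := (ring_sep hnt b hn hM hGr hMr hF hG h1 hF').2
    simp only [Before] at *
    omega
  · have := (ring_sep hnt b hM hn hMr hGr hF' h2 hG hF).1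
    simp only [Before] at *
    omega

/-- The ring is complete except near the spokes `i` and `i + 1`, and it is closed there. -/
structure LongRing (W : Fan d) (R : Finset (KV d × KV d × KV d)) (F₀ : Fc d) (i : ZMod d) :
    Prop where
  e : ∀ j, j ≠ i → Comp W R F₀ (e j)
  p : ∀ j, j ≠ i → j ≠ i + 1 → ∀ m < W.g j, Comp W R F₀ (p j m)
  bridge : W.Has R (Fc.e i) ∨ W.Has R (t i) ∨
    (W.Has R (Fc.p i (W.g i - 1)) ∧ W.Has R (Fc.p (i + 1) 0))

theorem col_near (W : Fan d) (i : ZMod d) [NeZero d] :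
    (i - 1 - (i - 1)).val = 0 ∧ (i - (i - 1)).val = 1 ∧
    (i + 1 - (i - 1)).val = 2 := by
  have hd := W.five_le
  have h1 := val_succ (by omega) (i - 1 - (i - 1))
  have h2 := val_succ (by omega) (i - (i - 1))
  rw [show i - 1 - (i - 1) + 1 = i - (i - 1) by ring] at h1
  rw [show i - (i - 1) + 1 = i + 1 - (i - 1) by ring] at h2
  have h0 : (i - 1 - (i - 1)).val = 0 := by rw [sub_self, ZMod.val_zero]
  grind

theorem col_inj [NeZero d] {b : ZMod d} (h : (i - b).val = (j - b).val) : i = j := by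
  have := ZMod.val_injective d h
  rwa [sub_left_inj] at this

theorem longRing_of_gap [NeZero d] (hnt : ∀ i, ¬ Comp W R F₀ (t i)) (hF : Comp W R F₀ F)
    (hF' : Comp W R F₀ F') (hM : ¬ Comp W R F₀ M)
    (hMr : InRing W M) (h1 : Before W (i - 1) F M) (h2 : Before W (i - 1) M F')
    (h3 : ¬ Before W (i - 1) F (e (i - 1))) (h4 : ¬ Before W (i - 1) (e (i + 1)) F')
    (hb : W.Has R (Fc.e i) ∨ W.Has R (t i) ∨
      (W.Has R (Fc.p i (W.g i - 1)) ∧ W.Has R (Fc.p (i + 1) 0))) : LongRing W R F₀ i := by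
  obtain ⟨c0, c1, c2⟩ := col_near W i
  have hFr := hF.inRing hnt
  have hF'r := hF'.inRing hnt
  have key : ∀ G, InRing W G → (¬ Before W (i - 1) F G ∨ ¬ Before W (i - 1) G F') →
      Comp W R F₀ G := by
    intro G hGr hG
    by_contra hn
    have a1 : ¬ (col (i - 1) F = col (i - 1) G ∧ pos W F = pos W G) := fun h =>
      hn (key_inj hFr hGr h.1 h.2 ▸ hF)
    have a2 : ¬ (col (i - 1) F' = col (i - 1) G ∧ pos W F' = pos W G) := fun h =>
      hn (key_inj hF'r hGr h.1 h.2 ▸ hF')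
    refine hn (ring_gap hnt (i - 1) hF hF' hM hMr h1 h2 hGr ?_)
    simp only [Before] at *
    omega
  simp only [Before, col, Wheel.pos] at h3 h4
  rw [c0] at h3
  rw [c2] at h4
  refine ⟨fun j hj => key _ trivial ?_, fun j hj hj' m hm => key _ hm ?_, hb⟩
  · have d1 : (j - (i - 1)).val ≠ 1 := fun h => hj (col_inj (h.trans c1.symm))
    have d2 : (j - (i - 1)).val = 0 → W.g j = W.g (i - 1) := fun h => by
      rw [col_inj (h.trans c0.symm)]
    have d3 : (j - (i - 1)).val = 2 → W.g j = W.g (i + 1) := fun h => by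
      rw [col_inj (h.trans c2.symm)]
    simp only [Before, col, Wheel.pos]
    omega
  · have d1 : (j - (i - 1)).val ≠ 1 := fun h => hj (col_inj (h.trans c1.symm))
    have d2 : (j - (i - 1)).val = 0 → W.g j = W.g (i - 1) := fun h => by
      rw [col_inj (h.trans c0.symm)]
    have d3 : (j - (i - 1)).val ≠ 2 := fun h => hj' (col_inj (h.trans c2.symm))
    simp only [Before, col, Wheel.pos]
    omega

/-- The face at a position of the ring at a spoke. -/
theorem ring_Φ [NeZero d] (hnt : ∀ i, ¬ Comp W R F₀ (t i)) {j : ℕ}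
    (hj : j < W.g i + 4) (h : Comp W R F₀ (W.Φ i j)) : j < W.g i + 2 := by
  rcases W.pos_cases hj with rfl | ⟨m, hm, rfl⟩ | rfl | rfl | rfl
  · omega
  · omega
  · omega
  · simp_all
  simp_all

theorem before_Φ [NeZero d] {j k : ℕ} (hjk : j < k) (hk : k < W.g i + 2) :
    Before W (i - 1) (W.Φ i j) (W.Φ i k) := by
  obtain ⟨c0, c1, c2⟩ := col_near W i
  rcases W.pos_cases (show j < W.g i + 4 by omega) with rfl | ⟨m, hm, rfl⟩ | rfl | rfl | rfl <;>
  rcases W.pos_cases (show k < W.g i + 4 by omega) with rfl | ⟨n, hn, rfl⟩ | rfl | rfl | rfl <;>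
  try omega
  · rw [Φ_zero, W.Φ_succ hn]; simp only [Before, col, Wheel.pos, c0, c1]; omega
  · rw [Φ_zero, Φ_g1]; simp only [Before, col, Wheel.pos, c0, c1]; omega
  · rw [W.Φ_succ hm, W.Φ_succ hn]; exact .inr ⟨rfl, show m < n by omega⟩
  · rw [W.Φ_succ hm, Φ_g1]; exact .inr ⟨rfl, hm⟩

theorem Disc.ring_no_leaf (H : Disc W γ R z₀ z₁) [NeZero d]
    (hnt : ∀ i, ¬ Comp W R F₀ (t i)) (hnl : ∀ i, ¬ LongRing W R F₀ i)
    (x : KV d × KV d × KV d) : x ∉ leaves R (W.sub R (Comp W R F₀)) := by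
  have hP := closed_comp (W := W) (R := R) F₀
  obtain ⟨v, a, b⟩ := x
  rcases v with _ | i | i | ⟨i, m⟩
  · exact H.no_leaf_hub hP fun i j h1 => absurd h1 (hnt i)
  · refine H.no_leaf_spoke hP fun j j' h1 h2 => ?_
    wlog hlt : j < j' generalizing j j'
    · grind
    exfalso
    have e1 := ring_Φ hnt h1.1 h1.2.1
    have e2 := ring_Φ hnt h2.1 h2.2.1
    have hnx : W.nx i j = j + 1 := by unfold Fan.nx; split_ifs <;> omega
    have hM := h1.2.2
    rw [hnx] at hM
    have hne : j + 1 ≠ j' := fun h => hM (h ▸ h2.2.1)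
    obtain ⟨c0, c1, c2⟩ := col_near W i
    have hMr : InRing W (W.Φ i (j + 1)) := by
      have hjg : j < W.g i := by clear hM hnx; omega
      rw [W.Φ_succ hjg]
      exact hjg
    have hlast : ¬ Before W (i - 1) (e (i + 1)) (W.Φ i j') := by
      rcases W.pos_cases h2.1 with h | ⟨n, hn, h⟩ | h | h | h
      · omega
      · rw [h, W.Φ_succ hn]; simp only [Before, col, Wheel.pos, c1, c2]; omega
      · rw [h, Φ_g1]; simp only [Before, col, Wheel.pos, c1, c2]; omega
      · omega
      · omega
    have hfirst : ¬ Before W (i - 1) (W.Φ i j) (e (i - 1)) := by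
      rcases W.pos_cases h1.1 with h | ⟨n, hn, h⟩ | h | h | h
      · rw [h, Φ_zero]; simp only [Before]; omega
      · rw [h, W.Φ_succ hn]; rintro (hB | ⟨hB, -⟩)
        · change (i - (i - 1)).val < (i - 1 - (i - 1)).val at hB; omega
        · change (i - (i - 1)).val = (i - 1 - (i - 1)).val at hB; omega
      · exfalso; omega
      · exfalso; omega
      · exfalso; omega
    have hei : W.Has R (e i) := by
      rcases W.pos_cases h2.1 with h | ⟨n, hn, h⟩ | h | h | h
      · omega
      · refine (ring_gap hnt (i - 1) h1.2.1 h2.2.1 hM hMr (before_Φ (by omega) (by omega))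
          (before_Φ (by omega) (by omega)) (G := e i) trivial (.inr ?_)).has
        rw [h, W.Φ_succ hn]
        exact .inr ⟨rfl, hn⟩
      · have := h2.2.1.has
        rwa [h, Φ_g1] at this
      · omega
      · omega
    exact hnl i (longRing_of_gap hnt h1.2.1 h2.2.1 hM hMr (before_Φ (by omega) (by omega))
      (before_Φ (by omega) (by omega)) hfirst hlast (.inl hei))
  · intro hl
    obtain ⟨h1, h2, h3, -⟩ := H.leaf_hat hP hl
    obtain ⟨c0, c1, c2⟩ := col_near W i
    have hg := W.pos i
    refine hnl i (longRing_of_gap hnt h2 h3 h1 trivial ?_ ?_ ?_ ?_ (.inr (.inr ⟨h2.has, h3.has⟩)))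
    · exact .inr ⟨rfl, show W.g i - 1 < W.g i by omega⟩
    all_goals simp only [Before, col, Wheel.pos]; omega
  · exact H.no_leaf_rim hP

theorem Disc.ring_grow (H : Disc W γ R z₀ z₁) [NeZero d]
    (hnt : ∀ i, ¬ Comp W R F₀ (t i)) (hnl : ∀ i, ¬ LongRing W R F₀ i)
    (hF : W.Has R F)
    (hV : ((W.nodes F).1 ∉ verts (W.sub R (Comp W R F₀)) ∧
        (W.nodes F).2.1 ∈ verts (W.sub R (Comp W R F₀)) ∧
        (W.nodes F).2.2 ∈ verts (W.sub R (Comp W R F₀))) ∨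
      ((W.nodes F).1 ∈ verts (W.sub R (Comp W R F₀)) ∧
        (W.nodes F).2.1 ∉ verts (W.sub R (Comp W R F₀)) ∧
        (W.nodes F).2.2 ∈ verts (W.sub R (Comp W R F₀))) ∨
      ((W.nodes F).1 ∈ verts (W.sub R (Comp W R F₀)) ∧
        (W.nodes F).2.1 ∈ verts (W.sub R (Comp W R F₀)) ∧
        (W.nodes F).2.2 ∉ verts (W.sub R (Comp W R F₀)))) :
    ∃ i, F = p i 0 ∧ Gap W R (Comp W R F₀) i := by
  have hR := H.sys
  have hP := closed_comp (W := W) (R := R) F₀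
  set Y := Comp W R F₀ with hY
  have hFY : ¬ Y F := by
    intro h
    have := nodes_mem_verts hR hP.has h
    tauto
  have hhub : hub ∉ verts (W.sub R Y) := fun h => by
    obtain ⟨i, hi⟩ := (mem_verts_hub hR hP.has).1 h
    exact hnt i hi
  -- a gap at the face below the hat `i`
  have gap_e : ∀ i, s i ∈ verts (W.sub R Y) → s (i + 1) ∈ verts (W.sub R Y) → ¬ Y (e i) →
      (W.Has R (Fc.e i) ∨ W.Has R (t i) ∨
      (W.Has R (Fc.p i (W.g i - 1)) ∧ W.Has R (Fc.p (i + 1) 0))) → False := by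
    intro i h1 h2 h3 hb
    obtain ⟨c0, c1, c2⟩ := col_near W i
    obtain ⟨j, hj, hj'⟩ := (mem_verts_spoke hR hP.has).1 h1
    obtain ⟨k, hk, hk'⟩ := (mem_verts_spoke hR hP.has).1 h2
    have hj2 := ring_Φ hnt hj hj'
    have hk2 := ring_Φ hnt hk hk'
    have e1 : j ≠ W.g i + 1 := by
      rintro rfl
      simp_all
    have e2 : k ≠ 0 := by
      rintro rfl
      simp_all
    refine hnl i (longRing_of_gap hnt (M := e i) hj' hk' h3 trivial ?_ ?_ ?_ ?_ hb)
    · have := before_Φ (W := W) (i := i) (j := j) (k := W.g i + 1) (by omega) (by omega)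
      rwa [Φ_g1] at this
    · rcases W.pos_cases hk with h | ⟨n, hn, h⟩ | h | h | h
      · omega
      · rw [h, W.Φ_succ hn]; simp only [Before, col, Wheel.pos, c1, c2]; omega
      · rw [h, Φ_g1]; simp only [Before, col, Wheel.pos, c1, c2]; omega
      · omega
      · omega
    · rcases W.pos_cases hj with h | ⟨n, hn, h⟩ | h | h | h
      · rw [h, Φ_zero]; simp only [Before]; omega
      · rw [h, W.Φ_succ hn]; simp only [Before, col, Wheel.pos, c1, c0]; omega
      · omega
      · omega
      · omega
    · rcases W.pos_cases hk with h | ⟨n, hn, h⟩ | h | h | h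
      · omega
      · rw [h, W.Φ_succ hn]; simp only [Before, col, Wheel.pos, c2]; omega
      · rw [h, Φ_g1]; simp only [Before]; omega
      · omega
      · omega
  rcases F with i | i | ⟨i, m⟩
  · exfalso
    simp only [nodes] at hV
    rcases hV with hV | hV | hV
    · refine gap_e i hV.2.1 hV.2.2 (fun h => hFY (h.adj hF (.inr (Nb.te i)))) (.inr (.inl hF))
    exacts [hhub hV.1, hhub hV.1]
  · exfalso
    have hpe : ¬ Y (p i (W.g i - 1)) := fun h => hFY (h.adj hF (.inl (Nb.pe i)))
    have hep : ¬ Y (p (i + 1) 0) := fun h => hFY (h.adj hF (.inr (Nb.ep i)))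
    have hh : h i ∉ verts (W.sub R Y) := fun h => by
      rcases (mem_verts_hat hR hP.has).1 h with h | h | h
      exacts [hep h, hFY h, hpe h]
    simp only [nodes] at hV
    grind
  · have hv := hF.1
    have hm := hv.2
    simp only [nodes] at hV
    have hin : ∀ n, 0 < n → n < W.g i → W.rho i n ∈ verts (W.sub R Y) →
        Y (p i n) ∨ Y (p i (n - 1)) := by
      intro n h0 h1 h2
      rw [W.rho_inner h0 h1] at h2
      exact (mem_verts_rim hR hP.has h2).2.2
    have hpv : ∀ n, Y (p i n) → s i ∈ verts (W.sub R Y) := fun n h =>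
      (nodes_mem_verts hR hP.has h).1
    have e1 : i - 1 + 1 = i := by ring
    rcases hV with hV | hV | hV
    · have hm0 : m = 0 := by
        by_contra h0
        grind
      subst hm0
      have hg1 : W.g i = 1 := by
        by_contra h0
        have := W.pos i
        rcases hin 1 (by omega) (by omega) hV.2.2 with h | h <;> exact hV.1 (hpv _ h)
      refine ⟨i, rfl, hF, hg1, hV.1, ?_, ?_⟩
      · have h1 := hV.2.1
        rw [rho_zero] at h1
        rcases (mem_verts_hat hR hP.has).1 h1 with h | h | h
        · grind
        · have := (nodes_mem_verts hR hP.has h).2.2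
          simp only [nodes, e1] at this
          exact absurd this hV.1
        · exact h
      · have h1 := hV.2.2
        rw [zero_add, ← hg1, rho_g] at h1
        rcases (mem_verts_hat hR hP.has).1 h1 with h | h | h
        · exact h
        · have := (nodes_mem_verts hR hP.has h).1
          exact absurd this hV.1
        · exact absurd (hpv _ h) hV.1
    · exfalso
      have hm0 : m + 1 = W.g i := by
        by_contra h0
        rcases hin (m + 1) (by omega) (by omega) hV.2.2 with h | h
        exacts [hFY (h.adj hF (.inr (Nb.pp i m (by omega)))), hFY h]
      obtain rfl : m = W.g i - 1 := by omega
      have h1 := hV.2.2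
      rw [hm0, rho_g] at h1
      have hei : ¬ Y (e i) := fun h => hFY (h.adj hF (.inr (Nb.pe i)))
      have h2 : Y (p (i + 1) 0) := by
        rcases (mem_verts_hat hR hP.has).1 h1 with h | h | h
        exacts [h, absurd h hei, absurd h hFY]
      exact gap_e i hV.1 (nodes_mem_verts hR hP.has h2).1 hei (.inr (.inr ⟨hF, h2.has⟩))
    · exfalso
      have hm0 : m = 0 := by
        by_contra h0
        rcases hin m (by omega) (by omega) hV.2.1 with h | h
        · exact hFY h
        · have := Nb.pp (W := W) i (m - 1) (by omega)
          rw [show m - 1 + 1 = m by omega] at this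
          exact hFY (h.adj hF (.inl this))
      subst hm0
      have h1 := hV.2.1
      rw [rho_zero] at h1
      have hei : ¬ Y (e (i - 1)) := fun h => by
        have := Nb.ep (W := W) (i - 1)
        rw [e1] at this
        exact hFY (h.adj hF (.inl this))
      have h2 : Y (p (i - 1) (W.g (i - 1) - 1)) := by
        rcases (mem_verts_hat hR hP.has).1 h1 with h | h | h
        · grind
        exacts [absurd h hei, h]
      refine gap_e (i - 1) (nodes_mem_verts hR hP.has h2).1 (by rw [e1]; exact hV.1) hei
        (.inr (.inr ⟨h2.has, ?_⟩))
      rwa [e1]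

/-- A leaf at a spoke leads from the end of a run to the start of another run. -/
theorem Disc.leaf_runs (H : Disc W γ R z₀ z₁) (hP : Closed W R P)
    (hl : (s i, a, b) ∈ leaves R (W.sub R P)) :
    ∃ j k, EndPos W P i j ∧ StartPos W P i k ∧ a = W.X i (j + 1) ∧ b = W.X i k ∧
      (k = W.nx i (W.nx i j) → ¬ W.Valid (W.Φ i (W.nx i j))) ∧
      ∃ q < W.g i + 4, ¬ P (W.Φ i q) ∧ ((k ≤ q ∧ q < j) ∨ (j < k ∧ (k ≤ q ∨ q < j))) := by
  obtain ⟨j, k, hj, hk, rfl, rfl, hne⟩ := H.leaf_spoke hP hl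
  refine ⟨j, k, hj, hk, rfl, rfl, hne, ?_⟩
  by_contra hcon
  push Not at hcon
  have hj4 := hj.1
  have hk4 := hk.1
  set S := (range (W.g i + 4)).filter fun q =>
    (k ≤ q ∧ q ≤ j) ∨ (j < k ∧ (k ≤ q ∨ q ≤ j)) with hS
  have hSP : ∀ q ∈ S, P (W.Φ i q) := by
    intro q hq
    rw [hS, mem_filter, mem_range] at hq
    rcases eq_or_ne q j with rfl | hqj
    · exact hj.2.1
    grind
  have hmem : ∀ q, q < W.g i + 4 → ((k ≤ q ∧ q ≤ j) ∨ (j < k ∧ (k ≤ q ∨ q ≤ j))) → q ∈ S :=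
    fun q h1 h2 => mem_filter.2 ⟨mem_range.2 h1, h2⟩
  have hkS : k ∈ S := hmem k hk4 (by omega)
  have hcard := H.link (s i) (insert (W.X i (j + 1)) (S.image (W.X i))) (by simp) (by
    intro x hx
    rcases mem_insert.1 hx with rfl | hx
    · exact ⟨W.X i k, mem_insert_of_mem (mem_image_of_mem _ hkS), (mem_leaves.1 hl).1⟩
    · obtain ⟨q, hq, rfl⟩ := mem_image.1 hx
      have hPq := hSP q hq
      rw [hS, mem_filter, mem_range] at hq
      refine ⟨W.X i (q + 1), ?_, (hP.has _ hPq).mem H.sys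
        ((W.at_spoke (hP.has _ hPq).1).2 ⟨q, hq.1, rfl, rfl, rfl⟩)⟩
      rcases eq_or_ne q j with rfl | hqj
      · exact mem_insert_self _ _
      · refine mem_insert_of_mem ?_
        rw [← X_nx]
        refine mem_image_of_mem _ (hmem _ (nx_lt hq.1) ?_)
        unfold Fan.nx
        split_ifs <;> omega)
  have h1 : (insert (W.X i (j + 1)) (S.image (W.X i))).card ≤ S.card + 1 :=
    (card_insert_le _ _).trans (Nat.succ_le_succ card_image_le)
  have h2 := card_filter_add_card_filter_not (s := range (W.g i + 4))
    (fun j => P (W.Φ i j))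
  rw [card_range] at h2
  have hSc : S.card ≤ ((range (W.g i + 4)).filter fun j => P (W.Φ i j)).card :=
    card_le_card fun q hq => mem_filter.2 ⟨(mem_filter.1 hq).1, hSP q hq⟩
  have h3 := H.le_spoke i
  have h4 : ((range (W.g i + 4)).filter fun j => ¬ P (W.Φ i j)).card ≤ 1 := by omega
  rw [card_le_one] at h4
  have hfan : W.fan i := by
    by_contra hf
    have h5 := H.spoke' i hf
    have h6 := W.g_eq_one i hf
    omega
  have hall : ∀ q < W.g i + 4, ¬ P (W.Φ i q) → q = W.nx i j := fun q hq hn =>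
    h4 q (mem_filter.2 ⟨mem_range.2 hq, hn⟩) _
      (mem_filter.2 ⟨mem_range.2 (nx_lt hj.1), hj.2.2⟩)
  have hpre : ∃ q < W.g i + 4, W.nx i q = k := by
    rcases Nat.eq_zero_or_pos k with h0 | h0
    · exact ⟨W.g i + 3, by omega, by simp [Fan.nx, h0]⟩
    · refine ⟨k - 1, by omega, ?_⟩
      unfold Fan.nx
      split_ifs <;> omega
  obtain ⟨q, hq, rfl⟩ := hpre
  have hq' := hall q hq (hk.2.2 q hq rfl)
  refine hne (by rw [hq']) ?_
  rcases W.pos_cases (nx_lt hj.1) with h | ⟨m, hm, h⟩ | h | h | h <;> rw [h]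
  · rw [Φ_zero]; trivial
  · rw [W.Φ_succ hm]; exact ⟨hfan, hm⟩
  · rw [Φ_g1]; trivial
  · rw [Φ_g2]; trivial
  · rw [Φ_g3]; trivial

/-! #### A hole around the hub -/

/-- Three sides of a path of faces from the hub to the outside. -/
def Cut (W : Fan d) (k : ZMod d) (x y : KV d) : Prop :=
  (x = s k ∧ y = s (k + 1)) ∨ (x = s (k + 1) ∧ y = h k) ∨ (x = h k ∧ y = W.rho (k + 1) 1)

theorem rho_one_ne (k : ZMod d) : W.rho (k + 1) 1 ≠ W.rho k (W.g k - 1) := by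
  have h1 : k + 1 ≠ k - 1 := W.ne_of_sub 2
  have h2 : k + 1 ≠ k := W.ne_of_sub 1
  have := W.pos k
  unfold rho
  split_ifs <;> simp_all

theorem six_le_c6_of_cut (hR : Sys R) (hP : ∀ F, P F → W.Has R F)
    (he : P (e k)) (ht : ¬ P (t k))
    (hconn : ∀ v ∈ verts (W.sub R P), Relation.ReflTransGen
      (fun x y => Edge (W.sub R P) x y ∧ ¬ Cut W k x y ∧ ¬ Cut W k y x) (s k) v) :
    6 ≤ c6 (W.sub R P) := by
  set E : KV d → KV d → Prop :=
    fun x y => Edge (W.sub R P) x y ∧ ¬ Cut W k x y ∧ ¬ Cut W k y x with hE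
  have hEs : ∀ x y, E x y → E y x := fun x y h => ⟨h.1.symm, h.2.2, h.2.1⟩
  have hsymm : ∀ a b, Relation.ReflTransGen E a b → Relation.ReflTransGen E b a := by
    intro a b hab
    induction hab with
    | refl => exact Relation.ReflTransGen.refl
    | tail _ hbc ih => exact Relation.ReflTransGen.head (hEs _ _ hbc) ih
  have hcE : ∀ a ∈ verts (W.sub R P), ∀ b ∈ verts (W.sub R P), Relation.ReflTransGen E a b :=
    fun a ha b hb => (hsymm _ _ (hconn a ha)).trans (hconn b hb)
  have hD := sys_sub hR hP
  refine hD.six_le_c6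
    (fun a ha b hb => Relation.ReflTransGen.mono (fun _ _ h => h.1) _ _ (hcE a ha b hb)) fun h0 =>
      ?_
  obtain ⟨a, b, c, h1, h2, h3, h4⟩ := hD.exists_one_missing' h0 hEs (fun _ _ h => h.1) hcE
    ⟨s (k + 1), s k, (At.edges hR hP he (at_self _)).2.2,
      fun h => h.2.2 (.inl ⟨rfl, rfl⟩)⟩
  obtain ⟨F, hF, hat⟩ := (mem_sub hR hP).1 h1
  have hv := (hP F hF).1
  have hcut : Cut W k a b ∨ Cut W k b a := by
    by_contra hn
    push Not at hn
    exact h2 ⟨(At.edges hR hP hF hat).1, hn⟩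
  have e1 : k + 1 - 1 = k := by ring
  rcases hcut with (⟨rfl, rfl⟩ | ⟨rfl, rfl⟩ | ⟨rfl, rfl⟩) | (⟨rfl, rfl⟩ | ⟨rfl, rfl⟩ | ⟨rfl, rfl⟩)
  · obtain ⟨j, hj, rfl, h5, -⟩ := (W.at_spoke hv).1 hat
    have := W.X_inj hj (show W.g k + 2 < W.g k + 4 by omega) (by rw [← h5, X_g2])
    subst this
    rw [Φ_g2] at hF
    exact ht hF
  · obtain ⟨j, hj, rfl, h5, h6⟩ := (W.at_spoke hv).1 hat
    have := W.X_inj hj (show 1 < W.g (k + 1) + 4 by omega) (by rw [← h5, X_one, e1])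
    subst this
    rw [W.X_succ (W.pos _)] at h6
    exact h3.2.1 (.inr (.inr ⟨rfl, h6⟩))
  · rcases (W.at_hat hv).1 hat with ⟨-, -, rfl⟩ | ⟨-, h5, -⟩ | ⟨-, h5, -⟩
    exacts [h4.2.1 (.inr (.inl ⟨rfl, rfl⟩)), W.rho_ne_s _ _ _ h5, W.rho_ne_s _ _ _ h5]
  · obtain ⟨j, hj, rfl, h5, h6⟩ := (W.at_spoke hv).1 hat
    have := W.X_inj hj (show 0 < W.g (k + 1) + 4 by omega) (by rw [← h5, X_zero, e1])
    subst this
    rw [X_one, e1] at h6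
    exact h4.2.2 (.inr (.inl ⟨rfl, h6⟩))
  · rcases (W.at_hat hv).1 hat with ⟨-, h5, -⟩ | ⟨-, -, rfl⟩ | ⟨-, h5, -⟩
    · exact W.rho_ne_s _ _ _ h5.symm
    · exact h3.2.2 (.inl ⟨rfl, rfl⟩)
    · have := KV.s.inj h5
      exact (W.ne_of_sub 1) this
  · rcases (W.at_hat hv).1 hat.rot with ⟨-, -, h5⟩ | ⟨-, -, h5⟩ | ⟨-, -, h5⟩
    exacts [W.rho_ne_s _ _ _ h5, W.rho_ne_s _ _ _ h5, rho_one_ne _ h5]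

/-- The system contains the faces below all hats except two, and the spokes between are
connected. -/
theorem six_le_c6_of_ring [NeZero d] (hR : Sys R) (hP : ∀ F, P F → W.Has R F)
    (he : ∀ j, j ≠ i → j ≠ i - 1 → P (e j)) (ht : ¬ P (t (i + 2)))
    (hbr : ∀ j, j = i ∨ j = i - 1 → Relation.ReflTransGen (fun x y => Edge (W.sub R P) x y ∧
      (x ≠ s (i + 3) ∧ x ≠ h (i + 2)) ∧ (y ≠ s (i + 3) ∧ y ≠ h (i + 2))) (s (i + 1)) (s j)) :
    6 ≤ c6 (W.sub R P) := by
  have hd := W.five_le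
  have n1 : i + 2 ≠ i := W.ne_of_sub 2
  have n2 : i + 2 ≠ i - 1 := W.ne_of_sub 3
  have n3 : i + 1 ≠ i := W.ne_of_sub 1
  have n4 : i + 1 ≠ i - 1 := W.ne_of_sub 2
  have n5 : i + 2 ≠ i + 1 := W.ne_of_sub 1
  have n6 : i + 3 ≠ i + 1 := W.ne_of_sub 2
  have e12 : i + 1 + 1 = i + 2 := by ring
  have e23 : i + 2 + 1 = i + 3 := by ring
  refine six_le_c6_of_cut hR hP (he _ n1 n2) ht ?_
  set E : KV d → KV d → Prop :=
    fun x y => Edge (W.sub R P) x y ∧ ¬ Cut W (i + 2) x y ∧ ¬ Cut W (i + 2) y x with hE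
  have hEs : ∀ x y, E x y → E y x := fun x y h => ⟨h.1.symm, h.2.2, h.2.1⟩
  have hss : ∀ j, j ≠ i → j ≠ i - 1 → j ≠ i + 2 → E (s j) (s (j + 1)) := by
    intro j h1 h2 h3
    refine ⟨(At.edges hR hP (he j h1 h2) (at_self _)).2.2.symm, ?_, ?_⟩
    · rintro (⟨h4, -⟩ | ⟨-, h4⟩ | ⟨h4, -⟩)
      · exact h3 (KV.s.inj h4)
      · simp at h4
      · simp at h4
    · rintro (⟨h4, h5⟩ | ⟨-, h4⟩ | ⟨h4, -⟩)
      · grind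
      · simp at h4
      · simp at h4
  have h1 : Relation.ReflTransGen E (s (i + 2)) (s (i + 1)) := by
    have := hss (i + 1) n3 n4 n5.symm
    grind
  have h2 : ∀ j, j = i ∨ j = i - 1 → Relation.ReflTransGen E (s (i + 2)) (s j) := by
    intro j hj
    refine h1.trans (Relation.ReflTransGen.mono ?_ _ _ (hbr j hj))
    rintro x y ⟨h3, h4, h5⟩
    rw [← e23] at h4 h5
    refine ⟨h3, ?_, ?_⟩
    · rintro (⟨-, h6⟩ | ⟨h6, -⟩ | ⟨h6, -⟩)
      exacts [h5.1 h6, h4.1 h6, h4.2 h6]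
    · rintro (⟨-, h6⟩ | ⟨h6, -⟩ | ⟨h6, -⟩)
      exacts [h4.1 h6, h5.1 h6, h5.2 h6]
  have cast_ne : ∀ n : ℕ, 0 < n → n < d → (n : ZMod d) ≠ 0 := by
    intro n hn hn' h0
    rw [ZMod.natCast_eq_zero_iff] at h0
    have := Nat.le_of_dvd hn h0
    omega
  have h3 : ∀ n : ℕ, n + 4 ≤ d → Relation.ReflTransGen E (s (i + 2)) (s (i - 1 - n)) := by
    intro n
    induction n with
    | zero => intro _; simpa using h2 (i - 1) (.inr rfl)
    | succ n ih =>
      intro hn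
      have := hss (i - 1 - (n + 1 : ℕ)) ?_ ?_ ?_
      · rw [show i - 1 - ((n + 1 : ℕ) : ZMod d) + 1 = i - 1 - n by push_cast; ring] at this
        grind
      · intro h
        refine cast_ne (n + 2) (by omega) (by omega) ?_
        grind
      · intro h
        refine cast_ne (n + 1) (by omega) (by omega) ?_
        grind
      · intro h
        refine cast_ne (n + 4) (by omega) (by omega) ?_
        grind
  have h4 : ∀ j, Relation.ReflTransGen E (s (i + 2)) (s j) := by
    intro j
    have hm := (i - j).val_lt
    have hj : j = i - ((i - j).val : ℕ) := by rw [ZMod.natCast_zmod_val]; ring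
    rcases Nat.lt_or_ge (i - j).val 1 with h5 | h5
    · have : (i - j).val = 0 := by omega
      rw [this] at hj
      grind
    rcases Nat.lt_or_ge ((i - j).val + 2) d with h6 | h6
    · have := h3 ((i - j).val - 1) (by omega)
      rw [Nat.cast_sub h5, ZMod.natCast_zmod_val] at this
      rwa [show i - 1 - ((i - j) - ((1 : ℕ) : ZMod d)) = j by push_cast; ring] at this
    · rcases (show (i - j).val = d - 2 ∨ (i - j).val = d - 1 by omega) with h7 | h7
      · rw [h7, Nat.cast_sub (by omega), ZMod.natCast_self] at hj
        grind
      · rw [h7, Nat.cast_sub (by omega), ZMod.natCast_self] at hj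
        grind
  have hne : ∀ j y, y ≠ h (i + 2) → (∀ l, y ≠ s l) → ¬ Cut W (i + 2) (s j) y ∧
      ¬ Cut W (i + 2) y (s j) := by
    intro j y h5 h6
    constructor
    · rintro (⟨-, h7⟩ | ⟨-, h7⟩ | ⟨h7, -⟩)
      · exact h6 _ h7
      · exact h5 h7
      · simp at h7
    · rintro (⟨h7, -⟩ | ⟨h7, -⟩ | ⟨h7, -⟩)
      exacts [h6 _ h7, h6 _ h7, h5 h7]
  have hfin : ∀ j y, Edge (W.sub R P) (s j) y → y ≠ h (i + 2) → (∀ l, y ≠ s l) →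
      Relation.ReflTransGen E (s (i + 2)) y := fun j y h5 h6 h7 =>
    (h4 j).tail ⟨h5, hne j y h6 h7⟩
  intro v hv
  rcases v with _ | j | j | ⟨j, m⟩
  · obtain ⟨j, hj⟩ := (mem_verts_hub hR hP).1 hv
    exact hfin j _ (At.edges hR hP hj (at_self _)).1.symm (by simp) (by simp)
  · exact h4 j
  · by_cases hj : j = i + 2
    · subst hj
      refine (h4 (i + 2)).tail ⟨(At.edges hR hP (he _ n1 n2) (at_self _)).1, ?_, ?_⟩
      · rintro (⟨-, h7⟩ | ⟨h7, -⟩ | ⟨h7, -⟩)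
        · simp at h7
        · grind
        · simp at h7
      · rintro (⟨h7, -⟩ | ⟨h7, -⟩ | ⟨-, h7⟩)
        · simp at h7
        · simp at h7
        · exact W.rho_ne_s _ _ _ h7.symm
    · have hj' : (h j : KV d) ≠ h (i + 2) := fun h => hj (KV.h.inj h)
      rcases (mem_verts_hat hR hP).1 hv with h5 | h5 | h5
      · refine hfin (j + 1) _ (At.edges hR hP h5 ((W.at_hat (hP _ h5).1 (i := j)).2
          (.inl ⟨rfl, rfl, rfl⟩))).2.2 hj' (by simp)
      · exact hfin j _ (At.edges hR hP h5 (at_self _)).1 hj' (by simp)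
      · exact hfin j _ (At.edges hR hP h5 ((W.at_hat (hP _ h5).1 (i := j)).2
          (.inr (.inr ⟨rfl, rfl, rfl⟩)))).1.symm hj' (by simp)
  · obtain ⟨F, a, b, h5, h6⟩ := (mem_verts_sub hR hP).1 hv
    have h7 := At.edges hR hP h5 h6
    rcases (W.at_rim (hP _ h5).1 h6).2.2 with ⟨-, -, rfl⟩ | ⟨-, rfl, -⟩
    exacts [hfin j _ h7.2.2 (by simp) (by simp), hfin j _ h7.1.symm (by simp) (by simp)]

/-- Adding a face at the hub across the hole. -/
theorem c6_insert_t (hR : Sys R) (hP : ∀ F, P F → W.Has R F)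
    (hnt : ∀ j, ¬ P (t j)) (he : ¬ P (e i)) (hs : s i ∈ verts (W.sub R P))
    (hs' : s (i + 1) ∈ verts (W.sub R P)) (hT : W.Has R (t i)) :
    c6 (W.sub R P) + 6 ≤ c6 (W.sub R (fun F => P F ∨ F = t i)) := by
  have hun := sub_insert hR hP hT
  simp only [nodes] at hun
  have hne := hR.ne hT.2
  have htR : tri hub (s i) (s (i + 1)) ⊆ R := hR.rot.tri_subset hT.2
  have hhub : hub ∉ verts (W.sub R P) := fun h => by
    obtain ⟨j, hj⟩ := (mem_verts_hub hR hP).1 h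
    exact hnt j hj
  have hrc := rotClosed_sub hR hP
  have hdisj : Disjoint (W.sub R P) (tri hub (s i) (s (i + 1))) := by
    rw [disjoint_left]
    rintro ⟨a, b, c⟩ h1 h2
    have h3 := hrc.mem_verts h1
    rcases mem_tri.1 h2 with h | h | h <;> cases h
    exacts [hhub h3.1, hhub h3.2.2, hhub h3.2.1]
  have hsh : shared (W.sub R P) (tri hub (s i) (s (i + 1))) = ∅ := by
    rw [eq_empty_iff_forall_notMem]
    rintro ⟨a, b, c⟩ hx
    obtain ⟨h1, w, h2⟩ := mem_shared.1 hx
    have h3 := hrc.mem_verts h1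
    rcases mem_tri.1 h2 with h | h | h <;> cases h
    · exact hhub h3.2.1
    · obtain ⟨j, hj, h4, h5⟩ := (out_spoke hR hP).1 ⟨_, h1⟩
      have := W.X_inj hj (show 0 < W.g (i + 1) + 4 by omega)
        (by rw [← h5, X_zero, add_sub_cancel_right])
      subst this
      rw [Φ_zero, add_sub_cancel_right] at h4
      exact he h4
    · exact hhub h3.1
  rw [hun, c6_union hR sub_subset htR hdisj, c6_tri hne, hsh]
  have h2 : ({s i, s (i + 1)} : Finset (KV d)) ⊆
      verts (W.sub R P) ∩ verts (tri hub (s i) (s (i + 1))) := by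
    intro x hx
    have h3 := (rotClosed_tri _ _ _).mem_verts
      ((mem_tri (a := hub) (b := s i) (c := s (i + 1))).2 (.inl rfl))
    grind
  have h3 := card_le_card h2
  grind

/-- The shape of a leaf at a spoke, if the faces at the spoke are known. -/
theorem Disc.leaf_pattern (H : Disc W γ R z₀ z₁) (hP : Closed W R P)
    (hl : (s i, a, b) ∈ leaves R (W.sub R P))
    (hA : ∀ q < W.g i + 4, P (W.Φ i q) ↔ A q) :
    ∃ j k, j < W.g i + 4 ∧ k < W.g i + 4 ∧ A j ∧ A k ∧
      ((j < W.g i + 3 ∧ ¬ A (j + 1)) ∨ (j = W.g i + 3 ∧ ¬ A 0)) ∧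
      ((0 < k ∧ ¬ A (k - 1)) ∨ (k = 0 ∧ ¬ A (W.g i + 3))) ∧
      a = W.X i (j + 1) ∧ b = W.X i k ∧ (k = j + 2 → j < W.g i ∧ ¬ W.fan i) ∧
      ¬ (j = W.g i + 2 ∧ k = 0) ∧ ¬ (j = W.g i + 3 ∧ k = 1) ∧
      ∃ q < W.g i + 4, ¬ A q ∧ ((k ≤ q ∧ q < j) ∨ (j < k ∧ (k ≤ q ∨ q < j))) := by
  obtain ⟨j, k, hj, hk, ha, hb, hv, q, hq, hq1, hq2⟩ := H.leaf_runs hP hl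
  have hj4 := hj.1
  have hk4 := hk.1
  have hvn : W.nx i j = j + 1 ∨ (j = W.g i + 3 ∧ W.nx i j = 0) := by
    unfold Fan.nx; split_ifs <;> omega
  have hval : ∀ q < W.g i + 4, ¬ W.Valid (W.Φ i q) → 0 < q ∧ q ≤ W.g i ∧ ¬ W.fan i := by
    intro q hq hn
    rcases W.pos_cases hq with rfl | ⟨m, hm, rfl⟩ | rfl | rfl | rfl
    · rw [Φ_zero] at hn; exact absurd trivial hn
    · rw [W.Φ_succ hm] at hn
      exact ⟨by omega, by omega, fun hf => hn ⟨hf, hm⟩⟩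
    · rw [Φ_g1] at hn; exact absurd trivial hn
    · rw [Φ_g2] at hn; exact absurd trivial hn
    · rw [Φ_g3] at hn; exact absurd trivial hn
  refine ⟨j, k, hj4, hk4, (hA _ hj4).1 hj.2.1, (hA _ hk4).1 hk.2.1, ?_, ?_, ha, hb, ?_, ?_, ?_,
    q, hq, fun h => hq1 ((hA _ hq).2 h), hq2⟩
  · have := hj.2.2
    rcases hvn with h | ⟨h, h'⟩
    · by_cases h3 : j = W.g i + 3
      · rw [h3] at h; unfold Fan.nx at h; simp at h
      grind
    grind
  · rcases Nat.eq_zero_or_pos k with h | h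
    · exact .inr ⟨h, fun h' => hk.2.2 (W.g i + 3) (by omega) (by simp [Fan.nx, h])
        ((hA _ (by omega)).2 h')⟩
    · refine .inl ⟨h, fun h' => hk.2.2 (k - 1) (by omega) ?_ ((hA _ (by omega)).2 h')⟩
      unfold Fan.nx; split_ifs <;> omega
  · intro h
    have h1 : W.nx i j = j + 1 := by unfold Fan.nx; split_ifs <;> omega
    have h2 := hval _ (nx_lt hj4) (hv (by rw [h1, h]; unfold Fan.nx; split_ifs <;> omega))
    exact ⟨by omega, h2.2.2⟩
  · rintro ⟨h1, h2⟩
    have h3 : W.nx i j = W.g i + 3 := by unfold Fan.nx; split_ifs <;> omega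
    have h4 := hval _ (nx_lt hj4) (hv (by rw [h3, h2]; simp [Fan.nx]))
    omega
  · rintro ⟨h1, h2⟩
    have h3 : W.nx i j = 0 := by unfold Fan.nx; split_ifs <;> omega
    have h4 := hval _ (nx_lt hj4) (hv (by rw [h3, h2]; simp [Fan.nx]))
    omega

theorem closed_has : Closed W R (W.Has R) where
  has _ h := h
  adj _ _ _ h _ := h

theorem Disc.verts_has (H : Disc W γ R z₀ z₁) : verts R = verts (W.sub R (W.Has R)) := by
  refine subset_antisymm ?_ (verts_mono sub_subset)
  intro v hv
  by_contra hn
  have hz : z₀ ∈ verts (W.sub R (W.Has R)) ∧ z₁ ∈ verts (W.sub R (W.Has R)) := by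
    obtain ⟨F, c, hF, h | h⟩ := H.start
    · exact ⟨(mem_verts_sub H.sys fun _ h => h).2 ⟨F, _, _, hF, h⟩,
        (mem_verts_sub H.sys fun _ h => h).2 ⟨F, _, _, hF, h.rot⟩⟩
    · exact ⟨(mem_verts_sub H.sys fun _ h => h).2 ⟨F, _, _, hF, h.rot⟩,
        (mem_verts_sub H.sys fun _ h => h).2 ⟨F, _, _, hF, h⟩⟩
  obtain ⟨F, a, b, c, h2, h3, h4, -⟩ := H.gen (fun v => v ∉ verts (W.sub R (W.Has R))) ⟨v, hv, hn⟩
    (not_not.2 hz.1) (not_not.2 hz.2)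
  exact h4 ((mem_verts_sub H.sys fun _ h => h).2 ⟨F, _, _, h2, h3⟩)

theorem Φ_iff (hq : q < W.g i + 4) :
    P (W.Φ i q) ↔ (q = 0 ∧ P (e (i - 1))) ∨ (0 < q ∧ q ≤ W.g i ∧ P (p i (q - 1))) ∨
      (q = W.g i + 1 ∧ P (e i)) ∨ (q = W.g i + 2 ∧ P (t i)) ∨ (q = W.g i + 3 ∧ P (t (i - 1))) := by
  have := W.pos i
  rcases W.pos_cases hq with rfl | ⟨m, hm, rfl⟩ | rfl | rfl | rfl
  · simp
  · rw [W.Φ_succ hm]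
    grind
  · simp
  · simp
  · simp

theorem pattern_gap {c c' ε ε' : ℕ} (hg : 0 < g) (hu : u < g + 4) (hv : v < g + 4)
    (hA : A = fun q => (q = 0 ∧ ε' = 1) ∨ (0 < q ∧ q ≤ g) ∨
        (q = g + 1 ∧ ε = 1) ∨ (q = g + 2 ∧ c = 1) ∨ (q = g + 3 ∧ c' = 1))
    (h1 : A u) (h2 : A v) (h3 : (u < g + 3 ∧ ¬ A (u + 1)) ∨ (u = g + 3 ∧ ¬ A 0))
    (h4 : (0 < v ∧ ¬ A (v - 1)) ∨ (v = 0 ∧ ¬ A (g + 3))) (h5 : v ≠ u + 2)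
    (h6 : ¬ (u = g + 2 ∧ v = 0)) (h7 : ¬ (u = g + 3 ∧ v = 1)) (hq : q < g + 4) (h8 : ¬ A q)
    (h9 : (v ≤ q ∧ q < u) ∨ (u < v ∧ (v ≤ q ∨ q < u))) :
    ε ≠ 1 ∧ ε' ≠ 1 ∧ ((c = 1 ∧ c' ≠ 1 ∧ u = g + 2 ∧ v = 1) ∨ (c ≠ 1 ∧ c' = 1 ∧ u = g ∧ v = g + 3)) ∨
    (ε ≠ 1 ∧ ε' = 1 ∧ c' = 1) ∨ (ε = 1 ∧ ε' ≠ 1 ∧ c = 1) := by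
  subst hA
  have n0 : g + 3 ≠ 0 := by omega
  beta_reduce at h1 h2 h3 h4 h8
  by_cases e1 : c = 1 <;> by_cases e2 : c' = 1 <;> by_cases e3 : ε = 1 <;> by_cases e4 : ε' = 1 <;>
    simp only [e1, e2, e3, e4, ne_eq, not_true, not_false_iff, and_true, true_and, and_false,
      false_and,
      or_false, false_or, or_true, true_or] at h1 h2 h3 h4 h8 ⊢ <;> omega

theorem exists_flag (p : Prop) : ∃ c : ℕ, c = 1 ↔ p := by
  by_cases h : p
  exacts [⟨1, by simp [h]⟩, ⟨0, by simp [h]⟩]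

/-- What is known about a gap next to a ring. -/
structure RingGap (W : Fan d) (R : Finset (KV d × KV d × KV d)) (i : ZMod d) : Prop where
  g_eq : W.g i = 1
  e : ∀ j, W.Has R (e j) ↔ j ≠ i ∧ j ≠ i - 1
  p : ∀ j, ∀ m < W.g j, W.Has R (p j m)
  t : ∀ j, W.Has R (t j) → j = i ∨ j = i - 1

theorem ringGap [NeZero d] (hR : Sys R) (hnt : ∀ i, ¬ Comp W R F₀ (t i))
    (hg : Gap W R (Comp W R F₀) i) : RingGap W R i := by
  have hne := hg.not_e hR (closed_comp F₀)
  obtain ⟨c0, c1, c2⟩ := col_near W i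
  have hpos := W.pos (i - 1)
  have key : ∀ G, InRing W G → (Before W (i - 1) G (p (i - 1) (W.g (i - 1) - 1)) ∨
      Before W (i - 1) (p (i + 1) 0) G) → Comp W R F₀ G := fun G hG h =>
    ring_gap hnt (i - 1) hg.left hg.right (M := Fc.e (i - 1)) (fun h => hne.2 h.has) trivial
      (.inr ⟨rfl, show W.g (i - 1) - 1 < W.g (i - 1) by omega⟩)
      (.inl (show (i - 1 - (i - 1)).val < (i + 1 - (i - 1)).val by omega)) hG h
  have he : ∀ j, j ≠ i → j ≠ i - 1 → Comp W R F₀ (Fc.e j) := by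
    intro j h1 h2
    have d0 : (j - (i - 1)).val ≠ 0 := fun h => h2 (col_inj (h.trans c0.symm))
    have d1 : (j - (i - 1)).val ≠ 1 := fun h => h1 (col_inj (h.trans c1.symm))
    refine key _ trivial (.inr ?_)
    rcases Nat.lt_or_ge 2 (j - (i - 1)).val with h | h
    exacts [.inl (show (i + 1 - (i - 1)).val < (j - (i - 1)).val by omega),
      .inr ⟨show (i + 1 - (i - 1)).val = (j - (i - 1)).val by omega, W.pos j⟩]
  have hp : ∀ j, j ≠ i → ∀ m < W.g j, Comp W R F₀ (Fc.p j m) := by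
    intro j h1 m hm
    have d1 : (j - (i - 1)).val ≠ 1 := fun h => h1 (col_inj (h.trans c1.symm))
    by_cases h2 : j = i - 1
    · subst h2
      by_cases h3 : m = W.g (i - 1) - 1
      · rw [h3]; exact hg.left
      · exact key _ hm (.inl (.inr ⟨rfl, show m < W.g (i - 1) - 1 by omega⟩))
    · have d0 : (j - (i - 1)).val ≠ 0 := fun h => h2 (col_inj (h.trans c0.symm))
      by_cases h3 : j = i + 1 ∧ m = 0
      · obtain ⟨rfl, rfl⟩ := h3
        exact hg.right
      · refine key _ hm (.inr ?_)
        rcases Nat.lt_or_ge 2 (j - (i - 1)).val with h | h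
        · exact .inl (show (i + 1 - (i - 1)).val < (j - (i - 1)).val by omega)
        · have h4 : j = i + 1 := col_inj (b := i - 1) (by omega)
          exact .inr ⟨show (i + 1 - (i - 1)).val = (j - (i - 1)).val by omega,
            show 0 < m from Nat.pos_of_ne_zero fun h => h3 ⟨h4, h⟩⟩
  refine ⟨hg.g_eq, fun j => ⟨fun h => ⟨?_, ?_⟩, fun h => (he j h.1 h.2).has⟩, fun j m hm => ?_,
    fun j hj => ?_⟩
  · rintro rfl; exact hne.1 h
  · rintro rfl; exact hne.2 h
  · by_cases h : j = i
    · subst h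
      obtain rfl : m = 0 := by have := hg.g_eq; omega
      exact hg.has
    · exact (hp j h m hm).has
  · by_contra hn
    push Not at hn
    exact hnt j ((he j hn.1 hn.2).adj hj (.inr (Nb.te j)))

theorem RingGap.six_le [NeZero d] (hR : Sys R) (hg : RingGap W R i)
    (hP : ∀ F, P F → W.Has R F) (hPT : ∀ F, (∀ j, F ≠ Fc.t j) → W.Has R F → P F) :
    6 ≤ c6 (W.sub R P) := by
  have n1 : i + 2 ≠ i := W.ne_of_sub 2
  have n2 : i + 2 ≠ i - 1 := W.ne_of_sub 3
  have n3 : i + 3 ≠ i := W.ne_of_sub 3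
  have n4 : i + 3 ≠ i - 1 := W.ne_of_sub 4
  have n5 : i + 3 ≠ i + 1 := W.ne_of_sub 2
  have hp : ∀ j, ∀ m < W.g j, P (Fc.p j m) := fun j m hm => hPT _ (by simp) (hg.p j m hm)
  refine six_le_c6_of_ring hR hP (i := i) (fun j h1 h2 => hPT _ (by simp) ((hg.e j).2 ⟨h1, h2⟩))
    (fun h => ?_) ?_
  · rcases hg.t _ (hP _ h) with h | h
    exacts [n1 h, n2 h]
  have h1 := hp (i + 1) 0 (W.pos _)
  have h2 := hp i 0 (W.pos _)
  have h3 := hp (i - 1) (W.g (i - 1) - 1) (by have := W.pos (i - 1); omega)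
  have e1 := (At.edges hR hP h1 (at_self _)).1
  have e2 := At.edges hR hP h2 (at_self _)
  have e3 := (At.edges hR hP h3 (at_self _)).2.2
  have hρ : W.rho i 1 = h i := by
    have := W.rho_g i
    rwa [hg.g_eq] at this
  simp only [nodes, rho_zero, zero_add, add_sub_cancel_right, hρ] at e1 e2 e3
  rw [Nat.sub_add_cancel (W.pos _), rho_g] at e3
  rintro j (rfl | rfl)
  · refine (Relation.ReflTransGen.single (b := h j) ⟨e1, ?_, ?_⟩).tail ⟨e2.2.2, ?_, ?_⟩ <;>
      simp [n1.symm, n3.symm, n5.symm]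
  · refine ((Relation.ReflTransGen.single (b := h i) ⟨e1, ?_, ?_⟩).tail (c := h (i - 1))
      ⟨e2.2.1.symm, ?_, ?_⟩).tail ⟨e3, ?_, ?_⟩ <;>
      simp [n1.symm, n2.symm, n4.symm, n5.symm]

theorem Disc.ring_gap_false (H : Disc W γ R z₀ z₁) [NeZero d] (hg : RingGap W R i) :
    False := by
  have hR := H.sys
  have hP := closed_has (W := W) (R := R)
  have hg1 := hg.g_eq
  have n1 : i + 1 ≠ i := W.ne_of_sub 1
  have n2 : i + 1 ≠ i - 1 := W.ne_of_sub 2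
  have n3 : i - 1 ≠ i := (W.ne_of_sub 1).symm
  have hρ : W.rho i 1 = h i := by
    have := W.rho_g i
    rwa [hg1] at this
  have hfan : ∀ j, W.fan j := fun j => (hg.p j 0 (W.pos j)).1.1
  have hsp : ∀ j a b, (s j, a, b) ∈ leaves R (W.sub R (W.Has R)) → j = i ∧
      ((W.Has R (t i) ∧ ¬ W.Has R (t (i - 1)) ∧ a = W.X i 4 ∧ b = W.X i 1) ∨
      (¬ W.Has R (t i) ∧ W.Has R (t (i - 1)) ∧ a = W.X i 2 ∧ b = W.X i 4)) := by
    intro j a b hl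
    have hpos := W.pos j
    obtain ⟨c, hc⟩ := exists_flag (W.Has R (t j))
    obtain ⟨c', hc'⟩ := exists_flag (W.Has R (t (j - 1)))
    obtain ⟨ε, hε⟩ := exists_flag (W.Has R (e j))
    obtain ⟨ε', hε'⟩ := exists_flag (W.Has R (e (j - 1)))
    obtain ⟨u, v, hu, hv, h1, h2, h3, h4, rfl, rfl, h5, h6, h7, q, hq, h8, h9⟩ :=
      H.leaf_pattern hP hl (A := fun q => (q = 0 ∧ ε' = 1) ∨ (0 < q ∧ q ≤ W.g j) ∨
        (q = W.g j + 1 ∧ ε = 1) ∨ (q = W.g j + 2 ∧ c = 1) ∨ (q = W.g j + 3 ∧ c' = 1)) (by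
        intro q hq
        have q3 : 0 < q → q ≤ W.g j → W.Has R (p j (q - 1)) := fun _ _ =>
          hg.p j (q - 1) (by omega)
        rw [Φ_iff (P := W.Has R) hq, hc, hc', hε, hε']
        exact or_congr Iff.rfl (or_congr
          ⟨fun h => ⟨h.1, h.2.1⟩, fun h => ⟨h.1, h.2, q3 h.1 h.2⟩⟩ Iff.rfl))
    simp only [hfan j, not_true, and_false] at h5
    have hpat := pattern_gap hpos hu hv rfl h1 h2 h3 h4 h5 h6 h7 hq h8 h9
    by_cases hji : j = i
    · subst hji
      rw [← hc, ← hc']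
      refine ⟨rfl, ?_⟩
      have q1 : ε ≠ 1 := by rw [Ne, hε, hg.e]; simp
      have q2 : ε' ≠ 1 := by rw [Ne, hε', hg.e]; simp
      grind
    · exfalso
      have q1 : j - 1 ≠ i ↔ j ≠ i + 1 := by rw [Ne, sub_eq_iff_eq_add]
      have q2 : j - 1 ≠ i - 1 := fun h => hji (sub_left_inj.1 h)
      have t1 : W.Has R (t j) → j = i - 1 := fun h => (hg.t j h).resolve_left hji
      have t2 : W.Has R (t (j - 1)) → j = i + 1 := fun h => by
        rcases hg.t _ h with h | h
        exacts [sub_eq_iff_eq_add.1 h, absurd (sub_left_inj.1 h) hji]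
      have t3 : ε' = 1 ↔ j ≠ i + 1 := by rw [hε', hg.e, q1]; exact and_iff_left q2
      have t4 : ε = 1 ↔ j ≠ i - 1 := by rw [hε, hg.e]; exact and_iff_right hji
      have t5 : c = 1 → ¬ ε = 1 := fun h h' => t4.1 h' (t1 (hc.1 h))
      have t6 : c' = 1 → ¬ ε' = 1 := fun h h' => t3.1 h' (t2 (hc'.1 h))
      have t7 : ε = 1 ∨ ε' = 1 := by
        rw [t3, t4]
        by_contra hn
        grind
      rcases hpat with h | h | h
      exacts [t7.elim h.1 h.2.1, t6 h.2.2 h.2.1, t5 h.2.2 h.1]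
  have hle := c6_le_leaves hR H.c6_eq sub_subset (rotClosed_sub hR hP.has) H.verts_has.symm
  set x₁ : KV d × KV d × KV d := (h i, W.rho i (W.g i - 1), W.rho (i + 1) 1) with hx₁
  set x₂ : KV d × KV d × KV d := (h (i - 1), W.rho (i - 1) (W.g (i - 1) - 1), h i) with hx₂
  have hnot : x₁ ∈ leaves R (W.sub R (W.Has R)) → x₂ ∈ leaves R (W.sub R (W.Has R)) → False := by
    intro hx hy
    have h1 := (mem_leaves.1 hx).1
    have h2 := hR.rot _ _ _ (hR.rot _ _ _ (mem_leaves.1 hy).1)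
    have h3 : W.g i - 1 = 0 := by omega
    rw [h3, rho_zero] at h1
    have h4 := hR.func _ _ _ _ h1 h2
    have h5 := W.pos (i - 1)
    exact rho_ne_rho_two i (by omega) (by omega) h4
  have hloc : ∀ x, x ∈ leaves R (W.sub R (W.Has R)) → x = x₁ ∨ x = x₂ ∨ x.1 = s i := by
    rintro ⟨v, a, b⟩ hl
    rcases v with _ | j | j | ⟨j, m⟩
    · refine absurd hl (H.no_leaf_hub hP fun a b h1 h2 h3 h4 => ?_)
      have e1 : i - 1 + 1 = i := by ring
      rcases hg.t _ h1 with rfl | rfl <;> rcases hg.t _ h3 with rfl | rfl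
      · rfl
      · grind
      · grind
      · rfl
    · grind
    · obtain ⟨h1, -, -, h4, h5⟩ := H.leaf_hat hP hl
      have h6 : j = i ∨ j = i - 1 := by
        by_contra hn
        push Not at hn
        exact h1 ((hg.e j).2 hn)
      rcases h6 with rfl | rfl
      · exact .inl (by rw [h4, h5])
      · refine .inr (.inl ?_)
        rw [h4, h5, sub_add_cancel, hρ]
    · exact absurd hl (H.no_leaf_rim hP)
  by_cases hx : (W.Has R (t i) ∧ ¬ W.Has R (t (i - 1))) ∨ (¬ W.Has R (t i) ∧ W.Has R (t (i - 1)))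
  · obtain ⟨y, hy⟩ : ∃ y, ∀ x, x ∈ leaves R (W.sub R (W.Has R)) → x.1 = s i → x = y := by
      rcases hx with hx | hx
      · refine ⟨(s i, W.X i 4, W.X i 1), ?_⟩
        rintro ⟨v, a, b⟩ h1 rfl
        have := (hsp i a b h1).2
        simp only [hx.1, hx.2, true_and, false_and, or_false, not_true, not_false_iff] at this
        rw [this.1, this.2]
      · refine ⟨(s i, W.X i 2, W.X i 4), ?_⟩
        rintro ⟨v, a, b⟩ h1 rfl
        have := (hsp i a b h1).2
        simp only [hx.1, hx.2, true_and, false_and, false_or, not_true, not_false_iff] at this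
        rw [this.1, this.2]
    have hcard : (leaves R (W.sub R (W.Has R))).card ≤ 2 := by
      by_cases h1 : x₁ ∈ leaves R (W.sub R (W.Has R))
      · refine (card_le_card (t := {x₁, y}) ?_).trans card_le_two
        intro x hx
        rw [mem_insert, mem_singleton]
        rcases hloc x hx with h | h | h
        exacts [.inl h, (hnot h1 (h ▸ hx)).elim, .inr (hy x hx h)]
      · refine (card_le_card (t := {x₂, y}) ?_).trans card_le_two
        intro x hx
        rw [mem_insert, mem_singleton]
        rcases hloc x hx with h | h | h
        exacts [(h1 (h ▸ hx)).elim, .inl h, .inr (hy x hx h)]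
    have hc : ∀ k, (k = i ∨ k = i - 1) → W.Has R (t k) → (∀ j, W.Has R (t j) → j = k) →
        12 ≤ c6 (W.sub R (W.Has R)) := by
      intro k hk hT huniq
      set P : Fc d → Prop := fun F => W.Has R F ∧ ∀ j, F ≠ t j with hPdef
      have hP0 : ∀ F, P F → W.Has R F := fun F hF => hF.1
      have h1 := hg.six_le hR hP0 fun F h1 h2 => ⟨h2, h1⟩
      have hs : ∀ j, s j ∈ verts (W.sub R P) := fun j =>
        (nodes_mem_verts hR hP0 (F := p j 0) ⟨hg.p j 0 (W.pos j), by simp⟩).1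
      have h2 := c6_insert_t hR hP0 (i := k) (fun j hj => hj.2 j rfl)
        (fun h => (hg.e k).not.2 (by rcases hk with rfl | rfl <;> simp) h.1) (hs _) (hs _) hT
      have h3 : (fun F => P F ∨ F = t k) = W.Has R := by
        ext F
        constructor
        · grind
        · intro h
          by_cases h4 : ∃ j, F = t j
          · grind
          grind
      rw [h3] at h2
      omega
    have : 12 ≤ c6 (W.sub R (W.Has R)) := by
      rcases hx with hx | hx
      · exact hc i (.inl rfl) hx.1 fun j hj => (hg.t j hj).resolve_right (by
          rintro rfl; exact hx.2 hj)
      · exact hc (i - 1) (.inr rfl) hx.2 fun j hj => (hg.t j hj).resolve_left (by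
          rintro rfl; exact hx.1 hj)
    omega
  · have hcard : (leaves R (W.sub R (W.Has R))).card ≤ 1 := by
      have hns : ∀ x, x ∈ leaves R (W.sub R (W.Has R)) → x.1 ≠ s i := by
        rintro ⟨v, a, b⟩ h1 rfl
        grind
      by_cases h1 : x₁ ∈ leaves R (W.sub R (W.Has R))
      · refine (card_le_card (t := {x₁}) ?_).trans (card_singleton _).le
        intro x hx
        rw [mem_singleton]
        rcases hloc x hx with h | h | h
        exacts [h, (hnot h1 (h ▸ hx)).elim, absurd h (hns x hx)]
      · refine (card_le_card (t := {x₂}) ?_).trans (card_singleton _).le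
        intro x hx
        rw [mem_singleton]
        rcases hloc x hx with h | h | h
        exacts [(h1 (h ▸ hx)).elim, h, absurd h (hns x hx)]
    have := hg.six_le hR (P := W.Has R) (fun _ h => h) fun _ _ h => h
    omega

/-- What is known about a long ring. -/
structure RingHole (W : Fan d) (R : Finset (KV d × KV d × KV d)) (i : ZMod d) : Prop where
  e : ∀ j, j ≠ i → W.Has R (Fc.e j)
  p : ∀ j, j ≠ i → j ≠ i + 1 → ∀ m < W.g j, W.Has R (Fc.p j m)
  t : ∀ j, W.Has R (Fc.t j) → j = i
  run : ∀ q, q = i ∨ q = i + 1 → ∀ m₀ m m₁, m₀ < m → m < m₁ → m₁ < W.g q → W.Has R (Fc.p q m) →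
    W.Has R (Fc.p q m₀) ∨ W.Has R (Fc.p q m₁)
  corner : ¬ W.Has R (Fc.e i) → ∀ m₀ < W.g i, ∀ m₁ < W.g (i + 1), ¬ W.Has R (Fc.p i m₀) →
    ¬ W.Has R (Fc.p (i + 1) m₁) → (∀ m, m₀ < m → ¬ W.Has R (Fc.p i m)) ∧
      ∀ m < m₁, ¬ W.Has R (Fc.p (i + 1) m)
  bridge : W.Has R (Fc.e i) ∨ W.Has R (Fc.t i) ∨
    (W.Has R (Fc.p i (W.g i - 1)) ∧ W.Has R (Fc.p (i + 1) 0))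

theorem Disc.ringHole (H : Disc W γ R z₀ z₁) [NeZero d]
    (hnt : ∀ i, ¬ Comp W R F₀ (t i)) (hF₀ : W.Has R F₀)
    (hz : ∀ z, z = z₀ ∨ z = z₁ → ∃ a b, W.At F₀ z a b) (hl : LongRing W R F₀ i) :
    RingHole W R i := by
  have hR := H.sys
  obtain ⟨c0, c1, c2⟩ := col_near W i
  have hY0 : Comp W R F₀ F₀ := ⟨hF₀, Relation.ReflTransGen.refl⟩
  have n1 : i + 1 ≠ i := W.ne_of_sub 1
  have he1 := hl.e (i + 1) n1
  have hin : ∀ q m a b F, W.Has R F → W.At F (r q m) a b → 0 < m ∧ m < W.g q ∧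
      ((F = p q m ∧ a = W.rho q (m + 1) ∧ b = s q) ∨
        (F = p q (m - 1) ∧ a = s q ∧ b = W.rho q (m - 1))) := fun q m a b F hF h =>
    W.at_rim hF.1 h
  refine ⟨fun j hj => (hl.e j hj).has, fun j h1 h2 m hm => (hl.p j h1 h2 m hm).has, fun j hj => ?_,
    ?_, ?_, hl.bridge⟩
  · by_contra hn
    exact hnt j ((hl.e j hn).adj hj (.inr (Nb.te j)))
  · intro q hq m₀ m m₁ h1 h2 h3 hm
    by_contra hn
    push Not at hn
    have hz' : ∀ z, z = z₀ ∨ z = z₁ → ¬ ∃ m', m₀ < m' ∧ m' ≤ m₁ ∧ z = r q m' := by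
      rintro z hz1 ⟨m', g1, g2, rfl⟩
      obtain ⟨a, b, hat⟩ := hz _ hz1
      have hFm : ∃ n, m₀ < n ∧ n < m₁ ∧ F₀ = p q n := by grind
      obtain ⟨n, g3, g4, g5⟩ := hFm
      have := (ring_sep hnt (i - 1) (M := p q m₀) (G := p q m₁) (fun h => hn.1 h.has)
        (fun h => hn.2 h.has) (show m₀ < W.g q by omega) h3 hY0
        (by rw [g5]; exact .inr ⟨rfl, g3⟩) (by rw [g5]; exact .inr ⟨rfl, g4⟩) he1).2
      rcases this with h | ⟨h', h⟩
      · change (i + 1 - (i - 1)).val < (q - (i - 1)).val at h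
        grind
      · change W.g (i + 1) < m₁ at h
        rcases hq with rfl | rfl
        · change (q + 1 - (q - 1)).val = (q - (q - 1)).val at h'
          omega
        · omega
    obtain ⟨F, a, b, c, g1, g2, ⟨m', g3, g4, rfl⟩, g5, g6⟩ := H.gen
      (fun v => ∃ m', m₀ < m' ∧ m' ≤ m₁ ∧ v = r q m')
      ⟨r q m, by
        have := nodes_mem_verts hR (fun F h => h) hm
        have h4 : W.rho q m = r q m := W.rho_inner (by omega) (by omega)
        simp only [nodes] at this
        exact h4 ▸ verts_mono sub_subset this.2.1, m, h1, h2.le, rfl⟩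
      (hz' _ (.inl rfl)) (hz' _ (.inr rfl))
    rcases (hin _ _ _ _ _ g1 g2).2.2 with ⟨rfl, rfl, -⟩ | ⟨rfl, -, rfl⟩
    · have : m' ≠ m₁ := by rintro rfl; exact hn.2 g1
      exact g5 ⟨m' + 1, by omega, by omega, W.rho_inner (by omega) (by omega)⟩
    · have : m' - 1 ≠ m₀ := by rintro rfl; exact hn.1 g1
      exact g6 ⟨m' - 1, by omega, by omega, W.rho_inner (by omega) (by omega)⟩
  · intro he m₀ hm₀ m₁ hm₁ h1 h2
    by_contra hcon
    have hex : ∃ v ∈ verts R, (∃ m', m₀ < m' ∧ m' < W.g i ∧ v = r i m') ∨ v = h i ∨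
        (∃ m', 0 < m' ∧ m' ≤ m₁ ∧ v = r (i + 1) m') := by
      by_cases h3 : ∀ m, m₀ < m → ¬ W.Has R (p i m)
      · have h4 : ∃ m < m₁, W.Has R (p (i + 1) m) := by grind
        obtain ⟨m, h5, h6⟩ := h4
        have := verts_mono sub_subset (nodes_mem_verts hR (fun F h => h) h6).2.1
        simp only [nodes] at this
        refine ⟨_, this, ?_⟩
        rcases Nat.eq_zero_or_pos m with rfl | h7
        exacts [.inr (.inl (by rw [rho_zero, add_sub_cancel_right])),
          .inr (.inr ⟨m, h7, h5.le, W.rho_inner h7 (by omega)⟩)]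
      · push Not at h3
        obtain ⟨m, h5, h6⟩ := h3
        have := verts_mono sub_subset (nodes_mem_verts hR (fun F h => h) h6).2.1
        exact ⟨_, this, .inl ⟨m, h5, h6.1.2, W.rho_inner (by omega) h6.1.2⟩⟩
    have hz' : ∀ z, z = z₀ ∨ z = z₁ → ¬ ((∃ m', m₀ < m' ∧ m' < W.g i ∧ z = r i m') ∨ z = h i ∨
        (∃ m', 0 < m' ∧ m' ≤ m₁ ∧ z = r (i + 1) m')) := by
      intro z hz1 hz2
      obtain ⟨a, b, hat⟩ := hz _ hz1
      have hFm : (∃ n, m₀ < n ∧ F₀ = p i n) ∨ (∃ n, n < m₁ ∧ F₀ = p (i + 1) n) := by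
        rcases hz2 with ⟨m', g1, g2, rfl⟩ | rfl | ⟨m', g1, g2, rfl⟩
        · rcases (hin _ _ _ _ _ hF₀ hat).2.2 with ⟨h, -⟩ | ⟨h, -⟩
          · exact .inl ⟨_, g1, h⟩
          · refine .inl ⟨m' - 1, lt_of_le_of_ne (by omega) ?_, h⟩
            grind
        · rcases (W.at_hat hF₀.1).1 hat with ⟨h, -⟩ | ⟨h, -⟩ | ⟨h, -⟩
          · refine .inr ⟨0, Nat.pos_of_ne_zero ?_, h⟩
            grind
          · exact absurd (h ▸ hF₀) he
          · refine .inl ⟨_, lt_of_le_of_ne (by omega) ?_, h⟩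
            grind
        · rcases (hin _ _ _ _ _ hF₀ hat).2.2 with ⟨h, -⟩ | ⟨h, -⟩
          · refine .inr ⟨_, lt_of_le_of_ne g2 ?_, h⟩
            grind
          grind
      have hb : Before W (i - 1) (p i m₀) F₀ ∧ Before W (i - 1) F₀ (p (i + 1) m₁) := by
        rcases hFm with ⟨n, g1, g2⟩ | ⟨n, g1, g2⟩ <;> rw [g2]
        · exact ⟨.inr ⟨rfl, g1⟩,
            .inl (show (i - (i - 1)).val < (i + 1 - (i - 1)).val by omega)⟩
        · exact ⟨.inl (show (i - (i - 1)).val < (i + 1 - (i - 1)).val by omega),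
            .inr ⟨rfl, g1⟩⟩
      have := (ring_sep hnt (i - 1) (M := p i m₀) (G := p (i + 1) m₁) (fun h => h1 h.has)
        (fun h => h2 h.has) hm₀ hm₁ hY0 hb.1 hb.2 he1).2
      rcases this with h | ⟨-, h⟩
      · exact lt_irrefl _ h
      · change W.g (i + 1) < m₁ at h
        omega
    obtain ⟨F, a, b, c, g1, g2, g3, g5, g6⟩ := H.gen _ hex (hz' _ (.inl rfl)) (hz' _ (.inr rfl))
    rcases g3 with ⟨m', g3, g4, rfl⟩ | rfl | ⟨m', g3, g4, rfl⟩
    · rcases (hin _ _ _ _ _ g1 g2).2.2 with ⟨rfl, rfl, -⟩ | ⟨rfl, -, rfl⟩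
      · refine g5 ?_
        by_cases h3 : m' + 1 = W.g i
        exacts [.inr (.inl (by rw [h3, rho_g])),
          .inl ⟨m' + 1, by omega, by omega, W.rho_inner (by omega) (by omega)⟩]
      · have : m' - 1 ≠ m₀ := by rintro rfl; exact h1 g1
        exact g6 (.inl ⟨m' - 1, by omega, by omega, W.rho_inner (by omega) (by omega)⟩)
    · rcases (W.at_hat g1.1).1 g2 with ⟨rfl, rfl, -⟩ | ⟨rfl, -⟩ | ⟨rfl, -, rfl⟩
      · have : m₁ ≠ 0 := by rintro rfl; exact h2 g1
        exact g5 (.inr (.inr ⟨1, by omega, by omega, W.rho_inner (by omega) (by omega)⟩))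
      · exact he g1
      · have : m₀ ≠ W.g i - 1 := by rintro rfl; exact h1 g1
        exact g6 (.inl ⟨W.g i - 1, by omega, by omega, W.rho_inner (by omega) (by omega)⟩)
    · rcases (hin _ _ _ _ _ g1 g2).2.2 with ⟨rfl, rfl, -⟩ | ⟨rfl, -, rfl⟩
      · have : m' ≠ m₁ := by rintro rfl; exact h2 g1
        exact g5 (.inr (.inr ⟨m' + 1, by omega, by omega, W.rho_inner (by omega) (by omega)⟩))
      · refine g6 ?_
        by_cases h3 : m' = 1
        · subst h3
          exact .inr (.inl (by simp))
        · exact .inr (.inr ⟨m' - 1, by omega, by omega, W.rho_inner (by omega) (by omega)⟩)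

theorem RingHole.six_le [NeZero d] (hR : Sys R) (hg : RingHole W R i) (hP : ∀ F, P F → W.Has R F)
    (hPT : ∀ F, (∀ j, F ≠ Fc.t j) → W.Has R F → P F)
    (hb : W.Has R (Fc.e i) ∨ P (Fc.t i) ∨
      (W.Has R (Fc.p i (W.g i - 1)) ∧ W.Has R (Fc.p (i + 1) 0))) :
    6 ≤ c6 (W.sub R P) := by
  have n1 : i + 2 ≠ i := W.ne_of_sub 2
  have n2 : i + 2 ≠ i - 1 := W.ne_of_sub 3
  have n3 : i + 3 ≠ i := W.ne_of_sub 3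
  have n4 : i + 3 ≠ i - 1 := W.ne_of_sub 4
  have n5 : i + 3 ≠ i + 1 := W.ne_of_sub 2
  have n6 : i - 1 ≠ i := (W.ne_of_sub 1).symm
  have hE : ∀ j, W.Has R (Fc.e j) → P (Fc.e j) := fun j h => hPT _ (by simp) h
  refine six_le_c6_of_ring hR hP (i := i) (fun j h1 _ => hE j (hg.e j h1))
    (fun h => n1 (hg.t _ (hP _ h))) ?_
  have h1 : Relation.ReflTransGen (fun x y => Edge (W.sub R P) x y ∧
      (x ≠ s (i + 3) ∧ x ≠ h (i + 2)) ∧ (y ≠ s (i + 3) ∧ y ≠ h (i + 2))) (s (i + 1)) (s i) := by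
    rcases hb with h | h | ⟨h, h'⟩
    · exact Relation.ReflTransGen.single ⟨(At.edges hR hP (hE _ h) (at_self _)).2.2,
        by simp [n5.symm], by simp [n3.symm]⟩
    · exact Relation.ReflTransGen.single ⟨(At.edges hR hP h (at_self _)).2.1.symm,
        by simp [n5.symm], by simp [n3.symm]⟩
    · have e1 := (At.edges hR hP (hPT _ (by simp) h') (at_self _)).1
      have e2 := (At.edges hR hP (hPT _ (by simp) h) (at_self _)).2.2
      simp only [nodes, rho_zero, add_sub_cancel_right] at e1 e2
      rw [Nat.sub_add_cancel (W.pos _), rho_g] at e2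
      exact (Relation.ReflTransGen.single (b := KV.h i)
        ⟨e1, by simp [n5.symm], by simp [n1.symm]⟩).tail
        ⟨e2, by simp [n1.symm], by simp [n3.symm]⟩
  rintro j (rfl | rfl)
  · exact h1
  · have e3 := (At.edges hR hP (hE _ (hg.e _ n6)) (at_self _)).2.2
    simp only [nodes, sub_add_cancel] at e3
    grind

/-- Two leaves at a vertex with two last neighbours. -/
theorem Disc.card_out_two (H : Disc W γ R z₀ z₁) (hD : D ⊆ R)
    (hr : RotClosed D) {p : KV d} (hl : (p, a, b) ∈ leaves R D)
    (hl' : (p, a', b') ∈ leaves R D)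
    (huniq : ∀ x, Dart D x p → ¬ Dart D p x → x = a ∨ x = a') :
    γ p ≤ ((verts D).filter fun b => Dart D p b).card + 2 := by
  obtain ⟨h1, h2, h3, h4⟩ := mem_leaves.1 hl
  obtain ⟨h1', h2', h3', h4'⟩ := mem_leaves.1 hl'
  have := H.link p (insert a (insert a' ((verts D).filter fun b => Dart D p b)))
    ⟨a, mem_insert_self _ _⟩ (by
    have hmem : ∀ x, Dart D p x →
        x ∈ insert a (insert a' ((verts D).filter fun b => Dart D p b)) := fun x hx =>
      mem_insert_of_mem (mem_insert_of_mem
        (mem_filter.2 ⟨(hr.edge_verts (.inl hx)).2, hx⟩))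
    intro x hx
    rcases mem_insert.1 hx with rfl | hx
    · exact ⟨b, hmem b h4, h1⟩
    rcases mem_insert.1 hx with rfl | hx
    · grind
    · obtain ⟨c, hc⟩ := (mem_filter.1 hx).2
      refine ⟨c, ?_, hD hc⟩
      by_cases hpc : Dart D p c
      · exact hmem c hpc
      · rcases huniq c ⟨x, hr _ _ _ (hr _ _ _ hc)⟩ hpc with rfl | rfl
        exacts [mem_insert_self _ _, mem_insert_of_mem (mem_insert_self _ _)])
  grind

theorem Disc.no_leaf_of_card (H : Disc W γ R z₀ z₁) (hD : D ⊆ R)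
    (hr : RotClosed D) {p : KV d} (S : Finset (KV d)) (hS : ∀ x, Dart D p x → x ∈ S)
    (hc : S.card + 1 < γ p) {w : KV d} (huniq : ∀ x, Dart D x p → ¬ Dart D p x → x = w) :
      (p, a, b) ∉ leaves R D := by
  intro hl
  obtain ⟨h1, h2, h3, h4⟩ := mem_leaves.1 hl
  have ha : ¬ Dart D p a := by
    rintro ⟨c, hc⟩
    rw [H.sys.func _ _ _ _ h1 (hD hc)] at h2
    exact h2 hc
  have := H.card_out hD hr hl fun x h5 h6 => (huniq x h5 h6).trans (huniq a h3 ha).symm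
  have h5 : ((verts D).filter fun b => Dart D p b).card ≤ S.card :=
    card_le_card fun x hx => hS x (mem_filter.1 hx).2
  omega

theorem dart_union_tri {p : KV d} :
    Dart (D ∪ tri p a b) x y ↔ Dart D x y ∨ (x = p ∧ y = a) ∨ (x = a ∧ y = b) ∨
      (x = b ∧ y = p) := by
  constructor
  · rintro ⟨c, hc⟩
    rcases mem_union.1 hc with h | h
    · exact .inl ⟨c, h⟩
    · rcases mem_tri.1 h with h | h | h <;> cases h <;> simp
  · rintro (⟨c, h⟩ | ⟨rfl, rfl⟩ | ⟨rfl, rfl⟩ | ⟨rfl, rfl⟩)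
    exacts [⟨c, mem_union_left _ h⟩, ⟨b, mem_union_right _ (mem_tri.2 (.inl rfl))⟩,
      ⟨p, mem_union_right _ (mem_tri.2 (.inr (.inl rfl)))⟩,
      ⟨a, mem_union_right _ (mem_tri.2 (.inr (.inr rfl)))⟩]

theorem rho_succ_ne (q : ZMod d) (hm : 0 < m) (hu : u < W.g q) :
    W.rho (q + 1) m ≠ W.rho q u := by
  have h1 : q + 1 ≠ q - 1 := W.ne_of_sub 2
  have h2 : q + 1 ≠ q := W.ne_of_sub 1
  unfold rho
  grind

/-- A leaf over the rim of a spoke can be filled. -/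
theorem Disc.outer_leaf (H : Disc W γ R z₀ z₁) (hP : Closed W R P)
    (hv : verts (W.sub R P) = verts R) {q : ZMod d} (hun : u < n) (hn : n ≤ W.g q)
    (hu : P (W.Φ q u)) (hn' : P (W.Φ q (n + 1))) (h1 : ¬ P (p q u)) (h2 : ¬ P (p q (n - 1)))
    (hl : (s q, W.rho q u, W.rho q n) ∈ leaves R (W.sub R P)) :
    c6 (W.sub R P) + 3 ≤ 3 * (leaves R (W.sub R P)).card := by
  have hR := H.sys
  have hrc := rotClosed_sub hR hP.has
  have hug : u < W.g q := by omega
  have hsub : W.sub R P ∪ tri (s q) (W.rho q u) (W.rho q n) ⊆ R :=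
    union_subset sub_subset (hR.rot.tri_subset (mem_leaves.1 hl).1)
  have hrc' := hrc.union (rotClosed_tri (s q) (W.rho q u) (W.rho q n))
  have hne : W.rho q u ≠ W.rho q n := fun h => by
    have := W.rho_inj hug.le hn h
    omega
  refine card_leaves_insert hR H.c6_eq sub_subset hrc hv hl ?_ ?_
  · intro hd
    obtain ⟨F, c, hF, hat⟩ := (dart_out hR hP.has).1 hd
    rcases Nat.lt_or_ge n (W.g q) with h3 | h3
    · rw [W.rho_inner (by omega) h3] at hat
      rcases (W.at_rim (hP.has _ hF).1 hat).2.2 with ⟨-, h4, -⟩ | ⟨-, h4, -⟩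
      · have := W.rho_inj hug.le h3 h4
        omega
      · exact W.rho_ne_s _ _ _ h4
    · obtain rfl : n = W.g q := by omega
      rw [rho_g] at hat
      rcases (W.at_hat (hP.has _ hF).1).1 hat with ⟨-, h4, -⟩ | ⟨-, h4, -⟩ | ⟨-, h4, -⟩
      exacts [rho_succ_ne q (by omega) hug h4.symm, W.rho_ne_s _ _ _ h4, W.rho_ne_s _ _ _ h4]
  · rintro v x y (rfl | rfl)
    · rcases Nat.eq_zero_or_pos u with rfl | hu0
      · rw [Φ_zero] at hu
        have hat := fun F hF a b => W.at_hat (i := q - 1) (F := F) (a := a) (b := b) (hP.has F hF).1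
        simp only [sub_add_cancel] at hat
        rw [rho_zero] at hne ⊢
        have hγ := H.hat (q - 1)
        have hout : ∀ z, Dart (W.sub R P ∪ tri (s q) (h (q - 1)) (W.rho q n)) (h (q - 1)) z →
            z = W.rho q n ∨ z = s q ∨ (z = s (q - 1) ∧ P (p (q - 1) (W.g (q - 1) - 1))) := by
          intro z hz
          rcases dart_union_tri.1 hz with hz | ⟨h3, -⟩ | ⟨-, h3⟩ | ⟨h3, -⟩
          · obtain ⟨F, c, hF, h4⟩ := (dart_out hR hP.has).1 hz
            grind
          · simp at h3
          exacts [.inl h3, absurd h3 hne]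
        have hin : ∀ z, Dart (W.sub R P ∪ tri (s q) (h (q - 1)) (W.rho q n)) z (h (q - 1)) →
            z = s q ∨ z = s (q - 1) ∨ (z = W.rho (q - 1) (W.g (q - 1) - 1) ∧
              P (p (q - 1) (W.g (q - 1) - 1))) := by
          intro z hz
          rcases dart_union_tri.1 hz with hz | ⟨h3, -⟩ | ⟨-, h3⟩ | ⟨-, h3⟩
          · obtain ⟨F, c, hF, h4⟩ := (dart_in hR hP.has).1 hz
            grind
          · exact .inl h3
          · exact absurd h3 hne
          · simp at h3
        have hs : Dart (W.sub R P ∪ tri (s q) (h (q - 1)) (W.rho q n)) (h (q - 1)) (s q) :=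
          dart_union_tri.2 (.inl ((dart_out hR hP.has).2 ⟨_, _, hu, (hat _ hu _ _).2
            (.inr (.inl ⟨rfl, rfl, rfl⟩))⟩))
        rw [rho_zero] at hsub hrc'
        refine H.no_leaf_of_card hsub hrc' {W.rho q n, s q, s (q - 1)} ?_ ?_
          (w := if P (p (q - 1) (W.g (q - 1) - 1)) then W.rho (q - 1) (W.g (q - 1) - 1)
            else s (q - 1)) ?_
        · grind
        · grind
        · intro z hz hz'
          rcases hin z hz with rfl | rfl | ⟨rfl, h3⟩
          · exact absurd hs hz'
          · split_ifs with h3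
            · exact absurd (dart_union_tri.2 (.inl ((dart_out hR hP.has).2 ⟨_, _, h3,
                (hat _ h3 _ _).2 (.inr (.inr ⟨rfl, rfl, rfl⟩))⟩))) hz'
            · rfl
          · rw [if_pos h3]
      · have hr : W.rho q u = r q u := W.rho_inner hu0 hug
        have hγ := H.rim q u
        rw [hr] at hne ⊢
        rw [hr] at hsub hrc'
        have hat := fun F hF a b (h : W.At F (r q u) a b) => (W.at_rim (hP.has F hF).1 h).2.2
        refine H.no_leaf_of_card hsub hrc' {W.rho q n, s q} ?_ ?_ (w := W.rho q (u - 1)) ?_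
        · intro z hz
          simp only [mem_insert, mem_singleton]
          rcases dart_union_tri.1 hz with hz | ⟨h3, -⟩ | ⟨-, h3⟩ | ⟨h3, -⟩
          · obtain ⟨F, c, hF, h4⟩ := (dart_out hR hP.has).1 hz
            rcases hat F hF _ _ h4 with ⟨rfl, -⟩ | ⟨-, h5, -⟩
            exacts [absurd hF h1, .inr h5]
          · simp at h3
          exacts [.inl h3, absurd h3 hne]
        · grind
        · intro z hz hz'
          rcases dart_union_tri.1 hz with hz | ⟨h3, -⟩ | ⟨-, h3⟩ | ⟨-, h3⟩
          · obtain ⟨F, c, hF, h4⟩ := (dart_in hR hP.has).1 hz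
            rcases hat F hF _ _ h4 with ⟨rfl, -⟩ | ⟨-, -, h5⟩
            exacts [absurd hF h1, h5]
          · refine absurd (dart_union_tri.2 (.inl ?_)) hz'
            rw [h3, ← hr]
            have h6 : P (p q (u - 1)) := by
              rw [← W.Φ_succ (show u - 1 < W.g q by omega), show u - 1 + 1 = u by omega]
              exact hu
            refine (dart_out hR hP.has).2 ⟨_, W.rho q (u - 1), h6, .inr (.inl ?_)⟩
            simp only [nodes]
            grind
          · exact absurd h3 hne
          · simp at h3
    · rcases Nat.lt_or_ge n (W.g q) with hng | hng
      · have hr : W.rho q n = r q n := W.rho_inner (by omega) hng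
        have hγ := H.rim q n
        rw [hr] at hne ⊢
        rw [hr] at hsub hrc'
        have hat := fun F hF a b (h : W.At F (r q n) a b) => (W.at_rim (hP.has F hF).1 h).2.2
        refine H.no_leaf_of_card hsub hrc' {W.rho q (n + 1), s q} ?_ ?_ (w := W.rho q u) ?_
        · intro z hz
          simp only [mem_insert, mem_singleton]
          rcases dart_union_tri.1 hz with hz | ⟨h3, -⟩ | ⟨h3, -⟩ | ⟨-, h3⟩
          · obtain ⟨F, c, hF, h4⟩ := (dart_out hR hP.has).1 hz
            rcases hat F hF _ _ h4 with ⟨-, h5, -⟩ | ⟨rfl, -⟩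
            exacts [.inl h5, absurd hF h2]
          · simp at h3
          exacts [absurd h3.symm hne, .inr h3]
        · grind
        · intro z hz hz'
          rcases dart_union_tri.1 hz with hz | ⟨-, h3⟩ | ⟨h3, -⟩ | ⟨-, h3⟩
          · obtain ⟨F, c, hF, h4⟩ := (dart_in hR hP.has).1 hz
            rcases hat F hF _ _ h4 with ⟨-, -, h5⟩ | ⟨rfl, -⟩
            · rw [h5] at hz'
              exact absurd (dart_union_tri.2 (.inr (.inr (.inr ⟨rfl, rfl⟩)))) hz'
            · exact absurd hF h2
          · exact absurd h3.symm hne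
          · exact h3
          · simp at h3
      · obtain rfl : n = W.g q := by omega
        rw [Φ_g1] at hn'
        have hγ := H.hat q
        have hat := fun F hF a b => W.at_hat (i := q) (F := F) (a := a) (b := b) (hP.has F hF).1
        rw [rho_g] at hne ⊢
        rw [rho_g] at hsub hrc'
        refine H.no_leaf_of_card hsub hrc' {W.rho (q + 1) 1, s (q + 1), s q} ?_ ?_
          (w := W.rho q u) ?_
        · intro z hz
          simp only [mem_insert, mem_singleton]
          rcases dart_union_tri.1 hz with hz | ⟨h3, -⟩ | ⟨h3, -⟩ | ⟨-, h3⟩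
          · obtain ⟨F, c, hF, h4⟩ := (dart_out hR hP.has).1 hz
            rcases (hat F hF _ _).1 h4 with ⟨-, h5, -⟩ | ⟨-, h5, -⟩ | ⟨rfl, -⟩
            exacts [.inl h5, .inr (.inl h5), absurd hF h2]
          · simp at h3
          exacts [absurd h3.symm hne, .inr (.inr h3)]
        · have := card_le_three (a := W.rho (q + 1) 1) (b := s (q + 1)) (c := s q)
          omega
        · intro z hz hz'
          rcases dart_union_tri.1 hz with hz | ⟨-, h3⟩ | ⟨h3, -⟩ | ⟨-, h3⟩
          · obtain ⟨F, c, hF, h4⟩ := (dart_in hR hP.has).1 hz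
            rcases (hat F hF _ _).1 h4 with ⟨-, -, h5⟩ | ⟨-, -, h5⟩ | ⟨rfl, -⟩
            · rw [h5] at hz'
              exact absurd
                (dart_union_tri.2 (.inl ((dart_out hR hP.has).2 ⟨_, _, hn', (hat _ hn' _ _).2
                (.inr (.inl ⟨rfl, rfl, rfl⟩))⟩))) hz'
            · rw [h5] at hz'
              exact absurd (dart_union_tri.2 (.inr (.inr (.inr ⟨rfl, rfl⟩)))) hz'
            · exact absurd hF h2
          · exact absurd h3.symm hne
          · exact h3
          · simp at h3

/-! #### Ends and starts of runs -/

theorem pattern_full (hall : ∀ a, 0 < a → a ≤ g → A a)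
    (a0 : A 0 ∨ A (g + 1)) (a2 : A (g + 2) → A 0) (a3 : A (g + 3) → A (g + 1))
    (hu : u < g + 4) (hv : v < g + 4)
    (h1 : A u) (h2 : A v) (h3 : (u < g + 3 ∧ ¬ A (u + 1)) ∨ (u = g + 3 ∧ ¬ A 0))
    (h4 : (0 < v ∧ ¬ A (v - 1)) ∨ (v = 0 ∧ ¬ A (g + 3))) (h5 : v ≠ u + 2)
    (h6 : ¬ (u = g + 2 ∧ v = 0)) (h7 : ¬ (u = g + 3 ∧ v = 1)) (hq : q < g + 4) (h8 : ¬ A q)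
    (h9 : (v ≤ q ∧ q < u) ∨ (u < v ∧ (v ≤ q ∨ q < u))) : False := by
  have e1 : u ≤ g → u = g ∨ u = 0 ∧ g = 0 := fun h => by grind
  have e2 : v ≤ g + 1 → v ≤ 1 := fun h => by grind
  have c1 : u = 0 ∨ u = g ∨ u = g + 1 ∨ u = g + 2 ∨ u = g + 3 := by omega
  grind

theorem pattern_closed_right (hg : 0 < g) (a0 : A 0) (a1 : A (g + 1))
    (a2 : ¬ A (g + 2)) (hrun : ∀ a b c, 0 < a → a < b → b < c → c ≤ g → A b → A a ∨ A c)
    (hu : u < g + 4) (hv : v < g + 4)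
    (h1 : A u) (h2 : A v) (h3 : (u < g + 3 ∧ ¬ A (u + 1)) ∨ (u = g + 3 ∧ ¬ A 0))
    (h4 : (0 < v ∧ ¬ A (v - 1)) ∨ (v = 0 ∧ ¬ A (g + 3))) (h5 : v = u + 2 → u < g)
    (h6 : ¬ (u = g + 2 ∧ v = 0)) (h7 : ¬ (u = g + 3 ∧ v = 1)) (hq : q < g + 4) (h8 : ¬ A q)
    (h9 : (v ≤ q ∧ q < u) ∨ (u < v ∧ (v ≤ q ∨ q < u))) :
    (u < g ∧ u + 1 < v ∧ v ≤ g + 1 ∧ ¬ A (u + 1) ∧ ¬ A (v - 1)) ∨ (u = g + 1 ∧ v = 0) := by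
  have hu0 : u ≠ g + 3 := by rintro rfl; grind
  have hv0 : v ≠ g + 3 := by rintro rfl; grind
  have ug : u ≠ g := by rintro rfl; grind
  have vg : v ≠ g + 2 := by rintro rfl; grind
  by_cases hvu : v ≤ u
  · have : v ≤ q ∧ q < u := by omega
    have : v < q := by grind
    have : v = 0 ∨ ¬ A (v - 1) := by grind
    have := hrun (v - 1) v q
    have := hrun q u (u + 1)
    grind
  · have := hrun (v - 1) v q
    have := hrun q u (u + 1)
    grind

theorem pattern_closed_left (hg : 0 < g) (a0 : A 0) (a1 : A (g + 1))
    (a2 : ¬ A (g + 3)) (hrun : ∀ a b c, 0 < a → a < b → b < c → c ≤ g → A b → A a ∨ A c)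
    (hu : u < g + 4) (hv : v < g + 4)
    (h1 : A u) (h2 : A v) (h3 : (u < g + 3 ∧ ¬ A (u + 1)) ∨ (u = g + 3 ∧ ¬ A 0))
    (h4 : (0 < v ∧ ¬ A (v - 1)) ∨ (v = 0 ∧ ¬ A (g + 3))) (h5 : v = u + 2 → u < g)
    (h6 : ¬ (u = g + 2 ∧ v = 0)) (h7 : ¬ (u = g + 3 ∧ v = 1)) (hq : q < g + 4) (h8 : ¬ A q)
    (h9 : (v ≤ q ∧ q < u) ∨ (u < v ∧ (v ≤ q ∨ q < u))) :
    (u < g ∧ u + 1 < v ∧ v ≤ g + 1 ∧ ¬ A (u + 1) ∧ ¬ A (v - 1)) ∨ (u = g + 1 ∧ v = 0) := by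
  have hu0 : u ≠ g + 3 := by rintro rfl; grind
  have hv0 : v ≠ g + 3 := by rintro rfl; grind
  have ug : u ≠ g := by rintro rfl; grind
  by_cases hvu : v ≤ u
  · have : v ≤ q ∧ q < u := by omega
    have : v < q := by grind
    have : v = 0 ∨ ¬ A (v - 1) := by grind
    have := hrun (v - 1) v q
    have := hrun q u (u + 1)
    grind
  · have := hrun (v - 1) v q
    have := hrun q u (u + 1)
    grind

theorem pattern_prefix (hg : 0 < g) (a0 : A 0) (a1 : ¬ A (g + 1))
    (a2 : A (g + 2)) (a3 : ¬ A (g + 3)) (hrun : ∀ a b, 0 < a → a < b → b ≤ g → A b → A a)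
    (hu : u < g + 4) (hv : v < g + 4)
    (h1 : A u) (h2 : A v) (h3 : (u < g + 3 ∧ ¬ A (u + 1)) ∨ (u = g + 3 ∧ ¬ A 0))
    (h4 : (0 < v ∧ ¬ A (v - 1)) ∨ (v = 0 ∧ ¬ A (g + 3))) (h5 : v = u + 2 → u < g)
    (h6 : ¬ (u = g + 2 ∧ v = 0)) (h7 : ¬ (u = g + 3 ∧ v = 1)) (hq : q < g + 4) (h8 : ¬ A q)
    (h9 : (v ≤ q ∧ q < u) ∨ (u < v ∧ (v ≤ q ∨ q < u))) :
    u < g ∧ v = g + 2 := by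
  have hu0 : u ≠ g + 3 := by rintro rfl; grind
  have hv0 : v ≠ g + 3 := by rintro rfl; grind
  grind

theorem pattern_suffix (hg : 0 < g) (a0 : ¬ A 0) (a1 : A (g + 1))
    (a2 : ¬ A (g + 2)) (a3 : A (g + 3)) (hrun : ∀ a b, a < b → b ≤ g → A a → A b)
    (hu : u < g + 4) (hv : v < g + 4)
    (h1 : A u) (h2 : A v) (h3 : (u < g + 3 ∧ ¬ A (u + 1)) ∨ (u = g + 3 ∧ ¬ A 0))
    (h4 : (0 < v ∧ ¬ A (v - 1)) ∨ (v = 0 ∧ ¬ A (g + 3))) (h5 : v = u + 2 → u < g)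
    (h6 : ¬ (u = g + 2 ∧ v = 0)) (h7 : ¬ (u = g + 3 ∧ v = 1)) (hq : q < g + 4) (h8 : ¬ A q)
    (h9 : (v ≤ q ∧ q < u) ∨ (u < v ∧ (v ≤ q ∨ q < u))) :
    u = g + 3 ∧ 1 < v ∧ v ≤ g + 1 := by
  have hu0 : u ≠ g + 2 := by rintro rfl; grind
  have hv0 : v ≠ g + 2 := by rintro rfl; grind
  grind

theorem pattern_open_left (hg : 0 < g) (a0 : A 0) (ag : A g)
    (a1 : ¬ A (g + 1)) (a3 : ¬ A (g + 3))
    (hrun : ∀ a b c, 0 < a → a < b → b < c → c ≤ g → A b → A a ∨ A c)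
    (hu : u < g + 4) (hv : v < g + 4)
    (h1 : A u) (h2 : A v) (h3 : (u < g + 3 ∧ ¬ A (u + 1)) ∨ (u = g + 3 ∧ ¬ A 0))
    (h4 : (0 < v ∧ ¬ A (v - 1)) ∨ (v = 0 ∧ ¬ A (g + 3))) (h5 : v = u + 2 → u < g)
    (h6 : ¬ (u = g + 2 ∧ v = 0)) (h7 : ¬ (u = g + 3 ∧ v = 1)) (hq : q < g + 4) (h8 : ¬ A q)
    (h9 : (v ≤ q ∧ q < u) ∨ (u < v ∧ (v ≤ q ∨ q < u))) :
    (u < g ∧ ¬ A (u + 1) ∧ (¬ A (g + 2) → u + 1 < v ∧ v ≤ g ∧ ¬ A (v - 1))) ∨ (u = g ∧ v = 0) ∨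
      (u = g + 2 ∧ A (g + 2)) := by
  have hu0 : u ≠ g + 3 := by rintro rfl; grind
  have hv0 : v ≠ g + 3 := by rintro rfl; grind
  have hv1 : v ≠ g + 1 := by rintro rfl; grind
  have hu1 : u ≠ g + 1 := by rintro rfl; grind
  by_cases hvu : v ≤ u
  · have := hrun (v - 1) v q
    have := hrun q u (u + 1)
    grind
  · have := hrun (v - 1) v q
    have := hrun q u (u + 1)
    grind

theorem pattern_open_right (hg : 0 < g) (a0 : ¬ A 0) (ag : A 1)
    (a1 : A (g + 1)) (a2 : ¬ A (g + 2))
    (hrun : ∀ a b c, 0 < a → a < b → b < c → c ≤ g → A b → A a ∨ A c)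
    (hu : u < g + 4) (hv : v < g + 4)
    (h1 : A u) (h2 : A v) (h3 : (u < g + 3 ∧ ¬ A (u + 1)) ∨ (u = g + 3 ∧ ¬ A 0))
    (h4 : (0 < v ∧ ¬ A (v - 1)) ∨ (v = 0 ∧ ¬ A (g + 3))) (h5 : v = u + 2 → u < g)
    (h6 : ¬ (u = g + 2 ∧ v = 0)) (h7 : ¬ (u = g + 3 ∧ v = 1)) (hq : q < g + 4) (h8 : ¬ A q)
    (h9 : (v ≤ q ∧ q < u) ∨ (u < v ∧ (v ≤ q ∨ q < u))) :
    (u < g ∧ ¬ A (u + 1) ∧ (¬ A (g + 3) → u + 1 < v ∧ v ≤ g + 1 ∧ ¬ A (v - 1))) ∨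
      (u = g + 1 ∧ v = 1) ∨ (u = g + 3 ∧ A (g + 3)) := by
  have hu0 : u ≠ g + 2 := by rintro rfl; grind
  have hv0 : v ≠ g + 2 := by rintro rfl; grind
  have hv1 : v ≠ 0 := by rintro rfl; grind
  have hu1 : u ≠ g := by rintro rfl; grind
  by_cases hvu : v ≤ u
  · have := hrun (v - 1) v q
    have := hrun q u (u + 1)
    grind
  · have := hrun (v - 1) v q
    have := hrun q u (u + 1)
    grind

theorem Disc.leaf_pattern' (H : Disc W γ R z₀ z₁)
    (hl : (s i, a, b) ∈ leaves R (W.sub R (W.Has R))) :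
    ∃ j k, j < W.g i + 4 ∧ k < W.g i + 4 ∧ W.Has R (W.Φ i j) ∧ W.Has R (W.Φ i k) ∧
      ((j < W.g i + 3 ∧ ¬ W.Has R (W.Φ i (j + 1))) ∨ (j = W.g i + 3 ∧ ¬ W.Has R (W.Φ i 0))) ∧
      ((0 < k ∧ ¬ W.Has R (W.Φ i (k - 1))) ∨ (k = 0 ∧ ¬ W.Has R (W.Φ i (W.g i + 3)))) ∧
      a = W.X i (j + 1) ∧ b = W.X i k ∧ (k = j + 2 → j < W.g i ∧ ¬ W.fan i) ∧
      ¬ (j = W.g i + 2 ∧ k = 0) ∧ ¬ (j = W.g i + 3 ∧ k = 1) ∧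
      ∃ q < W.g i + 4, ¬ W.Has R (W.Φ i q) ∧ ((k ≤ q ∧ q < j) ∨ (j < k ∧ (k ≤ q ∨ q < j))) :=
  H.leaf_pattern closed_has hl (A := fun q => W.Has R (W.Φ i q)) fun _ _ => Iff.rfl

theorem Disc.no_leaf_full (H : Disc W γ R z₀ z₁)
    (hp : ∀ m < W.g j, W.Has R (p j m)) (h0 : W.Has R (e (j - 1)) ∨ W.Has R (e j))
    (h2 : W.Has R (t j) → W.Has R (e (j - 1))) (h3 : W.Has R (t (j - 1)) → W.Has R (e j)) :
      (s j, a, b) ∉ leaves R (W.sub R (W.Has R)) := by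
  intro hl
  have hf := (hp 0 (W.pos j)).1.1
  obtain ⟨u, v, hu, hv, g1, g2, g3, g4, -, -, g5, g6, g7, q, hq, g8, g9⟩ := H.leaf_pattern' hl
  refine pattern_full (A := fun q => W.Has R (W.Φ j q)) (fun a ha ha' => ?_) ?_ ?_ ?_ hu hv g1 g2 g3
    g4
    (fun h => (g5 h).2 hf) g6 g7 hq g8 g9
  · have := W.Φ_succ (i := j) (m := a - 1) (by omega)
    grind
  · simpa using h0
  · simpa using h2
  · simpa using h3

/-- The faces of the fan at a spoke cannot come and go. -/
theorem run_Φ (hrun : ∀ m₀ m m₁, m₀ < m → m < m₁ → m₁ < W.g j → W.Has R (p j m) →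
    W.Has R (p j m₀) ∨ W.Has R (p j m₁)) (a b c : ℕ) (h0 : 0 < a) (h1 : a < b) (h2 : b < c)
    (h3 : c ≤ W.g j) (h : W.Has R (W.Φ j b)) : W.Has R (W.Φ j a) ∨ W.Has R (W.Φ j c) := by
  obtain ⟨a, rfl⟩ := Nat.exists_eq_succ_of_ne_zero h0.ne'
  obtain ⟨b, rfl⟩ := Nat.exists_eq_succ_of_ne_zero (by omega : b ≠ 0)
  obtain ⟨c, rfl⟩ := Nat.exists_eq_succ_of_ne_zero (by omega : c ≠ 0)
  rw [Nat.succ_eq_add_one, W.Φ_succ (by omega)] at h ⊢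
  rw [Nat.succ_eq_add_one, W.Φ_succ (by omega)]
  grind

theorem leaf_eq_of_end (hR : Sys R) {p : KV d}
    (h : (p, a, b) ∈ leaves R D) (h' : (p, a, b') ∈ leaves R D) : b = b' :=
  hR.func _ _ _ _ (mem_leaves.1 h).1 (mem_leaves.1 h').1

theorem card_filter_le_of_missing (S : Finset ℕ) (hS : ∀ q ∈ S, q < n ∧ ¬ A q) :
    ((range n).filter A).card + S.card ≤ n := by
  have h1 := card_filter_add_card_filter_not (s := range n) A
  rw [card_range] at h1
  have h2 : S.card ≤ ((range n).filter fun q => ¬ A q).card :=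
    card_le_card fun q hq =>
      mem_filter.2 ⟨mem_range.2 (hS q hq).1, (hS q hq).2⟩
  omega

/-- Two leaves that start at the only two ends of runs at a spoke with three missing faces. -/
theorem Disc.not_two_leaves (H : Disc W γ R z₀ z₁) {u' : ℕ}
    (S : Finset ℕ) (hS : ∀ q ∈ S, q < W.g j + 4 ∧ ¬ W.Has R (W.Φ j q)) (hS3 : 3 ≤ S.card)
    (hends : ∀ v, EndPos W (W.Has R) j v → v = u ∨ v = u')
    (h : (s j, W.X j (u + 1), b) ∈ leaves R (W.sub R (W.Has R)))
    (h' : (s j, W.X j (u' + 1), b') ∈ leaves R (W.sub R (W.Has R))) : False := by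
  have h1 := H.card_out_two sub_subset (rotClosed_sub H.sys fun _ h => h) h h' (by
    intro x h5 h6
    obtain ⟨v, hv, rfl⟩ := inEnd_spoke H.sys (fun _ h => h) h5 h6
    rcases hends v hv with rfl | rfl
    exacts [.inl rfl, .inr rfl])
  have h2 := card_out_spoke H.sys (P := W.Has R) (fun _ h => h) j
  have h3 := card_filter_le_of_missing S hS
  have h4 := H.le_spoke j
  omega

theorem EndPos.lt_or (h : EndPos W P j v) :
    (v < W.g j + 3 ∧ ¬ P (W.Φ j (v + 1))) ∨ (v = W.g j + 3 ∧ ¬ P (W.Φ j 0)) := by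
  obtain ⟨h1, h2, h3⟩ := h
  unfold Fan.nx at h3
  grind

/-- A leaf over a spoke whose ring is closed on both sides. -/
theorem Disc.leaf_closed (H : Disc W γ R z₀ z₁)
    (hrun : ∀ m₀ m m₁, m₀ < m → m < m₁ → m₁ < W.g j → W.Has R (p j m) →
      W.Has R (p j m₀) ∨ W.Has R (p j m₁)) (h0 : W.Has R (e (j - 1))) (h1 : W.Has R (e j))
    (h23 : ¬ W.Has R (t j) ∨ ¬ W.Has R (t (j - 1)))
    (hl : (s j, a, b) ∈ leaves R (W.sub R (W.Has R))) :
    (∃ u v, u < W.g j ∧ u + 1 < v ∧ v ≤ W.g j + 1 ∧ ¬ W.Has R (W.Φ j (u + 1)) ∧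
      ¬ W.Has R (W.Φ j (v - 1)) ∧ W.Has R (W.Φ j u) ∧ W.Has R (W.Φ j v) ∧
      a = W.X j (u + 1) ∧ b = W.X j v) ∨
    (a = s (j + 1) ∧ b = s (j - 1) ∧ ¬ W.Has R (t j) ∧ ¬ W.Has R (t (j - 1))) := by
  have hpos := W.pos j
  obtain ⟨u, v, hu, hv, g1, g2, g3, g4, rfl, rfl, g5, g6, g7, q, hq, g8, g9⟩ := H.leaf_pattern' hl
  have hr := run_Φ hrun
  have a0 : W.Has R (W.Φ j 0) := by simpa using h0
  have a1 : W.Has R (W.Φ j (W.g j + 1)) := by simpa using h1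
  have key : (u < W.g j ∧ u + 1 < v ∧ v ≤ W.g j + 1 ∧ ¬ W.Has R (W.Φ j (u + 1)) ∧
      ¬ W.Has R (W.Φ j (v - 1))) ∨ (u = W.g j + 1 ∧ v = 0) := by
    rcases h23 with h | h
    · exact pattern_closed_right (A := fun q => W.Has R (W.Φ j q)) hpos a0 a1 (by simpa using h)
        hr hu hv g1 g2 g3 g4 (fun h => (g5 h).1) g6 g7 hq g8 g9
    · exact pattern_closed_left (A := fun q => W.Has R (W.Φ j q)) hpos a0 a1 (by simpa using h)
        hr hu hv g1 g2 g3 g4 (fun h => (g5 h).1) g6 g7 hq g8 g9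
  rcases key with h | ⟨rfl, rfl⟩
  · exact .inl ⟨u, v, h.1, h.2.1, h.2.2.1, h.2.2.2.1, h.2.2.2.2, g1, g2, rfl, rfl⟩
  simp_all

theorem Disc.leaf_closed_unique (H : Disc W γ R z₀ z₁)
    (hrun : ∀ m₀ m m₁, m₀ < m → m < m₁ → m₁ < W.g j → W.Has R (p j m) →
      W.Has R (p j m₀) ∨ W.Has R (p j m₁)) (h0 : W.Has R (e (j - 1))) (h1 : W.Has R (e j))
    (h23 : ¬ W.Has R (t j) ∨ ¬ W.Has R (t (j - 1)))
    (hl : (s j, a, b) ∈ leaves R (W.sub R (W.Has R)))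
    (hl' : (s j, a', b') ∈ leaves R (W.sub R (W.Has R))) : a = a' ∧ b = b' := by
  have hpos := W.pos j
  have hr := run_Φ hrun
  have huni : ∀ u u', u < u' → u' < W.g j → ¬ W.Has R (W.Φ j (u + 1)) → W.Has R (W.Φ j u') →
      ¬ W.Has R (W.Φ j (u' + 1)) → False := by grind
  have hmix : ∀ u b b', u < W.g j → W.Has R (W.Φ j u) → ¬ W.Has R (W.Φ j (u + 1)) →
      ¬ W.Has R (t j) → ¬ W.Has R (t (j - 1)) →
      (s j, W.X j (u + 1), b) ∈ leaves R (W.sub R (W.Has R)) →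
      (s j, s (j + 1), b') ∈ leaves R (W.sub R (W.Has R)) → False := by
    intro u b b' k1 k2 k3 k4 k5 k6 k7
    refine H.not_two_leaves (u := u) (u' := W.g j + 1) {u + 1, W.g j + 2, W.g j + 3} ?_ ?_ ?_ k6
      (by simpa using k7)
    · intro q hq
      simp only [mem_insert, mem_singleton] at hq
      rcases hq with rfl | rfl | rfl
      exacts [⟨by omega, k3⟩, ⟨by omega, by simpa using k4⟩, ⟨by omega, by simpa using k5⟩]
    · rw [card_eq_three.2 ⟨u + 1, W.g j + 2, W.g j + 3, by omega, by omega, by omega, rfl⟩]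
    · intro v hv
      have hv1 := hv.1
      have hv2 := hv.2.1
      rcases hv.lt_or with ⟨q1, q2⟩ | ⟨q1, q2⟩
      · have n1 : v ≠ W.g j := by rintro rfl; exact q2 (by simpa using h1)
        have n2 : v ≠ W.g j + 2 := by rintro rfl; exact k4 (by simpa using hv2)
        by_cases h5 : v = W.g j + 1
        · exact .inr h5
        · have : v < W.g j := by omega
          grind
      simp_all
  suffices ha : a = a' by
    subst ha
    exact ⟨rfl, leaf_eq_of_end H.sys hl hl'⟩
  rcases H.leaf_closed hrun h0 h1 h23 hl with ⟨u, v, k1, k2, k3, k4, k5, k6, k7, rfl, rfl⟩ |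
    ⟨rfl, rfl, k1, k2⟩ <;>
  rcases H.leaf_closed hrun h0 h1 h23 hl' with ⟨u', v', k1', k2', k3', k4', k5', k6', k7', rfl, rfl⟩
    | ⟨rfl, rfl, k1', k2'⟩
  · rcases lt_trichotomy u u' with h6 | h6 | h6
    · exact (huni u u' h6 k1' k4 k6' k4').elim
    · rw [h6]
    grind
  · grind
  · grind
  · rfl

/-- The places of the leaves of a long ring. -/
theorem Disc.ringHole_loc (H : Disc W γ R z₀ z₁) (hg : RingHole W R i) {v : KV d}
    (hl : (v, a, b) ∈ leaves R (W.sub R (W.Has R))) :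
    v = s i ∨ v = s (i + 1) ∨ (v = h i ∧ a = W.rho i (W.g i - 1) ∧ b = W.rho (i + 1) 1 ∧
      ¬ W.Has R (e i) ∧ W.Has R (p i (W.g i - 1)) ∧ W.Has R (p (i + 1) 0)) := by
  rcases v with _ | j | j | ⟨j, m⟩
  · refine absurd hl (H.no_leaf_hub closed_has fun a b h1 _ h3 _ => ?_)
    rw [hg.t a h1, hg.t b h3]
  · by_contra hn
    push Not at hn
    have hj1 : j ≠ i := fun h => hn.1 (h ▸ rfl)
    have hj2 : j ≠ i + 1 := fun h => hn.2.1 (h ▸ rfl)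
    have hj3 : j - 1 ≠ i := fun h => hj2 (sub_eq_iff_eq_add.1 h)
    exact H.no_leaf_full (hg.p j hj1 hj2) (.inr (hg.e j hj1)) (fun _ => hg.e _ hj3)
      (fun _ => hg.e _ hj1) hl
  · obtain ⟨h1, h2, h3, h4, h5⟩ := H.leaf_hat closed_has hl
    obtain rfl : j = i := by
      by_contra hn
      exact h1 (hg.e j hn)
    grind
  · exact absurd hl (H.no_leaf_rim closed_has)

theorem Disc.ringHole_not_e (H : Disc W γ R z₀ z₁) [NeZero d] (hg : RingHole W R i) :
    ¬ W.Has R (e i) := by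
  intro he
  have hR := H.sys
  have n1 : i + 1 ≠ i := W.ne_of_sub 1
  have n2 : i - 1 ≠ i := (W.ne_of_sub 1).symm
  have e1 : i + 1 - 1 = i := by ring
  have hc := hg.six_le hR (P := W.Has R) (fun _ h => h) (fun _ _ h => h) (.inl he)
  have hle := c6_le_leaves hR H.c6_eq sub_subset (rotClosed_sub hR (P := W.Has R) fun _ h => h)
    H.verts_has.symm
  have h0 : ∀ j, j = i ∨ j = i + 1 → W.Has R (e (j - 1)) := by
    rintro j (rfl | rfl)
    · exact hg.e _ n2
    · rwa [e1]
  have h1 : ∀ j, j = i ∨ j = i + 1 → W.Has R (e j) := by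
    rintro j (rfl | rfl)
    exacts [he, hg.e _ n1]
  have h2 : ∀ j, j = i ∨ j = i + 1 → ¬ W.Has R (t j) ∨ ¬ W.Has R (t (j - 1)) := by
    rintro j (rfl | rfl)
    exacts [.inr fun h => n2 (hg.t _ h), .inl fun h => n1 (hg.t _ h)]
  have hloc : ∀ v a b, (v, a, b) ∈ leaves R (W.sub R (W.Has R)) → ∃ j, (j = i ∨ j = i + 1) ∧ v = s
    j := by
    intro v a b hl
    rcases H.ringHole_loc hg hl with h | h | h
    exacts [⟨i, .inl rfl, h⟩, ⟨i + 1, .inr rfl, h⟩, absurd he h.2.2.2.1]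
  have hcard : (leaves R (W.sub R (W.Has R))).card ≤ 2 := by
    refine (card_le_card_of_injOn (t := {s i, s (i + 1)}) (fun x => x.1) ?_ ?_).trans
      card_le_two
    · rintro ⟨v, a, b⟩ hl
      grind
    · rintro ⟨v, a, b⟩ hl ⟨v', a', b'⟩ hl' h
      obtain rfl : v = v' := h
      obtain ⟨j, hj, rfl⟩ := hloc _ _ _ hl
      have := H.leaf_closed_unique (hg.run j hj) (h0 j hj) (h1 j hj) (h2 j hj) hl hl'
      rw [this.1, this.2]
  have hin : ∀ j a b, (j = i ∨ j = i + 1) → (s j, a, b) ∈ leaves R (W.sub R (W.Has R)) →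
      a = s (j + 1) ∧ b = s (j - 1) := by
    intro j a b hj hl
    rcases H.leaf_closed (hg.run j hj) (h0 j hj) (h1 j hj) (h2 j hj) hl with
      ⟨u, v, k1, k2, k3, k4, k5, k6, k7, rfl, rfl⟩ | h
    · exfalso
      obtain ⟨n, rfl⟩ : ∃ n, v = n + 1 := ⟨v - 1, by omega⟩
      rw [W.X_succ (by omega), W.X_succ (by omega)] at hl
      rw [W.Φ_succ k1] at k4
      rw [Nat.add_sub_cancel, show n = n - 1 + 1 by omega, W.Φ_succ (by omega)] at k5
      have := H.outer_leaf closed_has H.verts_has.symm (by omega) (by omega) k6 k7 k4 k5 hl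
      omega
    · exact ⟨h.1, h.2.1⟩
  have hcard1 : (leaves R (W.sub R (W.Has R))).card ≤ 1 := by
    have hno : ∀ a b a' b', (s i, a, b) ∈ leaves R (W.sub R (W.Has R)) →
        (s (i + 1), a', b') ∈ leaves R (W.sub R (W.Has R)) → False := by
      intro a b a' b' hl hl'
      obtain ⟨rfl, rfl⟩ := hin _ _ _ (.inl rfl) hl
      obtain ⟨rfl, rfl⟩ := hin _ _ _ (.inr rfl) hl'
      have h3 := (mem_leaves.1 hl).1
      have h4 := hR.rot _ _ _ (hR.rot _ _ _ (mem_leaves.1 hl').1)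
      rw [e1] at h4
      have := KV.s.inj (hR.func _ _ _ _ h3 h4)
      exact (W.ne_of_sub 3) this.symm
    rw [card_le_one]
    rintro ⟨v, a, b⟩ hl ⟨v', a', b'⟩ hl'
    obtain ⟨j, hj, rfl⟩ := hloc _ _ _ hl
    obtain ⟨j', hj', rfl⟩ := hloc _ _ _ hl'
    rcases hj with rfl | rfl <;> rcases hj' with rfl | rfl
    · obtain ⟨rfl, rfl⟩ := hin _ _ _ (.inl rfl) hl
      grind
    · exact (hno _ _ _ _ hl hl').elim
    · exact (hno _ _ _ _ hl' hl).elim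
    · obtain ⟨rfl, rfl⟩ := hin _ _ _ (.inr rfl) hl
      grind
  omega

/-- A long ring is closed by the two outer faces at a hat. -/
theorem Disc.ringHole_outer (H : Disc W γ R z₀ z₁) [NeZero d] (hg : RingHole W R i) :
    W.Has R (p i (W.g i - 1)) ∧ W.Has R (p (i + 1) 0) := by
  have hR := H.sys
  have he := H.ringHole_not_e hg
  by_contra hcon
  have hti := (hg.bridge.resolve_left he).resolve_right hcon
  have n1 : i + 1 ≠ i := W.ne_of_sub 1
  have n2 : i - 1 ≠ i := (W.ne_of_sub 1).symm
  have e1 : i + 1 - 1 = i := by ring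
  have hp0 := W.pos i
  have hp1 := W.pos (i + 1)
  have hc := hg.six_le hR (P := W.Has R) (fun _ h => h) (fun _ _ h => h) (.inr (.inl hti))
  have hle := c6_le_leaves hR H.c6_eq sub_subset (rotClosed_sub hR (P := W.Has R) fun _ h => h)
    H.verts_has.symm
  have hpre : ∀ m₀ m, m₀ < m → W.Has R (p i m) → W.Has R (p i m₀) := by
    intro m₀ m h1 h2
    by_contra hn
    have hm := h2.1.2
    have h3 : W.Has R (p i (W.g i - 1)) := by
      by_cases h4 : m = W.g i - 1
      · rwa [← h4]
      · exact (hg.run i (.inl rfl) m₀ m (W.g i - 1) h1 (by omega) (by omega) h2).resolve_left hn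
    have h4 : ¬ W.Has R (p (i + 1) 0) := fun h => hcon ⟨h3, h⟩
    exact (hg.corner he m₀ (by omega) 0 hp1 hn h4).1 m h1 h2
  have hsuf : ∀ m m₁, m < m₁ → m₁ < W.g (i + 1) → W.Has R (p (i + 1) m) → W.Has R
    (p (i + 1) m₁) := by
    intro m m₁ h1 h1' h2
    by_contra hn
    have h3 : W.Has R (p (i + 1) 0) := by
      by_cases h4 : m = 0
      · rwa [← h4]
      · exact (hg.run (i + 1) (.inr rfl) 0 m m₁ (by omega) h1 h1' h2).resolve_right hn
    have h4 : ¬ W.Has R (p i (W.g i - 1)) := fun h => hcon ⟨h, h3⟩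
    exact (hg.corner he _ (by omega) m₁ h1' h4 hn).2 m h1 h2
  have hl0 : ∀ a b, (s i, a, b) ∈ leaves R (W.sub R (W.Has R)) →
      ∃ u < W.g i, a = W.rho i u ∧ b = s (i + 1) := by
    intro a b hl
    obtain ⟨u, v, hu, hv, g1, g2, g3, g4, rfl, rfl, g5, g6, g7, q, hq, g8, g9⟩ := H.leaf_pattern' hl
    have := pattern_prefix (A := fun q => W.Has R (W.Φ i q)) hp0 (by simpa using hg.e _ n2)
      (by simpa using he) (by simpa using hti) (by simpa using fun h => n2 (hg.t _ h)) (by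
        intro a b h1 h2 h3 h4
        obtain ⟨a, rfl⟩ := Nat.exists_eq_succ_of_ne_zero h1.ne'
        obtain ⟨b, rfl⟩ := Nat.exists_eq_succ_of_ne_zero (by omega : b ≠ 0)
        rw [Nat.succ_eq_add_one, W.Φ_succ (by omega)] at h4 ⊢
        exact hpre a b (by omega) h4) hu hv g1 g2 g3 g4 (fun h => (g5 h).1) g6 g7 hq g8 g9
    exact ⟨u, this.1, W.X_succ (by omega), by rw [this.2, X_g2]⟩
  have hl1 : ∀ a b, (s (i + 1), a, b) ∈ leaves R (W.sub R (W.Has R)) →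
      ∃ m, 0 < m ∧ a = s i ∧ b = W.rho (i + 1) m := by
    intro a b hl
    obtain ⟨u, v, hu, hv, g1, g2, g3, g4, rfl, rfl, g5, g6, g7, q, hq, g8, g9⟩ := H.leaf_pattern' hl
    have := pattern_suffix (A := fun q => W.Has R (W.Φ (i + 1) q)) hp1 (by simpa using he)
      (by simpa using hg.e _ n1) (by simpa using fun h => n1 (hg.t _ h))
      (by simpa using hti) (by
        intro a b h2 h3 h4
        rcases Nat.eq_zero_or_pos a with rfl | h1
        · simp_all
        obtain ⟨a, rfl⟩ := Nat.exists_eq_succ_of_ne_zero h1.ne'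
        obtain ⟨b, rfl⟩ := Nat.exists_eq_succ_of_ne_zero (by omega : b ≠ 0)
        rw [Nat.succ_eq_add_one, W.Φ_succ (by omega)] at h4 ⊢
        exact hsuf a b (by omega) (by omega) h4) hu hv g1 g2 g3 g4 (fun h => (g5 h).1) g6 g7 hq g8
          g9
    refine ⟨v - 1, by omega, by rw [this.1, X_g4, e1], ?_⟩
    have h5 := W.X_succ (i := i + 1) (m := v - 1) (by omega)
    grind
  have hno : ∀ a b a' b', (s i, a, b) ∈ leaves R (W.sub R (W.Has R)) →
      (s (i + 1), a', b') ∈ leaves R (W.sub R (W.Has R)) → False := by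
    intro a b a' b' hl hl'
    obtain ⟨u, hu, rfl, rfl⟩ := hl0 _ _ hl
    obtain ⟨m, hm, rfl, rfl⟩ := hl1 _ _ hl'
    have h3 := hR.rot _ _ _ (hR.rot _ _ _ (mem_leaves.1 hl).1)
    exact rho_succ_ne i hm hu (hR.func _ _ _ _ (mem_leaves.1 hl').1 h3)
  have hcard1 : (leaves R (W.sub R (W.Has R))).card ≤ 1 := by
    rw [card_le_one]
    have hloc : ∀ v a b, (v, a, b) ∈ leaves R (W.sub R (W.Has R)) → v = s i ∨ v = s (i + 1) := by
      intro v a b hl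
      rcases H.ringHole_loc hg hl with h | h | h
      exacts [.inl h, .inr h, absurd h.2.2.2.2 hcon]
    rintro ⟨v, a, b⟩ hl ⟨v', a', b'⟩ hl'
    rcases hloc _ _ _ hl with rfl | rfl <;> rcases hloc _ _ _ hl' with rfl | rfl
    · obtain ⟨u, hu, rfl, rfl⟩ := hl0 _ _ hl
      obtain ⟨u', hu', rfl, rfl⟩ := hl0 _ _ hl'
      have := hR.func _ _ _ _ (hR.rot _ _ _ (hR.rot _ _ _ (mem_leaves.1 hl).1))
        (hR.rot _ _ _ (hR.rot _ _ _ (mem_leaves.1 hl').1))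
      rw [this]
    · exact (hno _ _ _ _ hl hl').elim
    · exact (hno _ _ _ _ hl' hl).elim
    · obtain ⟨u, hu, rfl, rfl⟩ := hl1 _ _ hl
      obtain ⟨u', hu', rfl, rfl⟩ := hl1 _ _ hl'
      rw [leaf_eq_of_end hR hl hl']
  omega

theorem twelve_le_of_ringHole [NeZero d] (hR : Sys R) (hg : RingHole W R i)
    (he : ¬ W.Has R (e i)) (ht : W.Has R (t i)) (h1 : W.Has R (p i (W.g i - 1)))
    (h2 : W.Has R (p (i + 1) 0)) : 12 ≤ c6 (W.sub R (W.Has R)) := by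
  have hP : ∀ F, (W.Has R F ∧ ∀ j, F ≠ t j) → W.Has R F := fun F h => h.1
  have hc := hg.six_le hR hP (fun F h3 h4 => ⟨h4, h3⟩) (.inr (.inr ⟨h1, h2⟩))
  have hs : s i ∈ verts (W.sub R fun F => W.Has R F ∧ ∀ j, F ≠ t j) :=
    (mem_verts_spoke hR hP).2 ⟨W.g i, by omega, ⟨by
      have := W.Φ_succ (i := i) (m := W.g i - 1) (by have := W.pos i; omega)
      rw [Nat.sub_add_cancel (W.pos i)] at this
      rwa [this], by
      have := W.Φ_succ (i := i) (m := W.g i - 1) (by have := W.pos i; omega)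
      rw [Nat.sub_add_cancel (W.pos i)] at this
      simp [this]⟩⟩
  have hs' : s (i + 1) ∈ verts (W.sub R fun F => W.Has R F ∧ ∀ j, F ≠ t j) :=
    (mem_verts_spoke hR hP).2 ⟨1, by omega, ⟨by
      rwa [W.Φ_succ (i := i + 1) (m := 0) (W.pos _)], by
      simp [W.Φ_succ (i := i + 1) (m := 0) (W.pos _)]⟩⟩
  have hi := c6_insert_t hR hP (fun j h => h.2 j rfl) (fun h => he h.1) hs hs' ht
  have : (fun F => (W.Has R F ∧ ∀ j, F ≠ t j) ∨ F = t i) = W.Has R := by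
    funext F
    refine propext ⟨?_, fun h => ?_⟩
    · grind
    · by_cases h3 : ∃ j, F = t j
      · obtain ⟨j, rfl⟩ := h3
        rw [hg.t j h]; exact .inr rfl
      grind
  rw [this] at hi
  omega

theorem Disc.open_count (H : Disc W γ R z₀ z₁) [NeZero d] {κ : ZMod d} (hg : RingHole W R i)
    (he : ¬ W.Has R (e i)) (hp1 : W.Has R (p i (W.g i - 1))) (hp2 : W.Has R (p (i + 1) 0))
    {uI uT x y : ℕ} {bI : KV d} (hκ : κ = i ∨ κ = i + 1)
    (hother : ∀ q, q = i ∨ q = i + 1 → q ≠ κ → ∀ a b, (s q, a, b) ∉ leaves R (W.sub R (W.Has R)))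
    (hleaf : ∀ a b, (s κ, a, b) ∈ leaves R (W.sub R (W.Has R)) →
      (∃ u v, u < W.g κ ∧ a = W.X κ (u + 1) ∧ b = W.X κ v ∧ W.Has R (W.Φ κ u) ∧
        W.Has R (W.Φ κ v) ∧ ¬ W.Has R (W.Φ κ (u + 1)) ∧
        (¬ W.Has R (t i) → u + 1 < v ∧ v ≤ W.g κ + 1 ∧ ¬ W.Has R (W.Φ κ (v - 1)))) ∨
      (a = W.X κ (uI + 1) ∧ b = bI) ∨ (a = W.X κ (uT + 1) ∧ W.Has R (t i)))
    (hends : ¬ W.Has R (t i) → ∀ v, EndPos W (W.Has R) κ v → v < W.g κ ∨ v = uI)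
    (hx : (x = 0 ∨ W.g κ < x) ∧ x < W.g κ + 4 ∧ ¬ W.Has R (W.Φ κ x))
    (hy : W.g κ < y ∧ y < W.g κ + 4 ∧ ¬ W.Has R (W.Φ κ y)) (hxy : x ≠ y) :
    (s κ, W.X κ (uI + 1), bI) ∈ leaves R (W.sub R (W.Has R)) ∧
      outBdry R (W.sub R (W.Has R)) = ∅ := by
  have hR := H.sys
  have hle := c6_le_leaves hR H.c6_eq sub_subset (rotClosed_sub hR (P := W.Has R) fun _ h => h)
    H.verts_has.symm
  have hr := run_Φ (hg.run κ hκ)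
  have huni : ∀ u u', u < W.g κ → u' < W.g κ → W.Has R (W.Φ κ u) → W.Has R (W.Φ κ u') →
      ¬ W.Has R (W.Φ κ (u + 1)) → ¬ W.Has R (W.Φ κ (u' + 1)) → u = u' := by
    have : ∀ u u', u < u' → u' < W.g κ → W.Has R (W.Φ κ u') →
        ¬ W.Has R (W.Φ κ (u + 1)) → ¬ W.Has R (W.Φ κ (u' + 1)) → False := by grind
    grind
  have hloc : ∀ v a b, (v, a, b) ∈ leaves R (W.sub R (W.Has R)) →
      v = s κ ∨ (v = h i ∧ a = W.rho i (W.g i - 1)) := by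
    intro v a b hl
    rcases H.ringHole_loc hg hl with h | h | h
    · grind
    · grind
    · exact .inr ⟨h.1, h.2.1⟩
  obtain ⟨U, hU⟩ : ∃ U : Finset ℕ, ∀ u, u ∈ U ↔ u < W.g κ ∧ W.Has R (W.Φ κ u) ∧
      ¬ W.Has R (W.Φ κ (u + 1)) ∧ ∃ b, (s κ, W.X κ (u + 1), b) ∈ leaves R (W.sub R (W.Has R)) :=
    ⟨(range (W.g κ)).filter fun u => W.Has R (W.Φ κ u) ∧
      ¬ W.Has R (W.Φ κ (u + 1)) ∧ ∃ b, (s κ, W.X κ (u + 1), b) ∈ leaves R (W.sub R (W.Has R)),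
      fun u => by simp⟩
  have hU1 : U.card ≤ 1 := by
    rw [card_le_one]
    intro u hu u' hu'
    rw [hU] at hu hu'
    grind
  obtain ⟨I, hI⟩ : ∃ I : Finset (KV d × KV d), ∀ z, z ∈ I ↔ z = (s κ, W.X κ (uI + 1)) ∧
      (s κ, W.X κ (uI + 1), bI) ∈ leaves R (W.sub R (W.Has R)) :=
    ⟨({(s κ, W.X κ (uI + 1))} : Finset (KV d × KV d)).filter fun _ =>
      (s κ, W.X κ (uI + 1), bI) ∈ leaves R (W.sub R (W.Has R)),
      fun z => by rw [mem_filter, mem_singleton]⟩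
  have hI1 : I.card ≤ 1 := by
    rw [card_le_one]
    grind
  obtain ⟨V, hV⟩ : ∃ V : Finset (KV d × KV d), ∀ z, z ∈ V ↔ z = (s κ, W.X κ (uT + 1)) ∧
      W.Has R (t i) :=
    ⟨({(s κ, W.X κ (uT + 1))} : Finset (KV d × KV d)).filter fun _ => W.Has R (t i),
      fun z => by rw [mem_filter, mem_singleton]⟩
  have hV1 : V.card ≤ 1 := by
    rw [card_le_one]
    grind
  have hcard : (leaves R (W.sub R (W.Has R))).card ≤ 1 + U.card + I.card + V.card := by
    have hinj : Set.InjOn (fun z : KV d × KV d × KV d => (z.1, z.2.1))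
        (leaves R (W.sub R (W.Has R)) : Set (KV d × KV d × KV d)) := by
      rintro ⟨v, a, b⟩ hl ⟨v', a', b'⟩ hl' hh
      simp only [Prod.mk.injEq] at hh
      obtain ⟨rfl, rfl⟩ := hh
      rw [leaf_eq_of_end hR hl hl']
    rw [← card_image_of_injOn hinj]
    have hsub : (leaves R (W.sub R (W.Has R))).image (fun z => (z.1, z.2.1)) ⊆
        (({(h i, W.rho i (W.g i - 1))} ∪ U.image fun u => (s κ, W.X κ (u + 1))) ∪ I) ∪ V := by
      intro z hz
      obtain ⟨⟨v, a, b⟩, hl, rfl⟩ := mem_image.1 hz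
      rcases hloc _ _ _ hl with rfl | ⟨rfl, rfl⟩
      · rcases hleaf _ _ hl with ⟨u, v, k1, rfl, rfl, k2, k3, k4, -⟩ | ⟨rfl, rfl⟩ | ⟨rfl, k⟩
        · exact mem_union_left _ (mem_union_left _ (mem_union_right _
            (mem_image.2 ⟨u, (hU u).2 ⟨k1, k2, k4, _, hl⟩, rfl⟩)))
        exacts [mem_union_left _ (mem_union_right _ ((hI _).2 ⟨rfl, hl⟩)),
          mem_union_right _ ((hV _).2 ⟨rfl, k⟩)]
      · exact mem_union_left _ (mem_union_left _ (mem_union_left _ (by simp)))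
    have k1 := card_le_card hsub
    have k2 := card_union_le (({(h i, W.rho i (W.g i - 1))} ∪ U.image fun u =>
      (s κ, W.X κ (u + 1))) ∪ I) V
    have k3 := card_union_le ({(h i, W.rho i (W.g i - 1))} ∪ U.image fun u =>
      (s κ, W.X κ (u + 1))) I
    have k4 := card_union_le {(h i, W.rho i (W.g i - 1))} (U.image fun u =>
      (s κ, W.X κ (u + 1)))
    have k5 := card_image_le (s := U) (f := fun u => (s κ, W.X κ (u + 1)))
    grind
  have hI0 : (s κ, W.X κ (uI + 1), bI) ∉ leaves R (W.sub R (W.Has R)) → I.card = 0 := by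
    intro hn
    rw [card_eq_zero, eq_empty_iff_forall_notMem]
    grind
  rw [← card_eq_zero]
  by_cases ht : W.Has R (t i)
  · have hc := twelve_le_of_ringHole hR hg he ht hp1 hp2
    by_cases hn : (s κ, W.X κ (uI + 1), bI) ∈ leaves R (W.sub R (W.Has R))
    · exact ⟨hn, by omega⟩
    · have := hI0 hn
      omega
  · have hV0 : V.card = 0 := by
      rw [card_eq_zero, eq_empty_iff_forall_notMem]
      grind
    have hc := hg.six_le hR (P := W.Has R) (fun _ h => h) (fun _ _ h => h)
      (.inr (.inr ⟨hp1, hp2⟩))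
    rcases U.eq_empty_or_nonempty with hU0 | ⟨u, hu⟩
    · rw [hU0, card_empty] at hcard
      by_cases hn : (s κ, W.X κ (uI + 1), bI) ∈ leaves R (W.sub R (W.Has R))
      · exact ⟨hn, by omega⟩
      · have := hI0 hn
        omega
    · exfalso
      obtain ⟨k1, k2, k3, b, hl⟩ := (hU u).1 hu
      have k3' := k3
      rw [W.Φ_succ k1] at k3'
      by_cases hn : (s κ, W.X κ (uI + 1), bI) ∈ leaves R (W.sub R (W.Has R))
      · refine H.not_two_leaves (u := u) (u' := uI) {u + 1, x, y} ?_ ?_ ?_ hl hn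
        · intro q hq
          simp only [mem_insert, mem_singleton] at hq
          rcases hq with rfl | rfl | rfl
          exacts [⟨by omega, k3⟩, hx.2, hy.2]
        · rw [card_eq_three.2 ⟨u + 1, x, y, by omega, by omega, hxy, rfl⟩]
        · intro v hv
          rcases hends ht v hv with h1 | h1
          · refine .inl (huni v u h1 k1 hv.2.1 k2 ?_ k3)
            rcases hv.lt_or with h2 | h2
            · exact h2.2
            · omega
          · exact .inr h1
      · have := hI0 hn
        have key : 9 ≤ 3 * (leaves R (W.sub R (W.Has R))).card := by
          rcases hleaf _ _ hl with ⟨u', v, j1, j2, rfl, j3, j4, j5, j6⟩ | ⟨j1, rfl⟩ | ⟨-, j⟩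
          · obtain ⟨j6, j7, j8⟩ := j6 ht
            obtain rfl := huni u u' k1 j1 k2 j3 k3 j5
            obtain ⟨n, rfl⟩ : ∃ n, v = n + 1 := ⟨v - 1, by omega⟩
            rw [W.X_succ (by omega), W.X_succ (by omega)] at hl
            rw [Nat.add_sub_cancel, show n = n - 1 + 1 by omega, W.Φ_succ (by omega)] at j8
            have := H.outer_leaf closed_has H.verts_has.symm (by omega) (by omega) k2 j4 k3' j8 hl
            omega
          exacts [absurd (j1 ▸ hl) hn, absurd j ht]
        omega

/-- Closedness of the link of a vertex, by predecessors. -/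
theorem Disc.link_pred (H : Disc W γ R z₀ z₁) (p : KV d) (S : Finset (KV d)) (hS : S.Nonempty)
    (hp : ∀ b ∈ S, ∃ a ∈ S, (p, a, b) ∈ R) : S.card = γ p := by
  refine H.link p S hS ?_
  choose! f hf hf' using hp
  have hinj : Set.InjOn f S := by
    intro b hb b' hb' h
    exact H.sys.func _ _ _ _ (hf' b hb) (h ▸ hf' b' hb')
  have himg : S.image f = S := eq_of_subset_of_card_le
    (image_subset_iff.2 hf) (by rw [card_image_of_injOn hinj])
  grind

theorem dart_of_outBdry (hR : Sys R) (h0 : outBdry R D = ∅) (h1 : (a, b, c) ∈ R)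
    (h2 : (a, b, c) ∉ D) : Dart R b a := by
  by_contra hn
  have : (a, b, c) ∈ outBdry R D :=
    mem_filter.2 ⟨mem_sdiff.2 ⟨h1, h2⟩, hn⟩
  grind

/-- A spoke all of whose outer faces are present, but none of its inner faces. -/
structure Outer (W : Fan d) (R : Finset (KV d × KV d × KV d)) (j : ZMod d) : Prop where
  p : ∀ m < W.g j, W.Has R (p j m)
  e : W.Has R (Fc.e j)
  e' : W.Has R (Fc.e (j - 1))
  t : ¬ W.Has R (Fc.t j)
  t' : ¬ W.Has R (Fc.t (j - 1))

theorem Outer.has (ho : Outer W R j) (hq : q < W.g j + 2) :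
    W.Has R (W.Φ j q) := by
  rcases W.pos_cases (show q < W.g j + 4 by omega) with rfl | ⟨m, hm, rfl⟩ | rfl | rfl | rfl
  · simpa using ho.e'
  · rw [W.Φ_succ hm]; exact ho.p m hm
  · simpa using ho.e
  · omega
  · omega

theorem Outer.mem (hR : Sys R) (ho : Outer W R j) (hq : q < W.g j + 2) :
    (s j, W.X j q, W.X j (q + 1)) ∈ R :=
  (ho.has hq).mem hR ((W.at_spoke (ho.has hq).1).2 ⟨q, by omega, rfl, rfl, rfl⟩)

theorem Outer.lt_of_mem (hR : Sys R) (ho : Outer W R j)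
    (hm : (s j, a, b) ∈ W.sub R (W.Has R)) : ∃ q < W.g j + 2, a = W.X j q ∧ b = W.X j (q + 1) := by
  obtain ⟨F, h1, h2⟩ := (mem_sub hR fun _ h => h).1 hm
  obtain ⟨q, hq, rfl, rfl, rfl⟩ := (W.at_spoke h1.1).1 h2
  refine ⟨q, ?_, rfl, rfl⟩
  rcases W.pos_cases hq with rfl | ⟨m, hm, rfl⟩ | rfl | rfl | rfl
  · omega
  · omega
  · omega
  exacts [absurd (by simpa using h1) ho.t, absurd (by simpa using h1) ho.t']

theorem X_ne_h (h1 : j ≠ i) (h2 : j ≠ i + 1) (q : ℕ) (hq : q < W.g j + 3) :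
    W.X j q ≠ h i := by
  have h2' : j - 1 ≠ i := fun h => h2 (sub_eq_iff_eq_add.1 h)
  intro hh
  rcases W.pos_cases (show q < W.g j + 4 by omega) with rfl | ⟨m, hm, rfl⟩ | rfl | rfl | rfl
  · simp at hh
  · rw [W.X_succ hm.le, W.rho_eq_h hm.le] at hh
    grind
  · simp_all
  · simp at hh
  · omega

/-- The link of a spoke consists of its neighbours in the wheel, without the hub, and one more
vertex. -/
theorem link_eq {γ' : ℕ} {N : Finset (KV d)} (hN : N.card = γ')
    (hγ : γ' = W.g j + 4) (hX : ∀ q < W.g j + 3, W.X j q ∈ N) (hx : x ∈ N)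
    (hxX : ∀ q < W.g j + 3, W.X j q ≠ x) (hc : c ∈ N) :
    c = x ∨ ∃ q < W.g j + 3, c = W.X j q := by
  have hsub : insert x ((range (W.g j + 3)).image (W.X j)) ⊆ N := by grind
  have hnot : x ∉ (range (W.g j + 3)).image (W.X j) := by grind
  have hcard : (insert x ((range (W.g j + 3)).image (W.X j))).card = W.g j + 4 := by
    rw [card_insert_of_notMem hnot, card_image_of_injOn, card_range]
    intro a ha b hb hab
    exact W.X_inj (by have := mem_range.1 ha; omega)
      (by have := mem_range.1 hb; omega) hab
  have heq := eq_of_subset_of_card_le hsub (by omega)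
  grind

theorem Disc.turn (H : Disc W γ R z₀ z₁) (h1 : j ≠ i) (h2 : j ≠ i + 1)
    (ho : Outer W R j) (h0 : outBdry R (W.sub R (W.Has R)) = ∅)
    (hm : (s j, s (j + 1), h i) ∈ R) : (s j, h i, s (j - 1)) ∈ R := by
  have hR := H.sys
  have hg := W.pos j
  have hXh := X_ne_h (W := W) h1 h2
  have hnm : (s j, s (j + 1), h i) ∉ W.sub R (W.Has R) := by
    intro hh
    obtain ⟨q, hq, h3, h4⟩ := ho.lt_of_mem hR hh
    grind
  have hrc := rotClosed_sub hR (P := W.Has R) fun _ h => h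
  have hNh : Dart R (s j) (h i) := by
    refine dart_of_outBdry hR h0 (hR.rot _ _ _ (hR.rot _ _ _ hm)) fun hh => ?_
    exact hnm (hrc _ _ _ hh)
  have hcl : ∀ a b, (s j, a, b) ∈ R → Dart R (s j) b := by
    intro a b hab
    by_cases hT : (s j, a, b) ∈ W.sub R (W.Has R)
    · obtain ⟨q, hq, rfl, rfl⟩ := ho.lt_of_mem hR hT
      by_cases hq' : q + 1 < W.g j + 2
      · exact ⟨_, ho.mem hR hq'⟩
      · obtain rfl : q = W.g j + 1 := by omega
        rw [X_g2]
        exact ⟨_, hm⟩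
    · exact dart_of_outBdry hR h0 (hR.rot _ _ _ (hR.rot _ _ _ hab)) fun hh => hT (hrc _ _ _ hh)
  have hmemN : ∀ a, a ∈ (verts R).filter (fun a => Dart R (s j) a) ↔ Dart R (s j) a := by
    intro a
    rw [mem_filter, and_iff_right_of_imp]
    rintro ⟨c, hc⟩
    exact mem_verts.2 ⟨_, _, hR.rot _ _ _ hc⟩
  have hN := H.link (s j) ((verts R).filter fun a => Dart R (s j) a)
    ⟨_, (hmemN _).2 hNh⟩ (by
      intro a ha
      obtain ⟨b, hb⟩ := (hmemN a).1 ha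
      exact ⟨b, (hmemN b).2 (hcl a b hb), hb⟩)
  obtain ⟨c, hc⟩ := hNh
  have hf := (ho.p 0 (W.pos j)).1.1
  rcases link_eq hN (H.spoke j hf) (x := h i) (c := c) (fun q hq => (hmemN _).2 (by
      by_cases hq' : q < W.g j + 2
      · exact ⟨_, ho.mem hR hq'⟩
      · obtain rfl : q = W.g j + 2 := by omega
        rw [X_g2]
        exact ⟨_, hm⟩)) ((hmemN _).2 ⟨c, hc⟩) hXh ((hmemN c).2 (hcl _ _ hc)) with rfl | ⟨q, hq, rfl⟩
  · exact absurd rfl (hR.irr _ _ _ (hR.rot _ _ _ hc))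
  · rcases q with _ | q
    · rwa [X_zero] at hc
    · exfalso
      have h3 := hR.rot _ _ _ (hR.rot _ _ _ (ho.mem hR (q := q) (by omega)))
      exact hXh q (by omega) (hR.func _ _ _ _ h3 (hR.rot _ _ _ (hR.rot _ _ _ hc)))

theorem Disc.turn' (H : Disc W γ R z₀ z₁) (h1 : j ≠ i) (h2 : j ≠ i + 1)
    (ho : Outer W R j) (h0 : outBdry R (W.sub R (W.Has R)) = ∅)
    (hm : (s j, h i, s (j - 1)) ∈ R) : (s j, s (j + 1), h i) ∈ R := by
  have hR := H.sys
  have hg := W.pos j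
  have hXh := X_ne_h (W := W) h1 h2
  have hnm : (s j, h i, s (j - 1)) ∉ W.sub R (W.Has R) := by
    intro hh
    obtain ⟨q, hq, h3, h4⟩ := ho.lt_of_mem hR hh
    exact hXh q (by omega) h3.symm
  have hrc := rotClosed_sub hR (P := W.Has R) fun _ h => h
  have hNh : Dart R (h i) (s j) := dart_of_outBdry hR h0 hm hnm
  have hcl : ∀ a b, (s j, a, b) ∈ R → Dart R a (s j) := by
    intro a b hab
    by_cases hT : (s j, a, b) ∈ W.sub R (W.Has R)
    · obtain ⟨q, hq, rfl, rfl⟩ := ho.lt_of_mem hR hT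
      rcases q with _ | q
      · rw [X_zero]
        exact ⟨_, hR.rot _ _ _ (hR.rot _ _ _ hm)⟩
      · exact ⟨_, hR.rot _ _ _ (hR.rot _ _ _ (ho.mem hR (q := q) (by omega)))⟩
    · exact dart_of_outBdry hR h0 hab hT
  have hmemN : ∀ a, a ∈ (verts R).filter (fun a => Dart R a (s j)) ↔ Dart R a (s j) := by
    intro a
    rw [mem_filter, and_iff_right_of_imp]
    rintro ⟨c, hc⟩
    exact mem_verts.2 ⟨_, _, hc⟩
  have hN := H.link_pred (s j) ((verts R).filter fun a => Dart R a (s j))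
    ⟨_, (hmemN _).2 hNh⟩ (by
      intro b hb
      obtain ⟨a, ha⟩ := (hmemN b).1 hb
      have ha := hR.rot _ _ _ ha
      exact ⟨a, (hmemN a).2 (hcl a b ha), ha⟩)
  obtain ⟨c, hc⟩ := hNh
  have hc := hR.rot _ _ _ hc
  have hf := (ho.p 0 (W.pos j)).1.1
  rcases link_eq hN (H.spoke j hf) (x := h i) (c := c) (fun q hq => (hmemN _).2 (by
      rcases q with _ | q
      · rw [X_zero]
        exact ⟨_, hR.rot _ _ _ (hR.rot _ _ _ hm)⟩
      · exact ⟨_, hR.rot _ _ _ (hR.rot _ _ _ (ho.mem hR (q := q) (by omega)))⟩))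
      ((hmemN _).2 ⟨_, hR.rot _ _ _ (hR.rot _ _ _ hc)⟩) hXh ((hmemN c).2 (hcl _ _ hc)) with
    rfl | ⟨q, hq, rfl⟩
  · exact absurd rfl (hR.irr _ _ _ (hR.rot _ _ _ hc))
  · by_cases hq' : q < W.g j + 2
    · exact absurd (hR.func _ _ _ _ (ho.mem hR hq') hc) (hXh _ (by omega))
    · obtain rfl : q = W.g j + 2 := by omega
      rwa [X_g2] at hc

theorem Disc.ringHole_false (H : Disc W γ R z₀ z₁) [NeZero d] (hg : RingHole W R i) :
    False := by
  have hR := H.sys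
  have he := H.ringHole_not_e hg
  obtain ⟨hp1, hp2⟩ := H.ringHole_outer hg
  have hd := W.five_le
  have n1 : i + 1 ≠ i := W.ne_of_sub 1
  have n2 : i - 1 ≠ i := (W.ne_of_sub 1).symm
  have e1 : i + 1 - 1 = i := by ring
  have hP : ∀ F, W.Has R F → W.Has R F := fun _ h => h
  have hrc := rotClosed_sub hR hP
  have hout : ∀ j, j ≠ i → j ≠ i + 1 → Outer W R j := by
    intro j h1 h2
    have h2' : j - 1 ≠ i := fun h => h2 (sub_eq_iff_eq_add.1 h)
    exact ⟨hg.p j h1 h2, hg.e j h1, hg.e _ h2', fun h => h1 (hg.t _ h), fun h => h2' (hg.t _ h)⟩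
  have hfull : (∀ m < W.g i, W.Has R (p i m)) ∨ ∀ m < W.g (i + 1), W.Has R (p (i + 1) m) := by
    by_contra hn
    push Not at hn
    obtain ⟨⟨m, hm, h1⟩, m', hm', h2⟩ := hn
    have h3 := (hg.corner he m hm m' hm' h1 h2).1 (W.g i - 1)
    grind
  have hnatne : ∀ n : ℕ, 0 < n → n < d → ((n : ℕ) : ZMod d) ≠ 0 := by
    intro n h1 h2 h3
    rw [ZMod.natCast_eq_zero_iff] at h3
    exact absurd (Nat.le_of_dvd h1 h3) (by omega)
  have hT := fun {F a b c} (hF : W.Has R F) (ha : W.At F a b c) =>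
    (mem_sub (W := W) hR hP).2 ⟨F, hF, ha⟩
  rcases hfull with hf | hf
  · have hno : ∀ a b, (s i, a, b) ∉ leaves R (W.sub R (W.Has R)) := fun a b =>
      H.no_leaf_full hf (.inl (hg.e _ n2)) (fun _ => hg.e _ n2) fun h => absurd (hg.t _ h) n2
    have hA0 : ¬ W.Has R (W.Φ (i + 1) 0) := by simpa [e1] using he
    have hA2 : ¬ W.Has R (W.Φ (i + 1) (W.g (i + 1) + 2)) := by
      simpa using fun h => n1 (hg.t _ h)
    have hA1 : W.Has R (W.Φ (i + 1) (W.g (i + 1) + 1)) := by simpa using hg.e _ n1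
    have hA3 : W.Has R (W.Φ (i + 1) (W.g (i + 1) + 3)) ↔ W.Has R (t i) := by simp [e1]
    have hAp : W.Has R (W.Φ (i + 1) 1) := by
      have := W.Φ_succ (W.pos (i + 1))
      grind
    obtain ⟨hl, h0⟩ := H.open_count hg he hp1 hp2 (κ := i + 1) (uI := W.g (i + 1) + 1)
      (uT := W.g (i + 1) + 3) (x := 0) (y := W.g (i + 1) + 2) (bI := W.X (i + 1) 1) (.inr rfl)
      (by
        rintro q (rfl | rfl) hq a b
        exacts [hno a b, absurd rfl hq])
      (by
        intro a b hl
        obtain ⟨u, v, hu, hv, g1, g2, g3, g4, rfl, rfl, g5, g6, g7, q, hq, g8, g9⟩ :=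
          H.leaf_pattern' hl
        rcases pattern_open_right (A := fun q => W.Has R (W.Φ (i + 1) q)) (W.pos _) hA0 hAp hA1 hA2
          (run_Φ (hg.run _ (.inr rfl))) hu hv g1 g2 g3 g4 (fun h => (g5 h).1) g6 g7 hq g8 g9 with
          h | ⟨rfl, rfl⟩ | h
        exacts [.inl ⟨u, v, h.1, rfl, rfl, g1, g2, h.2.1, fun ht => h.2.2 (fun h => ht (hA3.1 h))⟩,
          .inr (.inl ⟨rfl, rfl⟩), .inr (.inr ⟨by rw [h.1], hA3.1 h.2⟩)])
      (by
        intro ht v hv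
        have h1 := hv.1
        have h2 := hv.2.1
        rcases (show v < W.g (i + 1) ∨ v = W.g (i + 1) ∨ v = W.g (i + 1) + 1 ∨
          v = W.g (i + 1) + 2 ∨ v = W.g (i + 1) + 3 by omega) with h | h | h | h | h
        · exact .inl h
        · rcases hv.lt_or with h3 | h3
          · exact absurd hA1 (h ▸ h3.2)
          · omega
        exacts [.inr h, absurd (h ▸ h2) hA2, absurd (hA3.1 (h ▸ h2)) ht])
      ⟨.inl rfl, by omega, hA0⟩ ⟨by omega, by omega, hA2⟩ (by omega)
    rw [X_g2, X_one, e1] at hl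
    have key : ∀ n : ℕ, n + 2 ≤ d →
        (s (i + 1 + (n : ZMod d)), s (i + 1 + (n : ZMod d) + 1), h i) ∈ R := by
      intro n
      induction n with
      | zero =>
        intro _
        simpa using (mem_leaves.1 hl).1
      | succ n ih =>
        intro hn
        have h1 := hR.rot _ _ _ (ih (by omega))
        have e2 : i + 1 + (n : ZMod d) + 1 = i + 1 + ((n + 1 : ℕ) : ZMod d) := by push_cast; ring
        have e3 : i + 1 + (n : ZMod d) = i + 1 + ((n + 1 : ℕ) : ZMod d) - 1 := by push_cast; ring
        have m1 : i + 1 + ((n + 1 : ℕ) : ZMod d) ≠ i := by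
          intro hh
          refine hnatne (n + 2) (by omega) (by omega) ?_
          grind
        have m2 : i + 1 + ((n + 1 : ℕ) : ZMod d) ≠ i + 1 := by
          intro hh
          refine hnatne (n + 1) (by omega) (by omega) ?_
          linear_combination hh
        refine H.turn' m1 m2 (hout _ m1 m2) h0 ?_
        grind
    have h3 := key (d - 2) (by omega)
    have e4 : i + 1 + ((d - 2 : ℕ) : ZMod d) = i - 1 := by
      rw [Nat.cast_sub (by omega)]; simp; ring
    rw [e4, sub_add_cancel] at h3
    refine hno (h i) (s (i - 1)) (mem_leaves.2 ⟨hR.rot _ _ _ h3, fun hh => ?_, ?_, ?_⟩)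
    · obtain ⟨F, h4, h5⟩ := (mem_sub hR hP).1 hh
      obtain ⟨q, hq, rfl, h6, h7⟩ := (W.at_spoke h4.1).1 h5
      rw [← X_g1] at h6
      obtain rfl := W.X_inj (by omega) hq h6
      exact he (by simpa using h4)
    · exact ⟨_, hT hp1 (W.at_hat hp1.1 |>.2 (.inr (.inr ⟨rfl, rfl, rfl⟩)))⟩
    · refine (out_spoke hR hP).2 ⟨0, by omega, ?_, by simp⟩
      simpa using hg.e _ n2
  · have hno : ∀ a b, (s (i + 1), a, b) ∉ leaves R (W.sub R (W.Has R)) := fun a b =>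
      H.no_leaf_full hf (.inr (hg.e _ n1)) (fun h => absurd (hg.t _ h) n1) fun _ => hg.e _ n1
    have hA0 : W.Has R (W.Φ i 0) := by simpa using hg.e _ n2
    have hA2 : W.Has R (W.Φ i (W.g i + 2)) ↔ W.Has R (t i) := by simp
    have hA1 : ¬ W.Has R (W.Φ i (W.g i + 1)) := by simpa using he
    have hA3 : ¬ W.Has R (W.Φ i (W.g i + 3)) := by simpa using fun h => n2 (hg.t _ h)
    have hAp : W.Has R (W.Φ i (W.g i)) := by
      have := W.Φ_succ (i := i) (m := W.g i - 1) (by have := W.pos i; omega)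
      grind
    obtain ⟨hl, h0⟩ := H.open_count hg he hp1 hp2 (κ := i) (uI := W.g i)
      (uT := W.g i + 2) (x := W.g i + 1) (y := W.g i + 3) (bI := W.X i 0) (.inl rfl)
      (by
        rintro q (rfl | rfl) hq a b
        exacts [absurd rfl hq, hno a b])
      (by
        intro a b hl
        obtain ⟨u, v, hu, hv, g1, g2, g3, g4, rfl, rfl, g5, g6, g7, q, hq, g8, g9⟩ :=
          H.leaf_pattern' hl
        rcases pattern_open_left (A := fun q => W.Has R (W.Φ i q)) (W.pos _) hA0 hAp hA1 hA3
          (run_Φ (hg.run _ (.inl rfl))) hu hv g1 g2 g3 g4 (fun h => (g5 h).1) g6 g7 hq g8 g9 with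
          h | ⟨rfl, rfl⟩ | h
        · refine .inl ⟨u, v, h.1, rfl, rfl, g1, g2, h.2.1, fun ht => ?_⟩
          obtain ⟨k1, k2, k3⟩ := h.2.2 (fun h => ht (hA2.1 h))
          exact ⟨k1, by omega, k3⟩
        exacts [.inr (.inl ⟨rfl, rfl⟩), .inr (.inr ⟨by rw [h.1], hA2.1 h.2⟩)])
      (by
        intro ht v hv
        have h1 := hv.1
        have h2 := hv.2.1
        rcases (show v < W.g i ∨ v = W.g i ∨ v = W.g i + 1 ∨
          v = W.g i + 2 ∨ v = W.g i + 3 by omega) with h | h | h | h | h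
        exacts [.inl h, .inr h, absurd (h ▸ h2) hA1, absurd (hA2.1 (h ▸ h2)) ht,
          absurd (h ▸ h2) hA3])
      ⟨.inr (by omega), by omega, hA1⟩ ⟨by omega, by omega, hA3⟩ (by omega)
    rw [X_g1, X_zero] at hl
    have key : ∀ n : ℕ, n + 2 ≤ d →
        (s (i - (n : ZMod d)), h i, s (i - (n : ZMod d) - 1)) ∈ R := by
      intro n
      induction n with
      | zero =>
        intro _
        simpa using (mem_leaves.1 hl).1
      | succ n ih =>
        intro hn
        have h1 := hR.rot _ _ _ (hR.rot _ _ _ (ih (by omega)))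
        have e2 : i - (n : ZMod d) - 1 = i - ((n + 1 : ℕ) : ZMod d) := by push_cast; ring
        have e3 : i - (n : ZMod d) = i - ((n + 1 : ℕ) : ZMod d) + 1 := by push_cast; ring
        have m1 : i - ((n + 1 : ℕ) : ZMod d) ≠ i := by
          intro hh
          refine hnatne (n + 1) (by omega) (by omega) ?_
          linear_combination -hh
        have m2 : i - ((n + 1 : ℕ) : ZMod d) ≠ i + 1 := by
          intro hh
          refine hnatne (n + 2) (by omega) (by omega) ?_
          grind
        refine H.turn m1 m2 (hout _ m1 m2) h0 ?_
        grind
    have h3 := key (d - 2) (by omega)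
    have e4 : i - ((d - 2 : ℕ) : ZMod d) = i + 1 + 1 := by
      rw [Nat.cast_sub (by omega)]; simp; ring
    rw [e4, add_sub_cancel_right] at h3
    refine hno (s (i + 1 + 1)) (h i)
      (mem_leaves.2 ⟨hR.rot _ _ _ (hR.rot _ _ _ h3), fun hh => ?_, ?_, ?_⟩)
    · obtain ⟨F, h4, h5⟩ := (mem_sub hR hP).1 hh
      obtain ⟨q, hq, rfl, h6, h7⟩ := (W.at_spoke h4.1).1 h5
      rw [← X_g2] at h6
      obtain rfl := W.X_inj (by omega) hq h6
      exact n1 (hg.t _ (by simpa using h4))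
    · refine (in_spoke hR hP).2 ⟨W.g (i + 1) + 1, by omega, ?_, by simp⟩
      simpa using hg.e _ n1
    · exact ⟨_, hT hp2 (W.at_hat hp2.1 |>.2 (.inl ⟨rfl, rfl, rfl⟩)).rot.rot⟩

/-- All triangles of a disc in a wheel are faces of the wheel. -/
theorem Disc.isFace (H : Disc W γ R z₀ z₁) (habc : (a, b, c) ∈ R) :
    W.IsFace a b c := by
  have : NeZero d := ⟨by have := W.five_le; omega⟩
  have hR := H.sys
  obtain ⟨F₀, c₀, hF₀, hz⟩ := H.start
  have hP := closed_comp (W := W) (R := R) F₀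
  have hY0 : Comp W R F₀ F₀ := ⟨hF₀, Relation.ReflTransGen.refl⟩
  have hat : ∀ z, z = z₀ ∨ z = z₁ → ∃ a b, W.At F₀ z a b := by
    rintro z (rfl | rfl) <;> rcases hz with hz | hz
    exacts [⟨_, _, hz⟩, ⟨_, _, hz.rot⟩, ⟨_, _, hz.rot⟩, ⟨_, _, hz⟩]
  have hv : ∀ z, z = z₀ ∨ z = z₁ → z ∈ verts (W.sub R (Comp W R F₀)) := by
    intro z h
    obtain ⟨a, b, h⟩ := hat z h
    exact (mem_verts_sub hR hP.has).2 ⟨F₀, a, b, hY0, h⟩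
  by_cases hnt : ∃ k, Comp W R F₀ (t k)
  · obtain ⟨k, hk⟩ := hnt
    exact H.isFace_of_hub hk (hv _ (.inl rfl)) (hv _ (.inr rfl)) habc
  push Not at hnt
  by_cases hnl : ∃ i, LongRing W R F₀ i
  · obtain ⟨i, hi⟩ := hnl
    exact (H.ringHole_false (H.ringHole hnt hF₀ hat hi)).elim
  push Not at hnl
  rcases H.grow (hv _ (.inl rfl)) (hv _ (.inr rfl)) with h | ⟨F, hF, hV⟩
  · exact H.isFace_of_no_leaf hP h (conn_comp hR F₀) (H.ring_no_leaf hnt hnl) habc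
  · obtain ⟨i, -, hg⟩ := H.ring_grow hnt hnl hF hV
    exact (H.ring_gap_false (ringGap hR hnt hg)).elim

end Wheel

namespace TriSys

open Classical Finset

variable {V W : Type*} {D : Finset (V × V × V)} {φ : V → W}

/-- The image of a triangle. -/
def mapT (φ : V → W) (t : V × V × V) : W × W × W := (φ t.1, φ t.2.1, φ t.2.2)

theorem mem_image_mapT {a b c : W} : (a, b, c) ∈ D.image (mapT φ) ↔
    ∃ x y z, (x, y, z) ∈ D ∧ φ x = a ∧ φ y = b ∧ φ z = c := by
  simp [mapT]

theorem mapT_mem (hD : RotClosed D) (hφ : Set.InjOn φ (verts D)) {x y z : V} (hx : x ∈ verts D)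
    (hy : y ∈ verts D) (hz : z ∈ verts D) :
    (φ x, φ y, φ z) ∈ D.image (mapT φ) ↔ (x, y, z) ∈ D := by
  rw [mem_image_mapT]
  constructor
  · rintro ⟨x', y', z', h, h1, h2, h3⟩
    obtain ⟨k1, k2, k3⟩ := hD.mem_verts h
    rw [← hφ k1 hx h1, ← hφ k2 hy h2, ← hφ k3 hz h3]
    exact h
  grind

theorem verts_image : verts (D.image (mapT φ)) = (verts D).image φ := by
  simp only [verts, image_image]
  rfl

theorem Sys.image (hD : Sys D) (hφ : Set.InjOn φ (verts D)) : Sys (D.image (mapT φ)) where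
  rot a b c h₀ := by
    obtain ⟨x, y, z, h, rfl, rfl, rfl⟩ := mem_image_mapT.1 h₀
    exact mem_image_mapT.2 ⟨y, z, x, hD.rot _ _ _ h, rfl, rfl, rfl⟩
  func a b c c' h₀ h₁ := by
    obtain ⟨x, y, z, h, rfl, rfl, rfl⟩ := mem_image_mapT.1 h₀
    obtain ⟨x', y', z', h', h1, h2, rfl⟩ := mem_image_mapT.1 h₁
    obtain ⟨k1, k2, k3⟩ := hD.rot.mem_verts h
    obtain ⟨k1', k2', k3'⟩ := hD.rot.mem_verts h'
    obtain rfl := hφ k1' k1 h1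
    obtain rfl := hφ k2' k2 h2
    rw [hD.func _ _ _ _ h h']
  irr a b c h₀ := by
    obtain ⟨x, y, z, h, rfl, rfl, rfl⟩ := mem_image_mapT.1 h₀
    obtain ⟨k1, k2, k3⟩ := hD.rot.mem_verts h
    exact fun he => hD.irr _ _ _ h (hφ k1 k2 he)
  planar Z hZ hr hne := by
    have hm : ∀ x y z, (x, y, z) ∈ D.filter (fun t => mapT φ t ∈ Z) ↔
        (x, y, z) ∈ D ∧ (φ x, φ y, φ z) ∈ Z := fun x y z => mem_filter
    obtain ⟨⟨a, b, c⟩, ht⟩ := hne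
    obtain ⟨x, y, z, h, rfl, rfl, rfl⟩ := mem_image_mapT.1 (hZ ht)
    obtain ⟨x, y, z, h1, h2⟩ := hD.planar (D.filter fun t => mapT φ t ∈ Z) (filter_subset _ _)
      (fun a b c h => (hm _ _ _).2 ⟨hD.rot _ _ _ ((hm _ _ _).1 h).1, hr _ _ _ ((hm _ _ _).1 h).2⟩)
      ⟨_, (hm _ _ _).2 ⟨h, ht⟩⟩
    rw [hm] at h1
    refine ⟨_, _, _, h1.2, ?_⟩
    rintro ⟨c, hc⟩
    obtain ⟨y', x', w, h', e1, e2, rfl⟩ := mem_image_mapT.1 (hZ hc)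
    obtain ⟨k1, k2, k3⟩ := hD.rot.mem_verts h1.1
    obtain ⟨k1', k2', k3'⟩ := hD.rot.mem_verts h'
    obtain rfl := hφ k1' k2 e1
    obtain rfl := hφ k2' k1 e2
    exact h2 ⟨w, (hm _ _ _).2 ⟨h', hc⟩⟩

theorem c6_image (hD : Sys D) (hφ : Set.InjOn φ (verts D)) : c6 (D.image (mapT φ)) = c6 D := by
  have hI := hD.image hφ
  have h1 : (D.image (mapT φ)).card = D.card := by
    refine card_image_of_injOn ?_
    rintro ⟨x, y, z⟩ h ⟨x', y', z'⟩ h' he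
    obtain ⟨k1, k2, k3⟩ := hD.rot.mem_verts h
    obtain ⟨k1', k2', k3'⟩ := hD.rot.mem_verts h'
    simp only [mapT, Prod.mk.injEq] at he
    rw [hφ k1 k1' he.1, hφ k2 k2' he.2.1, hφ k3 k3' he.2.2]
  have h2 : edges (D.image (mapT φ)) = (edges D).image (Prod.map φ φ) := by
    ext ⟨a, b⟩
    rw [mem_edges hI.rot, mem_image]
    simp only [Edge, Dart, mem_image_mapT, Prod.exists, Prod.map_apply,
      Prod.mk.injEq, mem_edges hD.rot]
    grind
  rw [hI.c6_eq, hD.c6_eq, h1, h2, verts_image, card_image_of_injOn hφ,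
    card_image_of_injOn]
  rintro ⟨a, b⟩ h ⟨a', b'⟩ h' he
  simp only [Prod.map_apply, Prod.mk.injEq] at he
  have k1 := hD.rot.edge_verts ((mem_edges hD.rot).1 h)
  have k2 := hD.rot.edge_verts ((mem_edges hD.rot).1 h')
  rw [hφ k1.1 k2.1 he.1, hφ k1.2 k2.2 he.2]

end TriSys

/-! ### Drawings -/

open Classical Finset

theorem exists_iterate_eq {β : Type*} {g : β → β} {S : Set β} (hS : S.Finite)
    (hm : Set.MapsTo g S S)
    (hi : Set.InjOn g S) {x : β} (hx : x ∈ S) : ∃ k, 0 < k ∧ g^[k] x = x := by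
  have : Finite S := hS
  obtain ⟨k, h1, h2⟩ := ((Set.MapsTo.restrict_inj hm).2 hi).mem_periodicPts (⟨x, hx⟩ : S)
  refine ⟨k, h1, ?_⟩
  have := congrArg Subtype.val h2.eq
  rwa [hm.iterate_restrict] at this

namespace Drawing

variable {α : Type*} (D : Drawing α)

theorem finite_nbrs (v : α) : {u | D.Adj v u}.Finite :=
  D.verts.finite_toSet.subset fun _ h => D.mem_verts _ _ (D.symm _ _ h)

variable {D} in
theorem iterate_adj {v a : α} (h : D.Adj v a) (k : ℕ) : D.Adj v ((D.next v)^[k] a) := by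
  induction k with
  | zero => exact h
  | succ k ih =>
    rw [Function.iterate_succ_apply']
    exact D.next_adj _ _ ih

variable {D} in
theorem exists_next_eq {v b : α} (h : D.Adj v b) : ∃ a, D.Adj v a ∧ D.next v a = b := by
  obtain ⟨k, hk⟩ := D.next_cyclic v _ b (D.next_adj _ _ h) h
  refine ⟨(D.next v)^[k] b, iterate_adj h k, ?_⟩
  exact (Function.iterate_succ_apply' _ _ _).symm.trans
    ((Function.iterate_succ_apply _ _ _).trans hk)

theorem next_injOn (v : α) : Set.InjOn (D.next v) {u | D.Adj v u} := by
  have := injOn_of_surjOn_of_card_le (s := (D.finite_nbrs v).toFinset)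
    (t := (D.finite_nbrs v).toFinset) (D.next v) (fun a ha => by simpa using D.next_adj v a (by
      simpa using ha)) (fun b hb => by
        obtain ⟨a, h1, h2⟩ := exists_next_eq (D := D) (v := v) (b := b) (by simpa using hb)
        exact ⟨a, by simpa using h1, h2⟩) le_rfl
  simpa using this

/-- A set of neighbours of `v` that is closed under rotation consists of all neighbours. -/
theorem mem_of_next_closed {v : α} {X : α → Prop} (hX : ∀ a, D.Adj v a → X a → X (D.next v a))
    {a b : α} (ha : D.Adj v a) (hb : D.Adj v b) (h : X a) : X b := by
  obtain ⟨k, rfl⟩ := D.next_cyclic v a b ha hb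
  clear hb
  induction k with
  | zero => exact h
  | succ k ih =>
    rw [Function.iterate_succ_apply']
    exact hX _ (iterate_adj ha k) ih

/-- The darts, as a finite set. -/
noncomputable def dartSet : Finset (α × α) := (D.verts ×ˢ D.verts).filter fun p => D.Adj p.1 p.2

theorem mem_dartSet {u v : α} : (u, v) ∈ D.dartSet ↔ D.Adj u v := by
  simp only [dartSet, mem_filter, mem_product, and_iff_right_iff_imp]
  exact fun h => ⟨D.mem_verts _ _ h, D.mem_verts _ _ (D.symm _ _ h)⟩

theorem coe_dartSet : (D.dartSet : Set (α × α)) = D.darts := by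
  ext ⟨u, v⟩
  exact D.mem_dartSet

theorem mapsTo_faceNext : Set.MapsTo D.faceNext D.darts D.darts := fun p h =>
  D.symm _ _ (D.next_adj _ _ h)

theorem injOn_faceNext : Set.InjOn D.faceNext D.darts := by
  rintro ⟨u, v⟩ h ⟨u', v'⟩ h' he
  obtain ⟨h1, rfl⟩ := Prod.mk.inj he
  exact Prod.ext rfl (D.next_injOn _ h h' h1)

variable {D} in
theorem region_subset {p : α × α} (h : p ∈ D.darts) : D.region p ⊆ D.darts := by
  rintro q ⟨k, rfl⟩
  exact D.mapsTo_faceNext.iterate k h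

variable {D} in
theorem region_eq {p q : α × α} (h : p ∈ D.darts) (hq : q ∈ D.region p) :
    D.region q = D.region p := by
  have hqd := region_subset h hq
  obtain ⟨k, rfl⟩ := hq
  obtain ⟨m, hm, he⟩ := exists_iterate_eq (D.coe_dartSet ▸ D.dartSet.finite_toSet)
    D.mapsTo_faceNext D.injOn_faceNext h
  ext x
  constructor
  · rintro ⟨j, rfl⟩
    exact ⟨j + k, Function.iterate_add_apply _ _ _ _⟩
  · rintro ⟨j, rfl⟩
    have hper : ∀ n, D.faceNext^[m * n] p = p := fun n => by
      rw [Function.iterate_mul]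
      exact Function.iterate_fixed he n
    have : k ≤ m * k := Nat.le_mul_of_pos_left k hm
    refine ⟨j + (m * k - k), ?_⟩
    rw [← Function.iterate_add_apply, add_assoc, Nat.sub_add_cancel this,
      Function.iterate_add_apply, hper]

theorem region_eq_of_three {p : α × α} (h : D.faceNext^[3] p = p) :
    D.region p = {p, D.faceNext p, D.faceNext (D.faceNext p)} := by
  ext q
  constructor
  · rintro ⟨k, rfl⟩
    induction k with
    | zero => exact .inl rfl
    | succ k ih =>
      rw [Function.iterate_succ_apply']
      rcases ih with h1 | h1 | h1 <;> rw [h1]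
      exacts [.inr (.inl rfl), .inr (.inr rfl), .inl h]
  · rintro (rfl | rfl | rfl)
    exacts [⟨0, rfl⟩, ⟨1, rfl⟩, ⟨2, rfl⟩]

end Drawing

namespace NearTriangulation

open TriSys

variable {α : Type*} (G : NearTriangulation α)

theorem outer_subset : G.outer ⊆ G.darts := by
  rcases G.outer_region with ⟨p, hp, he⟩ | ⟨-, he⟩
  · rw [he]; exact Drawing.region_subset hp
  grind

theorem region_eq_outer {p : α × α} (h : p ∈ G.outer) : G.region p = G.outer := by
  rcases G.outer_region with ⟨q, hq, he⟩ | ⟨-, he⟩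
  · rw [he] at h ⊢
    exact Drawing.region_eq hq h
  grind

theorem outer_faceNext {p : α × α} (h : p ∈ G.outer) : G.faceNext p ∈ G.outer := by
  rw [← G.region_eq_outer h]
  exact ⟨1, rfl⟩

theorem outer_of_faceNext {p : α × α} (hp : p ∈ G.darts) (h : G.faceNext p ∈ G.outer) :
    p ∈ G.outer := by
  have h1 : G.region (G.faceNext p) = G.region p := Drawing.region_eq hp ⟨1, rfl⟩
  rw [← G.region_eq_outer h, h1]
  exact ⟨0, rfl⟩

variable {G} in
theorem clockwise_of_notMem {u v : α} (h : G.Adj u v) (h' : (u, v) ∉ G.outer) :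
    G.ClockwiseTriangle u v (G.next u v) := by
  have h3 := G.finite_triangle _ h h'
  simp only [Function.iterate_succ, Function.iterate_zero, Function.comp_apply, id,
    Drawing.faceNext, Prod.mk.injEq] at h3
  refine ⟨h, h', rfl, ?_, h3.2⟩
  rw [h3.2] at h3
  exact h3.1

variable {G} in
theorem ClockwiseTriangle.rot {u v w : α} (h : G.ClockwiseTriangle u v w) :
    G.ClockwiseTriangle v w u := by
  obtain ⟨h1, h2, h3, h4, h5⟩ := h
  have hw : G.Adj w u := G.symm _ _ (h3 ▸ G.next_adj _ _ h1)
  have hv : G.Adj v w := G.symm _ _ (h5 ▸ G.next_adj _ _ hw)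
  refine ⟨hv, fun ho => h2 ?_, h4, h5, h3⟩
  have := G.outer_faceNext ho
  rwa [Drawing.faceNext, h4] at this

variable {G} in
theorem ClockwiseTriangle.mem {u v w : α} (h : G.ClockwiseTriangle u v w) :
    u ∈ G.verts ∧ v ∈ G.verts ∧ w ∈ G.verts :=
  ⟨G.mem_verts _ _ h.1, G.mem_verts _ _ h.rot.1, G.mem_verts _ _ h.rot.rot.1⟩

/-- The finite regions, each with its three clockwise orders. -/
noncomputable def faces : Finset (α × α × α) :=
  (G.verts ×ˢ G.verts ×ˢ G.verts).filter fun t => G.ClockwiseTriangle t.1 t.2.1 t.2.2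

theorem mem_faces {u v w : α} : (u, v, w) ∈ G.faces ↔ G.ClockwiseTriangle u v w := by
  simp only [faces, mem_filter, mem_product, and_iff_right_iff_imp]
  exact fun h => h.mem

theorem sys_faces : Sys G.faces where
  rot a b c h := G.mem_faces.2 (G.mem_faces.1 h).rot
  func a b c c' h h' := by
    rw [mem_faces] at h h'
    exact h.2.2.1.symm.trans h'.2.2.1
  irr a b c h he := by
    rw [mem_faces] at h
    exact G.loopless a (he ▸ h.1)
  planar D hD hr hne := by
    by_contra hcon
    push Not at hcon
    obtain ⟨⟨a, b, c⟩, habc⟩ := hne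
    have hall : ∀ v a, Dart D v a → ∀ b, G.Adj v b → Dart D v b := by
      rintro v a ⟨c, h⟩ b hb
      refine G.mem_of_next_closed (X := fun b => Dart D v b) ?_ (G.mem_faces.1 (hD h)).1 hb ⟨c, h⟩
      rintro x hx ⟨y, hy⟩
      rw [(G.mem_faces.1 (hD hy)).2.2.1]
      exact hcon _ _ _ (hr _ _ _ (hr _ _ _ hy))
    have hrev : ∀ a b, Dart D a b → Dart D b a := fun a b ⟨c, h⟩ => hcon _ _ _ h
    have hconn : ∀ v, Relation.ReflTransGen G.Adj a v → ∃ b, Dart D v b := by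
      intro v h
      induction h with
      | refl => exact ⟨b, c, habc⟩
      | tail _ hbc ih =>
        grind
    have hdart : ∀ u v, G.Adj u v → Dart D u v := by
      intro u v h
      obtain ⟨x, hx⟩ := hconn u (G.connected.2 _ (G.mem_faces.1 (hD habc)).mem.1 _
        (G.mem_verts _ _ h))
      exact hall _ _ hx _ h
    rcases G.outer_region with ⟨⟨u, v⟩, hp, he⟩ | ⟨he, -⟩
    · obtain ⟨c, h⟩ := hdart u v hp
      exact (G.mem_faces.1 (hD h)).2.1 (he ▸ ⟨0, rfl⟩)
    · exact (Set.ext_iff.1 he (a, b)).1 (G.mem_faces.1 (hD habc)).1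

theorem euler_faces : 2 * G.faces.card + 6 * G.verts.card = 3 * G.dartSet.card + 6 := by
  have heul := G.euler
  have hfin : (G.dartSet.filter fun p => p ∉ G.outer).card = G.faces.card := by
    symm
    refine card_bij (fun t _ => (t.1, t.2.1)) ?_ ?_ ?_
    · rintro ⟨a, b, c⟩ h
      rw [mem_faces] at h
      exact mem_filter.2 ⟨(G.mem_dartSet).2 h.1, h.2.1⟩
    · rintro ⟨a, b, c⟩ h ⟨a', b', c'⟩ h' he
      obtain ⟨rfl, rfl⟩ := Prod.mk.inj he
      rw [G.sys_faces.func _ _ _ _ h h']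
    · rintro ⟨a, b⟩ h
      obtain ⟨h1, h2⟩ := mem_filter.1 h
      exact ⟨(a, b, G.next a b), G.mem_faces.2 (clockwise_of_notMem (G.mem_dartSet.1 h1) h2), rfl⟩
  have hd : G.darts.ncard = G.dartSet.card := by
    rw [← Drawing.coe_dartSet, Set.ncard_coe_finset]
  rw [hd] at heul
  rcases G.outer_region with hreg | ⟨he, -⟩
  · have h3 : ((G.dartSet.filter fun p => p ∉ G.outer).image G.region).card * 3 = G.faces.card := by
      rw [← hfin, card_eq_sum_card_image G.region, sum_const_nat]
      intro R hR
      obtain ⟨⟨u, v⟩, hp, rfl⟩ := mem_image.1 hR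
      obtain ⟨h1, h2⟩ := mem_filter.1 hp
      have hT := clockwise_of_notMem (G.mem_dartSet.1 h1) h2
      set w := G.next u v with hw
      have hr : G.region (u, v) = {(u, v), (w, u), (v, w)} := by
        rw [G.region_eq_of_three (G.finite_triangle _ hT.1 h2)]
        simp only [Drawing.faceNext, hT.2.2.1, hT.2.2.2.2]
      have hset : (G.dartSet.filter fun p => p ∉ G.outer).filter
          (fun q => G.region q = G.region (u, v)) = {(u, v), (w, u), (v, w)} := by
        ext q
        rw [mem_filter, mem_filter]
        constructor
        · rintro ⟨-, h⟩
          have : q ∈ G.region q := ⟨0, rfl⟩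
          grind
        · intro h
          have hq : q ∈ G.region (u, v) := by rw [hr]; simpa using h
          refine ⟨?_, Drawing.region_eq hT.1 hq⟩
          simp only [mem_insert, mem_singleton] at h
          rcases h with rfl | rfl | rfl
          exacts [⟨h1, h2⟩, ⟨G.mem_dartSet.2 hT.rot.rot.1, hT.rot.rot.2.1⟩,
            ⟨G.mem_dartSet.2 hT.rot.1, hT.rot.2.1⟩]
      rw [hset]
      obtain ⟨n1, n2, n3⟩ := G.sys_faces.ne (G.mem_faces.2 hT)
      grind
    have hregs : G.regions = insert G.outer
        (((G.dartSet.filter fun p => p ∉ G.outer).image G.region : Finset _) : Set _) := by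
      ext R
      rw [Set.mem_insert_iff, mem_coe, mem_image]
      constructor
      · rintro ⟨p, hp, rfl⟩
        by_cases h : p ∈ G.outer
        exacts [.inl (G.region_eq_outer h),
          .inr ⟨p, mem_filter.2 ⟨by rwa [← mem_coe, Drawing.coe_dartSet], h⟩, rfl⟩]
      · rintro (rfl | ⟨p, hp, rfl⟩)
        · exact hreg
        · have := (mem_filter.1 hp).1
          rw [← mem_coe, Drawing.coe_dartSet] at this
          exact ⟨p, this, rfl⟩
    have hnot : G.outer ∉ (G.dartSet.filter fun p => p ∉ G.outer).image G.region := by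
      intro h
      obtain ⟨p, hp, he⟩ := mem_image.1 h
      exact (mem_filter.1 hp).2 (he ▸ ⟨0, rfl⟩)
    have hn : G.numRegions = ((G.dartSet.filter fun p => p ∉ G.outer).image G.region).card + 1 := by
      rw [Drawing.numRegions, hregs, ← coe_insert, Set.ncard_coe_finset,
        card_insert_of_notMem hnot]
      omega
    rw [hn] at heul
    omega
  · have h0 : G.dartSet = ∅ := by
      rw [← coe_eq_empty, Drawing.coe_dartSet, he]
    have h1 : G.faces.card = 0 := by rw [← hfin, h0]; rfl
    have hn : G.numRegions = 1 := by
      have : G.regions = ∅ := by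
        ext R
        simp [Drawing.regions, he]
      rw [Drawing.numRegions, this]; simp
    omega

end NearTriangulation

open Classical Finset

theorem reflTransGen_symm {β : Type*} {r : β → β → Prop} (hr : ∀ a b, r a b → r b a) {a b : β}
    (h : Relation.ReflTransGen r a b) : Relation.ReflTransGen r b a := by
  induction h with
  | refl => exact .refl
  | tail _ hbc ih => exact .head (hr _ _ hbc) ih

/-! ### First returns -/

/-- `b` is the first point after `a` of the orbit of `a` that satisfies `N`, provided `N b`. -/
def FirstReturn {α : Type*} (g : α → α) (N : α → Prop) (a b : α) : Prop :=
  ∃ k, 0 < k ∧ g^[k] a = b ∧ ∀ j, 0 < j → j < k → ¬ N (g^[j] a)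

theorem FirstReturn.eq_of_step {α : Type*} {g : α → α} {N : α → Prop} {a b : α}
    (h : FirstReturn g N a b) (h1 : N (g a)) : b = g a := by
  obtain ⟨k, hk, rfl, hj⟩ := h
  rcases (show k = 1 ∨ 1 < k by omega) with rfl | hk
  · rfl
  · exact absurd h1 (hj 1 one_pos hk)

theorem FirstReturn.of_step {α : Type*} {g : α → α} {N : α → Prop} {a b : α} (h : g a = b) :
    FirstReturn g N a b := ⟨1, one_pos, h, by omega⟩

section
variable {α : Type*} {g h : α → α} {M N : α → Prop}

theorem firstReturn_of_subset (hM : ∀ y, M y → M (h y) ∧ FirstReturn g M y (h y))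
    (hNM : ∀ y, N y → M y) {y b : α} (hy : M y) (hb : N b) (hr : FirstReturn g N y b) :
    FirstReturn h N y b := by
  obtain ⟨k, hk, he, hj⟩ := hr
  induction k using Nat.strong_induction_on generalizing y with
  | _ k ih =>
    obtain ⟨h1, k', hk', he', hj'⟩ := hM y hy
    rcases lt_trichotomy k' k with hlt | rfl | hlt
    · have hn : ¬ N (h y) := he' ▸ hj k' hk' hlt
      have hit : ∀ j, g^[j] (h y) = g^[j + k'] y := fun j => by
        rw [Function.iterate_add_apply, he']
      obtain ⟨m, hm, hme, hmj⟩ := ih (k - k') (by omega) h1 (by omega)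
        (by rw [hit, Nat.sub_add_cancel hlt.le, he])
        (fun j h2 h3 => by rw [hit]; exact hj _ (by omega) (by omega))
      refine ⟨m + 1, by omega, by rwa [Function.iterate_succ_apply], fun j h2 h3 => ?_⟩
      obtain ⟨j, rfl⟩ := Nat.exists_eq_succ_of_ne_zero h2.ne'
      rw [Function.iterate_succ_apply]
      rcases Nat.eq_zero_or_pos j with rfl | h4
      exacts [hn, hmj j h4 (by omega)]
    exacts [FirstReturn.of_step (he'.symm.trans he), absurd (hNM _ (he ▸ hb)) (hj' k hk hlt)]

theorem firstReturn_trans (hM : ∀ y, M y → M (h y) ∧ FirstReturn g M y (h y))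
    (hNM : ∀ y, N y → M y) {y b : α} (hy : M y) (hr : FirstReturn h N y b) :
    FirstReturn g N y b := by
  obtain ⟨m, hm, he, hj⟩ := hr
  induction m generalizing y with
  | zero => omega
  | succ m ih =>
    obtain ⟨h1, k', hk', he', hj'⟩ := hM y hy
    rcases Nat.eq_zero_or_pos m with rfl | hm0
    · exact ⟨k', hk', he'.trans he, fun j h2 h3 h4 => hj' j h2 h3 (hNM _ h4)⟩
    · have hn : ¬ N (h y) := hj 1 one_pos (by omega)
      obtain ⟨k, hk, hke, hkj⟩ := ih h1 hm0 (by rwa [Function.iterate_succ_apply] at he)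
        (fun j h2 h3 => by
          have := hj (j + 1) (by omega) (by omega)
          rwa [Function.iterate_succ_apply] at this)
      have hit : ∀ j, g^[j] (h y) = g^[j + k'] y := fun j => by
        rw [Function.iterate_add_apply, he']
      refine ⟨k + k', by omega, by rw [← hit, hke], fun j h2 h3 => ?_⟩
      rcases lt_trichotomy j k' with h4 | rfl | h4
      · grind
      · rwa [he']
      · have := hkj (j - k') (by omega) (by omega)
        grind

end

namespace NearTriangulation

open TriSys

variable {α : Type*} {G H : NearTriangulation α}

/-! ### Subdrawings -/

theorem IsSubdrawing.next_eq (h : H.IsSubdrawing G) {v a : α} (h1 : H.Adj v a)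
    (h2 : H.Adj v (G.next v a)) : H.next v a = G.next v a :=
  FirstReturn.eq_of_step (h.next v a h1) h2

/-- A finite region of `G` all of whose edges belong to `H` is not joined to the infinite region. -/
theorem ClockwiseTriangle.not_eqvGen {u v w : α} (hT : G.ClockwiseTriangle u v w)
    (h1 : H.Adj u v) (h2 : H.Adj v w) (h3 : H.Adj w u) {q : α × α} (hq : q ∈ G.outer) :
    ¬ Relation.EqvGen (RegionStep H G) q (u, v) := by
  intro hr
  obtain ⟨-, ho, e1, e2, e3⟩ := id hT
  have f1 : G.faceNext (u, v) = (w, u) := by rw [Drawing.faceNext, e1]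
  have f2 : G.faceNext (w, u) = (v, w) := by rw [Drawing.faceNext, e3]
  have f3 : G.faceNext (v, w) = (u, v) := by rw [Drawing.faceNext, e2]
  have hH : ∀ p, p = (u, v) ∨ p = (v, w) ∨ p = (w, u) → p ∈ H.darts := by
    rintro p (rfl | rfl | rfl)
    exacts [h1, h2, h3]
  have key : ∀ p q, Relation.EqvGen (RegionStep H G) p q →
      ((p = (u, v) ∨ p = (v, w) ∨ p = (w, u)) ↔ (q = (u, v) ∨ q = (v, w) ∨ q = (w, u))) := by
    intro p q hpq
    induction hpq with
    | rel p q hs =>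
      obtain ⟨hp, rfl | ⟨rfl, hn⟩⟩ := hs
      · constructor
        · grind
        · rintro (h4 | h4 | h4)
          exacts [.inr (.inl (G.injOn_faceNext hp hT.rot.1 (h4.trans f3.symm))),
            .inr (.inr (G.injOn_faceNext hp hT.rot.rot.1 (h4.trans f2.symm))),
            .inl (G.injOn_faceNext hp hT.1 (h4.trans f1.symm))]
      · exact ⟨fun h4 => absurd (hH _ h4) hn, fun h4 => absurd (H.symm _ _ (hH _ h4)) hn⟩
    | refl => rfl
    | symm _ _ _ ih => exact ih.symm
    | trans _ _ _ _ _ ih1 ih2 => exact ih1.trans ih2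
  rcases (key _ _ hr).2 (.inl rfl) with rfl | rfl | rfl
  exacts [ho hq, hT.rot.2.1 hq, hT.rot.rot.2.1 hq]

/-- A finite region of `G` all of whose edges belong to `H` is a finite region of `H`. -/
theorem IsSubdrawing.clockwise (h : H.IsSubdrawing G) {u v w : α} (hT : G.ClockwiseTriangle u v w)
    (h1 : H.Adj u v) (h2 : H.Adj v w) (h3 : H.Adj w u) : H.ClockwiseTriangle u v w := by
  obtain ⟨-, ho, e1, e2, e3⟩ := id hT
  refine ⟨h1, fun hout => ?_, (h.next_eq h1 (e1 ▸ H.symm _ _ h3)).trans e1,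
    (h.next_eq h2 (e2 ▸ H.symm _ _ h1)).trans e2, (h.next_eq h3 (e3 ▸ H.symm _ _ h2)).trans e3⟩
  obtain ⟨q, hq, hr⟩ := (h.outer _ h1).1 hout
  exact hT.not_eqvGen h1 h2 h3 hq hr

theorem IsInducedSubdrawing.clockwise (h : H.IsInducedSubdrawing G) {u v w : α}
    (hT : G.ClockwiseTriangle u v w) (h1 : u ∈ H.verts) (h2 : v ∈ H.verts) (h3 : w ∈ H.verts) :
    H.ClockwiseTriangle u v w :=
  h.toIsSubdrawing.clockwise hT (h.induced _ h1 _ h2 hT.1) (h.induced _ h2 _ h3 hT.rot.1)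
    (h.induced _ h3 _ h1 hT.rot.rot.1)

/-- A finite corner of `H` does not contain an edge to an outer vertex of `G` outside `H`. -/
theorem IsSubdrawing.next_mem (h : H.IsSubdrawing G) {v a u : α} (h1 : H.Adj v a)
    (h2 : (v, a) ∉ H.outer) (h3 : (G.next v a, u) ∈ G.outer) : G.next v a ∈ H.verts := by
  by_contra hy
  have hvy : G.Adj v (G.next v a) := G.next_adj _ _ (h.adj _ _ h1)
  have hn : ∀ b, ¬ H.Adj (G.next v a) b := fun b hb => hy (H.mem_verts _ _ hb)
  refine h2 ((h.outer _ h1).2 ⟨_, h3, ?_⟩)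
  have e1 : Relation.EqvGen (RegionStep H G) (v, a) (G.next v a, v) :=
    .rel _ _ ⟨h.adj _ _ h1, .inl rfl⟩
  have e2 : Relation.EqvGen (RegionStep H G) (G.next v a, v) (G.next v a, u) := by
    refine G.mem_of_next_closed
      (X := fun b => Relation.EqvGen (RegionStep H G) (G.next v a, v) (G.next v a, b)) ?_
      (G.symm _ _ hvy) (G.outer_subset h3) (.refl _)
    intro b hb hr
    refine .trans _ _ _ hr (.trans _ (G.next (G.next v a) b, G.next v a) _
      (.rel _ _ ⟨hb, .inl rfl⟩) (.rel _ _ ⟨G.symm _ _ (G.next_adj _ _ hb), .inr ⟨rfl, ?_⟩⟩))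
    exact fun h4 => hn _ (H.symm _ _ h4)
  exact (e1.trans _ _ _ e2).symm

/-! ### Drawings generated from an edge -/

/-- The finite regions with all vertices in `U`. -/
noncomputable def facesIn (G : NearTriangulation α) (U : Set α) : Finset (α × α × α) :=
  G.faces.filter fun t => t.1 ∈ U ∧ t.2.1 ∈ U ∧ t.2.2 ∈ U

theorem mem_facesIn {U : Set α} {a b c : α} : (a, b, c) ∈ G.facesIn U ↔
    G.ClockwiseTriangle a b c ∧ a ∈ U ∧ b ∈ U ∧ c ∈ U := by
  rw [facesIn, mem_filter, mem_faces]

theorem sys_facesIn (U : Set α) : Sys (G.facesIn U) :=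
  G.sys_faces.mono (filter_subset _ _) fun a b c h => by
    rw [mem_facesIn] at h ⊢
    exact ⟨h.1.rot, h.2.2.1, h.2.2.2, h.2.1⟩

/-- Starting from `z₀` and `z₁`, all vertices of `U` are reached by finite regions that satisfy `T`
and have two earlier vertices. -/
structure Generated (G : NearTriangulation α) (U : Set α) (z₀ z₁ : α) (T : α → α → α → Prop) :
    Prop where
  mem₀ : z₀ ∈ U
  mem₁ : z₁ ∈ U
  adj : G.Adj z₀ z₁
  third : ∃ y ∈ U, y ≠ z₀ ∧ y ≠ z₁
  clockwise : ∀ a b c, T a b c → G.ClockwiseTriangle a b c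
  gen : ∀ X : α → Prop, (∃ y ∈ U, X y) → ¬ X z₀ → ¬ X z₁ →
    ∃ a b c, T a b c ∧ a ∈ U ∧ b ∈ U ∧ c ∈ U ∧ X c ∧ ¬ X a ∧ ¬ X b

variable {U : Set α} {z₀ z₁ : α} {T : α → α → α → Prop}

theorem Generated.start (h : G.Generated U z₀ z₁ T) :
    ∃ a b c, T a b c ∧ c ∈ U ∧ ((a = z₀ ∧ b = z₁) ∨ (a = z₁ ∧ b = z₀)) := by
  obtain ⟨y, hy, h1⟩ := h.third
  obtain ⟨a, b, c, h2, -, -, h3, -, h4, h5⟩ := h.gen (fun y => y ≠ z₀ ∧ y ≠ z₁) ⟨y, hy, h1⟩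
    (by simp) (by simp)
  have hab : a ≠ b := fun he => G.loopless a (by
    have := (h.clockwise _ _ _ h2).1
    rwa [← he] at this)
  grind

theorem Generated.mem_verts (h : G.Generated U z₀ z₁ T) {v : α} :
    v ∈ TriSys.verts (G.facesIn U) ↔ v ∈ U := by
  rw [TriSys.mem_verts]
  constructor
  · rintro ⟨b, c, hv⟩
    exact (mem_facesIn.1 hv).2.1
  · intro hv
    have hR := (sys_facesIn (G := G) U).rot
    obtain ⟨a, b, c, h1, h2, h3⟩ := h.start
    have hm : (a, b, c) ∈ G.facesIn U := mem_facesIn.2 ⟨h.clockwise _ _ _ h1, by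
      rcases h3 with ⟨rfl, rfl⟩ | ⟨rfl, rfl⟩
      exacts [⟨h.mem₀, h.mem₁, h2⟩, ⟨h.mem₁, h.mem₀, h2⟩]⟩
    by_cases e0 : v = z₀
    · rcases h3 with ⟨rfl, rfl⟩ | ⟨rfl, rfl⟩
      exacts [⟨_, _, e0 ▸ hm⟩, ⟨_, _, e0 ▸ hR _ _ _ hm⟩]
    by_cases e1 : v = z₁
    · rcases h3 with ⟨rfl, rfl⟩ | ⟨rfl, rfl⟩
      exacts [⟨_, _, e1 ▸ hR _ _ _ hm⟩, ⟨_, _, e1 ▸ hm⟩]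
    obtain ⟨a, b, c, h1, h2, h3, h4, rfl, -⟩ := h.gen (fun y => y = v) ⟨v, hv, rfl⟩ (Ne.symm e0)
      (Ne.symm e1)
    exact ⟨_, _, hR _ _ _ (hR _ _ _ (mem_facesIn.2 ⟨h.clockwise _ _ _ h1, h2, h3, h4⟩))⟩

theorem Generated.conn (h : G.Generated U z₀ z₁ T) : Conn (G.facesIn U) := by
  have hface : ∀ {a b c}, T a b c → a ∈ U → b ∈ U → c ∈ U → (a, b, c) ∈ G.facesIn U :=
    fun h1 h2 h3 h4 => mem_facesIn.2 ⟨h.clockwise _ _ _ h1, h2, h3, h4⟩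
  have key : ∀ v ∈ U, Relation.ReflTransGen (Edge (G.facesIn U)) z₀ v := by
    by_contra hcon
    push Not at hcon
    obtain ⟨y, hy⟩ := hcon
    obtain ⟨a, b, c, h1, h2, h3, h4, h5, h6, -⟩ := h.gen
      (fun v => ¬ Relation.ReflTransGen (Edge (G.facesIn U)) z₀ v) ⟨y, hy⟩
      (not_not.2 .refl) (not_not.2 (by
        obtain ⟨a, b, c, h1, h2, ⟨rfl, rfl⟩ | ⟨rfl, rfl⟩⟩ := h.start
        exacts [.single (.inl ⟨c, hface h1 h.mem₀ h.mem₁ h2⟩),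
          .single (.inr ⟨c, hface h1 h.mem₁ h.mem₀ h2⟩)]))
    rw [not_not] at h6
    exact h5 (h6.tail (.inr ⟨b, (sys_facesIn U).rot _ _ _ ((sys_facesIn U).rot _ _ _
      (hface h1 h2 h3 h4))⟩))
  exact fun a ha b hb =>
    (reflTransGen_symm (fun _ _ h => Edge.symm h) (key a (h.mem_verts.1 ha))).trans
      (key b (h.mem_verts.1 hb))

theorem facesIn_verts : G.facesIn G.verts = G.faces := by
  ext ⟨a, b, c⟩
  rw [mem_facesIn, mem_faces]
  exact ⟨fun h => h.1, fun h => ⟨h, h.mem⟩⟩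

/-- In a generated drawing, every edge belongs to a finite region. -/
theorem Generated.edge (h : G.Generated G.verts z₀ z₁ T) {u v : α} (huv : G.Adj u v) :
    Edge G.faces u v := by
  by_contra hn
  have hc := h.conn
  have hv := fun v => h.mem_verts (v := v)
  rw [facesIn_verts] at hc hv
  refine hn (((G.sys_faces.graph_le (V := G.verts) (A := G.dartSet) (E := Edge G.faces)
    (fun a b h => ⟨G.mem_verts _ _ (G.mem_dartSet.1 h), G.mem_verts _ _ (G.symm _ _
      (G.mem_dartSet.1 h))⟩) ?_ (fun _ _ h => Edge.symm h) ?_ ⟨z₀, h.mem₀⟩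
      fun a ha b hb => hc a ((hv a).2 ha) b ((hv b).2 hb)).2 G.euler_faces).1 u v
      (G.mem_dartSet.2 huv) hn)
  all_goals
    rintro a b (⟨c, h⟩ | ⟨c, h⟩)
    exacts [G.mem_dartSet.2 (G.mem_faces.1 h).1, G.mem_dartSet.2 (G.symm _ _ (G.mem_faces.1 h).1)]

theorem Generated.c6_faces (h : G.Generated G.verts z₀ z₁ T) : c6 G.faces = 0 := by
  have h1 : edges G.faces = G.dartSet := by
    ext ⟨a, b⟩
    rw [mem_edges G.sys_faces.rot, Drawing.mem_dartSet]
    refine ⟨?_, h.edge⟩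
    rintro (⟨c, h⟩ | ⟨c, h⟩)
    exacts [(G.mem_faces.1 h).1, G.symm _ _ (G.mem_faces.1 h).1]
  have h2 : TriSys.verts G.faces = G.verts := by
    ext v
    have := h.mem_verts (v := v)
    rwa [facesIn_verts] at this
  have h3 := G.euler_faces
  rw [G.sys_faces.c6_eq, h1, h2]
  zify at h3
  linarith

/-- In a generated drawing, every vertex has at most one outer corner. -/
theorem Generated.outer_unique (h : G.Generated G.verts z₀ z₁ T) {v a b : α}
    (ha : (v, a) ∈ G.outer) (hb : (v, b) ∈ G.outer) : a = b := by
  have hS := G.sys_faces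
  set D := G.faces.filter fun t => t.1 ≠ v ∧ t.2.1 ≠ v ∧ t.2.2 ≠ v with hD
  have hDm : ∀ x y z, (x, y, z) ∈ D ↔ G.ClockwiseTriangle x y z ∧ x ≠ v ∧ y ≠ v ∧ z ≠ v := by
    intro x y z
    rw [hD, mem_filter, mem_faces]
  have hDS : Sys D := hS.mono (filter_subset _ _) fun x y z h => by
    rw [hDm] at h ⊢
    exact ⟨h.1.rot, h.2.2.1, h.2.2.2, h.2.1⟩
  set A := G.dartSet.filter fun p => p.1 ≠ v ∧ p.2 ≠ v with hA
  have hAm : ∀ x y, (x, y) ∈ A ↔ G.Adj x y ∧ x ≠ v ∧ y ≠ v := by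
    intro x y
    rw [hA, mem_filter, Drawing.mem_dartSet]
  have hvm : v ∈ G.verts := G.mem_verts _ _ (G.outer_subset ha)
  have hEs : ∀ x y, (x, y) ∈ A → (y, x) ∈ A := fun x y h => by
    rw [hAm] at h ⊢
    exact ⟨G.symm _ _ h.1, h.2.2, h.2.1⟩
  obtain ⟨r, hr, hrv⟩ : ∃ r, (r = z₀ ∨ r = z₁) ∧ r ≠ v := by
    by_cases h0 : z₀ = v
    · exact ⟨z₁, .inr rfl, fun h1 => G.loopless v (by have := h.adj; rwa [h0, h1] at this)⟩
    simp_all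
  have hreach : ∀ w ∈ G.verts.erase v, Relation.ReflTransGen (fun x y => (x, y) ∈ A) r w := by
    by_contra hcon
    push Not at hcon
    obtain ⟨w, hw, hw'⟩ := hcon
    have hz :
      ∀ z, z = z₀ ∨ z = z₁ → ¬ (z ≠ v ∧ ¬ Relation.ReflTransGen (fun x y => (x, y) ∈ A) r z) := by
      rintro z hz ⟨h1, h2⟩
      by_cases hzr : r = z
      · exact h2 (hzr ▸ .refl)
      · refine h2 (.single ((hAm _ _).2 ⟨?_, hrv, h1⟩))
        have := h.adj
        grind
    obtain ⟨x, y, z, h1, -, -, -, ⟨h2, h3⟩, h4, h5⟩ := h.gen (fun w => w ≠ v ∧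
      ¬ Relation.ReflTransGen (fun x y => (x, y) ∈ A) r w)
      ⟨w, mem_of_mem_erase hw, ne_of_mem_erase hw, hw'⟩ (hz _ (.inl rfl))
      (hz _ (.inr rfl))
    have hT := h.clockwise _ _ _ h1
    have hxy : x ≠ y := (hS.ne (G.mem_faces.2 hT)).1
    by_cases hxv : x = v
    · have hyv : y ≠ v := fun h => hxy (hxv.trans h.symm)
      exact h5 ⟨hyv, fun h6 => h3 (h6.tail ((hAm _ _).2 ⟨hT.rot.1, hyv, h2⟩))⟩
    · exact h4 ⟨hxv, fun h6 => h3 (h6.tail ((hAm _ _).2 ⟨G.symm _ _ hT.rot.rot.1, hxv, h2⟩))⟩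
  have hle := (hDS.graph_le (V := G.verts.erase v) (A := A) (E := fun x y => (x, y) ∈ A)
    (fun x y hxy => by
      rw [hAm] at hxy
      exact ⟨mem_erase.2 ⟨hxy.2.1, G.mem_verts _ _ hxy.1⟩,
        mem_erase.2 ⟨hxy.2.2, G.mem_verts _ _ (G.symm _ _ hxy.1)⟩⟩)
    (by
      rintro x y (⟨z, hz⟩ | ⟨z, hz⟩)
      · rw [hDm] at hz
        exact (hAm _ _).2 ⟨hz.1.1, hz.2.1, hz.2.2.1⟩
      · rw [hDm] at hz
        exact (hAm _ _).2 ⟨G.symm _ _ hz.1.1, hz.2.2.1, hz.2.1⟩)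
    hEs (fun _ _ h => h)
    ⟨r, mem_erase.2 ⟨hrv, by rcases hr with rfl | rfl; exacts [h.mem₀, h.mem₁]⟩⟩
    fun x hx y hy => (reflTransGen_symm hEs (hreach x hx)).trans (hreach y hy)).1
  have heu := G.euler_faces
  have hV := card_erase_add_one hvm
  -- the darts at `v`
  set N := G.dartSet.filter fun p => p.1 = v with hN
  have hAc : G.dartSet.card = A.card + 2 * N.card := by
    have h1 := card_filter_add_card_filter_not (s := G.dartSet) fun p => p.1 = v
    have h2 := card_filter_add_card_filter_not
      (s := G.dartSet.filter fun p => ¬ p.1 = v) fun p => p.2 = v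
    have h3 : ((G.dartSet.filter fun p => ¬ p.1 = v).filter fun p => p.2 = v).card = N.card := by
      refine card_nbij' Prod.swap Prod.swap ?_ ?_ (fun _ _ => rfl) (fun _ _ => rfl)
      · rintro ⟨x, y⟩ hxy
        simp only [coe_filter, Set.mem_setOf_eq, mem_filter, Drawing.mem_dartSet] at hxy
        simp only [hN, coe_filter, Set.mem_setOf_eq, Prod.swap_prod_mk, Drawing.mem_dartSet]
        exact ⟨G.symm _ _ hxy.1.1, hxy.2⟩
      · rintro ⟨x, y⟩ hxy
        simp only [hN, coe_filter, Set.mem_setOf_eq, Drawing.mem_dartSet] at hxy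
        simp only [coe_filter, Set.mem_setOf_eq, mem_filter, Prod.swap_prod_mk, Drawing.mem_dartSet]
        refine ⟨⟨G.symm _ _ hxy.1, fun h => G.loopless v ?_⟩, hxy.2⟩
        grind
    have h4 : (G.dartSet.filter fun p => ¬ p.1 = v).filter (fun p => ¬ p.2 = v) = A := by
      rw [filter_filter]
    grind
  have hFc : G.faces.card = D.card + 3 * (G.faces.filter fun t => t.1 = v).card := by
    have hrot : ∀ (q : α × α × α → Prop), (G.faces.filter fun t => q (rot t)).card =
        (G.faces.filter q).card := by
      intro q
      refine card_nbij' rot (fun t => rot (rot t)) ?_ ?_ (fun _ _ => rfl) (fun _ _ => rfl)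
      · rintro ⟨x, y, z⟩ hx
        simp only [coe_filter, Set.mem_setOf_eq] at hx ⊢
        exact ⟨hS.rot _ _ _ hx.1, hx.2⟩
      · rintro ⟨x, y, z⟩ hx
        simp only [coe_filter, Set.mem_setOf_eq] at hx ⊢
        exact ⟨hS.rot _ _ _ (hS.rot _ _ _ hx.1), hx.2⟩
    have h1 := card_filter_add_card_filter_not (s := G.faces) fun t => t.1 = v
    have h2 := card_filter_add_card_filter_not
      (s := G.faces.filter fun t => ¬ t.1 = v) fun t => t.2.1 = v
    have h3 := card_filter_add_card_filter_not
      (s := (G.faces.filter fun t => ¬ t.1 = v).filter fun t => ¬ t.2.1 = v) fun t => t.2.2 = v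
    have h4 : ((G.faces.filter fun t => ¬ t.1 = v).filter fun t => t.2.1 = v) =
        G.faces.filter fun t => (rot t).1 = v := by
      ext ⟨x, y, z⟩
      refine ⟨fun h => ?_, fun h => ?_⟩ <;> obtain ⟨h1, h2⟩ := mem_filter.1 h
      exacts [mem_filter.2 ⟨(mem_filter.1 h1).1, h2⟩,
        mem_filter.2 ⟨mem_filter.2 ⟨h1, fun h' => (hS.ne h1).1 (h'.trans h2.symm)⟩, h2⟩]
    have h5 : (((G.faces.filter fun t => ¬ t.1 = v).filter fun t => ¬ t.2.1 = v).filter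
        fun t => t.2.2 = v) = G.faces.filter fun t => (rot (rot t)).1 = v := by
      ext ⟨x, y, z⟩
      refine ⟨fun h => ?_, fun h => ?_⟩ <;> obtain ⟨h1, h2⟩ := mem_filter.1 h
      · exact mem_filter.2 ⟨(mem_filter.1 (mem_filter.1 h1).1).1, h2⟩
      · exact mem_filter.2 ⟨mem_filter.2 ⟨mem_filter.2 ⟨h1, fun h' =>
          (hS.ne h1).2.2 (h2.trans h'.symm)⟩, fun h' => (hS.ne h1).2.1 (h'.trans h2.symm)⟩, h2⟩
    have h6 : ((G.faces.filter fun t => ¬ t.1 = v).filter fun t => ¬ t.2.1 = v).filter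
        (fun t => ¬ t.2.2 = v) = D := by
      rw [hD, filter_filter, filter_filter]
    rw [h4, hrot fun t => t.1 = v] at h2
    rw [h5, hrot fun t => (rot t).1 = v, hrot fun t => t.1 = v, h6] at h3
    omega
  have hNc : (N.filter fun p => p ∈ G.outer).card + (G.faces.filter fun t => t.1 = v).card =
      N.card := by
    rw [← card_filter_add_card_filter_not (s := N) fun p => p ∈ G.outer]
    congr 1
    refine card_bij (fun t _ => (t.1, t.2.1)) ?_ ?_ ?_
    · rintro ⟨x, y, z⟩ hx
      obtain ⟨h1, h2⟩ := mem_filter.1 hx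
      rw [mem_faces] at h1
      exact mem_filter.2 ⟨mem_filter.2 ⟨G.mem_dartSet.2 h1.1, h2⟩, h1.2.1⟩
    · rintro ⟨x, y, z⟩ hx ⟨x', y', z'⟩ hx' he
      obtain ⟨rfl, rfl⟩ := Prod.mk.inj he
      rw [hS.func _ _ _ _ (mem_filter.1 hx).1 (mem_filter.1 hx').1]
    · rintro ⟨x, y⟩ hxy
      obtain ⟨h1, h2⟩ := mem_filter.1 hxy
      obtain ⟨h1, h3⟩ := mem_filter.1 h1
      exact ⟨(x, y, G.next x y), mem_filter.2
        ⟨G.mem_faces.2 (clockwise_of_notMem (G.mem_dartSet.1 h1) h2), h3⟩, rfl⟩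
  have hone : (N.filter fun p => p ∈ G.outer).card ≤ 1 := by omega
  have hmem : ∀ x, (v, x) ∈ G.outer → (v, x) ∈ N.filter fun p => p ∈ G.outer := fun x hx =>
    mem_filter.2 ⟨mem_filter.2 ⟨G.mem_dartSet.2 (G.outer_subset hx), rfl⟩, hx⟩
  exact (Prod.mk.inj (card_le_one.1 hone _ (hmem a ha) _ (hmem b hb))).2

end NearTriangulation

/-! ### The skeleton of an axle as a wheel -/

open Classical Wheel Wheel.KV Wheel.Fc Finset

namespace Wheel

variable {d : ℕ} (W : Fan d)

/-- The vertices of the wheel. -/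
def Fan.Vert : KV d → Prop
  | r i m => W.fan i ∧ 0 < m ∧ m < W.g i
  | _ => True

variable {W}

theorem vert_rho {i : ZMod d} {m : ℕ} (hf : W.fan i) (hm : m ≤ W.g i) : W.Vert (W.rho i m) := by
  unfold Fan.rho
  split_ifs with h1 h2
  · trivial
  · trivial
  · exact ⟨hf, by omega, by omega⟩

theorem vert_of_isFace {a b c : KV d} (h : W.IsFace a b c) : W.Vert a ∧ W.Vert b ∧ W.Vert c := by
  obtain ⟨F, hF, h⟩ := h
  have key : W.Vert (W.nodes F).1 ∧ W.Vert (W.nodes F).2.1 ∧ W.Vert (W.nodes F).2.2 := by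
    rcases F with i | i | ⟨i, m⟩
    exacts [⟨trivial, trivial, trivial⟩, ⟨trivial, trivial, trivial⟩,
      ⟨trivial, vert_rho hF.1 hF.2.le, vert_rho hF.1 hF.2⟩]
  rcases h with h | h | h <;> rw [h] at key
  exacts [key, ⟨key.2.2, key.1, key.2.1⟩, ⟨key.2.1, key.2.2, key.1⟩]

theorem Fan.IsFace.rot {a b c : KV d} (h : W.IsFace a b c) : W.IsFace b c a :=
  h.imp fun _ h => ⟨h.1, h.2.rot⟩

theorem isFace_nodes {F : Fc d} (h : W.Valid F) :
    W.IsFace (W.nodes F).1 (W.nodes F).2.1 (W.nodes F).2.2 := ⟨F, h, .inl rfl⟩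

def zone : KV d → ZMod d
  | hub => 0
  | s i => i
  | h i => i
  | r i _ => i

def depth (W : Fan d) : KV d → ℕ
  | h i => W.g i
  | r _ m => m
  | _ => 0

/-- The boundary of the wheel is directed. -/
theorem boundary_dart {a b c : KV d} (hf : W.IsFace a b c) (hn : ∀ w, ¬ W.IsFace b a w) :
    (zone b = zone a ∧ depth W a < depth W b) ∨ zone b = zone a + 1 := by
  obtain ⟨F, hF, hat⟩ := hf
  have hT := fun i => isFace_nodes (W := W) (F := t i) trivial
  have hE := fun i => isFace_nodes (W := W) (F := e i) trivial
  rcases F with i | i | ⟨i, m⟩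
  · exfalso
    rcases hat with hat | hat | hat <;> simp only [Fan.nodes, Prod.mk.injEq] at hat <;>
      obtain ⟨rfl, rfl, rfl⟩ := hat
    · have := (hT (i - 1)).rot.rot
      simp only [Fan.nodes, sub_add_cancel] at this
      exact hn _ this
    exacts [hn _ (hT (i + 1)), hn _ (hE i).rot.rot]
  · rcases hat with hat | hat | hat <;> simp only [Fan.nodes, Prod.mk.injEq] at hat <;>
      obtain ⟨rfl, rfl, rfl⟩ := hat
    exacts [.inl ⟨rfl, W.pos i⟩, (hn _ (hT i).rot).elim, .inr rfl]
  · obtain ⟨hfan, hm⟩ := hF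
    have hP := fun m (hm : m < W.g i) => isFace_nodes (W := W) (F := p i m) ⟨hfan, hm⟩
    rcases hat with hat | hat | hat <;> simp only [Fan.nodes, Prod.mk.injEq] at hat <;>
      obtain ⟨rfl, rfl, rfl⟩ := hat
    · exfalso
      rcases Nat.eq_zero_or_pos m with rfl | h0
      · have := (hE (i - 1)).rot
        simp only [Fan.nodes, sub_add_cancel] at this
        simp_all
      · have := (hP (m - 1) (by omega)).rot.rot
        simp only [Fan.nodes, Nat.sub_add_cancel h0] at this
        exact hn _ this
    · exfalso
      rcases (show m + 1 = W.g i ∨ m + 1 < W.g i by omega) with h1 | h1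
      · have := hE i
        simp only [Fan.nodes] at this
        simp_all
      · exact hn _ (hP _ h1)
    · have hcol : zone (W.rho i (m + 1)) = i ∧ depth W (W.rho i (m + 1)) = m + 1 := by
        rcases (show m + 1 = W.g i ∨ m + 1 < W.g i by omega) with h1 | h1
        · rw [h1, Fan.rho_g]; exact ⟨rfl, rfl⟩
        · rw [Fan.rho_inner _ (by omega) h1]; exact ⟨rfl, rfl⟩
      rw [hcol.1, hcol.2]
      rcases Nat.eq_zero_or_pos m with rfl | h0
      · rw [Fan.rho_zero]; exact .inr (sub_add_cancel _ _).symm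
      · rw [Fan.rho_inner _ h0 hm]; exact .inl ⟨rfl, Nat.lt_succ_self m⟩

end Wheel

namespace Axle

variable {d : ℕ} (A : Axle d)

theorem u_cases {i : ℕ} (hi : i ∈ Finset.Icc 1 d) :
    A.u i = 5 ∨ A.u i = 6 ∨ A.u i = 7 ∨ A.u i = 8 ∨ A.u i = 12 := by
  have := A.u_mem i (mem_Icc.2 (by have := mem_Icc.1 hi; omega))
  simpa using this

theorem raise_hasFan_iff {i : ℕ} (hi : i ∈ Finset.Icc 1 d) : A.raise.HasFan i ↔ A.u i ≤ 8 := by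
  have h1 := mem_Icc.1 hi
  have hl := A.l_mem i (mem_Icc.2 (by omega))
  have hu := A.u_cases hi
  simp only [mem_insert, mem_singleton] at hl
  simp only [HasFan, raise]
  split_ifs <;> omega

theorem spoke_mem [NeZero d] (i : ZMod d) : i.val + 1 ∈ Finset.Icc 1 d :=
  mem_Icc.2 ⟨by omega, ZMod.val_lt i⟩

theorem exists_spoke [NeZero d] {k : ℕ} (hk : k ∈ Finset.Icc 1 d) : ∃ i :
    ZMod d, k = i.val + 1 := by
  have := mem_Icc.1 hk
  exact ⟨((k - 1 : ℕ) : ZMod d), by rw [ZMod.val_cast_of_lt] <;> omega⟩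

/-- The wheel of the skeleton. -/
def wheel (h5 : 5 ≤ d) : Fan d where
  g i := if A.u (i.val + 1) ≤ 8 then A.u (i.val + 1) - 4 else 1
  fan i := A.u (i.val + 1) ≤ 8
  pos i := by
    have : NeZero d := ⟨by omega⟩
    have := A.u_cases (spoke_mem i)
    split_ifs <;> omega
  five_le := h5
  g_eq_one i h := if_neg h

/-- The number of a vertex of the wheel. -/
def label : KV d → ℕ
  | hub => 0
  | s i => i.val + 1
  | h i => d + (i.val + 1)
  | r i m => (m + 1) * d + (i.val + 1)

theorem label_succ (h5 : 5 ≤ d) (i : ZMod d) : succSpoke d (i.val + 1) = (i + 1).val + 1 := by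
  have : NeZero d := ⟨by omega⟩
  have : Fact (1 < d) := ⟨by omega⟩
  have h1 := ZMod.val_lt i
  unfold succSpoke
  rw [ZMod.val_add, ZMod.val_one]
  split_ifs with h2
  · rw [h2, Nat.mod_self]
  · rw [Nat.mod_eq_of_lt (by omega)]

theorem label_hatBefore (h5 : 5 ≤ d) (i : ZMod d) :
    hatBefore d (i.val + 1) = d + ((i - 1).val + 1) := by
  have : NeZero d := ⟨by omega⟩
  have := label_succ h5 (i - 1)
  rw [sub_add_cancel] at this
  have h2 := ZMod.val_lt (i - 1)
  unfold succSpoke at this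
  unfold hatBefore
  split_ifs at this ⊢ <;> omega

theorem label_rho (h5 : 5 ≤ d) {i : ZMod d} (hf : (A.wheel h5).fan i) {m : ℕ}
    (hm : m ≤ (A.wheel h5).g i) : A.raise.rim (i.val + 1) m = label ((A.wheel h5).rho i m) := by
  have : NeZero d := ⟨by omega⟩
  have hg : (A.wheel h5).g i = A.u (i.val + 1) - 4 := if_pos hf
  have hu := A.u_cases (spoke_mem i)
  change (if m = 0 then hatBefore d (i.val + 1) else if m + 5 ≤ A.u (i.val + 1) then
    (m + 1) * d + (i.val + 1) else d + (i.val + 1)) = _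
  unfold Fan.rho
  split_ifs with h1 h2 h3 h3
  · exact label_hatBefore h5 i
  · omega
  · rfl
  · rfl
  · omega

theorem partTriangle_iff (h5 : 5 ≤ d) {x y z : ℕ} : A.raise.PartTriangle x y z ↔
    ∃ F, (A.wheel h5).Valid F ∧ TriSys.mapT label ((A.wheel h5).nodes F) = (x, y, z) := by
  have : NeZero d := ⟨by omega⟩
  have hg : ∀ {i : ZMod d}, (A.wheel h5).fan i → (A.wheel h5).g i = A.u (i.val + 1) - 4 :=
    fun h => if_pos h
  constructor
  · rintro (⟨k, hk⟩ | ⟨k, hk⟩ | ⟨k, m, hk, hf, hm⟩) <;> obtain ⟨i, rfl⟩ := exists_spoke hk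
    · exact ⟨t i, trivial, by rw [label_succ h5]; rfl⟩
    · exact ⟨e i, trivial, by rw [label_succ h5]; rfl⟩
    · have hf' : (A.wheel h5).fan i := (A.raise_hasFan_iff hk).1 hf
      have hm' : m + 5 ≤ A.u (i.val + 1) := hm
      have := hg hf'
      exact ⟨p i m, ⟨hf', by omega⟩, by
        rw [A.label_rho h5 hf' (by omega), A.label_rho h5 hf' (by omega)]; rfl⟩
  · rintro ⟨F, hF, he⟩
    rcases F with i | i | ⟨i, m⟩ <;> obtain ⟨rfl, h2⟩ := Prod.mk.inj he <;>
      obtain ⟨rfl, rfl⟩ := Prod.mk.inj h2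
    · have := PartTriangle.hub (A := A.raise) _ (spoke_mem i)
      rwa [label_succ h5] at this
    · have := PartTriangle.hat (A := A.raise) _ (spoke_mem i)
      rwa [label_succ h5] at this
    · have hu := A.u_cases (spoke_mem i)
      have h3 := hg hF.1
      have h4 := hF.2
      have := PartTriangle.fan (A := A.raise) _ m (spoke_mem i)
        ((A.raise_hasFan_iff (spoke_mem i)).2 hF.1) (show m + 5 ≤ A.u (i.val + 1) by omega)
      rwa [A.label_rho h5 hF.1 hF.2.le, A.label_rho h5 hF.1 hF.2] at this

theorem label_injOn (h5 : 5 ≤ d) : Set.InjOn label {k : KV d | (A.wheel h5).Vert k} := by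
  have : NeZero d := ⟨by omega⟩
  have key : ∀ {q q' : ℕ} {i i' : ZMod d}, q * d + (i.val + 1) = q' * d + (i'.val + 1) →
      q = q' ∧ i = i' := by
    intro q q' i i' h
    have h1 := ZMod.val_lt i
    have h2 := ZMod.val_lt i'
    have h3 : q = q' := by
      have e1 : (i.val + d * q) / d = q := by
        rw [Nat.add_mul_div_left _ _ (by omega), Nat.div_eq_of_lt h1, Nat.zero_add]
      have e2 : (i'.val + d * q') / d = q' := by
        rw [Nat.add_mul_div_left _ _ (by omega), Nat.div_eq_of_lt h2, Nat.zero_add]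
      grind
    subst h3
    exact ⟨rfl, ZMod.val_injective d (by omega)⟩
  have form : ∀ k : KV d, k = hub ∨ ∃ q i, label k = q * d + (i.val + 1) ∧
      ((q = 0 ∧ k = s i) ∨ (q = 1 ∧ k = h i) ∨ ∃ m, q = m + 1 ∧ k = r i m) := by
    rintro (_ | i | i | ⟨i, m⟩)
    exacts [.inl rfl, .inr ⟨0, i, by simp [label], .inl ⟨rfl, rfl⟩⟩,
      .inr ⟨1, i, by simp [label], .inr (.inl ⟨rfl, rfl⟩)⟩,
      .inr ⟨m + 1, i, rfl, .inr (.inr ⟨m, rfl, rfl⟩)⟩]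
  intro k hk k' hk' he
  rcases form k with rfl | ⟨q, i, h1, h2⟩ <;> rcases form k' with rfl | ⟨q', i', h1', h2'⟩
  · rfl
  · rw [h1'] at he; simp [label] at he
  · rw [h1] at he; simp [label] at he
  · obtain ⟨rfl, rfl⟩ := key (h1.symm.trans (he.trans h1'))
    rcases h2 with ⟨hq, rfl⟩ | ⟨hq, rfl⟩ | ⟨m, hq, rfl⟩ <;>
      rcases h2' with ⟨hq', rfl⟩ | ⟨hq', rfl⟩ | ⟨m', hq', rfl⟩ <;>
      first
      | rfl
      | omega
      | (have := hk.2.1; omega)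
      | (have := hk'.2.1; omega)
      | (obtain rfl : m = m' := by omega
         rfl)

theorem label_mem (h5 : 5 ≤ d) {x : ℕ} :
    A.raise.IsPartVertex x ↔ ∃ k, (A.wheel h5).Vert k ∧ label k = x := by
  have : NeZero d := ⟨by omega⟩
  constructor
  · rintro (hx | ⟨k, hk, j, hj, hf, hu, rfl⟩)
    · rcases Nat.eq_zero_or_pos x with rfl | h0
      · exact ⟨hub, trivial, rfl⟩
      · by_cases h1 : x ≤ d
        · obtain ⟨i, rfl⟩ := exists_spoke (mem_Icc.2 ⟨h0, h1⟩)
          exact ⟨s i, trivial, rfl⟩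
        · obtain ⟨i, hi⟩ := exists_spoke (d := d) (k := x - d) (mem_Icc.2 (by omega))
          exact ⟨h i, trivial, show d + (i.val + 1) = x by omega⟩
    · obtain ⟨i, rfl⟩ := exists_spoke hk
      have hf' : (A.wheel h5).fan i := (A.raise_hasFan_iff hk).1 hf
      have hg : (A.wheel h5).g i = A.u (i.val + 1) - 4 := if_pos hf'
      have hu' : j + 4 ≤ A.u (i.val + 1) := hu
      exact ⟨r i (j - 1), ⟨hf', by omega, by omega⟩, by rw [label, Nat.sub_add_cancel (by omega)]⟩
  · rintro ⟨k, hk, rfl⟩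
    rcases k with _ | i | i | ⟨i, m⟩
    · exact .inl (Nat.zero_le _)
    · exact .inl (by have := ZMod.val_lt i; simp only [label]; omega)
    · exact .inl (by have := ZMod.val_lt i; simp only [label]; omega)
    · obtain ⟨h1, h2, h3⟩ := hk
      have hg : (A.wheel h5).g i = A.u (i.val + 1) - 4 := if_pos h1
      exact .inr ⟨i.val + 1, spoke_mem i, m + 1, by omega,
        (A.raise_hasFan_iff (spoke_mem i)).2 h1, show m + 1 + 4 ≤ A.u (i.val + 1) by omega, rfl⟩

namespace IsSkeleton

variable {A} {K : Configuration ℕ} (hK : A.IsSkeleton K)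

include hK

theorem hub_mem : 0 ∈ K.verts := (hK.verts 0).2 (.inl (Nat.zero_le _))

theorem le_degree : 5 ≤ d := by
  have := K.five_le 0 hK.hub_mem
  rwa [hK.hub] at this

theorem mem_verts {x : ℕ} : x ∈ K.verts ↔ ∃ k, (A.wheel hK.le_degree).Vert k ∧ label k = x :=
  (hK.verts x).trans (A.label_mem _)

theorem clockwise {a b c : KV d} (h : (A.wheel hK.le_degree).IsFace a b c) :
    K.ClockwiseTriangle (label a) (label b) (label c) := by
  obtain ⟨F, hF, h⟩ := h
  have key : ∀ x y z, (A.wheel hK.le_degree).nodes F = (x, y, z) →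
      K.ClockwiseTriangle (label x) (label y) (label z) := fun x y z h =>
    hK.triangle _ _ _ ((A.partTriangle_iff hK.le_degree).2 ⟨F, hF, by rw [h]; rfl⟩)
  rcases h with h | h | h
  exacts [key _ _ _ h, (key _ _ _ h).rot.rot, (key _ _ _ h).rot]

theorem adj_cases {x y : ℕ} (h : K.Adj x y) : ∃ a b c, label a = x ∧ label b = y ∧
    ((A.wheel hK.le_degree).IsFace a b c ∨ (A.wheel hK.le_degree).IsFace b a c) := by
  obtain ⟨x', y', z', hT, hne, hx, hy⟩ := (hK.adj x y).1 h
  obtain ⟨F, hF, he⟩ := (A.partTriangle_iff hK.le_degree).1 hT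
  obtain ⟨h1, h2⟩ := Prod.mk.inj he
  obtain ⟨h2, h3⟩ := Prod.mk.inj h2
  subst h1 h2 h3
  have hf := isFace_nodes hF
  simp only [Set.mem_insert_iff, Set.mem_singleton_iff] at hx hy
  rcases hx with rfl | rfl | rfl <;> rcases hy with rfl | rfl | rfl <;> first
    | exact absurd rfl hne
    | exact ⟨_, _, _, rfl, rfl, .inl hf⟩
    | exact ⟨_, _, _, rfl, rfl, .inl hf.rot⟩
    | exact ⟨_, _, _, rfl, rfl, .inl hf.rot.rot⟩
    | exact ⟨_, _, _, rfl, rfl, .inr hf⟩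
    | exact ⟨_, _, _, rfl, rfl, .inr hf.rot⟩
    | exact ⟨_, _, _, rfl, rfl, .inr hf.rot.rot⟩

theorem isFace {a b c : KV d} (ha : (A.wheel hK.le_degree).Vert a)
    (hb : (A.wheel hK.le_degree).Vert b) (hc : (A.wheel hK.le_degree).Vert c)
    (h : K.ClockwiseTriangle (label a) (label b) (label c)) :
      (A.wheel hK.le_degree).IsFace a b c := by
  have hi := A.label_injOn hK.le_degree
  have hone : ∀ {a b c : KV d}, (A.wheel hK.le_degree).Vert a → (A.wheel hK.le_degree).Vert b →
      (A.wheel hK.le_degree).Vert c → K.ClockwiseTriangle (label a) (label b) (label c) →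
      (∃ w, (A.wheel hK.le_degree).IsFace a b w) → (A.wheel hK.le_degree).IsFace a b c := by
    rintro a b c ha hb hc h ⟨w, hw⟩
    have := hi hc (vert_of_isFace hw).2.2 (h.2.2.1.symm.trans (hK.clockwise hw).2.2.1)
    rwa [this]
  by_cases h1 : ∃ w, (A.wheel hK.le_degree).IsFace a b w
  · exact hone ha hb hc h h1
  by_cases h2 : ∃ w, (A.wheel hK.le_degree).IsFace b c w
  · exact (hone hb hc ha h.rot h2).rot.rot
  by_cases h3 : ∃ w, (A.wheel hK.le_degree).IsFace c a w
  · exact (hone hc ha hb h.rot.rot h3).rot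
  exfalso
  push Not at h1 h2 h3
  have hrev : ∀ {a b : KV d}, (A.wheel hK.le_degree).Vert a → (A.wheel hK.le_degree).Vert b →
      K.Adj (label a) (label b) → (∀ w, ¬ (A.wheel hK.le_degree).IsFace a b w) →
      (zone a = zone b ∧ depth (A.wheel hK.le_degree) b < depth (A.wheel hK.le_degree) a) ∨
        zone a = zone b + 1 := by
    intro a b ha hb hab hn
    obtain ⟨a', b', w, e1, e2, hf | hf⟩ := hK.adj_cases hab
    · obtain rfl := hi (vert_of_isFace hf).1 ha e1
      obtain rfl := hi (vert_of_isFace hf).2.1 hb e2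
      exact absurd hf (hn w)
    · obtain rfl := hi (vert_of_isFace hf).2.1 ha e1
      obtain rfl := hi (vert_of_isFace hf).1 hb e2
      exact boundary_dart hf hn
  have hw := (A.wheel hK.le_degree).cast_ne_zero (k := 1) (by omega) (by omega)
  have hw2 := (A.wheel hK.le_degree).cast_ne_zero (k := 2) (by omega) (by omega)
  have hw3 := (A.wheel hK.le_degree).cast_ne_zero (k := 3) (by omega) (by omega)
  push_cast at hw hw2 hw3
  rcases hrev ha hb h.1 h1 with k1 | k1 <;> rcases hrev hb hc h.rot.1 h2 with k2 | k2 <;>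
    rcases hrev hc ha h.rot.rot.1 h3 with k3 | k3
  · omega
  exacts [hw (by linear_combination -k1.1 - k2.1 - k3),
    hw (by linear_combination -k1.1 - k2 - k3.1), hw2 (by linear_combination -k1.1 - k2 - k3),
    hw (by linear_combination -k1 - k2.1 - k3.1), hw2 (by linear_combination -k1 - k2.1 - k3),
    hw2 (by linear_combination -k1 - k2 - k3.1), hw3 (by linear_combination -k1 - k2 - k3)]

end IsSkeleton

end Axle

/-! ### Discs of triangles in the skeleton -/

open Classical TriSys Wheel Wheel.KV Wheel.Fc Finset

theorem Wheel.valid_Φ {d : ℕ} {W : Fan d} {i : ZMod d} (hf : W.fan i) {j : ℕ} (hj : j < W.g i + 4) :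
    W.Valid (W.Φ i j) := by
  rcases W.pos_cases hj with rfl | ⟨m, hm, rfl⟩ | rfl | rfl | rfl
  · rw [Fan.Φ_zero]; trivial
  · rw [W.Φ_succ hm]; exact ⟨hf, hm⟩
  · rw [Fan.Φ_g1]; trivial
  · rw [Fan.Φ_g2]; trivial
  · rw [Fan.Φ_g3]; trivial

namespace Axle.IsSkeleton

variable {d : ℕ} {A : Axle d} {K : Configuration ℕ} (hK : A.IsSkeleton K)

include hK

theorem isFace_of_adj {a b : KV d} (ha : (A.wheel hK.le_degree).Vert a)
    (hb : (A.wheel hK.le_degree).Vert b) (h : K.Adj (label a) (label b)) :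
    ∃ c, (A.wheel hK.le_degree).IsFace a b c ∨ (A.wheel hK.le_degree).IsFace b a c := by
  have hi := A.label_injOn hK.le_degree
  obtain ⟨a', b', w, e1, e2, hf⟩ := hK.adj_cases h
  have hv : (A.wheel hK.le_degree).Vert a' ∧ (A.wheel hK.le_degree).Vert b' := by
    rcases hf with hf | hf
    exacts [⟨(vert_of_isFace hf).1, (vert_of_isFace hf).2.1⟩,
      ⟨(vert_of_isFace hf).2.1, (vert_of_isFace hf).1⟩]
  obtain rfl := hi hv.1 ha e1
  obtain rfl := hi hv.2 hb e2
  exact ⟨w, hf⟩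

theorem hub_adj {b : KV d} (hb : (A.wheel hK.le_degree).Vert b) (h : K.Adj 0 (label b)) :
    ∃ j, b = s j := by
  obtain ⟨c, ⟨F, -, h⟩ | ⟨F, -, h⟩⟩ := hK.isFace_of_adj (a := KV.hub) trivial hb h
  · obtain ⟨j, -, rfl, -⟩ := (A.wheel hK.le_degree).at_hub.1 h
    exact ⟨j, rfl⟩
  · obtain ⟨j, -, -, rfl⟩ := (A.wheel hK.le_degree).at_hub.1 h.rot
    exact ⟨j + 1, rfl⟩

theorem spoke_adj {i : ZMod d} {b : KV d} (hb : (A.wheel hK.le_degree).Vert b)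
    (h : K.Adj (label (s i)) (label b)) :
    ∃ j < (A.wheel hK.le_degree).g i + 4, b = (A.wheel hK.le_degree).X i j := by
  obtain ⟨c, ⟨F, hF, h⟩ | ⟨F, hF, h⟩⟩ := hK.isFace_of_adj (a := s i) trivial hb h
  · obtain ⟨j, hj, -, rfl, -⟩ := ((A.wheel hK.le_degree).at_spoke hF).1 h
    exact ⟨j, hj, rfl⟩
  · obtain ⟨j, hj, -, -, rfl⟩ := ((A.wheel hK.le_degree).at_spoke hF).1 h.rot
    exact ⟨_, nx_lt hj, X_nx.symm⟩

/-- A generated disc of triangles is mapped to the skeleton, if its vertices have the right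
degrees. -/
theorem clockwise_of_disc {α : Type*} {G : NearTriangulation α} {U : Set α} {z₀ z₁ : α} {f : α → ℕ}
    (hfi : Set.InjOn f U) (hfU : ∀ v ∈ U, f v ∈ K.verts)
    (hgen : G.Generated U z₀ z₁ fun a b c =>
      G.ClockwiseTriangle a b c ∧ K.ClockwiseTriangle (f a) (f b) (f c))
    (hc6 : c6 (G.facesIn U) = 0)
    (hlink : ∀ v ∈ U, ∀ S : Finset α, S.Nonempty → (∀ a ∈ S, ∃ b ∈ S, (v, a, b) ∈ G.facesIn U) →
      S.card = K.γ (f v))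
    (hclose : ∀ v ∈ U, ∀ (a : ℕ → α) (m : ℕ), m = K.γ (f v) → Set.InjOn a (Set.Iio m) →
      (∀ j, j + 1 < m → (v, a j, a (j + 1)) ∈ G.facesIn U) →
      (∀ y, K.Adj (f v) y → ∃ j < m, f (a j) = y) → (v, a (m - 1), a 0) ∈ G.facesIn U)
    {a b c : α} (habc : (a, b, c) ∈ G.facesIn U) : K.ClockwiseTriangle (f a) (f b) (f c) := by
  have h5 := hK.le_degree
  have : NeZero d := ⟨by omega⟩
  set W := A.wheel h5 with hW
  have hli := A.label_injOn h5
  have : Nonempty (KV d) := ⟨KV.hub⟩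
  have : Nonempty α := ⟨a⟩
  have hex : ∀ v ∈ U, ∃ k, W.Vert k ∧ label k = f v := fun v hv => hK.mem_verts.1 (hfU v hv)
  choose! ψ hψv hψ using hex
  have hψi : Set.InjOn ψ U := fun x hx y hy h => hfi hx hy (by rw [← hψ x hx, ← hψ y hy, h])
  have hD := NearTriangulation.sys_facesIn (G := G) U
  have hDU : ∀ v, v ∈ TriSys.verts (G.facesIn U) ↔ v ∈ U := fun v => hgen.mem_verts
  have hψi' : Set.InjOn ψ (TriSys.verts (G.facesIn U)) := hψi.mono fun v hv => (hDU v).1 hv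
  set R := (G.facesIn U).image (mapT ψ) with hR
  have hmem : ∀ {x y z}, x ∈ U → y ∈ U → z ∈ U → ((ψ x, ψ y, ψ z) ∈ R ↔ (x, y, z) ∈ G.facesIn U) :=
    fun hx hy hz => mapT_mem hD.rot hψi' ((hDU _).2 hx) ((hDU _).2 hy) ((hDU _).2 hz)
  have hRs : Sys R := hD.image hψi'
  have hRv : ∀ k, k ∈ TriSys.verts R → ∃ v ∈ U, ψ v = k := by
    intro k hk
    rw [hR, verts_image, mem_image] at hk
    grind
  choose! σ hσU hσ using hRv
  set γ : KV d → ℕ := fun k => if W.Vert k then K.γ (label k) else 7 with hγ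
  have hγψ : ∀ v ∈ U, γ (ψ v) = K.γ (f v) := fun v hv => by grind
  have hγ5 : ∀ k, 5 ≤ γ k := by
    intro k
    simp only [hγ]
    split_ifs with hk
    · exact K.five_le _ (hK.mem_verts.2 ⟨k, hk, rfl⟩)
    · omega
  have hγs : ∀ i, γ (s i) = A.u (i.val + 1) := by
    intro i
    have h1 : W.Vert (s i) := trivial
    have h2 : label (s i) = i.val + 1 := rfl
    simp only [hγ]
    rw [if_pos h1, h2, hK.γ _ (hK.mem_verts.2 ⟨s i, h1, h2⟩) (by omega)]
  have hcyc : ∀ (p : KV d) (x : ℕ → KV d) (n : ℕ), n = γ p → Set.InjOn x (Set.Iio n) →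
      (∀ j, j + 1 < n → (p, x j, x (j + 1)) ∈ R) →
      (∀ k, W.Vert k → K.Adj (label p) (label k) → ∃ j < n, k = x j) → (p, x (n - 1), x 0) ∈ R := by
    intro p x n hn hx hd hnb
    have hn5 := hγ5 p
    have hpR := (hRs.rot.mem_verts (hd 0 (by omega))).1
    have hxR : ∀ j < n, x j ∈ TriSys.verts R := by
      intro j hj
      rcases (show j + 1 < n ∨ (j = (n - 2) + 1 ∧ n - 2 + 1 < n) by omega) with h | ⟨rfl, h⟩
      exacts [(hRs.rot.mem_verts (hd j h)).2.1, (hRs.rot.mem_verts (hd _ h)).2.2]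
    have e0 : label p = f (σ p) := by rw [← hψ _ (hσU p hpR), hσ p hpR]
    have h := hclose (σ p) (hσU p hpR) (fun j => σ (x j)) n
      (by rw [hn, ← hγψ _ (hσU p hpR), hσ p hpR])
      (fun i hi j hj hij => hx hi hj
        (by rw [← hσ _ (hxR i hi), ← hσ _ (hxR j hj)]; exact congrArg ψ hij))
      (fun j hj => by
        rw [← hmem (hσU p hpR) (hσU _ (hxR j (by omega))) (hσU _ (hxR (j + 1) hj)), hσ p hpR,
          hσ _ (hxR j (by omega)), hσ _ (hxR _ hj)]
        exact hd j hj)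
      (fun y hy => by
        obtain ⟨k, hk, rfl⟩ := hK.mem_verts.1 (K.mem_verts _ _ (K.symm _ _ hy))
        obtain ⟨j, hj, rfl⟩ := hnb k hk (e0 ▸ hy)
        exact ⟨j, hj, by rw [← hψ _ (hσU _ (hxR j hj)), hσ _ (hxR j hj)]⟩)
    rw [← hmem (hσU p hpR) (hσU _ (hxR _ (by omega))) (hσU _ (hxR 0 (by omega))), hσ p hpR,
      hσ _ (hxR _ (by omega)), hσ _ (hxR 0 (by omega))] at h
    exact h
  have hface : ∀ {x y z}, G.ClockwiseTriangle x y z ∧ K.ClockwiseTriangle (f x) (f y) (f z) →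
      x ∈ U → y ∈ U → z ∈ U → ∃ F, W.Has R F ∧ W.At F (ψ x) (ψ y) (ψ z) := by
    intro x y z h hx hy hz
    obtain ⟨F, hF, hA⟩ := hK.isFace (hψv x hx) (hψv y hy) (hψv z hz)
      (by rw [hψ x hx, hψ y hy, hψ z hz]; exact h.2)
    exact ⟨F, Fan.has_of_mem hRs hF hA ((hmem hx hy hz).2
      (NearTriangulation.mem_facesIn.2 ⟨h.1, hx, hy, hz⟩)), hA⟩
  have H : Disc W γ R (ψ z₀) (ψ z₁) := {
    sys := hRs
    c6_eq := by rw [hR, c6_image hD hψi', hc6]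
    link := by
      intro p S hS hcl
      have hSR : ∀ k ∈ S, k ∈ TriSys.verts R := fun k hk => by
        obtain ⟨b, -, h⟩ := hcl k hk
        exact (hRs.rot.mem_verts h).2.1
      obtain ⟨k, hk⟩ := hS
      have hp : p ∈ TriSys.verts R := by
        obtain ⟨b, -, h⟩ := hcl k hk
        exact (hRs.rot.mem_verts h).1
      have hinj : Set.InjOn σ S := fun k hk l hl h => by
        rw [← hσ k (hSR k hk), ← hσ l (hSR l hl), h]
      rw [← card_image_of_injOn hinj, ← hσ p hp, hγψ _ (hσU p hp)]
      refine hlink _ (hσU p hp) _ ⟨_, mem_image_of_mem σ hk⟩ ?_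
      intro a ha
      obtain ⟨l, hl, rfl⟩ := mem_image.1 ha
      obtain ⟨m, hm, h⟩ := hcl l hl
      refine ⟨σ m, mem_image_of_mem σ hm, ?_⟩
      rw [← hmem (hσU p hp) (hσU l (hSR l hl)) (hσU m (hSR m hm)), hσ p hp, hσ l (hSR l hl),
        hσ m (hSR m hm)]
      exact h
    deg_hub := (if_pos trivial).trans hK.hub
    spoke := fun i hi => by
      have hg : W.g i = A.u (i.val + 1) - 4 := if_pos hi
      grind
    spoke' := fun i hi => by
      have h1 : ¬ A.u (i.val + 1) ≤ 8 := hi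
      have := hγs i
      omega
    hat := fun i => hγ5 _
    rim := fun i m => hγ5 _
    close_hub := fun i hi => by
      have h := hcyc KV.hub (fun j => s (i + 1 + j)) d ((if_pos trivial).trans hK.hub).symm
        (fun j hj k hk h => by
          have h1 : ((j : ℕ) : ZMod d) = (k : ℕ) := by simpa using h
          rw [ZMod.natCast_eq_natCast_iff', Nat.mod_eq_of_lt hj, Nat.mod_eq_of_lt hk] at h1
          exact h1)
        (fun j hj => by
          refine (hi (i + 1 + j) fun h => ?_).mem hRs
            (W.at_hub.2 ⟨_, rfl, rfl, by push_cast; ring_nf⟩)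
          have h1 : ((j + 1 : ℕ) : ZMod d) = 0 := by grind
          rw [ZMod.natCast_eq_zero_iff] at h1
          have := Nat.le_of_dvd (by omega) h1
          omega)
        (fun k hk h => by
          obtain ⟨j, rfl⟩ := hK.hub_adj hk h
          exact ⟨(j - i - 1).val, ZMod.val_lt _, by
            rw [ZMod.natCast_val, ZMod.cast_id]; congr 1; ring⟩)
      refine Fan.has_of_mem hRs trivial (W.at_hub.2 ⟨i, rfl, rfl, rfl⟩) ?_
      have e : ((d - 1 : ℕ) : ZMod d) = -1 := by
        rw [Nat.cast_sub (by omega)]; simp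
      simpa [e] using h
    close_spoke := fun i hf q hq hi => by
      have hg : W.g i = A.u (i.val + 1) - 4 := if_pos hf
      have h5s := hγ5 (s i)
      have hγi := hγs i
      set N := W.g i + 4 with hN
      have hlt : ∀ j, (q + 1 + j) % N < N := fun j => Nat.mod_lt _ (by omega)
      have hne : ∀ j k, j < k → k < N → (q + 1 + j) % N ≠ (q + 1 + k) % N := by
        intro j k hjk hk h
        have h1 := (Nat.modEq_iff_dvd' (show q + 1 + j ≤ q + 1 + k by omega)).1 h
        have := Nat.le_of_dvd (by omega) h1
        omega
      have hX : ∀ j, W.X i ((q + 1 + (j + 1)) % N) = W.X i ((q + 1 + j) % N + 1) := by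
        intro j
        rw [← X_nx (W := W)]
        congr 1
        have := hlt j
        unfold Fan.nx
        rw [← Nat.add_assoc, Nat.add_mod _ 1, Nat.mod_eq_of_lt (show 1 < N by omega)]
        split_ifs with h1
        · rw [h1, show W.g i + 3 + 1 = N from rfl, Nat.mod_self]
        · exact Nat.mod_eq_of_lt (by omega)
      have h := hcyc (s i) (fun j => W.X i ((q + 1 + j) % N)) N (by omega)
        (fun j hj k hk h => by
          have h1 := W.X_inj (hlt j) (hlt k) h
          by_contra hjk
          rcases lt_or_gt_of_ne hjk with h2 | h2
          exacts [hne j k h2 hk h1, hne k j h2 hj h1.symm])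
        (fun j hj => by
          have hj' : (q + 1 + j) % N ≠ q := fun h => by
            refine hne j (N - 1) (by omega) (by omega) (h.trans ?_)
            rw [show q + 1 + (N - 1) = q + N by omega, Nat.add_mod_right, Nat.mod_eq_of_lt hq]
          refine (hi _ (hlt j) hj').mem hRs ((W.at_spoke (valid_Φ hf (hlt j))).2
            ⟨_, hlt j, rfl, rfl, hX j⟩))
        (fun k hk h => by
          obtain ⟨j, hj, rfl⟩ := hK.spoke_adj hk h
          refine ⟨(j + (N - 1 - q)) % N, Nat.mod_lt _ (by omega), ?_⟩
          rw [Nat.add_mod_mod, show q + 1 + (j + (N - 1 - q)) = j + N by omega, Nat.add_mod_right,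
            Nat.mod_eq_of_lt hj])
      refine Fan.has_of_mem hRs (valid_Φ hf hq) ((W.at_spoke (valid_Φ hf hq)).2
        ⟨q, hq, rfl, rfl, rfl⟩) ?_
      have e1 : (q + 1 + (N - 1)) % N = q := by
        rw [show q + 1 + (N - 1) = q + N by omega, Nat.add_mod_right, Nat.mod_eq_of_lt hq]
      have e2 := hX (N - 1)
      rw [e1, show q + 1 + (N - 1 + 1) = q + 1 + 0 + N by omega, Nat.add_mod_right] at e2
      grind
    gen := by
      rintro X ⟨k, hk, hXk⟩ h0 h1
      obtain ⟨a, b, c, hT, ha, hb, hc, h2, h3, h4⟩ := hgen.gen (fun v => X (ψ v))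
        ⟨σ k, hσU k hk, by rwa [hσ k hk]⟩ h0 h1
      obtain ⟨F, hF, hA⟩ := hface hT ha hb hc
      exact ⟨F, _, _, _, hF, hA.rot.rot, h2, h3, h4⟩
    start := by
      obtain ⟨a, b, c, hT, hc, ⟨rfl, rfl⟩ | ⟨rfl, rfl⟩⟩ := hgen.start
      · obtain ⟨F, hF, hA⟩ := hface hT hgen.mem₀ hgen.mem₁ hc
        exact ⟨F, _, hF, .inl hA⟩
      · obtain ⟨F, hF, hA⟩ := hface hT hgen.mem₁ hgen.mem₀ hc
        exact ⟨F, _, hF, .inr hA⟩ }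
  obtain ⟨-, ha, hb, hc⟩ := NearTriangulation.mem_facesIn.1 habc
  have := hK.clockwise (H.isFace ((hmem ha hb hc).2 habc))
  grind

end Axle.IsSkeleton

/-! ### Enhancements -/

open Classical Finset

/-- A connected drawing with at least two vertices has no isolated vertex. -/
theorem Drawing.Connected.exists_adj {α : Type*} {D : Drawing α} (h : D.Connected) {v w : α}
    (hv : v ∈ D.verts) (hw : w ∈ D.verts) (hvw : v ≠ w) : ∃ u, D.Adj v u := by
  rcases (h.2 v hv w hw).cases_head with h1 | ⟨u, h1, -⟩
  exacts [absurd h1 hvw, ⟨u, h1⟩]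

namespace Configuration

variable {α : Type*}

/-- The properties of an enhancement that do not refer to a free completion. -/
structure Extends (L : Configuration α) (J : NearTriangulation α) : Prop where
  subset : L.verts ⊆ J.verts
  adj_iff : ∀ u ∈ L.verts, ∀ v ∈ L.verts, (L.Adj u v ↔ J.Adj u v)
  clockwise : ∀ a b c, L.ClockwiseTriangle a b c → J.ClockwiseTriangle a b c
  next : ∀ v a, L.Adj v a → FirstReturn (J.next v) (L.Adj v) a (L.next v a)
  closed : ∀ v ∈ L.verts, L.γ v ≤ J.deg v → ∀ a, (v, a) ∉ J.outer
  deg : ∀ v ∈ L.verts, (∀ a, (v, a) ∉ J.outer) → J.deg v = L.γ v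
  cases : (J = L.toNearTriangulation ∧ 3 ≤ L.verts.card) ∨ ∃ x v', L.IsCutVertex x ∧ v' ∉ L.verts ∧
    (∀ y, y ∈ J.verts ↔ y = v' ∨ y ∈ L.verts) ∧ J.Adj x v' ∧ ∃ u, (v', u) ∈ J.outer

theorem TwoConnected.extends {L : Configuration α} (h : L.TwoConnected) :
    L.Extends L.toNearTriangulation where
  subset := Finset.Subset.refl _
  adj_iff _ _ _ _ := Iff.rfl
  clockwise _ _ _ h := h
  next v a _ := FirstReturn.of_step rfl
  closed v hv hle a ha := absurd (L.on_outer v hv ⟨hv, .inl ⟨a, ha⟩⟩) (not_lt.2 hle)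
  deg v hv hn := by
    refine (L.inner v hv ?_).symm
    rintro ⟨-, ⟨u, hu⟩ | h1⟩
    · exact hn u hu
    · obtain ⟨w, hw, hwv⟩ := exists_mem_ne (show 1 < L.verts.card by have := h.1; omega) v
      obtain ⟨u, hu⟩ := h.2.1.exists_adj hv hw hwv.symm
      exact h1 u hu
  cases := .inl ⟨rfl, h.1⟩

theorem IsFreeCompletion.extends {L : Configuration α} {S J : NearTriangulation α} {x v' : α}
    (hS : IsFreeCompletion L S) (hx : L.IsCutVertex x) (hv'S : v' ∈ S.verts)
    (hv' : v' ∉ L.verts) (hxv : S.Adj x v') (hJ : J.IsInducedSubdrawing S)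
    (hJv : ∀ y, y ∈ J.verts ↔ y = v' ∨ y ∈ L.verts) : L.Extends J := by
  have hsub : L.verts ⊆ J.verts := fun y hy => (hJv y).2 (.inr hy)
  have hLJ : ∀ u ∈ L.verts, ∀ v ∈ L.verts, (L.Adj u v ↔ J.Adj u v) := fun u hu v hv =>
    ⟨fun h => hJ.induced _ (hsub hu) _ (hsub hv) (hS.induced.adj _ _ h),
      fun h => hS.induced.induced _ hu _ hv (hJ.adj _ _ h)⟩
  have hL : ∀ {u v}, L.Adj u v → J.Adj u v := fun h =>
    (hLJ _ (L.mem_verts _ _ h) _ (L.mem_verts _ _ (L.symm _ _ h))).1 h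
  have hv'J : v' ∈ J.verts := (hJv v').2 (.inl rfl)
  have hxL := hx.1
  have hxJ : J.Adj x v' := hJ.induced _ (hsub hxL) _ hv'J hxv
  have hnb : ∀ v ∈ J.verts, ∃ a, J.Adj v a := by
    intro v hv
    by_cases h : v = v'
    exacts [⟨x, h ▸ J.symm _ _ hxJ⟩, J.connected.exists_adj hv hv'J h]
  have hfull : ∀ v ∈ J.verts, (∀ a, (v, a) ∉ J.outer) → ∀ b, S.Adj v b → J.Adj v b := by
    intro v hv hn b hb
    obtain ⟨a, ha⟩ := hnb v hv
    refine S.mem_of_next_closed (X := J.Adj v) (fun c hc h => ?_) (hJ.adj _ _ ha) hb ha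
    refine hJ.induced _ hv _ ?_ (S.next_adj _ _ hc)
    by_cases hL : S.next v c ∈ L.verts
    · exact hsub hL
    · obtain ⟨u, hu⟩ := (hS.ring_outer _ (S.mem_verts _ _ (S.symm _ _ (S.next_adj _ _ hc)))).1 hL
      exact hJ.next_mem h (hn c) hu
  have hdeg : ∀ v, (∀ b, S.Adj v b → J.Adj v b) → J.deg v = S.deg v := fun v h =>
    congrArg Set.ncard (Set.ext fun b => ⟨hJ.adj v b, h b⟩)
  refine ⟨hsub, hLJ, ?_, ?_, ?_, ?_, .inr ⟨x, v', hx, hv', hJv, hxJ, ?_⟩⟩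
  · intro a b c h
    have h1 := hS.finite_regions _ _ h.1 h.2.1
    refine hJ.clockwise ⟨hS.induced.adj _ _ h.1, h1.1, h1.2.trans h.2.2.1,
      (hS.finite_regions _ _ h.rot.1 h.rot.2.1).2.trans h.2.2.2.1,
      (hS.finite_regions _ _ h.rot.rot.1 h.rot.rot.2.1).2.trans h.2.2.2.2⟩
      (hsub h.mem.1) (hsub h.mem.2.1) (hsub h.mem.2.2)
  · intro v a h
    exact firstReturn_of_subset (M := J.Adj v)
      (fun y hy => ⟨J.next_adj _ _ hy, hJ.next v y hy⟩) (fun y hy => hL hy) (hL h)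
      (L.next_adj _ _ h) (hS.induced.next v a h)
  · intro v hv hle a ha
    have hJa : J.Adj v a := J.outer_subset ha
    have hfull : ∀ b, S.Adj v b → J.Adj v b := by
      intro b hb
      have h1 : {u | J.Adj v u} ⊆ {u | S.Adj v u} := fun u hu => hJ.adj _ _ hu
      have h2 := Set.eq_of_subset_of_ncard_le h1 (by
        have := hS.degree v hv
        unfold Drawing.deg at this hle
        omega) (S.finite_nbrs v)
      exact h2.symm.subset hb
    have h1 : (v, a) ∉ S.outer := fun h => (hS.ring_outer v (hS.induced.verts_subset hv)).2 ⟨a, h⟩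
      hv
    have hT := S.clockwise_of_notMem (hJ.adj _ _ hJa) h1
    exact (hJ.clockwise hT (hsub hv) (J.mem_verts _ _ (J.symm _ _ hJa))
      (J.mem_verts _ _ (J.symm _ _ (hfull _ (S.next_adj _ _ hT.1))))).2.1 ha
  · intro v hv hn
    rw [hdeg v (hfull v (hsub hv) hn), hS.degree v hv]
  · by_contra! hn
    obtain ⟨u, hu⟩ := (hS.ring_outer v' hv'S).1 hv'
    have huJ := hfull v' hv'J hn u (S.outer_subset hu)
    have huv : u ≠ v' := fun h => J.loopless v' (h ▸ huJ)
    have huL : u ∈ L.verts := ((hJv u).1 (J.mem_verts _ _ (J.symm _ _ huJ))).resolve_left huv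
    obtain ⟨w, hw, hwe⟩ := S.exists_next_eq (S.symm _ _ (S.outer_subset hu) : S.Adj u v')
    exact (hS.ring_outer u (hS.induced.verts_subset huL)).2 ⟨w, S.outer_of_faceNext
      (p := (u, w)) hw (by rw [Drawing.faceNext, hwe]; exact hu)⟩ huL

theorem IsEnhancement.extends {L : Configuration α} {J : NearTriangulation α}
    (h : L.IsEnhancement J) : L.Extends J := by
  rcases h with ⟨h, rfl⟩ | ⟨x, hx, -, S, v', hS, h1, h2, h3, h4, h5⟩
  exacts [TwoConnected.extends h, hS.extends hx h1 h2 h3 h4 h5]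

end Configuration

/-- The vertices of an enhancement, in the order of a question with a positive answer. -/
theorem IsPositiveAnswer.exists_order {α β : Type*} {L : Configuration α} {J : NearTriangulation α}
    {n : ℕ} {Q : Fin (n + 2) → Query α} (hQ : IsQuestion L J Q) {K : Configuration β} {f : α → β}
    (hf : IsPositiveAnswer J Q K f) : ∃ rk : α → ℕ, ∀ y ∈ J.verts, y ≠ (Q 0).z → y ≠ (Q 1).z →
      ∃ u v, (J.ClockwiseTriangle u v y ∧ K.ClockwiseTriangle (f u) (f v) (f y)) ∧
        rk u < rk y ∧ rk v < rk y := by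
  have hrk : ∃ rk : α → ℕ, ∀ i, rk (Q i).z = i.val := by
    refine ⟨fun y => if h : ∃ i, (Q i).z = y then h.choose.val else 0, fun i => ?_⟩
    have h : ∃ j, (Q j).z = (Q i).z := ⟨i, rfl⟩
    refine (dif_pos h).trans ?_
    rw [hQ.distinct h.choose_spec]
  obtain ⟨rk, hrk⟩ := hrk
  refine ⟨rk, fun y hy h0 h1 => ?_⟩
  obtain ⟨i, rfl⟩ := (hQ.exhaust y).1 hy
  have hi : 2 ≤ i.val := by
    by_contra h
    rcases (show i.val = 0 ∨ i.val = 1 by omega) with h | h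
    exacts [h0 (by rw [show i = 0 from Fin.ext h]),
      h1 (by rw [show i = 1 from Fin.ext (h.trans (by simp))])]
  obtain ⟨⟨j, hj, e1⟩, k, hk, e2⟩ := hQ.earlier i hi
  refine ⟨_, _, ⟨(hQ.query i).1, hf.triangle i hi⟩, ?_, ?_⟩
  · rw [← e1, hrk, hrk]; exact hj
  grind

theorem IsPositiveAnswer.γ_eq {α β : Type*} {L : Configuration α} {J : NearTriangulation α}
    {n : ℕ} {Q : Fin (n + 2) → Query α} (hQ : IsQuestion L J Q) {K : Configuration β} {f : α → β}
    (hf : IsPositiveAnswer J Q K f) (hJ : L.verts ⊆ J.verts) {v : α} (hv : v ∈ L.verts) :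
    K.γ (f v) = L.γ v := by
  obtain ⟨i, rfl⟩ := (hQ.exhaust v).1 (hJ hv)
  have h : (Q i).deg = L.γ (Q i).z := by rw [(hQ.query i).2, Configuration.ξ, if_pos hv]
  have h5 := L.five_le _ hv
  rw [hf.degree i (by omega), h]

/-! ### The finite regions of an enhancement are mapped to the skeleton -/

open Classical TriSys Finset

namespace NearTriangulation

variable {α : Type*} {G : NearTriangulation α}

theorem card_of_closed {v : α} {S : Finset α} (hS : S.Nonempty)
    (h : ∀ a ∈ S, ∃ b ∈ S, (v, a, b) ∈ G.faces) : (∀ a, (v, a) ∉ G.outer) ∧ S.card = G.deg v := by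
  have h1 : ∀ a ∈ S, G.Adj v a ∧ (v, a) ∉ G.outer ∧ G.next v a ∈ S := by
    intro a ha
    obtain ⟨b, hb, hT⟩ := h a ha
    rw [mem_faces] at hT
    exact ⟨hT.1, hT.2.1, hT.2.2.1 ▸ hb⟩
  obtain ⟨a, ha⟩ := hS
  have h2 : ∀ b, G.Adj v b → b ∈ S := fun b hb =>
    G.mem_of_next_closed (X := (· ∈ S)) (fun c _ hc => (h1 c hc).2.2) (h1 a ha).1 hb ha
  refine ⟨fun b hb => (h1 b (h2 b (G.outer_subset hb))).2.1 hb, ?_⟩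
  rw [Drawing.deg, show {u | G.Adj v u} = (S : Set α) from
    Set.ext fun b => ⟨h2 b, fun hb => (h1 b hb).1⟩, Set.ncard_coe_finset]

theorem clockwise_last {v : α} {a : ℕ → α} {m : ℕ} (hm : 2 ≤ m) (ha : Set.InjOn a (Set.Iio m))
    (h : ∀ j, j + 1 < m → G.ClockwiseTriangle v (a j) (a (j + 1))) :
    m ≤ G.deg v ∧ (G.deg v = m → (∀ b, (v, b) ∉ G.outer) →
      G.ClockwiseTriangle v (a (m - 1)) (a 0)) := by
  have hadj : ∀ j < m, G.Adj v (a j) := by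
    intro j hj
    rcases (show j + 1 < m ∨ (j = (m - 2) + 1 ∧ m - 2 + 1 < m) by omega) with h1 | ⟨rfl, h1⟩
    exacts [(h j h1).1, G.symm _ _ (h _ h1).rot.rot.1]
  have hsub : ((range m).image a : Set α) ⊆ {u | G.Adj v u} := by grind
  have hcard : ((range m).image a : Set α).ncard = m := by
    rw [Set.ncard_coe_finset, card_image_of_injOn (by
      rw [coe_range]; exact ha), card_range]
  refine ⟨hcard ▸ Set.ncard_le_ncard hsub (G.finite_nbrs v), fun hd hn => ?_⟩
  have heq := Set.eq_of_subset_of_ncard_le hsub (by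
    rw [hcard, ← hd]; exact le_rfl) (G.finite_nbrs v)
  have hT := G.clockwise_of_notMem (hadj (m - 1) (by omega)) (hn _)
  have hmem : G.next v (a (m - 1)) ∈ ((range m).image a : Set α) := by
    rw [heq]; exact G.next_adj _ _ hT.1
  obtain ⟨k, hk, he⟩ := mem_image.1 hmem
  rw [mem_range] at hk
  rcases Nat.eq_zero_or_pos k with rfl | h0
  · rwa [← he] at hT
  · exfalso
    have h2 := h (k - 1) (by omega)
    rw [Nat.sub_add_cancel h0] at h2
    have h3 := G.next_injOn v h2.1 hT.1 (h2.2.2.1.trans he)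
    have := ha (show k - 1 < m by omega) (show m - 1 < m by omega) h3
    omega

theorem generated_of_order {U : Set α} {z₀ z₁ : α} {T : α → α → α → Prop} {rk : α → ℕ}
    (h₀ : z₀ ∈ U) (h₁ : z₁ ∈ U) (hadj : G.Adj z₀ z₁) (hthird : ∃ y ∈ U, y ≠ z₀ ∧ y ≠ z₁)
    (hT : ∀ a b c, T a b c → G.ClockwiseTriangle a b c)
    (h : ∀ y ∈ U, y ≠ z₀ → y ≠ z₁ → ∃ u v, T u v y ∧ u ∈ U ∧ v ∈ U ∧ rk u < rk y ∧ rk v < rk y) :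
    G.Generated U z₀ z₁ T := by
  refine ⟨h₀, h₁, hadj, hthird, hT, fun X ⟨y, hy, hXy⟩ hX0 hX1 => ?_⟩
  by_contra! hcon
  have key : ∀ n, ∀ y ∈ U, rk y = n → ¬ X y := by
    intro n
    induction n using Nat.strong_induction_on with
    | _ n ih =>
      rintro y hy rfl hXy
      obtain ⟨u, v, h1, hu, hv, h2, h3⟩ := h y hy (fun e => hX0 (e ▸ hXy)) (fun e => hX1 (e ▸ hXy))
      grind
  exact key _ y hy rfl hXy

theorem c6_facesIn_of_cover {U1 U2 : Set α} {x v' z₀ z₁ y₀ y₁ : α} {T T' : α → α → α → Prop}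
    (hxv' : x ≠ v') (g1 : G.Generated U1 z₀ z₁ T) (g2 : G.Generated U2 y₀ y₁ T')
    (hcap : ∀ y, y ∈ U1 ∧ y ∈ U2 ↔ y = x ∨ y = v')
    (hin : ∀ {a b c}, G.ClockwiseTriangle a b c →
      (a, b, c) ∈ G.facesIn U1 ∨ (a, b, c) ∈ G.facesIn U2) (hc6 : c6 G.faces = 0) :
    c6 (G.facesIn U1) = 0 ∧ c6 (G.facesIn U2) = 0 := by
  have hmem := fun U a b c => NearTriangulation.mem_facesIn (G := G) (U := U) (a := a) (b := b)
    (c := c)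
  have hsub : ∀ U : Set α, G.facesIn U ⊆ G.faces := fun U => filter_subset _ _
  have hno : ∀ {a b c}, G.ClockwiseTriangle a b c → (a = x ∨ a = v') → (b = x ∨ b = v') →
      (c = x ∨ c = v') → False := by
    intro a b c h ha hb hc
    have n1 : a ≠ b := fun e => G.loopless a (by have := h.1; rwa [← e] at this)
    have n2 : b ≠ c := fun e => G.loopless b (by have := h.rot.1; rwa [← e] at this)
    have n3 : c ≠ a := fun e => G.loopless c (by have := h.rot.rot.1; rwa [← e] at this)
    grind
  have hdisj : Disjoint (G.facesIn U1) (G.facesIn U2) := by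
    rw [disjoint_left]
    grind
  have hun : G.facesIn U1 ∪ G.facesIn U2 = G.faces := by
    ext ⟨a, b, c⟩
    rw [mem_union]
    exact ⟨fun h => h.elim (hsub _ ·) (hsub _ ·), fun h => hin (G.mem_faces.1 h)⟩
  have hcard : (TriSys.verts (G.facesIn U1) ∩ TriSys.verts (G.facesIn U2)).card = 2 := by
    rw [← card_pair hxv']
    congr 1
    ext y
    rw [mem_inter, g1.mem_verts, g2.mem_verts, mem_insert, mem_singleton]
    exact hcap y
  have hsh : (shared (G.facesIn U1) (G.facesIn U2)).card ≤ 1 := by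
    rw [card_le_one]
    have key : ∀ {a b c}, (a, b, c) ∈ shared (G.facesIn U1) (G.facesIn U2) →
        G.ClockwiseTriangle a b c ∧ c ∈ U1 ∧ (a = x ∨ a = v') ∧ (b = x ∨ b = v') ∧
          ∃ e ∈ U2, G.ClockwiseTriangle b a e := by
      intro a b c h
      obtain ⟨h1, e, h2⟩ := mem_shared.1 h
      grind
    rintro ⟨a, b, c⟩ h ⟨a', b', c'⟩ h'
    obtain ⟨hT, hc, ha, hb, -⟩ := key h
    obtain ⟨hT', hc', ha', hb', e, he, hTe⟩ := key h'
    have n1 : a ≠ b := fun e => G.loopless a (by have := hT.1; rwa [← e] at this)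
    have n2 : a' ≠ b' := fun e => G.loopless a' (by have := hT'.1; rwa [← e] at this)
    by_cases haa : a = a'
    · have hbb : b = b' := by grind
      subst haa hbb
      rw [← hT.2.2.1, ← hT'.2.2.1]
    · exfalso
      have e1 : a = b' := by grind
      have e2 : b = a' := by grind
      subst e1 e2
      have hce : c = e := hT.2.2.1.symm.trans hTe.2.2.1
      grind
  have hc := c6_union G.sys_faces (hsub U1) (hsub U2) hdisj
  have hp1 := (NearTriangulation.sys_facesIn (G := G) U1).c6_nonneg g1.conn
  have hp2 := (NearTriangulation.sys_facesIn (G := G) U2).c6_nonneg g2.conn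
  grind

end NearTriangulation

namespace Configuration.Extends

variable {α : Type*} {L : Configuration α} {J : NearTriangulation α} (hE : L.Extends J)
  {d : ℕ} {A : Axle d} {K : Configuration ℕ} {f : α → ℕ}

include hE

theorem clockwise_of_generated (hK : A.IsSkeleton K) (hfi : Set.InjOn f J.verts)
    (hfm : Set.MapsTo f J.verts K.verts) (hγ : ∀ v ∈ L.verts, K.γ (f v) = L.γ v) {U : Set α}
    {z₀ z₁ : α} (hU : ∀ v ∈ U, v ∈ J.verts)
    (hgen : J.Generated U z₀ z₁ fun a b c =>
      J.ClockwiseTriangle a b c ∧ K.ClockwiseTriangle (f a) (f b) (f c))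
    (hc6 : c6 (J.facesIn U) = 0)
    (hopen : ∀ v ∈ U, v ∉ L.verts → (∃ u, (v, u) ∈ J.outer) ∧
      ∃ y, K.Adj (f v) y ∧ ∀ w ∈ U, f w ≠ y)
    {a b c : α} (habc : (a, b, c) ∈ J.facesIn U) : K.ClockwiseTriangle (f a) (f b) (f c) := by
  have hfaces : ∀ {x y z}, (x, y, z) ∈ J.facesIn U → (x, y, z) ∈ J.faces := fun h =>
    J.mem_faces.2 (NearTriangulation.mem_facesIn.1 h).1
  refine hK.clockwise_of_disc (hfi.mono hU) (fun v hv => hfm (hU v hv)) hgen hc6 ?_ ?_ habc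
  · intro v hv S hS hcl
    obtain ⟨h1, h2⟩ := NearTriangulation.card_of_closed hS fun a ha => by
      obtain ⟨b, hb, h⟩ := hcl a ha
      exact ⟨b, hb, hfaces h⟩
    by_cases hvL : v ∈ L.verts
    · rw [h2, hγ v hvL, hE.deg v hvL h1]
    grind
  · intro v hv a m hm ha hd hnb
    have hm5 := K.five_le _ (hfm (hU v hv))
    have haU : ∀ j < m, a j ∈ U := by
      intro j hj
      rcases (show j + 1 < m ∨ (j = (m - 2) + 1 ∧ m - 2 + 1 < m) by omega) with h | ⟨rfl, h⟩
      exacts [(NearTriangulation.mem_facesIn.1 (hd j h)).2.2.1,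
        (NearTriangulation.mem_facesIn.1 (hd _ h)).2.2.2]
    by_cases hvL : v ∈ L.verts
    · obtain ⟨h1, h2⟩ := NearTriangulation.clockwise_last (by omega) ha fun j hj =>
        (NearTriangulation.mem_facesIn.1 (hd j hj)).1
      have h3 := hE.closed v hvL (by rw [← hγ v hvL, ← hm]; exact h1)
      exact NearTriangulation.mem_facesIn.2 ⟨h2 (by rw [hE.deg v hvL h3, hm, hγ v hvL]) h3, hv,
        haU _ (by omega), haU _ (by omega)⟩
    grind

variable {z₀ z₁ : α} {rk : α → ℕ}

theorem generated (h01 : L.Adj z₀ z₁) (hrk : ∀ y ∈ J.verts, y ≠ z₀ → y ≠ z₁ → ∃ u v,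
      (J.ClockwiseTriangle u v y ∧ K.ClockwiseTriangle (f u) (f v) (f y)) ∧
        rk u < rk y ∧ rk v < rk y) :
    J.Generated J.verts z₀ z₁ fun a b c =>
      J.ClockwiseTriangle a b c ∧ K.ClockwiseTriangle (f a) (f b) (f c) := by
  have h0 := L.mem_verts _ _ h01
  have h1 := L.mem_verts _ _ (L.symm _ _ h01)
  refine NearTriangulation.generated_of_order (rk := rk) (hE.subset h0) (hE.subset h1)
    ((hE.adj_iff _ h0 _ h1).1 h01) ?_ (fun _ _ _ h => h.1) fun y hy hy0 hy1 => ?_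
  · rcases hE.cases with ⟨-, h⟩ | ⟨x, v', -, hv', hJv, -⟩
    · by_contra! hcon
      have h2 : L.verts ⊆ {z₀, z₁} := fun y hy => by
        have := hcon y (hE.subset hy)
        grind
      have := (card_le_card h2).trans card_le_two
      omega
    · exact ⟨v', (hJv v').2 (.inl rfl), fun h => hv' (h ▸ h0), fun h => hv' (h ▸ h1)⟩
  · obtain ⟨u, v, hT, h2, h3⟩ := hrk y hy hy0 hy1
    exact ⟨u, v, hT, hT.1.mem.1, hT.1.mem.2.1, h2, h3⟩

/-- The finite regions of an enhancement are mapped to finite regions of the skeleton. -/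
theorem clockwise_skeleton (hK : A.IsSkeleton K) (hfi : Set.InjOn f J.verts)
    (hfm : Set.MapsTo f J.verts K.verts) (hγ : ∀ v ∈ L.verts, K.γ (f v) = L.γ v)
    (h01 : L.Adj z₀ z₁) (hrk : ∀ y ∈ J.verts, y ≠ z₀ → y ≠ z₁ → ∃ u v,
      (J.ClockwiseTriangle u v y ∧ K.ClockwiseTriangle (f u) (f v) (f y)) ∧
        rk u < rk y ∧ rk v < rk y) {a b c : α} (habc : J.ClockwiseTriangle a b c) :
    K.ClockwiseTriangle (f a) (f b) (f c) := by
  have hgen := hE.generated h01 hrk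
  have hc6 := hgen.c6_faces
  rcases hE.cases with ⟨rfl, -⟩ | ⟨x, v', hx, hv', hJv, hxv, hout⟩
  · exact hE.clockwise_of_generated hK hfi hfm hγ (fun _ h => h) hgen
      (by rwa [NearTriangulation.facesIn_verts]) (fun v hv h => absurd hv h)
      (by rwa [NearTriangulation.facesIn_verts, NearTriangulation.mem_faces])
  have hz0 := L.mem_verts _ _ h01
  have hz1 := L.mem_verts _ _ (L.symm _ _ h01)
  have hxL := hx.1
  have hxv' : x ≠ v' := fun h => hv' (h ▸ hxL)
  have hsymm : ∀ u v, L.AdjAvoiding x u v → L.AdjAvoiding x v u := fun u v h =>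
    ⟨L.symm _ _ h.1, h.2.2, h.2.1⟩
  obtain ⟨p, hp, hpL, hpx, hpz⟩ : ∃ p, (p = z₀ ∨ p = z₁) ∧ p ∈ L.verts ∧ p ≠ x ∧
      ∀ z, z = z₀ ∨ z = z₁ → z = x ∨ Relation.ReflTransGen (L.AdjAvoiding x) p z := by
    by_cases h : z₀ = x
    · have h2 : z₁ ≠ x := fun h' => L.loopless x (by rwa [h, h'] at h01)
      grind
    · refine ⟨z₀, .inl rfl, hz0, h, ?_⟩
      rintro z (rfl | rfl)
      · exact .inr .refl
      · by_cases h' : z = x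
        exacts [Or.inl h', .inr (.single ⟨h01, h, h'⟩)]
  set V1 : α → Prop := fun w => Relation.ReflTransGen (L.AdjAvoiding x) p w with hV1
  have hV1L : ∀ w, V1 w → w ∈ L.verts ∧ w ≠ x := by
    intro w hw
    rcases hw.cases_tail with rfl | ⟨y, -, h⟩
    exacts [⟨hpL, hpx⟩, ⟨L.mem_verts _ _ (L.symm _ _ h.1), h.2.2⟩]
  set V2 : α → Prop := fun w => w ∈ L.verts ∧ w ≠ x ∧ ¬ V1 w with hV2
  have hJcases : ∀ y ∈ J.verts, V1 y ∨ V2 y ∨ y = x ∨ y = v' := by grind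
  have hn12 : ∀ {u w}, J.Adj u w → V1 u → ¬ V2 w := by
    intro u w h hu hw
    exact hw.2.2 (hu.tail ⟨(hE.adj_iff _ (hV1L u hu).1 _ hw.1).2 h, (hV1L u hu).2, hw.2.1⟩)
  have hvJ : ∀ {u w}, J.Adj u w → u ∈ J.verts ∧ w ∈ J.verts := fun h =>
    ⟨J.mem_verts _ _ h, J.mem_verts _ _ (J.symm _ _ h)⟩
  have hV2ne : ∃ w, V2 w := by
    by_contra! hcon
    have h2 := hx.2
    have : L.numComponentsDelete x ≤ 1 := by
      unfold Drawing.numComponentsDelete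
      refine (Set.ncard_le_ncard (t := {{w | V1 w}}) ?_).trans_eq (Set.ncard_singleton _)
      rintro C ⟨u, hu, hux, rfl⟩
      have hu1 : V1 u := by grind
      ext w
      exact ⟨fun h => hu1.trans h, fun h => (reflTransGen_symm hsymm hu1).trans h⟩
    omega
  obtain ⟨w, hw, hwmin⟩ : ∃ w, V2 w ∧ ∀ y, V2 y → rk w ≤ rk y := by
    obtain ⟨w₀, hw₀⟩ := hV2ne
    obtain ⟨w, hw, h⟩ := exists_min_image (L.verts.filter V2) rk
      ⟨w₀, mem_filter.2 ⟨hw₀.1, hw₀⟩⟩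
    exact ⟨w, (mem_filter.1 hw).2, fun y hy => h y (mem_filter.2 ⟨hy.1, hy⟩)⟩
  have hV2z : ∀ y, V2 y → y ≠ z₀ ∧ y ≠ z₁ := by
    refine fun y hy => ⟨fun h => ?_, fun h => ?_⟩
    exacts [(hpz y (.inl h)).elim hy.2.1 hy.2.2, (hpz y (.inr h)).elim hy.2.1 hy.2.2]
  have hV2J : ∀ y, V2 y → y ∈ J.verts := fun y hy => hE.subset hy.1
  have hV2nb : ∀ {u y}, J.Adj u y → V2 y → V2 u ∨ u = x ∨ u = v' := fun h hy =>
    (hJcases _ (hvJ h).1).resolve_left fun h1 => hn12 h h1 hy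
  have hV1nb : ∀ {u y}, J.Adj u y → V1 y → V1 u ∨ u = x ∨ u = v' := fun h hy => by
    have := hJcases _ (hvJ h).1
    have := hn12 (J.symm _ _ h) hy
    tauto
  have hlt : rk x < rk w ∧ rk v' < rk w ∧ K.Adj (f v') (f w) := by
    obtain ⟨u, v, ⟨hT, hTK⟩, h1, h2⟩ := hrk w (hV2J w hw) (hV2z w hw).1 (hV2z w hw).2
    have hu := (hV2nb (J.symm _ _ hT.rot.rot.1) hw).resolve_left fun h =>
      absurd (hwmin u h) (by omega)
    have hv := (hV2nb hT.rot.1 hw).resolve_left fun h => absurd (hwmin v h) (by omega)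
    have huv : u ≠ v := fun h => J.loopless v (h ▸ hT.1)
    rcases hu with rfl | rfl <;> rcases hv with rfl | rfl
    exacts [absurd rfl huv, ⟨h1, h2, hTK.rot.1⟩, ⟨h2, h1, K.symm _ _ hTK.rot.rot.1⟩, absurd rfl huv]
  have hv'J : v' ∈ J.verts := (hJv v').2 (.inl rfl)
  have hv'z : v' ≠ z₀ ∧ v' ≠ z₁ := ⟨fun h => hv' (h ▸ hz0), fun h => hv' (h ▸ hz1)⟩
  obtain ⟨y₁, hy₁, hKy₁⟩ : ∃ y, V1 y ∧ K.Adj (f v') (f y) := by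
    obtain ⟨u, v, ⟨hT, hTK⟩, h1, h2⟩ := hrk v' hv'J hv'z.1 hv'z.2
    have hnot : ∀ y ∈ J.verts, rk y < rk v' → V1 y ∨ y = x := by
      intro y hy hlty
      rcases hJcases y hy with h | h | h | rfl
      exacts [.inl h, absurd (hwmin y h) (by omega), .inr h, absurd hlty (lt_irrefl _)]
    rcases hnot u hT.mem.1 h1 with h | rfl
    · exact ⟨u, h, hTK.rot.rot.1⟩
    · rcases hnot v hT.mem.2.1 h2 with h | rfl
      exacts [⟨v, h, K.symm _ _ hTK.rot.1⟩, absurd hT.1 (J.loopless _)]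
  set U1 : Set α := {y | V1 y ∨ y = x ∨ y = v'} with hU1
  set U2 : Set α := {y | V2 y ∨ y = x ∨ y = v'} with hU2
  have hU1J : ∀ y ∈ U1, y ∈ J.verts := by
    rintro y (h | rfl | rfl)
    exacts [hE.subset (hV1L y h).1, hE.subset hxL, hv'J]
  have hU2J : ∀ y ∈ U2, y ∈ J.verts := by grind
  have hU12 : ∀ y, y ∈ U1 → y ∈ U2 → y = x ∨ y = v' := by grind
  have g1 : J.Generated U1 z₀ z₁ fun a b c =>
      J.ClockwiseTriangle a b c ∧ K.ClockwiseTriangle (f a) (f b) (f c) := by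
    refine NearTriangulation.generated_of_order (rk := rk)
      ((hpz z₀ (.inl rfl)).elim (fun h => .inr (.inl h)) .inl)
      ((hpz z₁ (.inr rfl)).elim (fun h => .inr (.inl h)) .inl)
      ((hE.adj_iff _ hz0 _ hz1).1 h01) ⟨v', .inr (.inr rfl), hv'z⟩ (fun _ _ _ h => h.1)
      fun y hy hy0 hy1 => ?_
    obtain ⟨u, v, hT, h1, h2⟩ := hrk y (hU1J y hy) hy0 hy1
    refine ⟨u, v, hT, ?_, ?_, h1, h2⟩
    · rcases hy with h | h
      · exact hV1nb (J.symm _ _ hT.1.rot.rot.1) h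
      · have : ¬ V2 u := fun h3 => by
          have := hwmin u h3
          rcases h with rfl | rfl <;> omega
        exact (or_iff_right this).1 (or_left_comm.1 (hJcases u hT.1.mem.1))
    · rcases hy with h | h
      · exact hV1nb hT.1.rot.1 h
      · have : ¬ V2 v := fun h3 => by
          have := hwmin v h3
          rcases h with rfl | rfl <;> omega
        exact (or_iff_right this).1 (or_left_comm.1 (hJcases v hT.1.mem.2.1))
  have g2 : J.Generated U2 v' x fun a b c =>
      J.ClockwiseTriangle a b c ∧ K.ClockwiseTriangle (f a) (f b) (f c) := by
    refine NearTriangulation.generated_of_order (rk := rk) (.inr (.inr rfl))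
      (.inr (.inl rfl)) (J.symm _ _ hxv)
      ⟨w, .inl hw, fun h => hv' (h ▸ hw.1), hw.2.1⟩ (fun _ _ _ h => h.1) fun y hy hy0 hy1 => ?_
    have hy2 : V2 y := by grind
    obtain ⟨u, v, hT, h1, h2⟩ := hrk y (hU2J y hy) (hV2z y hy2).1 (hV2z y hy2).2
    exact ⟨u, v, hT, hV2nb (J.symm _ _ hT.1.rot.rot.1) hy2, hV2nb hT.1.rot.1 hy2, h1, h2⟩
  have hin : ∀ {a b c}, J.ClockwiseTriangle a b c →
      (a, b, c) ∈ J.facesIn U1 ∨ (a, b, c) ∈ J.facesIn U2 := by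
    intro a b c h
    rw [NearTriangulation.mem_facesIn, NearTriangulation.mem_facesIn]
    have hnot : ∀ y ∈ J.verts, ¬ V2 y → y ∈ U1 := fun y hy h =>
      (or_iff_right h).1 (or_left_comm.1 (hJcases y hy))
    have hsym := fun {u v} (h : J.Adj u v) => J.symm _ _ h
    by_cases ha : V2 a
    · exact .inr ⟨h, .inl ha, hV2nb (hsym h.1) ha, hV2nb h.rot.rot.1 ha⟩
    by_cases hb : V2 b
    · exact .inr ⟨h, hV2nb h.1 hb, .inl hb, hV2nb (hsym h.rot.1) hb⟩
    by_cases hc : V2 c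
    exacts [.inr ⟨h, hV2nb (hsym h.rot.rot.1) hc, hV2nb h.rot.1 hc, .inl hc⟩,
      .inl ⟨h, hnot a h.mem.1 ha, hnot b h.mem.2.1 hb, hnot c h.mem.2.2 hc⟩]
  obtain ⟨hc1, hc2⟩ := NearTriangulation.c6_facesIn_of_cover hxv' g1 g2
    (fun y => ⟨fun h => hU12 y h.1 h.2, fun h => ⟨.inr h, .inr h⟩⟩) hin hc6
  rcases hin habc with h | h
  · refine hE.clockwise_of_generated hK hfi hfm hγ hU1J g1 hc1 ?_ h
    rintro v hv hvL
    have hv2 : v = v' := by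
      rcases hv with h | h | h
      exacts [absurd (hV1L v h).1 hvL, absurd (h ▸ hxL) hvL, h]
    subst hv2
    refine ⟨hout, f w, hlt.2.2, fun y hy he => ?_⟩
    rcases hU12 w (hfi (hU1J y hy) (hV2J w hw) he ▸ hy) (.inl hw) with h | h
    exacts [hw.2.1 h, hvL (h ▸ hw.1)]
  · refine hE.clockwise_of_generated hK hfi hfm hγ hU2J g2 hc2 ?_ h
    rintro v hv hvL
    have hv2 : v = v' := by
      rcases hv with h | h | h
      exacts [absurd h.1 hvL, absurd (h ▸ hxL) hvL, h]
    subst hv2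
    refine ⟨hout, f y₁, hKy₁, fun y hy he => ?_⟩
    rcases hU12 y₁ (.inl hy₁) (hfi (hU2J y hy) (hE.subset (hV1L y₁ hy₁).1) he ▸ hy) with h | h
    exacts [(hV1L _ hy₁).2 h, hvL (h ▸ (hV1L _ hy₁).1)]

end Configuration.Extends

/-! ### Images of configurations -/

open Classical Finset

namespace Drawing

variable {α β : Type*} (D : Drawing α) (f : α → β) (hf : Set.InjOn f D.verts)

/-- The drawing with the vertices renamed by `f`. -/
noncomputable def map : Drawing β where
  verts := D.verts.image f
  Adj x y := ∃ u v, D.Adj u v ∧ f u = x ∧ f v = y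
  next x y := if h : ∃ p : α × α, D.Adj p.1 p.2 ∧ f p.1 = x ∧ f p.2 = y then
    f (D.next h.choose.1 h.choose.2) else y
  symm := by
    rintro _ _ ⟨u, v, h, rfl, rfl⟩
    exact ⟨v, u, D.symm _ _ h, rfl, rfl⟩
  loopless := by
    rintro _ ⟨u, v, h, h1, h2⟩
    have := hf (D.mem_verts _ _ h) (D.mem_verts _ _ (D.symm _ _ h)) (h1.trans h2.symm)
    exact D.loopless u (by rwa [← this] at h)
  mem_verts := by
    rintro _ _ ⟨u, v, h, rfl, rfl⟩
    exact mem_image_of_mem f (D.mem_verts _ _ h)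
  next_adj := by
    rintro _ _ ⟨u, v, h, rfl, rfl⟩
    have h' : ∃ p : α × α, D.Adj p.1 p.2 ∧ f p.1 = f u ∧ f p.2 = f v := ⟨(u, v), h, rfl, rfl⟩
    rw [dif_pos h']
    exact ⟨_, _, D.next_adj _ _ h'.choose_spec.1, h'.choose_spec.2.1, rfl⟩
  next_cyclic := by
    rintro x _ _ ⟨v, a, ha, rfl, rfl⟩ ⟨v', b, hb, h1, rfl⟩
    obtain rfl := hf (D.mem_verts _ _ hb) (D.mem_verts _ _ ha) h1
    have key :
      ∀ c, D.Adj v' c → (if h : ∃ p : α × α, D.Adj p.1 p.2 ∧ f p.1 = f v' ∧ f p.2 = f c then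
        f (D.next h.choose.1 h.choose.2) else f c) = f (D.next v' c) := by
      intro c hc
      have h' : ∃ p : α × α, D.Adj p.1 p.2 ∧ f p.1 = f v' ∧ f p.2 = f c := ⟨(v', c), hc, rfl, rfl⟩
      rw [dif_pos h', hf (D.mem_verts _ _ h'.choose_spec.1) (D.mem_verts _ _ hc) h'.choose_spec.2.1,
        hf (D.mem_verts _ _ (D.symm _ _ h'.choose_spec.1)) (D.mem_verts _ _ (D.symm _ _ hc))
          h'.choose_spec.2.2]
    obtain ⟨k, rfl⟩ := D.next_cyclic v' a b ha hb
    refine ⟨k, ?_⟩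
    clear hb h1
    induction k with
    | zero => rfl
    | succ k ih =>
      rw [Function.iterate_succ_apply', ih, Function.iterate_succ_apply']
      exact key _ (iterate_adj ha k)

variable {D f}

theorem map_adj {u v : α} (hu : u ∈ D.verts) (hv : v ∈ D.verts) :
    (D.map f hf).Adj (f u) (f v) ↔ D.Adj u v := by
  constructor
  · rintro ⟨u', v', h, h1, h2⟩
    rwa [hf (D.mem_verts _ _ h) hu h1, hf (D.mem_verts _ _ (D.symm _ _ h)) hv h2] at h
  · exact fun h => ⟨u, v, h, rfl, rfl⟩

theorem map_next {u v : α} (h : D.Adj u v) : (D.map f hf).next (f u) (f v) = f (D.next u v) := by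
  have h' : ∃ p : α × α, D.Adj p.1 p.2 ∧ f p.1 = f u ∧ f p.2 = f v := ⟨(u, v), h, rfl, rfl⟩
  refine (dif_pos h').trans ?_
  rw [hf (D.mem_verts _ _ h'.choose_spec.1) (D.mem_verts _ _ h) h'.choose_spec.2.1,
    hf (D.mem_verts _ _ (D.symm _ _ h'.choose_spec.1)) (D.mem_verts _ _ (D.symm _ _ h))
      h'.choose_spec.2.2]

include hf in
theorem injOn_prodMap : Set.InjOn (Prod.map f f) D.darts := by
  rintro ⟨u, v⟩ h ⟨u', v'⟩ h' he
  obtain ⟨h1, h2⟩ := Prod.mk.inj he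
  exact Prod.ext (hf (D.mem_verts _ _ h) (D.mem_verts _ _ h') h1)
    (hf (D.mem_verts _ _ (D.symm _ _ h)) (D.mem_verts _ _ (D.symm _ _ h')) h2)

theorem map_darts : (D.map f hf).darts = Prod.map f f '' D.darts := by
  ext ⟨x, y⟩
  constructor
  · rintro ⟨u, v, h, rfl, rfl⟩
    exact ⟨(u, v), h, rfl⟩
  · rintro ⟨⟨u, v⟩, h, he⟩
    obtain ⟨rfl, rfl⟩ := Prod.mk.inj he
    exact ⟨u, v, h, rfl, rfl⟩

theorem map_faceNext_iterate {p : α × α} (h : p ∈ D.darts) (k : ℕ) :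
    (D.map f hf).faceNext^[k] (Prod.map f f p) = Prod.map f f (D.faceNext^[k] p) := by
  induction k with
  | zero => rfl
  | succ k ih =>
    rw [Function.iterate_succ_apply', ih, Function.iterate_succ_apply']
    exact Prod.ext (map_next hf (D.mapsTo_faceNext.iterate k h)) rfl

theorem map_region {p : α × α} (h : p ∈ D.darts) :
    (D.map f hf).region (Prod.map f f p) = Prod.map f f '' D.region p := by
  ext q
  constructor
  · rintro ⟨k, rfl⟩
    exact ⟨_, ⟨k, rfl⟩, (map_faceNext_iterate hf h k).symm⟩
  · rintro ⟨_, ⟨k, rfl⟩, rfl⟩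
    exact ⟨k, map_faceNext_iterate hf h k⟩

theorem map_regions : (D.map f hf).regions = Set.image (Prod.map f f) '' D.regions := by
  ext R
  constructor
  · rintro ⟨p, hp, rfl⟩
    rw [map_darts] at hp
    obtain ⟨q, hq, rfl⟩ := hp
    exact ⟨_, ⟨q, hq, rfl⟩, (map_region hf hq).symm⟩
  · rintro ⟨_, ⟨p, hp, rfl⟩, rfl⟩
    exact ⟨_, by rw [map_darts]; exact ⟨p, hp, rfl⟩, (map_region hf hp).symm⟩

include hf in
theorem injOn_image_regions : Set.InjOn (Set.image (Prod.map f f)) D.regions := by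
  rintro _ ⟨p, hp, rfl⟩ _ ⟨q, hq, rfl⟩ h
  exact (injOn_prodMap hf).image_eq_image_iff (region_subset hp) (region_subset hq) |>.1 h

theorem map_numRegions : (D.map f hf).numRegions = D.numRegions := by
  rw [numRegions, map_regions, Set.ncard_image_of_injOn (injOn_image_regions hf), numRegions]

theorem map_connected (h : D.Connected) : (D.map f hf).Connected := by
  refine ⟨h.1.image f, ?_⟩
  intro x hx y hy
  obtain ⟨u, hu, rfl⟩ := mem_image.1 hx
  obtain ⟨v, hv, rfl⟩ := mem_image.1 hy
  exact (h.2 u hu v hv).lift f fun a b hab => ⟨a, b, hab, rfl, rfl⟩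

theorem map_deg {v : α} (hv : v ∈ D.verts) : (D.map f hf).deg (f v) = D.deg v := by
  have : {u | (D.map f hf).Adj (f v) u} = f '' {u | D.Adj v u} := by
    ext y
    constructor
    · rintro ⟨v', u, h, h1, rfl⟩
      obtain rfl := hf (D.mem_verts _ _ h) hv h1
      exact ⟨u, h, rfl⟩
    · rintro ⟨u, h, rfl⟩
      exact ⟨v, u, h, rfl, rfl⟩
  have hsub : {u | D.Adj v u} ⊆ D.verts := fun u hu => D.mem_verts _ _ (D.symm _ _ hu)
  rw [deg, this, Set.ncard_image_of_injOn (hf.mono hsub), deg]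

theorem map_component {x u : α} (hx : x ∈ D.verts) (hu : u ∈ D.verts) :
    {w | Relation.ReflTransGen ((D.map f hf).AdjAvoiding (f x)) (f u) w} =
      f '' {w | Relation.ReflTransGen (D.AdjAvoiding x) u w} := by
  ext y
  constructor
  · intro h
    induction (h : Relation.ReflTransGen _ _ _) with
    | refl => exact ⟨u, .refl, rfl⟩
    | tail _ hbc ih =>
      obtain ⟨a, ha, rfl⟩ := ih
      obtain ⟨⟨a', b, hab, h1, rfl⟩, h2, h3⟩ := hbc
      have haD : a ∈ D.verts := by
        rcases ha.cases_tail with rfl | ⟨z, -, h⟩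
        exacts [hu, D.mem_verts _ _ (D.symm _ _ h.1)]
      obtain rfl := hf (D.mem_verts _ _ hab) haD h1
      exact ⟨b, ha.tail ⟨hab, fun e => h2 (e ▸ rfl), fun e => h3 (e ▸ rfl)⟩, rfl⟩
  · rintro ⟨w, hw, rfl⟩
    refine hw.lift f fun a b hab =>
      ⟨⟨a, b, hab.1, rfl, rfl⟩, fun e => hab.2.1 ?_, fun e => hab.2.2 ?_⟩
    exacts [hf (D.mem_verts _ _ hab.1) hx e, hf (D.mem_verts _ _ (D.symm _ _ hab.1)) hx e]

theorem map_numComponentsDelete {x : α} (hx : x ∈ D.verts) :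
    (D.map f hf).numComponentsDelete (f x) = D.numComponentsDelete x := by
  have hsub : ∀ u ∈ D.verts, {w | Relation.ReflTransGen (D.AdjAvoiding x) u w} ⊆ D.verts := by
    intro u hu w hw
    rcases (show Relation.ReflTransGen _ _ _ from hw).cases_tail with rfl | ⟨z, -, h⟩
    exacts [hu, D.mem_verts _ _ (D.symm _ _ h.1)]
  have hset : {C : Set β | ∃ u ∈ (D.map f hf).verts, u ≠ f x ∧
      C = {w | Relation.ReflTransGen ((D.map f hf).AdjAvoiding (f x)) u w}} =
      Set.image f '' {C : Set α | ∃ u ∈ D.verts, u ≠ x ∧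
        C = {w | Relation.ReflTransGen (D.AdjAvoiding x) u w}} := by
    ext C
    constructor
    · rintro ⟨_, h, hne, rfl⟩
      obtain ⟨u, hu, rfl⟩ := mem_image.1 h
      exact ⟨_, ⟨u, hu, fun e => hne (e ▸ rfl), rfl⟩, (map_component hf hx hu).symm⟩
    · rintro ⟨_, ⟨u, hu, hne, rfl⟩, rfl⟩
      exact ⟨f u, mem_image_of_mem f hu, fun e => hne (hf hu hx e),
        (map_component hf hx hu).symm⟩
  rw [numComponentsDelete, hset, Set.ncard_image_of_injOn, numComponentsDelete]
  rintro _ ⟨u, hu, -, rfl⟩ _ ⟨v, hv, -, rfl⟩ h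
  exact (hf.image_eq_image_iff (hsub u hu) (hsub v hv)).1 h

theorem map_isCutVertex {x : α} (hx : x ∈ D.verts) :
    (D.map f hf).IsCutVertex (f x) ↔ D.IsCutVertex x := by
  rw [IsCutVertex, IsCutVertex, map_numComponentsDelete hf hx]
  exact and_congr_left fun _ => ⟨fun _ => hx, fun _ => mem_image_of_mem f hx⟩

end Drawing

namespace NearTriangulation

variable {α β : Type*} (G : NearTriangulation α) (f : α → β) (hf : Set.InjOn f G.verts)

/-- The near-triangulation with the vertices renamed by `f`. -/
noncomputable def map : NearTriangulation β where
  toDrawing := G.toDrawing.map f hf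
  outer := Prod.map f f '' G.outer
  connected := Drawing.map_connected hf G.connected
  euler := by
    rw [Drawing.map_numRegions, Drawing.map_darts, Set.ncard_image_of_injOn
      (Drawing.injOn_prodMap hf),
      ← G.euler]
    exact congrArg (fun n => 2 * (n + _)) (card_image_of_injOn hf)
  outer_region := by
    rcases G.outer_region with h | ⟨h1, h2⟩
    · exact .inl (by rw [Drawing.map_regions]; exact ⟨_, h, rfl⟩)
    · exact .inr ⟨by rw [Drawing.map_darts, h1, Set.image_empty], by rw [h2, Set.image_empty]⟩
  finite_triangle := by
    intro p hp hout
    rw [Drawing.map_darts] at hp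
    obtain ⟨q, hq, rfl⟩ := hp
    rw [Drawing.map_faceNext_iterate hf hq, G.finite_triangle q hq fun h => hout ⟨q, h, rfl⟩]

variable {G f}

theorem map_outer {u v : α} (h : G.Adj u v) :
    (f u, f v) ∈ (G.map f hf).outer ↔ (u, v) ∈ G.outer := by
  constructor
  · rintro ⟨p, hp, he⟩
    rwa [Drawing.injOn_prodMap hf (G.outer_subset hp) (show (u, v) ∈ G.darts from h) he] at hp
  · exact fun h => ⟨(u, v), h, rfl⟩

theorem map_onOuter {v : α} (hv : v ∈ G.verts) : (G.map f hf).OnOuter (f v) ↔ G.OnOuter v := by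
  refine and_congr ⟨fun _ => hv, fun _ => mem_image_of_mem f hv⟩ (or_congr ?_ ?_)
  · constructor
    · rintro ⟨y, ⟨a, b⟩, h, he⟩
      obtain ⟨h1, -⟩ := Prod.mk.inj he
      obtain rfl := hf (G.mem_verts _ _ (G.outer_subset h)) hv h1
      exact ⟨b, h⟩
    · rintro ⟨u, hu⟩
      exact ⟨f u, (v, u), hu, rfl⟩
  · constructor
    · exact fun h u hu => h (f u) ⟨v, u, hu, rfl, rfl⟩
    · rintro h _ ⟨v', u, hu, h1, rfl⟩
      exact h u (by rwa [hf (G.mem_verts _ _ hu) hv h1] at hu)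

end NearTriangulation

namespace Configuration

variable {α β : Type*} (L : Configuration α) (f : α → β) (hf : Set.InjOn f L.verts)

/-- The configuration with the vertices renamed by `f`. -/
noncomputable def map (γ' : β → ℕ) (hγ : ∀ v ∈ L.verts, γ' (f v) = L.γ v) : Configuration β where
  toNearTriangulation := L.toNearTriangulation.map f hf
  γ := γ'
  components_le := by
    intro x hx
    obtain ⟨v, hv, rfl⟩ := mem_image.1 hx
    exact (Drawing.map_numComponentsDelete hf hv).trans_le (L.components_le v hv)
  cut_vertex := by
    intro x hx h
    obtain ⟨v, hv, rfl⟩ := mem_image.1 hx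
    have := L.cut_vertex v hv ((Drawing.map_numComponentsDelete hf hv).symm.trans h)
    rw [hγ v hv, this]
    exact congrArg (· + 2) (Drawing.map_deg hf hv).symm
  inner := by
    intro x hx h
    obtain ⟨v, hv, rfl⟩ := mem_image.1 hx
    rw [NearTriangulation.map_onOuter hf hv] at h
    rw [hγ v hv, L.inner v hv h]
    exact (Drawing.map_deg hf hv).symm
  on_outer := by
    intro x hx h
    obtain ⟨v, hv, rfl⟩ := mem_image.1 hx
    rw [NearTriangulation.map_onOuter hf hv] at h
    rw [hγ v hv]
    exact (Drawing.map_deg hf hv).trans_lt (L.on_outer v hv h)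
  five_le := by
    intro x hx
    obtain ⟨v, hv, rfl⟩ := mem_image.1 hx
    rw [hγ v hv]
    exact L.five_le v hv
  ring_size := by
    refine L.ring_size.trans_eq ?_
    have hv : (L.toNearTriangulation.map f hf).verts = L.verts.image f := rfl
    rw [hv, filter_image, sum_image (hf.mono fun v hv => (mem_filter.1 hv).1)]
    have hd : ∀ v ∈ L.verts, (L.toNearTriangulation.map f hf).deg (f v) = L.deg v :=
      fun v hv => Drawing.map_deg hf hv
    refine sum_congr (filter_congr fun v hv => ?_) fun v hv => ?_
    · exact (and_congr (NearTriangulation.map_onOuter hf hv)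
        (not_congr (Drawing.map_isCutVertex hf hv))).symm
    grind

variable {L f}

theorem map_isOrientedIso {γ' : β → ℕ} (hγ : ∀ v ∈ L.verts, γ' (f v) = L.γ v) :
    IsOrientedIso f L (L.map f hf γ' hγ) where
  bij := ⟨fun v hv => mem_image_of_mem f hv, hf, fun x hx => by
    obtain ⟨v, hv, rfl⟩ := mem_image.1 hx
    exact ⟨v, hv, rfl⟩⟩
  adj u hu v hv := (Drawing.map_adj hf hu hv).symm
  next v a h := Drawing.map_next hf h
  outer u v h := (NearTriangulation.map_outer hf h).symm
  γ := hγ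

end Configuration

/-! ### The image of a configuration is a subconfiguration of the skeleton -/

open Classical Finset

namespace NearTriangulation

variable {α : Type*} {G H : NearTriangulation α}

theorem eqvGen_firstReturn (hadj : ∀ u v, H.Adj u v → G.Adj u v) {v a b : α} (ha : G.Adj v a)
    (h : FirstReturn (G.next v) (H.Adj v) a b) :
    Relation.EqvGen (RegionStep H G) (v, a) (b, v) := by
  obtain ⟨k, hk, he, hj⟩ := h
  induction k generalizing a with
  | zero => omega
  | succ k ih =>
    have h1 : Relation.EqvGen (RegionStep H G) (v, a) (G.next v a, v) := .rel _ _ ⟨ha, .inl rfl⟩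
    rcases Nat.eq_zero_or_pos k with rfl | hk0
    · simp_all
    · have h2 : ¬ H.Adj v (G.next v a) := hj 1 one_pos (by omega)
      have h3 : G.Adj v (G.next v a) := G.next_adj _ _ ha
      refine h1.trans _ _ _ (.trans _ (v, G.next v a) _
        (.rel _ _ ⟨G.symm _ _ h3, .inr ⟨rfl, fun h => h2 (H.symm _ _ h)⟩⟩) ?_)
      refine ih h3 hk0 he fun j h4 h5 => ?_
      have := hj (j + 1) (by omega) (by omega)
      simp_all

theorem exists_firstReturn {N : α → Prop} {v a : α} (ha : G.Adj v a) {c : α} (hc : G.Adj v c)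
    (hN : N c) : ∃ b, N b ∧ FirstReturn (G.next v) N a b := by
  have hex : ∃ k, 0 < k ∧ N ((G.next v)^[k] a) := by
    obtain ⟨k, hk⟩ := G.next_cyclic v _ c (G.next_adj _ _ ha) hc
    exact ⟨k + 1, Nat.succ_pos k, by rwa [Function.iterate_succ_apply, hk]⟩
  exact ⟨_, (Nat.find_spec hex).2, Nat.find hex, (Nat.find_spec hex).1, rfl, fun j h1 h2 h3 =>
    Nat.find_min hex h2 ⟨h1, h3⟩⟩

/-- A drawing is a subdrawing if it is so at every vertex and its finite regions are finite
regions. -/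
theorem isSubdrawing_of_clockwise (hv : H.verts ⊆ G.verts) (hadj : ∀ u v, H.Adj u v → G.Adj u v)
    (hnext : ∀ v a, H.Adj v a → FirstReturn (G.next v) (H.Adj v) a (H.next v a))
    (hfin : ∀ u v w, H.ClockwiseTriangle u v w → G.ClockwiseTriangle u v w)
    (hne : ∃ u v, H.Adj u v) : H.IsSubdrawing G := by
  have hback : ∀ p ∈ H.darts, (∃ q ∈ G.outer, Relation.EqvGen (RegionStep H G) q p) →
      p ∈ H.outer := by
    rintro ⟨u, v⟩ hp ⟨q, hq, hr⟩
    by_contra hn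
    have hT := H.clockwise_of_notMem hp hn
    exact (hfin _ _ _ hT).not_eqvGen hT.1 hT.rot.1 hT.rot.rot.1 hq hr
  refine ⟨hv, hadj, hnext, fun p hp => ⟨fun hout => ?_, hback p hp⟩⟩
  obtain ⟨u₀, v₀, h₀⟩ := hne
  have hHnb : ∀ y ∈ H.verts, ∃ z, H.Adj y z := by
    intro y hy
    by_cases h : y = u₀
    exacts [⟨v₀, h ▸ h₀⟩, H.connected.exists_adj hy (H.mem_verts _ _ h₀) h]
  have hreach : ∀ y, Relation.ReflTransGen G.Adj y u₀ → ∀ z, G.Adj y z →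
      ∃ p' ∈ H.darts, Relation.EqvGen (RegionStep H G) (y, z) p' := by
    have hmem : ∀ y ∈ H.verts, ∀ z, G.Adj y z →
        ∃ p' ∈ H.darts, Relation.EqvGen (RegionStep H G) (y, z) p' := by
      intro y hy z hz
      obtain ⟨m, hm⟩ := hHnb y hy
      obtain ⟨b, hb, hr⟩ := exists_firstReturn hz (hadj _ _ hm) hm
      exact ⟨(b, y), H.symm _ _ hb, eqvGen_firstReturn hadj hz hr⟩
    intro y hy
    induction hy using Relation.ReflTransGen.head_induction_on with
    | refl => exact hmem u₀ (H.mem_verts _ _ h₀)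
    | head hyy' hrest ih =>
      rename_i y y'
      intro z hz
      by_cases hyH : y ∈ H.verts
      · exact hmem y hyH z hz
      · obtain ⟨p', hp', hr⟩ := ih y (G.symm _ _ hyy')
        refine ⟨p', hp', .trans _ _ _ ?_ hr⟩
        obtain ⟨b, rfl, hr'⟩ := exists_firstReturn (N := fun b => b = y') hz hyy' rfl
        refine eqvGen_firstReturn hadj hz ?_
        obtain ⟨k, hk, he, -⟩ := hr'
        exact ⟨k, hk, he, fun _ _ _ h => hyH (H.mem_verts _ _ h)⟩
  obtain ⟨q, hq⟩ : ∃ q, q ∈ G.outer := by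
    rcases G.outer_region with ⟨q, -, he⟩ | ⟨he, -⟩
    exacts [⟨q, he ▸ ⟨0, rfl⟩⟩,
      absurd (show (u₀, v₀) ∈ G.darts from hadj _ _ h₀) (he ▸ Set.notMem_empty _)]
  have hqd := G.outer_subset hq
  obtain ⟨p', hp', hr⟩ := hreach q.1 (G.connected.2 _ (G.mem_verts _ _ hqd) _
    (hv (H.mem_verts _ _ h₀))) q.2 hqd
  have hp'o := hback p' hp' ⟨q, hq, hr⟩
  refine ⟨q, hq, hr.trans _ _ _ ?_⟩
  rw [← H.region_eq_outer hp'o] at hout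
  obtain ⟨k, rfl⟩ := hout
  clear hp
  induction k with
  | zero => exact .refl _
  | succ k ih =>
    refine ih.trans _ _ _ ?_
    rw [Function.iterate_succ_apply']
    have hd := H.mapsTo_faceNext.iterate k hp'
    exact eqvGen_firstReturn hadj (hadj _ _ hd) (hnext _ _ hd)

end NearTriangulation

namespace Configuration.Extends

variable {α : Type*} {L : Configuration α} {J : NearTriangulation α} (hE : L.Extends J)
  {K : Configuration ℕ} {f : α → ℕ} {z₀ z₁ : α} {T : α → α → α → Prop}

include hE

theorem map_isSubconfiguration (hfi : Set.InjOn f J.verts) (hfm : Set.MapsTo f J.verts K.verts)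
    (hgen : J.Generated J.verts z₀ z₁ T) (h01 : L.Adj z₀ z₁)
    (hCT : ∀ a b c, J.ClockwiseTriangle a b c → K.ClockwiseTriangle (f a) (f b) (f c))
    (hfL : Set.InjOn f L.verts) (hγ : ∀ v ∈ L.verts, K.γ (f v) = L.γ v) :
    (L.map f hfL K.γ hγ).IsSubconfiguration K := by
  refine ⟨?_, fun _ _ => rfl⟩
  have hJK : ∀ {u v}, J.Adj u v → K.Adj (f u) (f v) := by
    intro u v h
    rcases hgen.edge h with ⟨w, hw⟩ | ⟨w, hw⟩
    exacts [(hCT _ _ _ (J.mem_faces.1 hw)).1, K.symm _ _ (hCT _ _ _ (J.mem_faces.1 hw)).1]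
  have hLJ : ∀ {u v}, L.Adj u v → J.Adj u v := fun h =>
    (hE.adj_iff _ (L.mem_verts _ _ h) _ (L.mem_verts _ _ (L.symm _ _ h))).1 h
  have hJK' : ∀ v b, J.Adj v b → FirstReturn (K.next (f v)) ((J.map f hfi).Adj (f v)) (f b)
      (f (J.next v b)) := by
    intro v b hb
    by_cases ho : (v, b) ∈ J.outer
    · obtain ⟨y, hy, hr⟩ := NearTriangulation.exists_firstReturn
        (N := (J.map f hfi).Adj (f v)) (hJK hb) (hJK hb) ⟨v, b, hb, rfl, rfl⟩
      obtain ⟨v', c, hc, h1, rfl⟩ := hy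
      obtain rfl := hfi (J.mem_verts _ _ hc) (J.mem_verts _ _ hb) h1
      obtain ⟨b', hb', rfl⟩ := J.exists_next_eq hc
      by_cases ho' : (v', b') ∈ J.outer
      · rw [hgen.outer_unique ho ho'] at hr ⊢
        exact hr
      · exfalso
        have hT := (hCT _ _ _ (J.clockwise_of_notMem hb' ho')).2.2.1
        obtain ⟨k, hk, he, hj⟩ := hr
        obtain ⟨k, rfl⟩ := Nat.exists_eq_succ_of_ne_zero hk.ne'
        rw [Function.iterate_succ_apply'] at he
        have h2 := K.next_injOn _ (Drawing.iterate_adj (hJK hb) k) (hJK hb') (he.trans hT.symm)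
        rcases Nat.eq_zero_or_pos k with rfl | h0
        · exact ho' (hfi (J.mem_verts _ _ (J.symm _ _ hb)) (J.mem_verts _ _ (J.symm _ _ hb'))
            h2 ▸ ho)
        · exact hj k h0 (Nat.lt_succ_self k) (h2 ▸ ⟨v', b', hb', rfl, rfl⟩)
    · exact FirstReturn.of_step (hCT _ _ _ (J.clockwise_of_notMem hb ho)).2.2.1
  refine NearTriangulation.isSubdrawing_of_clockwise ?_ ?_ ?_ ?_
    ⟨f z₀, f z₁, z₀, z₁, h01, rfl, rfl⟩
  · intro x hx
    obtain ⟨v, hv, rfl⟩ := (map_isOrientedIso hfL hγ).bij.surjOn hx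
    exact hfm (hE.subset hv)
  · rintro _ _ ⟨u, v, h, rfl, rfl⟩
    exact hJK (hLJ h)
  · rintro _ _ ⟨v, a, h, rfl, rfl⟩
    rw [show (L.map f hfL K.γ hγ).next (f v) (f a) = f (L.next v a) from Drawing.map_next hfL h]
    refine firstReturn_trans (M := (J.map f hfi).Adj (f v)) (h := (J.map f hfi).next (f v)) ?_ ?_
      ⟨v, a, hLJ h, rfl, rfl⟩ ?_
    · rintro _ ⟨v', b, hb, h1, rfl⟩
      obtain rfl := hfi (J.mem_verts _ _ hb) (hE.subset (L.mem_verts _ _ h)) h1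
      refine ⟨(J.map f hfi).next_adj _ _ ⟨v', b, hb, rfl, rfl⟩, ?_⟩
      rw [show (J.map f hfi).next (f v') (f b) = f (J.next v' b) from Drawing.map_next hfi hb]
      exact hJK' v' b hb
    · rintro _ ⟨v', b, hb, h1, rfl⟩
      exact ⟨v', b, hLJ hb, h1, rfl⟩
    · obtain ⟨k, hk, he, hj⟩ := hE.next v a h
      have hit : ∀ j, ((J.map f hfi).next (f v))^[j] (f a) = f ((J.next v)^[j] a) := by
        intro j
        induction j with
        | zero => rfl
        | succ j ih =>
          rw [Function.iterate_succ_apply', ih, Function.iterate_succ_apply']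
          exact Drawing.map_next hfi (Drawing.iterate_adj (hLJ h) j)
      refine ⟨k, hk, by rw [hit, he], fun j h1 h2 h3 => hj j h1 h2 ?_⟩
      rw [hit] at h3
      obtain ⟨v', b, hb, h4, h5⟩ := h3
      have hja := Drawing.iterate_adj (hLJ h) j
      rwa [hfL (L.mem_verts _ _ hb) (L.mem_verts _ _ h) h4, hfi (hE.subset (L.mem_verts _ _
        (L.symm _ _ hb))) (J.mem_verts _ _ (J.symm _ _ hja)) h5] at hb
  · rintro x y z hT
    obtain ⟨u, v, h, rfl, rfl⟩ := id hT.1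
    have ho : (u, v) ∉ L.outer := fun h' => hT.2.1 ((NearTriangulation.map_outer hfL h).2 h')
    have hz : z = f (L.next u v) := hT.2.2.1.symm.trans (Drawing.map_next hfL h)
    rw [hz]
    exact hCT _ _ _ (hE.clockwise _ _ _ (L.clockwise_of_notMem h ho))

end Configuration.Extends

/-! ### Deleting vertices from the skeleton -/

open Classical TriSys Wheel Wheel.KV Wheel.Fc Finset

namespace NearTriangulation

variable {α : Type*} (G : NearTriangulation α)

/-- The darts with both ends in `S`. -/
noncomputable def dartsIn (S : Finset α) : Finset (α × α) :=
  G.dartSet.filter fun p => p.1 ∈ S ∧ p.2 ∈ S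

variable {G}

theorem mem_dartsIn {S : Finset α} {u v : α} :
    (u, v) ∈ G.dartsIn S ↔ G.Adj u v ∧ u ∈ S ∧ v ∈ S := by
  rw [dartsIn, mem_filter, Drawing.mem_dartSet]

variable (G) in
/-- The vertices, edges and finite regions in `S` satisfy one half of Euler's formula. -/
def Full (S : Finset α) : Prop :=
  3 * (G.dartsIn S).card + 6 ≤ 2 * (G.facesIn S).card + 6 * S.card

theorem full_verts : G.Full G.verts := by
  have h1 : G.dartsIn G.verts = G.dartSet := by
    ext ⟨u, v⟩
    rw [mem_dartsIn, Drawing.mem_dartSet]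
    exact ⟨fun h => h.1, fun h => ⟨h, G.mem_verts _ _ h, G.mem_verts _ _ (G.symm _ _ h)⟩⟩
  have := G.euler_faces
  rw [Full, h1, facesIn_verts]
  omega

/-- A vertex whose regions in `S` do not surround it can be deleted. -/
theorem Full.erase [DecidableEq α] {S : Finset α} (h : G.Full S) {y a z : α} (hy : y ∈ S)
    (ha : a ∈ S)
    (hya : G.Adj y a) (hyz : G.Adj y z) (hz : z ∈ S → ∀ b, ¬ G.ClockwiseTriangle y z b) :
    G.Full (S.erase y) := by
  set N := S.filter (G.Adj y) with hN
  set N' := N.filter fun c => ∃ b, (y, c, b) ∈ G.facesIn S with hN'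
  have hlt : N'.card < N.card := by
    refine card_lt_card ((filter_subset _ _).ssubset_of_ne fun heq => ?_)
    have hall : ∀ c ∈ N, ∃ b, (y, c, b) ∈ G.facesIn S := fun c hc => by grind
    have hzS : z ∈ S := by
      refine G.mem_of_next_closed (X := (· ∈ S)) (fun c hc hcS => ?_) hya hyz ha
      obtain ⟨b, hb⟩ := hall c (mem_filter.2 ⟨hcS, hc⟩)
      rw [mem_facesIn] at hb
      rw [hb.1.2.2.1]
      exact hb.2.2.2
    obtain ⟨b, hb⟩ := hall z (mem_filter.2 ⟨hzS, hyz⟩)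
    exact hz hzS b (mem_facesIn.1 hb).1
  have hA : (G.dartsIn (S.erase y)).card + (N.card + N.card) ≤ (G.dartsIn S).card := by
    have e1 : (N.image fun c => (y, c)).card = N.card :=
      card_image_of_injective _ fun _ _ h => (Prod.mk.inj h).2
    have e2 : (N.image fun c => (c, y)).card = N.card :=
      card_image_of_injective _ fun _ _ h => (Prod.mk.inj h).1
    have d1 : Disjoint (N.image fun c => (y, c)) (N.image fun c => (c, y)) := by
      rw [disjoint_left]
      rintro ⟨u, v⟩ h1 h2
      simp only [hN, mem_image, mem_filter, Prod.mk.injEq] at h1 h2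
      obtain ⟨c, hc, rfl, rfl⟩ := h1
      obtain ⟨c', hc', rfl, rfl⟩ := h2
      exact G.loopless _ hc.2
    have d2 : Disjoint (G.dartsIn (S.erase y))
        ((N.image fun c => (y, c)) ∪ N.image fun c => (c, y)) := by
      rw [disjoint_left]
      rintro ⟨u, v⟩ h1 h2
      simp only [mem_dartsIn, mem_erase, mem_union, mem_image,
        Prod.mk.injEq] at h1 h2
      grind
    have c1 := card_union_of_disjoint d1
    rw [e1, e2] at c1
    rw [← c1, ← card_union_of_disjoint d2]
    refine card_le_card ?_
    rintro ⟨u, v⟩ h1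
    simp only [hN, mem_dartsIn, mem_erase, mem_union, mem_image,
      mem_filter, Prod.mk.injEq] at h1 ⊢
    rcases h1 with h1 | ⟨c, hc, rfl, rfl⟩ | ⟨c, hc, rfl, rfl⟩
    exacts [⟨h1.1, h1.2.1.2, h1.2.2.2⟩, ⟨hc.2, hy, hc.1⟩, ⟨G.symm _ _ hc.2, hc.1, hy⟩]
  have hP :
    (G.facesIn S).card ≤ (G.facesIn (S.erase y)).card + (N'.card + (N'.card + N'.card)) := by
    have hsub : G.facesIn S ⊆ G.facesIn (S.erase y) ∪ (N'.image (fun c => (y, c, G.next y c)) ∪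
        (N'.image (fun c => (c, G.next y c, y)) ∪ N'.image fun c => (G.next y c, y, c))) := by
      rintro ⟨u, v, w⟩ h1
      have hrot : ∀ {u v w}, (u, v, w) ∈ G.facesIn S → (v, w, u) ∈ G.facesIn S :=
        (sys_facesIn (S : Set α)).rot _ _ _
      have key : ∀ {c b}, (y, c, b) ∈ G.facesIn S → c ∈ N' ∧ G.next y c = b := fun {c b} h =>
        ⟨mem_filter.2 ⟨mem_filter.2 ⟨(mem_facesIn.1 h).2.2.1, (mem_facesIn.1 h).1.1⟩,
          b, h⟩, (mem_facesIn.1 h).1.2.2.1⟩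
      simp only [mem_union, mem_image, Prod.mk.injEq]
      by_cases hu : u = y
      · grind
      by_cases hv : v = y
      · grind
      by_cases hw : w = y
      · grind
      · rw [mem_facesIn] at h1
        refine .inl (mem_facesIn.2 ⟨h1.1, ?_, ?_, ?_⟩) <;>
          simp only [coe_erase, Set.mem_diff, Set.mem_singleton_iff]
        exacts [⟨h1.2.1, hu⟩, ⟨h1.2.2.1, hv⟩, ⟨h1.2.2.2, hw⟩]
    exact (card_le_card hsub).trans ((card_union_le _ _).trans (Nat.add_le_add_left
      ((card_union_le _ _).trans (Nat.add_le_add card_image_le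
        ((card_union_le _ _).trans (Nat.add_le_add card_image_le
          card_image_le)))) _))
  have hS := card_erase_add_one hy
  unfold Full at h ⊢
  omega

theorem Full.sdiff [DecidableEq α] {S : Finset α} (h : G.Full S) (Y : Finset α)
    (hY : ∀ S' ⊆ S, S \ Y ⊆ S' → ∀ y ∈ Y, y ∈ S' → ∃ a ∈ S', G.Adj y a ∧
      ∃ z, G.Adj y z ∧ (z ∈ S' → ∀ b, ¬ G.ClockwiseTriangle y z b)) : G.Full (S \ Y) := by
  induction Y using Finset.induction_on with
  | empty => rwa [sdiff_empty]
  | insert y Y hyY ih =>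
    have ih' := ih fun S' h1 h2 y' hy' => hY S' h1
      ((sdiff_subset_sdiff le_rfl (subset_insert _ _)).trans h2) y'
      (mem_insert_of_mem hy')
    rw [sdiff_insert]
    by_cases hy : y ∈ S \ Y
    · obtain ⟨a, ha, hya, z, hyz, hz⟩ := hY (S \ Y) sdiff_subset
        (sdiff_subset_sdiff le_rfl (subset_insert _ _)) y
        (mem_insert_self _ _) hy
      exact ih'.erase hy ha hya hyz hz
    · rwa [erase_eq_of_notMem hy]

end NearTriangulation

namespace Wheel

variable {d : ℕ} {W : Fan d}

/-- Adjacent vertices other than the hub have the same zone or consecutive zones. -/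
theorem zone_near {a b c : KV d} (h : W.IsFace a b c) (ha : a ≠ hub) (hb : b ≠ hub) :
    zone b = zone a ∨ zone b = zone a + 1 ∨ zone b = zone a - 1 := by
  have hz : ∀ i m, zone (W.rho i m) = if m = 0 then i - 1 else i := by
    intro i m
    unfold Fan.rho
    split_ifs <;> rfl
  have hzs : ∀ i, zone (s i : KV d) = i := fun _ => rfl
  have hzh : ∀ i, zone (KV.h i : KV d) = i := fun _ => rfl
  obtain ⟨F, -, h | h | h⟩ := h <;> rcases F with i | i | ⟨i, m⟩ <;>
    obtain ⟨h1, h2⟩ := Prod.mk.inj h <;> obtain ⟨h2, h3⟩ := Prod.mk.inj h2 <;> subst h1 h2 h3 <;>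
    first
    | exact absurd rfl ha
    | exact absurd rfl hb
    | (simp only [hzs, hzh, hz]; split_ifs <;> simp)
    | (simp only [hzs, hzh, hz]; simp)

end Wheel

namespace Axle.IsSkeleton

variable {d : ℕ} {A : Axle d} {K : Configuration ℕ} (hK : A.IsSkeleton K)

include hK

theorem not_clockwise {a z : KV d} (ha : (A.wheel hK.le_degree).Vert a)
    (hz : (A.wheel hK.le_degree).Vert z)
    (hn : ∀ F c, (A.wheel hK.le_degree).Valid F → ¬ (A.wheel hK.le_degree).At F a z c) (b : ℕ) :
    ¬ K.ClockwiseTriangle (label a) (label z) b := by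
  intro h
  obtain ⟨c, hc, rfl⟩ := hK.mem_verts.1 h.mem.2.2
  obtain ⟨F, hF, hA⟩ := hK.isFace ha hz hc h
  exact hn F c hF hA

/-- Every vertex other than the hub and the spokes is adjacent to a spoke and has an outer
corner. -/
theorem outer_corner {k : KV d} (hk : (A.wheel hK.le_degree).Vert k) (h0 : k ≠ KV.hub)
    (hs : ∀ i, k ≠ s i) : ∃ i : ZMod d, K.Adj (label k) (label (s i)) ∧
      ∃ z, K.Adj (label k) z ∧ ∀ b, ¬ K.ClockwiseTriangle (label k) z b := by
  set W := A.wheel hK.le_degree with hW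
  have hadj : ∀ {a b c : KV d}, W.IsFace a b c → K.Adj (label a) (label b) := fun h =>
    (hK.clockwise h).1
  rcases k with _ | i | i | ⟨i, m⟩
  · exact absurd rfl h0
  · exact absurd rfl (hs i)
  · have hf := isFace_nodes (W := W) (F := e i) trivial
    refine ⟨i, K.symm _ _ (hadj hf), ?_⟩
    by_cases hi : W.fan i
    · have hg := W.pos i
      have hp := isFace_nodes (W := W) (F := p i (W.g i - 1)) ⟨hi, by omega⟩
      simp only [Fan.nodes, Nat.sub_add_cancel hg, Fan.rho_g] at hp
      refine ⟨_, K.symm _ _ (hadj hp.rot), hK.not_clockwise trivial (vert_of_isFace hp).2.1 ?_⟩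
      intro F c hF hA
      rcases (W.at_hat hF).1 hA with ⟨-, h, -⟩ | ⟨-, h, -⟩ | ⟨-, h, -⟩
      exacts [rho_one_ne i h.symm, W.rho_ne_s _ _ _ h, W.rho_ne_s _ _ _ h]
    · refine ⟨_, K.symm _ _ (hadj hf), hK.not_clockwise trivial trivial ?_⟩
      intro F c hF hA
      rcases (W.at_hat hF).1 hA with ⟨-, h, -⟩ | ⟨-, h, -⟩ | ⟨rfl, -, -⟩
      exacts [W.rho_ne_s _ _ _ h.symm, (W.ne_of_sub 1) (KV.s.inj h).symm, hi hF.1]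
  · obtain ⟨hi, hm0, hm⟩ := hk
    have hp := isFace_nodes (W := W) (F := p i (m - 1)) ⟨hi, by omega⟩
    simp only [Fan.nodes, Nat.sub_add_cancel hm0, W.rho_inner hm0 hm] at hp
    refine ⟨i, hadj hp.rot.rot, _, K.symm _ _ (hadj hp.rot),
      hK.not_clockwise ⟨hi, hm0, hm⟩ (vert_of_isFace hp).2.1 ?_⟩
    intro F c hF hA
    obtain ⟨-, -, ⟨-, h, -⟩ | ⟨-, h, -⟩⟩ := W.at_rim hF hA
    · have := W.rho_inj (by omega) (by omega) h
      omega
    · exact W.rho_ne_s _ _ _ h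

theorem hub_adj_spoke (i : ZMod d) : K.Adj 0 (label (s i)) :=
  (hK.clockwise (isFace_nodes (F := t i) trivial)).1

/-- Deleting all vertices that are not in `S` does not increase the number of holes. -/
theorem full_of_wellPositioned {S : Finset ℕ} (hS : S ⊆ K.verts)
    (hwp : ∀ i : ZMod d, label (s i) ∉ S → label (h i) ∉ S ∨ label (h (i - 1)) ∉ S)
    (hhub : 0 ∉ S → ∃ i j : ZMod d, j ≠ i ∧ label (s j) ∉ S ∧
      (label (s i) ∈ S ∨ ∃ a ∈ S, K.Adj (label (s i)) a)) : K.Full S := by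
  have h5 := hK.le_degree
  have hlab := A.label_injOn h5
  have hsp : ∀ i : ZMod d, (A.wheel h5).Vert (s i) := fun _ => trivial
  have hadj : ∀ {a b c : KV d}, (A.wheel h5).IsFace a b c → K.Adj (label a) (label b) := fun h =>
    (hK.clockwise h).1
  have hs0 : ∀ i : ZMod d, label (s i) ≠ 0 := fun i h => Nat.succ_ne_zero _ h
  have hspK : ∀ i : ZMod d, label (s i) ∈ K.verts := fun i => hK.mem_verts.2 ⟨_, hsp i, rfl⟩
  set Y₁ := K.verts.filter fun x => x ∉ S ∧ x ≠ 0 ∧ ∀ i : ZMod d, x ≠ label (s i) with hY₁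
  have f₁ : K.Full (K.verts \ Y₁) := by
    refine K.full_verts.sdiff Y₁ fun S' _ hS' y hy hyS' => ?_
    obtain ⟨hyK, -, hy0, hys⟩ := mem_filter.1 hy
    obtain ⟨k, hk, rfl⟩ := hK.mem_verts.1 hyK
    obtain ⟨i, hi, z, hz, hb⟩ := hK.outer_corner hk (fun h => hy0 (h ▸ rfl)) fun i h => hys i
      (h ▸ rfl)
    grind
  have hm₁ : ∀ x, x ∈ K.verts \ Y₁ ↔ x ∈ S ∨ x = 0 ∨ ∃ i : ZMod d, x = label (s i) := by
    intro x
    simp only [hY₁, mem_sdiff, mem_filter]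
    constructor
    · grind
    · rintro (h1 | rfl | ⟨i, rfl⟩)
      exacts [⟨hS h1, fun h => h.2.1 h1⟩, ⟨hK.hub_mem, fun h => h.2.2.1 rfl⟩,
        ⟨hspK i, fun h => h.2.2.2 i rfl⟩]
  have f₂ : ∀ E : ℕ → Prop, ∃ S₂, K.Full S₂ ∧
      ∀ x, x ∈ S₂ ↔ x ∈ S ∨ x = 0 ∨ ((∃ i : ZMod d, x = label (s i)) ∧ E x) := by
    intro E
    refine ⟨_, f₁.sdiff (K.verts.filter fun x => x ∉ S ∧ ¬ E x ∧ ∃ i : ZMod d, x = label (s i))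
      fun S' hS'1 hS'2 y hy hyS' => ?_, fun x => ?_⟩
    rotate_left
    · grind
    obtain ⟨hyK, hyS, -, i, rfl⟩ := mem_filter.1 hy
    refine ⟨0, hS'2 (mem_sdiff.2 ⟨(hm₁ 0).2 (.inr (.inl rfl)), fun h => ?_⟩),
      K.symm _ _ (hK.hub_adj_spoke i), ?_⟩
    · obtain ⟨j, hj⟩ := (mem_filter.1 h).2.2.2
      exact hs0 j hj.symm
    · have hnot : ∀ j : ZMod d, label (h j) ∉ S → label (h j) ∉ S' := by
        intro j hj hj'
        rcases (hm₁ _).1 (hS'1 hj') with h | h | ⟨l, h⟩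
        · exact hj h
        · have := hlab (show (A.wheel h5).Vert (KV.h j) from trivial)
            (show (A.wheel h5).Vert KV.hub from trivial)
              (h.trans (show 0 = label (d := d) KV.hub from rfl))
          simp at this
        · have := hlab (show (A.wheel h5).Vert (KV.h j) from trivial) (hsp l) h
          simp at this
      rcases hwp i hyS with h | h
      · exact ⟨_, hadj (isFace_nodes (F := e i) trivial), fun h' => absurd h' (hnot _ h)⟩
      · have hf := isFace_nodes (W := A.wheel h5) (F := e (i - 1)) trivial
        simp only [Fan.nodes, sub_add_cancel] at hf
        exact ⟨_, K.symm _ _ (hadj hf.rot), fun h' => absurd h' (hnot _ h)⟩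
  by_cases h0 : 0 ∈ S
  · obtain ⟨S₂, f, hm⟩ := f₂ fun _ => False
    convert f using 1
    ext x
    rw [hm]
    exact ⟨.inl, fun h => h.elim id fun h => h.elim (fun e => e ▸ h0) fun h => h.2.elim⟩
  obtain ⟨i, j, hji, hjS, hi⟩ := hhub h0
  obtain ⟨S₂, f₂', hm₂'⟩ := f₂ fun x => x = label (s i)
  have hm₂ : ∀ x, x ∈ S₂ ↔ x ∈ S ∨ x = 0 ∨ x = label (s i) := fun x =>
    (hm₂' x).trans (or_congr_right (or_congr_right ⟨fun h => h.2, fun h => ⟨⟨i, h⟩, h⟩⟩))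
  have f₃ := f₂'.erase ((hm₂ 0).2 (.inr (.inl rfl))) ((hm₂ _).2 (.inr (.inr rfl)))
    (hK.hub_adj_spoke i) (hK.hub_adj_spoke j) fun h => by
      rcases (hm₂ _).1 h with h | h | h
      exacts [absurd h hjS, absurd h (hs0 j), absurd (KV.s.inj (hlab (hsp j) (hsp i) h)) hji]
  by_cases hiS : label (s i) ∈ S
  · convert f₃ using 1
    ext x
    rw [mem_erase, hm₂]
    constructor
    · grind
    · grind
  obtain ⟨a, ha, hia⟩ := hi.resolve_left hiS
  have hm₃ : ∀ x, x ∈ S₂.erase 0 ↔ x ∈ S ∨ x = label (s i) := by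
    intro x
    rw [mem_erase, hm₂]
    constructor
    · rintro ⟨h1, h2 | rfl | rfl⟩
      exacts [Or.inl h2, absurd rfl h1, .inr rfl]
    · rintro (h | rfl)
      exacts [⟨fun e => h0 (e ▸ h), .inl h⟩, ⟨hs0 i, .inr (.inr rfl)⟩]
  have f₄ := f₃.erase ((hm₃ _).2 (.inr rfl)) ((hm₃ a).2 (.inl ha)) hia
    (K.symm _ _ (hK.hub_adj_spoke i)) fun h => absurd rfl (mem_erase.1 h).1
  convert f₄ using 1
  ext x
  rw [mem_erase, hm₃]
  constructor
  · grind
  grind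

end Axle.IsSkeleton

/-! ### Induced subconfigurations of the skeleton -/

open Classical TriSys Wheel Wheel.KV Wheel.Fc Finset

namespace Axle.IsSkeleton

variable {d : ℕ} {A : Axle d} {K : Configuration ℕ} (hK : A.IsSkeleton K)

include hK

/-- A set of radius at most two that does not contain the hub contains at most five spokes. -/
theorem exists_spoke_notMem (hd : 6 ≤ d) {M : NearTriangulation ℕ}
    (hMK : ∀ u v, M.Adj u v → K.Adj u v) (hsub : M.verts ⊆ K.verts)
    (hr : M.HasRadiusAtMostTwo) (h0 : 0 ∉ M.verts) : ∃ i : ZMod d, label (s i) ∉ M.verts := by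
  obtain ⟨c, hc, hcv⟩ := hr
  obtain ⟨k, hk, rfl⟩ := hK.mem_verts.1 (hsub hc)
  have hhub : ∀ k : KV d, label k ∈ M.verts → k ≠ KV.hub := by
    rintro _ h rfl
    exact h0 h
  have hstep : ∀ x, (A.wheel hK.le_degree).Vert x → ∀ y, M.Adj (label x) y → ∃ z, label z = y ∧
      (A.wheel hK.le_degree).Vert z ∧
      (zone z = zone x ∨ zone z = zone x + 1 ∨ zone z = zone x - 1) := by
    intro x hx y hxy
    have hyM := M.mem_verts _ _ (M.symm _ _ hxy)
    obtain ⟨z, hz, rfl⟩ := hK.mem_verts.1 (hsub hyM)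
    have hx0 := hhub x (M.mem_verts _ _ hxy)
    have hz0 := hhub z hyM
    refine ⟨z, rfl, hz, ?_⟩
    obtain ⟨b, hf | hf⟩ := hK.isFace_of_adj hx hz (hMK _ _ hxy)
    · exact zone_near hf hx0 hz0
    · rcases zone_near hf hz0 hx0 with h | h | h
      exacts [.inl h.symm, .inr (.inr (eq_sub_of_add_eq h.symm)),
        .inr (.inl (sub_eq_iff_eq_add.1 h.symm))]
  have hne : ∀ n : ℕ, 0 < n → n < 6 → ((n : ℕ) : ZMod d) ≠ 0 := by
    intro n h1 h2 h
    rw [ZMod.natCast_eq_zero_iff] at h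
    have := Nat.le_of_dvd h1 h
    omega
  have e1 := hne 1 (by norm_num) (by norm_num)
  have e2 := hne 2 (by norm_num) (by norm_num)
  have e3 := hne 3 (by norm_num) (by norm_num)
  have e4 := hne 4 (by norm_num) (by norm_num)
  have e5 := hne 5 (by norm_num) (by norm_num)
  push_cast at e1 e2 e3 e4 e5
  have hzs : ∀ i : ZMod d, zone (s i) = i := fun _ => rfl
  refine ⟨zone k + 3, fun hi => ?_⟩
  have hinj := A.label_injOn hK.le_degree
  have hsv : (A.wheel hK.le_degree).Vert (s (zone k + 3)) := trivial
  rcases hcv _ hi with h | h | ⟨w, h1, h2⟩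
  · have := congrArg zone (hinj hsv hk h)
    simp_all
  · obtain ⟨z, hz, hzv, hzz⟩ := hstep k hk _ h
    rw [hinj hzv hsv hz] at hzz
    rcases hzz with h | h | h <;> rw [hzs] at h
    exacts [e3 (by linear_combination h), e2 (by linear_combination h),
      e4 (by linear_combination h)]
  · obtain ⟨z, rfl, hzv, hzz⟩ := hstep k hk _ h1
    obtain ⟨z', hz', hzv', hzz'⟩ := hstep z hzv _ h2
    rw [hinj hzv' hsv hz'] at hzz'
    rcases hzz with h | h | h <;> rcases hzz' with h' | h' | h' <;> rw [hzs] at h'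
    exacts [e3 (by linear_combination h + h'), e2 (by linear_combination h + h'),
      e4 (by linear_combination h + h'), e2 (by linear_combination h + h'),
      e1 (by linear_combination h + h'), e3 (by linear_combination h + h'),
      e4 (by linear_combination h + h'), e3 (by linear_combination h + h'),
      e5 (by linear_combination h + h')]

/-- A well-positioned subconfiguration of radius at most two is induced, unless the skeleton has a
triangle that is cut off by an edge of the skeleton. -/
theorem full_of_radius (hd : 6 ≤ d) {M : Configuration ℕ} (hsub : M.verts ⊆ K.verts)
    (hMK : ∀ u v, M.Adj u v → K.Adj u v) (hr : M.HasRadiusAtMostTwo)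
    (hwp : WellPositioned d M) : K.Full M.verts := by
  have : NeZero d := ⟨by omega⟩
  have : Fact (1 < d) := ⟨by omega⟩
  refine hK.full_of_wellPositioned hsub (fun i hi => ?_) fun h0 => ?_
  · have := hwp _ (spoke_mem i) hi
    rwa [label_hatBefore hK.le_degree] at this
  by_cases hs : ∃ i : ZMod d, label (s i) ∈ M.verts
  · obtain ⟨i, hi⟩ := hs
    obtain ⟨j, hj⟩ := hK.exists_spoke_notMem hd hMK hsub hr h0
    grind
  · push Not at hs
    obtain ⟨x, hx⟩ := M.connected.1
    obtain ⟨k, hk, rfl⟩ := hK.mem_verts.1 (hsub hx)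
    obtain ⟨i, hi, -⟩ := hK.outer_corner hk (fun e => h0 (by rw [e] at hx; exact hx)) fun i e =>
      hs i (e ▸ hx)
    exact ⟨i, i + 1, by simp, hs _, .inr ⟨_, hx, K.symm _ _ hi⟩⟩

end Axle.IsSkeleton

namespace NearTriangulation

variable {α : Type*} {G H : NearTriangulation α}

/-- If a subdrawing with few holes is not induced, then some finite region has exactly one edge
that is missing. -/
theorem IsSubdrawing.exists_corner (h : H.IsSubdrawing G) (hfull : G.Full H.verts)
    (hn : ∃ u ∈ H.verts, ∃ v ∈ H.verts, G.Adj u v ∧ ¬ H.Adj u v) :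
    ∃ a b c, G.ClockwiseTriangle a b c ∧ ¬ H.Adj a b ∧ H.Adj b c ∧ H.Adj c a := by
  have hle := (sys_facesIn (G := G) (H.verts : Set α)).graph_le (V := H.verts)
    (A := G.dartsIn H.verts) (E := H.Adj)
    (fun a b hab => (mem_dartsIn.1 hab).2) ?_ H.symm (fun a b hab => mem_dartsIn.2
      ⟨h.adj _ _ hab, H.mem_verts _ _ hab, H.mem_verts _ _ (H.symm _ _ hab)⟩)
    H.connected.1 H.connected.2
  · obtain ⟨u, hu, v, hv, h1, h2⟩ := hn
    obtain ⟨a, b, c, hT, h3⟩ := (hle.2 (le_antisymm hle.1 hfull)).2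
      ⟨u, v, mem_dartsIn.2 ⟨h1, hu, hv⟩, h2⟩
    exact ⟨a, b, c, (mem_facesIn.1 hT).1, h3⟩
  · rintro a b (⟨c, hT⟩ | ⟨c, hT⟩) <;> rw [mem_facesIn] at hT
    exacts [mem_dartsIn.2 ⟨hT.1.1, hT.2.1, hT.2.2.1⟩,
      mem_dartsIn.2 ⟨G.symm _ _ hT.1.1, hT.2.2.1, hT.2.1⟩]

end NearTriangulation

namespace Configuration

variable {α β δ : Type*}

theorem Extends.not_corner {L : Configuration α} {J : NearTriangulation α} (hE : L.Extends J)
    {K : Configuration ℕ} {f : α → ℕ} {z₀ z₁ : α} {T : α → α → α → Prop}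
    (hfi : Set.InjOn f J.verts) (hgen : J.Generated J.verts z₀ z₁ T)
    (hCT : ∀ a b c, J.ClockwiseTriangle a b c → K.ClockwiseTriangle (f a) (f b) (f c))
    (hfL : Set.InjOn f L.verts) (hγ : ∀ v ∈ L.verts, K.γ (f v) = L.γ v)
    (hsub : (L.map f hfL K.γ hγ).IsSubconfiguration K) {a b c : ℕ}
    (hT : K.ClockwiseTriangle a b c) (hab : ¬ (L.map f hfL K.γ hγ).Adj a b)
    (hbc : (L.map f hfL K.γ hγ).Adj b c) (hca : (L.map f hfL K.γ hγ).Adj c a) : False := by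
  have hnext : (L.map f hfL K.γ hγ).next c a = b :=
    (hsub.sub.next_eq hca (by rw [hT.rot.rot.2.2.1]; exact (L.map f hfL K.γ hγ).symm _ _ hbc)).trans
      hT.rot.rot.2.2.1
  obtain ⟨v, x, hvx, rfl, rfl⟩ := hca
  rw [show (L.map f hfL K.γ hγ).next (f v) (f x) = f (L.next v x) from Drawing.map_next hfL hvx]
    at hnext
  subst hnext
  have hvL := L.mem_verts _ _ hvx
  have hvy := L.next_adj _ _ hvx
  have hxL := L.mem_verts _ _ (L.symm _ _ hvx)
  have hyL := L.mem_verts _ _ (L.symm _ _ hvy)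
  have hLJ : ∀ {u v}, L.Adj u v → J.Adj u v := fun h =>
    (hE.adj_iff _ (L.mem_verts _ _ h) _ (L.mem_verts _ _ (L.symm _ _ h))).1 h
  have hxy : ¬ L.Adj x (L.next v x) := fun h => hab ⟨_, _, h, rfl, rfl⟩
  have hmem := fun {u w} (h : J.Adj u w) => J.mem_verts _ _ (J.symm _ _ h)
  have hout : (v, x) ∈ J.outer := by
    by_contra ho
    have hTJ := J.clockwise_of_notMem (hLJ hvx) ho
    have he : f (J.next v x) = f (L.next v x) :=
      (hCT _ _ _ hTJ).2.2.1.symm.trans hT.rot.rot.2.2.1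
    have he' := hfi (hmem (J.next_adj _ _ (hLJ hvx))) (hE.subset hyL) he
    exact hxy ((hE.adj_iff _ hxL _ hyL).2 (he' ▸ hTJ.rot.1))
  have hfin : ∀ w, J.Adj v w → ∃ w', J.Adj v w' ∧ K.ClockwiseTriangle (f v) (f w) (f w') := by
    intro w hw
    by_cases hwx : w = x
    · subst hwx
      exact ⟨_, hLJ hvy, hT.rot.rot⟩
    · have ho : (v, w) ∉ J.outer := fun h => hwx (hgen.outer_unique h hout)
      have hTJ := J.clockwise_of_notMem hw ho
      exact ⟨_, J.next_adj _ _ hw, hCT _ _ _ hTJ⟩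
  have hnb : ∀ y, K.Adj (f v) y → ∃ w, J.Adj v w ∧ f w = y := fun y hy =>
    K.mem_of_next_closed (X := fun y => ∃ w, J.Adj v w ∧ f w = y) (by
      rintro _ _ ⟨w, hw, rfl⟩
      obtain ⟨w', hw', hTw⟩ := hfin w hw
      exact ⟨w', hw', hTw.2.2.1.symm⟩) hT.rot.rot.1 hy ⟨x, hLJ hvx, rfl⟩
  have hdeg : K.deg (f v) = J.deg v := by
    have : {y | K.Adj (f v) y} = f '' {w | J.Adj v w} := by
      ext y
      refine ⟨hnb y, ?_⟩
      rintro ⟨w, hw, rfl⟩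
      obtain ⟨_, -, h⟩ := hfin w hw
      exact h.1
    have hs : {w | J.Adj v w} ⊆ J.verts := fun w hw => hmem hw
    rw [Drawing.deg, this, Set.ncard_image_of_injOn (hfi.mono hs), Drawing.deg]
  have hin : K.γ (f v) = K.deg (f v) := by
    refine K.inner _ hT.mem.2.2 ?_
    rintro ⟨-, ⟨y, hy⟩ | h⟩
    · obtain ⟨w, hw, rfl⟩ := hnb y (K.outer_subset hy)
      obtain ⟨_, -, h⟩ := hfin w hw
      exact h.2.1 hy
    · exact h _ hT.rot.rot.1
  exact hE.closed v hvL (by rw [← hγ v hvL, hin, hdeg]) x hout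

theorem IsOrientedIso.trans {N : Configuration δ} {L : Configuration α} {M : Configuration β}
    {g : δ → α} {f : α → β} (hg : IsOrientedIso g N L) (hf : IsOrientedIso f L M) :
    IsOrientedIso (f ∘ g) N M where
  bij := hf.bij.comp hg.bij
  adj u hu v hv := (hg.adj u hu v hv).trans (hf.adj _ (hg.bij.mapsTo hu) _ (hg.bij.mapsTo hv))
  next v a h := by
    have h1 := (hg.adj v (N.mem_verts _ _ h) a (N.mem_verts _ _ (N.symm _ _ h))).1 h
    exact (hf.next _ _ h1).trans (congrArg f (hg.next v a h))
  outer u v h := (hg.outer u v h).trans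
    (hf.outer _ _ ((hg.adj u (N.mem_verts _ _ h) v (N.mem_verts _ _ (N.symm _ _ h))).1 h))
  γ v hv := (hf.γ _ (hg.bij.mapsTo hv)).trans (hg.γ v hv)

theorem IsReversedIso.trans {N : Configuration δ} {L : Configuration α} {M : Configuration β}
    {g : δ → α} {f : α → β} (hg : IsReversedIso g N L) (hf : IsOrientedIso f L M) :
    IsReversedIso (f ∘ g) N M where
  bij := hf.bij.comp hg.bij
  adj u hu v hv := (hg.adj u hu v hv).trans (hf.adj _ (hg.bij.mapsTo hu) _ (hg.bij.mapsTo hv))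
  next v a h := by
    have h0 := N.next_adj _ _ h
    have h1 := (hg.adj v (N.mem_verts _ _ h) _ (N.mem_verts _ _ (N.symm _ _ h0))).1 h0
    exact (hf.next _ _ h1).trans (congrArg f (hg.next v a h))
  outer u v h := (hg.outer u v h).trans (hf.outer _ _ (L.symm _ _
    ((hg.adj u (N.mem_verts _ _ h) v (N.mem_verts _ _ (N.symm _ _ h))).1 h)))
  γ v hv := (hf.γ _ (hg.bij.mapsTo hv)).trans (hg.γ v hv)

end Configuration

theorem mainTheorem7 {α : Type*} (𝒞 : Set (Configuration ℕ))
    (L : Configuration α) (hL : L.IsGood 𝒞)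
    (J : NearTriangulation α) (n : ℕ) (Q : Fin (n + 2) → Query α) (hQ : IsQuestion L J Q)
    (d : ℕ) (A : Axle d) (K : Configuration ℕ) (hK : A.IsSkeleton K)
    (f : α → ℕ) (hf : IsPositiveAnswer J Q K f) :
    ∃ K₀ : Configuration ℕ, Configuration.IsOrientedIso f L K₀ ∧ L.Isomorphic K₀ ∧
      K₀.IsSubconfiguration K ∧
      (6 ≤ d → L.HasRadiusAtMostTwo → WellPositioned d K₀ →
        K₀.IsInducedSubconfiguration K ∧ A.SemiReducible 𝒞) := by
  have hE := hQ.enhancement.extends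
  have hfL : Set.InjOn f L.verts := hf.injOn.mono hE.subset
  have hγ : ∀ v ∈ L.verts, K.γ (f v) = L.γ v := fun v hv => hf.γ_eq hQ hE.subset hv
  obtain ⟨rk, hrk⟩ := hf.exists_order hQ
  have hgen := hE.generated hQ.adj hrk
  have hCT : ∀ a b c, J.ClockwiseTriangle a b c → K.ClockwiseTriangle (f a) (f b) (f c) :=
    fun a b c h => hE.clockwise_skeleton hK hf.injOn hf.mapsTo hγ hQ.adj hrk h
  have hiso : Configuration.IsOrientedIso f L (L.map f hfL K.γ hγ) :=
    Configuration.map_isOrientedIso hfL hγ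
  have hsub := hE.map_isSubconfiguration hf.injOn hf.mapsTo hgen hQ.adj hCT hfL hγ
  refine ⟨L.map f hfL K.γ hγ, hiso, ⟨f, .inl hiso⟩, hsub, fun hd hr hwp => ?_⟩
  have hr' : (L.map f hfL K.γ hγ).HasRadiusAtMostTwo := by
    obtain ⟨c, hc, h⟩ := hr
    refine ⟨f c, hiso.bij.mapsTo hc, fun y hy => ?_⟩
    obtain ⟨u, hu, rfl⟩ := hiso.bij.surjOn hy
    rcases h u hu with rfl | h1 | ⟨w, h1, h2⟩
    exacts [Or.inl rfl, .inr (.inl ⟨_, _, h1, rfl, rfl⟩),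
      .inr (.inr ⟨f w, ⟨_, _, h1, rfl, rfl⟩, _, _, h2, rfl, rfl⟩)]
  have hfull := hK.full_of_radius hd hsub.sub.verts_subset hsub.sub.adj hr' hwp
  have hind : (L.map f hfL K.γ hγ).IsInducedSubconfiguration K := by
    refine ⟨⟨hsub.sub, ?_⟩, hsub.γ⟩
    by_contra! hn
    obtain ⟨a, b, c, hT, hab, hbc, hca⟩ := hsub.sub.exists_corner hfull hn
    exact hE.not_corner hf.injOn hgen hCT hfL hγ hsub hT hab hbc hca
  refine ⟨hind, K, _, hK, ?_, hind, hwp⟩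
  obtain ⟨N, hN, g, hg | hg⟩ := hL
  exacts [⟨N, hN, _, .inl (hg.trans hiso)⟩, ⟨N, hN, _, .inr (hg.trans hiso)⟩]
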